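/- **Setting.** Let $m\ge 1$, $p\ge 0$, let $\mathcal H$ be an infinite-dimensional real Hilbert space with norm $\|\cdot\|$, $\mathcal Q=\mathbb R^p\times\mathcal H$, and let $\mathcal X_1,\dots,\mathcal X_m$ be measure spaces (reference measures written $dx$). For $\tau=(\theta,h)\in\mathcal Q$ let $\eta_l(x;\tau)$, $x\in\mathcal X_l$, be known real functions and put $$f_{l,\tau}=\frac{e^{\eta_l(\cdot;\tau)}}{\int_{\mathcal X_l}e^{\eta_l(x;\tau)}dx},\qquad \mu_{l,\tau}(\varphi)=\int \varphi f_{l,\tau}\,dx,\qquad V_{l,\tau}(\varphi_1,\varphi_2)=\mu_{l,\tau}(\varphi_1\varphi_2)-\mu_{l,\tau}(\varphi_1)\mu_{l,\tau}(\varphi_2),\qquad V_{l,\tau}(\varphi)=V_{l,\tau}(\varphi,\varphi).$$ Let $\tau_0=(\theta_0,h_0)\in\mathcal Q$ be the true parameter, $L^2_0(\mathcal X_l)=L^2(f_{l,\tau_0}dx)\ominus\{1\}$, and assume $\eta_l(\cdot;\tau)\in L^2_0(\mathcal X_l)$ for all $\tau\in\mathcal Q$. The observations $X_{li}$ ($1\le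 l\le m$, $i\ge1$) are independent, $X_{li}$ having density $f_{l,\tau_0}$. For sample sizes $(n_l)_{l\le m}$, $\lambda>0$ and a bilinear form $J$ on $\mathcal H$, with $J(h)=J(h,h)$, put $$\mathcal L(\theta,h)=\sum_{l=1}^m\Big\{-\frac1{n_l}\sum_{i=1}^{n_l}\eta_l(X_{li};\theta,h)+\log\int_{\mathcal X_l}e^{\eta_l(x;\theta,h)}dx\Big\},\qquad \mathcal L_\lambda(\theta,h)=\mathcal L(\theta,h)+\frac\lambda2J(h).$$ **Assumptions.** There are bounded linear operators $L_{l,\theta}:\mathbb R^p\to L^2_0(\mathcal X_l)$ and $L_{l,h}:\mathcal H\to L^2_0(\mathcal X_l)$ with zero null spaces, open sets $\mathcal N_{\theta_0}\ni\theta_0$ and $\mathcal N_{h_0}\ni h_0$ in $\mathbb R^p$ and $\mathcal H$ with $\mathcal N=\mathcal N_{\theta_0}\times\mathcal N_{h_0}$ convex, positive constants $C_1,C_2,C_3,C_4,C_d$ with $C_d<2C_1$, and $r>1$ such that: 1. $J$ is a (finite) symmetric, positive semidefinite bilinear form on $\mathcal H$ whose null space $\{h:J(h)=0\}$ is finite-dimensional.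 2. (i) For every $\lambda>0$ there are $M_1,M_2>0$ with $M_1\|g\|^2\le\sum_lV_{l,\tau_0}(L_{l,h}g)+\lambda J(g)\le M_2\|g\|^2$ for all $g\in\mathcal H$. (ii) There is $c_\delta>0$ with $\sum_lV_{l,\tau_0}(L_{l,\theta}\zeta-L_{l,h}g)>c_\delta$ for all $g\in\mathcal H$ and all $\zeta\in\mathbb R^p$ of Euclidean norm $1$. 3. Each $\eta_l$ is one-to-one on $\mathcal N$ as a map into $L^2_0(\mathcal X_l)$, and is three times continuously Fréchet differentiable on $\mathcal N$, both as such a map and, for every $x\in\mathcal X_l$, as the real function $\tau\mapsto\eta_l(x;\tau)$. For all sample sizes $n_l\ge1$, $\tau_0$ is the only root in $\mathcal N$ of $E[D_\theta\mathcal L(\tau)]=0$, $E[D_h\mathcal L(\tau)]=0$. 4. For all $\tau\in\mathcal N$ and $(\zeta,g)\in\mathcal Q$, $\;C_1\sum_lV_{l,\tau_0}(L_{l,\theta}\zeta+L_{l,h}g)\le\sum_lV_{l,\tau_0}(D_\theta\eta_l(\tau)\zeta+D_h\eta_l(\tau)g)\le C_2\sum_lV_{l,\tau_0}(L_{l,\theta}\zeta+L_{l,h}g)$.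 5. For all $\tau_1,\tau_2\in\mathcal N$ and $(\zeta,g)\in\mathcal Q$, $\;\sum_lV_{l,\tau_0}\big[(D_\theta\eta_l(\tau_1)-D_\theta\eta_l(\tau_2))\zeta+(D_h\eta_l(\tau_1)-D_h\eta_l(\tau_2))g\big]\le C_d\sum_lV_{l,\tau_0}(L_{l,\theta}\zeta+L_{l,h}g)$. 6. For all $\tau\in\mathcal N$, $e^{\eta_l(\cdot;\tau)}$ is integrable for each $l$, and for all $f_l\in L^2_0(\mathcal X_l)$ ($l\le m$) the variances $V_{l,\tau}(f_l)$ are finite and $C_3\sum_lV_{l,\tau_0}(f_l)\le\sum_lV_{l,\tau}(f_l)\le C_4\sum_lV_{l,\tau_0}(f_l)$. 7. $g\mapsto\sum_lV_{l,\tau_0}(L_{l,h}g)$ is completely continuous with respect to $J$: for every $\varepsilon>0$ there are finitely many continuous linear functionals on $\mathcal H$ such that $\sum_lV_{l,\tau_0}(L_{l,h}g)\le\varepsilon J(g)$ for every $g$ at which all of them vanish. 8. Let $(\phi_\nu)_{\nu\ge1}$ be a complete (its linear span is dense in $\mathcal H$) system with $\sum_lV_{l,\tau_0}(L_{l,h}\phi_\nu,L_{l,h}\phi_\mu)=\delta_{\nu\mu}$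 and $J(\phi_\nu,\phi_\mu)=\rho_\nu\delta_{\nu\mu}$, where $0\le\rho_1\le\rho_2\le\cdots\to\infty$. Then $\rho_\nu=\kappa_\nu\nu^r$ with $\kappa_\nu\in(\beta_1,\beta_2)\subset(0,\infty)$ for all large $\nu$. Consider sequences of sample sizes $(n_l)$ and of $\lambda>0$ along which $n=\min_ln_l\to\infty$, $\lambda\to0$ and $n\lambda^{1/r}\to\infty$. Assume that, eventually along the sequence, $\mathcal L$ is almost surely convex on $\mathcal N$, and that $\hat\tau$ is a random element of $\mathcal Q$ which, with probability tending to one, lies in $\mathcal N$ and is the unique local minimum of $\mathcal L_\lambda$ in $\mathcal N$. **Theorem.** Let $\mathrm{SKL}(\tau_0,\tau)=\sum_{l=1}^m\{\mathrm{KL}(f_{l,\tau_0},f_{l,\tau})+\mathrm{KL}(f_{l,\tau},f_{l,\tau_0})\}$ be the symmetrized Kullback–Leibler distance summed over the samples. For every $\tau\in\mathcal N$, $$\mathrm{SKL}(\tau_0,\tau)=\sum_{l=1}^m\big\{\mu_{l,\tau_0}[\eta_l(\tau_0)-\eta_l(\tau)]+\mu_{l,\tau}[\eta_l(\tau)-\eta_l(\tau_0)]\big\},$$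 and $$\mathrm{SKL}(\tau_0,\hat\tau)=O_p\big(n^{-1}\lambda^{-1/r}+\lambda\big).$$ -/

import Mathlib

open MeasureTheory ProbabilityTheory Filter Topology
open scoped ENNReal

noncomputable section

namespace SemiDensity

/-- The space `L²(P) ⊖ {1}`: square integrable functions (modulo `P`-null sets) orthogonal to the
constant functions. -/
def L20 {α : Type*} [MeasurableSpace α] (P : Measure α) [IsFiniteMeasure P] :
    Submodule ℝ (Lp ℝ 2 P) :=
  (Submodule.span ℝ {Lp.const 2 P (1 : ℝ)})ᗮ

lemma toLp_mem_L20 {α : Type*} [MeasurableSpace α] {P : Measure α} [IsFiniteMeasure P]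
    {f : α → ℝ} (hf : MemLp f 2 P) (h0 : ∫ x, f x ∂P = 0) : hf.toLp f ∈ L20 P := by
  rw [L20, Submodule.mem_orthogonal_singleton_iff_inner_right, L2.inner_def, ← h0]
  apply integral_congr_ae
  filter_upwards [hf.coeFn_toLp, Lp.coeFn_const 2 P (1 : ℝ)] with x h1 h2
  rw [h1, h2]
  simp

/-- The product parameter space `𝒬 = ℝᵖ × ℋ`. -/
abbrev Param (p : ℕ) (H : Type*) : Type _ := EuclideanSpace ℝ (Fin p) × H

/-- The `m`-sample semiparametric density model. `ν l` is the dominating measure (`dx`) on the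
`l`-th sample space, `η l τ x` is the logistic transformation `η_l(x; τ)`, and `τ₀` is the true
parameter. The measure `(ν l).tilted (η l τ)` has `ν l`-density `exp η_l(·; τ) / ∫ exp η_l(·; τ)`.
The last two fields say that `η_l` maps `𝒬` into `L²_{τ₀}(𝒳_l) ⊖ {1}`. -/
structure Model (m p : ℕ) (H : Type*) (𝓧 : Fin m → Type*) [∀ l, MeasurableSpace (𝓧 l)] where
  ν : ∀ l, Measure (𝓧 l)
  η : ∀ l, Param p H → 𝓧 l → ℝ
  τ₀ : Param p H
  memLp : ∀ l τ, MemLp (η l τ) 2 ((ν l).tilted (η l τ₀))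
  integral_eq_zero : ∀ l τ, ∫ x, η l τ x ∂((ν l).tilted (η l τ₀)) = 0

namespace Model

/-- The law of one observation of the `l`-th sample under the parameter `τ`. -/
def P {m p : ℕ} {H : Type*} {𝓧 : Fin m → Type*} [∀ l, MeasurableSpace (𝓧 l)]
    (M : Model m p H 𝓧) (l : Fin m) (τ : Param p H) : Measure (𝓧 l) :=
  (M.ν l).tilted (M.η l τ)

instance {m p : ℕ} {H : Type*} {𝓧 : Fin m → Type*} [∀ l, MeasurableSpace (𝓧 l)]
    (M : Model m p H 𝓧) (l : Fin m) (τ : Param p H) : IsZeroOrProbabilityMeasure (M.P l τ) := by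
  unfold P
  infer_instance

/-- The space `L²₀(𝒳_l)`. -/
abbrev L2 {m p : ℕ} {H : Type*} {𝓧 : Fin m → Type*} [∀ l, MeasurableSpace (𝓧 l)]
    (M : Model m p H 𝓧) (l : Fin m) : Submodule ℝ (Lp ℝ 2 (M.P l M.τ₀)) :=
  L20 (M.P l M.τ₀)

/-- `η_l` as a map `𝒬 → L²₀(𝒳_l)`. -/
def etaL2 {m p : ℕ} {H : Type*} {𝓧 : Fin m → Type*} [∀ l, MeasurableSpace (𝓧 l)]
    (M : Model m p H 𝓧) (l : Fin m) (τ : Param p H) : M.L2 l :=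
  ⟨MemLp.toLp (μ := M.P l M.τ₀) (M.η l τ) (M.memLp l τ),
    toLp_mem_L20 (P := M.P l M.τ₀) (M.memLp l τ) (M.integral_eq_zero l τ)⟩

/-- `V_{l,τ}(f)`, the variance of `f` under the density with parameter `τ`. -/
def V {m p : ℕ} {H : Type*} {𝓧 : Fin m → Type*} [∀ l, MeasurableSpace (𝓧 l)]
    (M : Model m p H 𝓧) (l : Fin m) (τ : Param p H) (f : M.L2 l) : ℝ :=
  Var[fun x => (f : Lp ℝ 2 (M.P l M.τ₀)) x; M.P l τ]

/-- `V_{l,τ}(f, g)`, the covariance of `f` and `g` under the density with parameter `τ`. -/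
def Vcov {m p : ℕ} {H : Type*} {𝓧 : Fin m → Type*} [∀ l, MeasurableSpace (𝓧 l)]
    (M : Model m p H 𝓧) (l : Fin m) (τ : Param p H) (f g : M.L2 l) : ℝ :=
  cov[fun x => (f : Lp ℝ 2 (M.P l M.τ₀)) x, fun x => (g : Lp ℝ 2 (M.P l M.τ₀)) x; M.P l τ]

/-- The Fréchet partial derivative `D_θ η_l(τ) : ℝᵖ → L²₀(𝒳_l)`. -/
def Dθ {m p : ℕ} {H : Type*} [NormedAddCommGroup H] [InnerProductSpace ℝ H]
    {𝓧 : Fin m → Type*} [∀ l, MeasurableSpace (𝓧 l)]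
    (M : Model m p H 𝓧) (l : Fin m) (τ : Param p H) : EuclideanSpace ℝ (Fin p) →L[ℝ] M.L2 l :=
  fderiv ℝ (fun θ => M.etaL2 l (θ, τ.2)) τ.1

/-- The Fréchet partial derivative `D_h η_l(τ) : ℋ → L²₀(𝒳_l)`. -/
def Dh {m p : ℕ} {H : Type*} [NormedAddCommGroup H] [InnerProductSpace ℝ H]
    {𝓧 : Fin m → Type*} [∀ l, MeasurableSpace (𝓧 l)]
    (M : Model m p H 𝓧) (l : Fin m) (τ : Param p H) : H →L[ℝ] M.L2 l :=
  fderiv ℝ (fun h => M.etaL2 l (τ.1, h)) τ.2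

/-- The joint negative log likelihood
`∑_l { -n_l⁻¹ ∑_{i < n_l} η_l(x_{l,i}; τ) + log ∫ exp η_l(·; τ) }` of the data `x`, of which the
first `n l` observations of the `l`-th sample are used. -/
def nll {m p : ℕ} {H : Type*} {𝓧 : Fin m → Type*} [∀ l, MeasurableSpace (𝓧 l)]
    (M : Model m p H 𝓧) (n : Fin m → ℕ) (x : ∀ l, ℕ → 𝓧 l) (τ : Param p H) : ℝ :=
  ∑ l, (-((n l : ℝ)⁻¹ * ∑ i ∈ Finset.range (n l), M.η l τ (x l i))
    + Real.log (∫ y, Real.exp (M.η l τ y) ∂(M.ν l)))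

/-- The penalized joint negative log likelihood with smoothing parameter `lam`. -/
def pnll {m p : ℕ} {H : Type*} [NormedAddCommGroup H] [InnerProductSpace ℝ H]
    {𝓧 : Fin m → Type*} [∀ l, MeasurableSpace (𝓧 l)]
    (M : Model m p H 𝓧) (J : LinearMap.BilinForm ℝ H) (n : Fin m → ℕ) (lam : ℝ)
    (x : ∀ l, ℕ → 𝓧 l) (τ : Param p H) : ℝ :=
  M.nll n x τ + lam / 2 * J τ.2 τ.2

/-- The penalized estimator: `τ` lies in the neighborhood `N` and is the unique local minimum there
of the penalized joint negative log likelihood. -/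
def IsEstimator {m p : ℕ} {H : Type*} [NormedAddCommGroup H] [InnerProductSpace ℝ H]
    {𝓧 : Fin m → Type*} [∀ l, MeasurableSpace (𝓧 l)]
    (M : Model m p H 𝓧) (J : LinearMap.BilinForm ℝ H) (N : Set (Param p H)) (n : Fin m → ℕ)
    (lam : ℝ) (x : ∀ l, ℕ → 𝓧 l) (τ : Param p H) : Prop :=
  τ ∈ N ∧ IsLocalMin (M.pnll J n lam x) τ ∧
    ∀ τ' ∈ N, IsLocalMin (M.pnll J n lam x) τ' → τ' = τ

/-- The symmetrized Kullback-Leibler distance between `τ₀` and `τ`, summed over the samples. -/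
def SKL {m p : ℕ} {H : Type*} {𝓧 : Fin m → Type*} [∀ l, MeasurableSpace (𝓧 l)]
    (M : Model m p H 𝓧) (τ : Param p H) : ℝ≥0∞ :=
  ∑ l, (InformationTheory.klDiv (M.P l M.τ₀) (M.P l τ)
    + InformationTheory.klDiv (M.P l τ) (M.P l M.τ₀))

end Model

/-- `J` is (the semi-inner product of) a square seminorm with finite-dimensional null space. -/
structure IsPenalty {H : Type*} [NormedAddCommGroup H] [InnerProductSpace ℝ H]
    (J : LinearMap.BilinForm ℝ H) : Prop where
  symm : ∀ g h, J g h = J h g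
  nonneg : ∀ g, 0 ≤ J g g
  finiteDimensional_null : FiniteDimensional ℝ (Submodule.span ℝ {g | J g g = 0})

/-- The conditions on the auxiliary operators `L_{l,θ}` and `L_{l,h}`. The constants `M₁`, `M₂` may
depend on `lam` (uniform ones as `lam → 0` cannot exist if `J` is unbounded relative to
`∑ V_{l,τ₀}(L_{l,h} ·)`). -/
structure AuxiliaryOperators {m p : ℕ} {H : Type*} [NormedAddCommGroup H] [InnerProductSpace ℝ H]
    {𝓧 : Fin m → Type*} [∀ l, MeasurableSpace (𝓧 l)]
    (M : Model m p H 𝓧) (J : LinearMap.BilinForm ℝ H)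
    (Lθ : ∀ l, EuclideanSpace ℝ (Fin p) →L[ℝ] M.L2 l) (Lh : ∀ l, H →L[ℝ] M.L2 l) : Prop where
  injective_θ : ∀ l, Function.Injective (Lθ l)
  injective_h : ∀ l, Function.Injective (Lh l)
  norm_equiv : ∀ lam : ℝ, 0 < lam → ∃ M₁ M₂ : ℝ, 0 < M₁ ∧ 0 < M₂ ∧ ∀ g : H,
    M₁ * ‖g‖ ^ 2 ≤ ∑ l, M.V l M.τ₀ (Lh l g) + lam * J g g ∧
    ∑ l, M.V l M.τ₀ (Lh l g) + lam * J g g ≤ M₂ * ‖g‖ ^ 2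
  separated : ∃ c : ℝ, 0 < c ∧ ∀ (ζ : EuclideanSpace ℝ (Fin p)) (g : H), ‖ζ‖ = 1 →
    c < ∑ l, M.V l M.τ₀ (Lθ l ζ - Lh l g)

/-- On `N = Nθ × Nh` every `η_l` is one-to-one and three times continuously Fréchet differentiable,
both as a map into `L²₀(𝒳_l)` and at each sample point, and `τ₀` is the only root in `N` of
`E[D_θ ∑_l 𝓛_{n_l}(τ)] = 0`, `E[D_h ∑_l 𝓛_{n_l}(τ)] = 0`, where `x ω` is the random data. -/
structure SmoothIdentifiable {m p : ℕ} {H : Type*} [NormedAddCommGroup H] [InnerProductSpace ℝ H]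
    {𝓧 : Fin m → Type*} [∀ l, MeasurableSpace (𝓧 l)] (M : Model m p H 𝓧)
    {Ω : Type*} [MeasurableSpace Ω] (μ : Measure Ω) (X : ∀ l, ℕ → Ω → 𝓧 l)
    (N : Set (Param p H)) : Prop where
  injOn : ∀ l, Set.InjOn (M.etaL2 l) N
  contDiffOn : ∀ l, ContDiffOn ℝ 3 (M.etaL2 l) N
  contDiffOn_apply : ∀ l x, ContDiffOn ℝ 3 (fun τ => M.η l τ x) N
  unique_root : ∀ n : Fin m → ℕ, (∀ l, 0 < n l) → ∀ τ ∈ N,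
    ((∀ ζ : EuclideanSpace ℝ (Fin p),
        ∫ ω, fderiv ℝ (fun θ => M.nll n (fun l i => X l i ω) (θ, τ.2)) τ.1 ζ ∂μ = 0) ∧
      (∀ g : H,
        ∫ ω, fderiv ℝ (fun h => M.nll n (fun l i => X l i ω) (τ.1, h)) τ.2 g ∂μ = 0)) ↔
    τ = M.τ₀

/-- Two-sided comparison of the derivatives of `η_l` with the auxiliary operators on `N`. -/
def DerivativeBounds {m p : ℕ} {H : Type*} [NormedAddCommGroup H] [InnerProductSpace ℝ H]
    {𝓧 : Fin m → Type*} [∀ l, MeasurableSpace (𝓧 l)] (M : Model m p H 𝓧)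
    (Lθ : ∀ l, EuclideanSpace ℝ (Fin p) →L[ℝ] M.L2 l) (Lh : ∀ l, H →L[ℝ] M.L2 l)
    (N : Set (Param p H)) (C₁ C₂ : ℝ) : Prop :=
  ∀ τ ∈ N, ∀ (ζ : EuclideanSpace ℝ (Fin p)) (g : H),
    C₁ * ∑ l, M.V l M.τ₀ (Lθ l ζ + Lh l g) ≤ ∑ l, M.V l M.τ₀ (M.Dθ l τ ζ + M.Dh l τ g) ∧
    ∑ l, M.V l M.τ₀ (M.Dθ l τ ζ + M.Dh l τ g) ≤ C₂ * ∑ l, M.V l M.τ₀ (Lθ l ζ + Lh l g)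

/-- Bound on the oscillation of the derivatives of `η_l` over `N`. -/
def DerivativeOscillation {m p : ℕ} {H : Type*} [NormedAddCommGroup H] [InnerProductSpace ℝ H]
    {𝓧 : Fin m → Type*} [∀ l, MeasurableSpace (𝓧 l)] (M : Model m p H 𝓧)
    (Lθ : ∀ l, EuclideanSpace ℝ (Fin p) →L[ℝ] M.L2 l) (Lh : ∀ l, H →L[ℝ] M.L2 l)
    (N : Set (Param p H)) (C : ℝ) : Prop :=
  ∀ τ₁ ∈ N, ∀ τ₂ ∈ N, ∀ (ζ : EuclideanSpace ℝ (Fin p)) (g : H),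
    ∑ l, M.V l M.τ₀ ((M.Dθ l τ₁ - M.Dθ l τ₂) ζ + (M.Dh l τ₁ - M.Dh l τ₂) g) ≤
      C * ∑ l, M.V l M.τ₀ (Lθ l ζ + Lh l g)

/-- The densities with parameter in `N` exist, and their variances are uniformly comparable to
those under the true density. -/
structure VarianceEquivalent {m p : ℕ} {H : Type*}
    {𝓧 : Fin m → Type*} [∀ l, MeasurableSpace (𝓧 l)] (M : Model m p H 𝓧)
    (N : Set (Param p H)) (C₃ C₄ : ℝ) : Prop where
  integrable_exp : ∀ l, ∀ τ ∈ N, Integrable (fun x => Real.exp (M.η l τ x)) (M.ν l)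
  memLp : ∀ l, ∀ τ ∈ N, ∀ f : M.L2 l,
    MemLp (fun x => (f : Lp ℝ 2 (M.P l M.τ₀)) x) 2 (M.P l τ)
  le_variance : ∀ τ ∈ N, ∀ f : (l : Fin m) → M.L2 l,
    C₃ * ∑ l, M.V l M.τ₀ (f l) ≤ ∑ l, M.V l τ (f l)
  variance_le : ∀ τ ∈ N, ∀ f : (l : Fin m) → M.L2 l,
    ∑ l, M.V l τ (f l) ≤ C₄ * ∑ l, M.V l M.τ₀ (f l)

/-- The quadratic functional `B` is completely continuous with respect to the quadratic functional
`A`: for every `ε > 0` there are finitely many linear functionals such that `B g ≤ ε A g` for all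
`g` on which they vanish. -/
def CompletelyContinuous {H : Type*} [NormedAddCommGroup H] [InnerProductSpace ℝ H]
    (B A : H → ℝ) : Prop :=
  ∀ ε : ℝ, 0 < ε → ∃ S : Finset (H →L[ℝ] ℝ), ∀ g : H, (∀ ℓ ∈ S, ℓ g = 0) → B g ≤ ε * A g

/-- `(φ, ρ)` is the eigensystem of `∑_l V_{l,τ₀}(L_{l,h} ·)` and `J`: the two forms are
simultaneously diagonal in the complete system `φ`, with eigenvalues `ρ` listed in increasing
order and tending to infinity. -/
structure IsEigensystem {m p : ℕ} {H : Type*} [NormedAddCommGroup H] [InnerProductSpace ℝ H]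
    {𝓧 : Fin m → Type*} [∀ l, MeasurableSpace (𝓧 l)]
    (M : Model m p H 𝓧) (J : LinearMap.BilinForm ℝ H) (Lh : ∀ l, H →L[ℝ] M.L2 l)
    (φ : ℕ → H) (ρ : ℕ → ℝ) : Prop where
  variance_diag : ∀ i j, ∑ l, M.Vcov l M.τ₀ (Lh l (φ i)) (Lh l (φ j)) = if i = j then 1 else 0
  penalty_diag : ∀ i j, J (φ i) (φ j) = if i = j then ρ i else 0
  nonneg : ∀ i, 0 ≤ ρ i
  monotone : Monotone ρ
  tendsto : Tendsto ρ atTop atTop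
  complete : (Submodule.span ℝ (Set.range φ)).topologicalClosure = ⊤

/-- The eigenvalues of `∑_l V_{l,τ₀}(L_{l,h} ·)` and `J` are `κ_ν ν^r` with `κ_ν` between two
positive constants, for all large `ν` (`ρ i` is the eigenvalue with number `ν = i + 1`). -/
def EigenvalueGrowth {m p : ℕ} {H : Type*} [NormedAddCommGroup H] [InnerProductSpace ℝ H]
    {𝓧 : Fin m → Type*} [∀ l, MeasurableSpace (𝓧 l)]
    (M : Model m p H 𝓧) (J : LinearMap.BilinForm ℝ H) (Lh : ∀ l, H →L[ℝ] M.L2 l)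
    (r : ℝ) : Prop :=
  ∀ (φ : ℕ → H) (ρ : ℕ → ℝ), IsEigensystem M J Lh φ ρ →
    ∃ β₁ β₂ : ℝ, 0 < β₁ ∧ ∀ᶠ i : ℕ in atTop,
      β₁ * ((i : ℝ) + 1) ^ r < ρ i ∧ ρ i < β₂ * ((i : ℝ) + 1) ^ r

/-- `Z_k = O_p(a_k)` as `k → ∞`, for `[0, ∞]`-valued random quantities `Z_k`
(not required to be measurable: `μ` is then the outer measure). -/
def IsBigOp {Ω : Type*} [MeasurableSpace Ω] (μ : Measure Ω) (Z : ℕ → Ω → ℝ≥0∞) (a : ℕ → ℝ) :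
    Prop :=
  ∀ ε : ℝ, 0 < ε → ∃ B : ℝ, 0 < B ∧
    ∀ᶠ k in atTop, μ {ω | ENNReal.ofReal (B * a k) < Z k ω} ≤ ENNReal.ofReal ε

end SemiDensity

end

/-! Write `LL` for the operator taking (ζ, g) to the family of L_{l,θ}ζ + L_{l,h}g, put q(d) = ‖LL
d‖² + λJ(g) for d = (ζ, g), and let ε² be a large multiple R of n⁻¹λ^{-1/r} + λ. The penalized
likelihood is convex. If q(τ̂ - τ₀) exceeded ε², then on the segment from τ₀ to τ̂ there would be a
point with q = ε² at which the penalized loss is no larger than at τ₀. So it suffices to bound the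
increments 𝓛(τ₀ + d) - 𝓛(τ₀) from below, uniformly over q(d) ≤ 2ε², by κ‖LL d‖² minus a small
multiple of ε² (`norm_sq_add_penalty_le_of_isLocalMin`).

Deterministic comparisons. The variance comparison, applied to centred indicators, forces the
densities f_τ / f_τ₀ to be bounded above and below uniformly on the neighbourhood
(`exists_abs_dη_sub_cgf_le`). Hence cumulants and SKL are controlled by the squared L² norm of η(τ)
- η(τ₀). The derivative bounds with C_d < 2C₁ make this norm comparable to ‖LL d‖
(`exists_comparison_of_fderiv`). Thus q(τ̂ - τ₀) ≤ ε² gives SKL = O(ε²).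

The increment of 𝓛 is a linearization remainder minus a score term. In the eigensystem, which
complete continuity provides (`exists_simultaneous_diagonalization`), the score is controlled by
Markov's inequality in the norm dual to q. Its size is governed by the effective dimension D = p +
∑(1 + λρ_ν)⁻¹, which is of order λ^{-1/r} (`exists_sum_inv_le`).

The remainder is nonlinear, and only second moments are available. Two facts replace empirical
process theory. First, almost sure convexity gives subgradient inequalities at τ₀ and at any other
centre z. Independence of the samples splits each of them into one bound per sample
(`exists_ae_lower_bounds`). Together they bound the remainder below by a constant plus the positive
part of a function affine in the parameter (`exists_remainder_lower_bound`). Second, a Gaussian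
change of measure combined with Catoni's truncation gives a lower bound for empirical means of such
positive parts. It is uniform over all parameters and needs only second moments
(`measure_exists_sum_pos_part_lt_le`).

Linearizing at z loses about ‖LL z‖·‖LL(v - z)‖, so z must be close to v. The ellipsoid is therefore
cut into exp(O(D)) small cells (`exists_cells`). The union bound over the cells is beaten by
exp(-α²nε²), because nε² is a large multiple of D. -/

namespace SemiDensity

/-! ### Gaussian shifts and the change of measure inequality. -/

section Gaussian

variable {ι : Type*} [Fintype ι]

/-- The standard Gaussian measure on `ι → ℝ`. -/
noncomputable abbrev stdGauss (ι : Type*) [Fintype ι] : Measure (ι → ℝ) :=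
  Measure.pi fun _ : ι => gaussianReal 0 1

lemma gaussianReal_eq_withDensity_exp (u : ℝ) :
    gaussianReal u 1 = (gaussianReal 0 1).withDensity
      fun v => ENNReal.ofReal (Real.exp (u * v - u ^ 2 / 2)) := by
  rw [gaussianReal_of_var_ne_zero _ one_ne_zero, gaussianReal_of_var_ne_zero _ one_ne_zero,
    ← withDensity_mul _ (measurable_gaussianPDF _ _) (by fun_prop)]
  congr 1
  ext v
  simp only [gaussianPDF, gaussianPDFReal, Pi.mul_apply]
  rw [← ENNReal.ofReal_mul (by positivity), mul_assoc _ (Real.exp _) (Real.exp _), ← Real.exp_add]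
  congr 3
  simp
  ring

/-- The Cameron-Martin formula in finite dimension. The shifted measure is a product, so it is
enough to compare boxes. There the density factors over the coordinates and independence leaves the
one-dimensional case. -/
lemma stdGauss_map_add (u : ι → ℝ) :
    (stdGauss ι).map (fun v => u + v) = (stdGauss ι).withDensity
      fun v => ENNReal.ofReal (Real.exp (∑ j, u j * v j - (∑ j, u j ^ 2) / 2)) := by
  have h1 : (stdGauss ι).map (fun v => u + v) = Measure.pi fun j => gaussianReal (u j) 1 := by
    have := Measure.pi_map_pi (μ := fun _ : ι => gaussianReal 0 1) (f := fun j x => u j + x)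
      (fun j => by fun_prop)
    simp only [gaussianReal_map_const_add, zero_add] at this
    exact this
  rw [h1]
  refine Measure.pi_eq fun s hs => ?_
  rw [withDensity_apply _ (MeasurableSet.univ_pi hs)]
  have hX : iIndepFun (fun (j : ι) (v : ι → ℝ) =>
      (s j).indicator (fun x => ENNReal.ofReal (Real.exp (u j * x - u j ^ 2 / 2))) (v j))
      (stdGauss ι) :=
    iIndepFun_pi (μ := fun _ : ι => gaussianReal 0 1)
      (X := fun j => (s j).indicator (fun x => ENNReal.ofReal (Real.exp (u j * x - u j ^ 2 / 2))))
      (fun j => (Measurable.indicator (by fun_prop) (hs j)).aemeasurable)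
  have h2 := lintegral_prod_eq_prod_lintegral_of_indepFun Finset.univ _ hX
    (fun j => (Measurable.indicator (by fun_prop) (hs j)).comp (measurable_pi_apply j))
  have h3 : ∀ j, ∫⁻ v, (s j).indicator
      (fun x => ENNReal.ofReal (Real.exp (u j * x - u j ^ 2 / 2))) (v j) ∂(stdGauss ι)
      = gaussianReal (u j) 1 (s j) := by
    intro j
    rw [gaussianReal_eq_withDensity_exp (u j), withDensity_apply _ (hs j),
      ← lintegral_indicator (hs j)]
    exact (measurePreserving_eval (fun _ : ι => gaussianReal 0 1) j).lintegral_comp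
      (Measurable.indicator (by fun_prop) (hs j))
  simp_rw [h3] at h2
  rw [← h2, ← lintegral_indicator (MeasurableSet.univ_pi hs)]
  refine lintegral_congr fun v => ?_
  by_cases hv : v ∈ Set.univ.pi s
  · rw [Set.indicator_of_mem hv]
    have : ∀ j ∈ Finset.univ, (s j).indicator
        (fun x => ENNReal.ofReal (Real.exp (u j * x - u j ^ 2 / 2))) (v j)
        = ENNReal.ofReal (Real.exp (u j * v j - u j ^ 2 / 2)) :=
      fun j _ => Set.indicator_of_mem (hv j trivial) _
    rw [Finset.prod_congr rfl this, ← ENNReal.ofReal_prod_of_nonneg (fun _ _ => by positivity),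
      ← Real.exp_sum, Finset.sum_sub_distrib, Finset.sum_div]
  · rw [Set.indicator_of_notMem hv]
    simp only [Set.mem_pi, Set.mem_univ, forall_const, not_forall] at hv
    obtain ⟨j, hj⟩ := hv
    rw [Finset.prod_eq_zero (Finset.mem_univ j)]
    exact Set.indicator_of_notMem hj _

/-- Jensen's inequality for the exponential function. -/
lemma ofReal_exp_integral_le {α : Type*} [MeasurableSpace α] {P : Measure α}
    [IsProbabilityMeasure P] {h : α → ℝ} (hh : Integrable h P) :
    ENNReal.ofReal (Real.exp (∫ x, h x ∂P)) ≤ ∫⁻ x, ENNReal.ofReal (Real.exp (h x)) ∂P := by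
  by_cases hi : Integrable (fun x => Real.exp (h x)) P
  · rw [← ofReal_integral_eq_lintegral_ofReal hi (ae_of_all _ fun x => (Real.exp_pos _).le)]
    exact ENNReal.ofReal_le_ofReal (convexOn_exp.map_integral_le Real.continuous_exp.continuousOn
      isClosed_univ (by simp) hh hi)
  · have : ∫⁻ x, ENNReal.ofReal (Real.exp (h x)) ∂P = ∞ := by
      by_contra hne
      refine hi ⟨Real.continuous_exp.comp_aestronglyMeasurable hh.1, ?_⟩
      rw [hasFiniteIntegral_iff_ofReal (ae_of_all _ fun x => (Real.exp_pos _).le)]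
      exact lt_top_iff_ne_top.2 hne
    rw [this]; exact le_top

lemma integrable_eval_stdGauss (j : ι) : Integrable (fun v : ι → ℝ => v j) (stdGauss ι) :=
  (measurePreserving_eval (fun _ : ι => gaussianReal 0 1) j).integrable_comp_of_integrable
    ((memLp_id_gaussianReal 1).integrable le_rfl)

lemma integral_eval_stdGauss (j : ι) : ∫ v, v j ∂(stdGauss ι) = 0 := by
  have := (measurePreserving_eval (fun _ : ι => gaussianReal 0 1) j).map_eq
  have h2 := integral_map (μ := stdGauss ι) (measurable_pi_apply j).aemeasurable
    (f := fun x : ℝ => x) aestronglyMeasurable_id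
  rw [← h2, this, integral_id_gaussianReal]

lemma integrable_linear_stdGauss (c : ι → ℝ) :
    Integrable (fun v : ι → ℝ => ∑ j, c j * v j) (stdGauss ι) :=
  integrable_finsetSum _ fun j _ => (integrable_eval_stdGauss j).const_mul _

lemma integral_linear_stdGauss (c : ι → ℝ) : ∫ v, ∑ j, c j * v j ∂(stdGauss ι) = 0 := by
  rw [integral_finsetSum _ fun j _ => (integrable_eval_stdGauss j).const_mul _]
  simp [integral_const_mul, integral_eval_stdGauss]

lemma memLp_linear_stdGauss (c : ι → ℝ) :
    MemLp (fun v : ι → ℝ => ∑ j, c j * v j) 2 (stdGauss ι) :=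
  memLp_finsetSum _ fun j _ => ((memLp_id_gaussianReal 2).comp_measurePreserving
    (measurePreserving_eval (fun _ : ι => gaussianReal 0 1) j)).const_mul (c j)

lemma integral_sq_linear_stdGauss (c : ι → ℝ) :
    ∫ v, (∑ j, c j * v j) ^ 2 ∂(stdGauss ι) = ∑ j, c j ^ 2 := by
  have h := variance_sum_pi (μ := fun _ : ι => gaussianReal 0 1) (X := fun j x => c j * x)
    (fun j => (memLp_id_gaussianReal 2).const_mul (c j))
  rw [variance_eq_sub] at h
  · have h0 : ∫ v, (∑ j, fun ω : ι → ℝ => c j * ω j) v ∂(stdGauss ι) = 0 := by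
      simpa using integral_linear_stdGauss c
    rw [h0] at h
    simp only [Pi.pow_apply, Finset.sum_apply, ne_eq, OfNat.ofNat_ne_zero, not_false_eq_true,
      zero_pow, sub_zero] at h
    rw [h]
    refine Finset.sum_congr rfl fun j _ => ?_
    rw [variance_const_mul]
    simp [variance_fun_id_gaussianReal]
  · convert memLp_linear_stdGauss c using 1
    ext v; simp

/-- The Gaussian change of measure inequality: a Cameron-Martin shift followed by Jensen. -/
lemma exp_integral_shift_le (u : ι → ℝ) {f : (ι → ℝ) → ℝ} (hf : Measurable f)
    (hi : Integrable (fun v => f (u + v)) (stdGauss ι)) :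
    ENNReal.ofReal (Real.exp (∫ v, f (u + v) ∂(stdGauss ι) - (∑ j, u j ^ 2) / 2))
      ≤ ∫⁻ v, ENNReal.ofReal (Real.exp (f v)) ∂(stdGauss ι) := by
  -- The exponent is f minus the log density of the shift. Translating by u cancels that density, so
  -- the integral of g(u + v) is that of exp f. Jensen on the translated side leaves only -|u|²/2,
  -- since linear functions have mean zero.
  set g : (ι → ℝ) → ℝ≥0∞ := fun w =>
    ENNReal.ofReal (Real.exp (f w - (∑ j, u j * w j - (∑ j, u j ^ 2) / 2))) with hg
  have hgm : Measurable g := by fun_prop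
  have h1 : ∫⁻ v, g (u + v) ∂(stdGauss ι)
      = ∫⁻ v, ENNReal.ofReal (Real.exp (f v)) ∂(stdGauss ι) := by
    rw [← lintegral_map hgm (by fun_prop : Measurable fun v : ι → ℝ => u + v), stdGauss_map_add,
      lintegral_withDensity_eq_lintegral_mul _ (by fun_prop) hgm]
    refine lintegral_congr fun v => ?_
    simp only [Pi.mul_apply, hg]
    rw [← ENNReal.ofReal_mul (by positivity), ← Real.exp_add]
    congr 2; ring
  rw [← h1]
  have h2 : ∀ v, f (u + v) - (∑ j, u j * (u + v) j - (∑ j, u j ^ 2) / 2)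
      = f (u + v) - ∑ j, u j * v j - (∑ j, u j ^ 2) / 2 := by
    intro v
    simp only [Pi.add_apply, mul_add, Finset.sum_add_distrib]
    have : ∑ j, u j * u j = ∑ j, u j ^ 2 := by simp [sq]
    rw [this]; ring
  have hint : Integrable (fun v => f (u + v) - ∑ j, u j * v j - (∑ j, u j ^ 2) / 2)
      (stdGauss ι) := (hi.sub (integrable_linear_stdGauss u)).sub (integrable_const _)
  have h3 := ofReal_exp_integral_le hint
  have h4 : ∫ v, (f (u + v) - ∑ j, u j * v j - (∑ j, u j ^ 2) / 2) ∂(stdGauss ι)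
      = ∫ v, f (u + v) ∂(stdGauss ι) - (∑ j, u j ^ 2) / 2 := by
    rw [integral_sub (f := fun v => f (u + v) - ∑ j, u j * v j)
      (hi.sub (integrable_linear_stdGauss u)) (integrable_const _),
      integral_sub hi (integrable_linear_stdGauss u), integral_linear_stdGauss]
    simp
  rw [h4] at h3
  simpa only [hg, h2] using h3

end Gaussian

/-- Catoni's truncation function. -/
noncomputable def catoni (t : ℝ) : ℝ := -Real.log (1 - t + t ^ 2)

lemma catoni_arg_pos (t : ℝ) : 0 < 1 - t + t ^ 2 := by nlinarith [sq_nonneg (t - 1 / 2)]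

/-- The reason for the choice of the truncation: its exponential moment involves only the first two
moments of t. -/
lemma exp_neg_catoni (t : ℝ) : Real.exp (-catoni t) = 1 - t + t ^ 2 := by
  rw [catoni, neg_neg, Real.exp_log (catoni_arg_pos t)]

lemma measurable_catoni : Measurable catoni := by unfold catoni; fun_prop

/-- The minimum of 1 - t + t² is 3/4. This cap keeps the smoothing remainder bounded, although the
functions involved are only square integrable. -/
lemma catoni_le_third (t : ℝ) : catoni t ≤ 1 / 3 := by
  rw [catoni]
  have h := Real.one_sub_inv_le_log_of_pos (catoni_arg_pos t)
  have h2 : (1 - t + t ^ 2)⁻¹ ≤ 4 / 3 := by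
    rw [inv_le_comm₀ (catoni_arg_pos t) (by norm_num)]
    nlinarith [sq_nonneg (t - 1 / 2)]
  linarith

lemma catoni_le_self {t : ℝ} (ht : -1 ≤ t) : catoni t ≤ t := by
  have h : Real.exp (-t) ≤ 1 - t + t ^ 2 := by
    rcases le_total t 1 with h1 | h1
    · have := Real.abs_exp_sub_one_sub_id_le (x := -t) (abs_le.2 ⟨by linarith, by linarith⟩)
      have := (abs_le.1 this).2
      nlinarith
    · have : Real.exp (-t) ≤ 1 := Real.exp_le_one_iff.2 (by linarith)
      nlinarith
  rw [catoni]
  have := (Real.le_log_iff_exp_le (catoni_arg_pos t)).2 h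
  linarith

lemma catoni_le_neg_quarter {t : ℝ} (ht : t ≤ -1) : catoni t ≤ -1 / 4 := by
  rw [catoni]
  have h := Real.one_sub_inv_le_log_of_pos (catoni_arg_pos t)
  have h2 : (1 - t + t ^ 2)⁻¹ ≤ 3 / 4 := by
    rw [inv_le_comm₀ (catoni_arg_pos t) (by norm_num)]
    nlinarith
  linarith

/-- Separates a value t from a Gaussian perturbation y whose linear term averages out. Far to the
left `catoni` lies above the identity, and this forces the positive part of t. There `catoni` is at
most -1/4, the minimum of y + y². -/
lemma catoni_add_le (t y : ℝ) : catoni (t + y) ≤ max t 0 + (y + y ^ 2) := by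
  rcases le_total (-1) (t + y) with h | h
  · have := catoni_le_self h
    have := le_max_left t 0
    nlinarith [sq_nonneg y]
  · have h1 := catoni_le_neg_quarter h
    have := le_max_right t 0
    nlinarith [sq_nonneg (y + 1 / 2)]

lemma abs_catoni_le (t : ℝ) : |catoni t| ≤ 1 + |t| + t ^ 2 := by
  rw [abs_le]
  constructor
  · rw [catoni]
    have h := Real.log_le_sub_one_of_pos (catoni_arg_pos t)
    have := neg_abs_le t
    linarith
  · have := catoni_le_third t
    have := abs_nonneg t
    nlinarith [sq_nonneg t]

/-! ### PAC-Bayesian lower bounds for empirical means under second moments. -/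

section PACBayes

/-- Polarization of the second moment formula for linear functions. -/
lemma integral_mul_eval_stdGauss {ι : Type*} [Fintype ι] [DecidableEq ι] (i j : ι) :
    ∫ v, v i * v j ∂(stdGauss ι) = if i = j then 1 else 0 := by
  have h1 := integral_sq_linear_stdGauss (Pi.single i 1 + Pi.single j 1 : ι → ℝ)
  have h2 := integral_sq_linear_stdGauss (Pi.single i 1 - Pi.single j 1 : ι → ℝ)
  have i1 := (memLp_linear_stdGauss (Pi.single i 1 + Pi.single j 1 : ι → ℝ)).integrable_sq
  have i2 := (memLp_linear_stdGauss (Pi.single i 1 - Pi.single j 1 : ι → ℝ)).integrable_sq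
  have h3 := integral_sub i1 i2
  rw [h1, h2] at h3
  have h4 : ∀ v : ι → ℝ, (∑ k, (Pi.single i 1 + Pi.single j 1 : ι → ℝ) k * v k) ^ 2
      - (∑ k, (Pi.single i 1 - Pi.single j 1 : ι → ℝ) k * v k) ^ 2 = 4 * (v i * v j) := by
    intro v
    simp only [Pi.add_apply, Pi.sub_apply, add_mul, sub_mul, Finset.sum_add_distrib,
      Finset.sum_sub_distrib, Pi.single_apply, ite_mul, one_mul, zero_mul, Finset.sum_ite_eq',
      Finset.mem_univ, if_true]
    ring
  simp_rw [h4] at h3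
  rw [integral_const_mul, ← Finset.sum_sub_distrib] at h3
  have h5 : ∀ k, (Pi.single i 1 + Pi.single j 1 : ι → ℝ) k ^ 2
      - (Pi.single i 1 - Pi.single j 1 : ι → ℝ) k ^ 2
      = if k = i then (if i = j then 4 else 0) else 0 := by
    intro k
    simp only [Pi.add_apply, Pi.sub_apply, Pi.single_apply]
    split_ifs <;> simp_all
    norm_num
  simp_rw [h5] at h3
  simp only [Finset.sum_ite_eq', Finset.mem_univ, if_true] at h3
  split_ifs at h3 ⊢ <;> linarith

lemma integrable_mul_eval_stdGauss {ι : Type*} [Fintype ι] (i j : ι) :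
    Integrable (fun v : ι → ℝ => v i * v j) (stdGauss ι) := by
  have h : ∀ k : ι, MemLp (fun v : ι → ℝ => v k) 2 (stdGauss ι) := fun k =>
    (memLp_id_gaussianReal 2).comp_measurePreserving
      (measurePreserving_eval (fun _ : ι => gaussianReal 0 1) k)
  exact (h i).integrable_mul (h j)

/-- The second moment of an affine family of square integrable functions is a quadratic
polynomial of the parameter. -/
lemma integral_sq_affine {α ι : Type*} [MeasurableSpace α] [Fintype ι] {P : Measure α}
    {a : α → ℝ} {ℓ : ι → α → ℝ} (ha : MemLp a 2 P) (hℓ : ∀ j, MemLp (ℓ j) 2 P) (v : ι → ℝ) :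
    ∫ x, (a x + ∑ j, v j * ℓ j x) ^ 2 ∂P = ∫ x, a x ^ 2 ∂P + ∑ j, v j * (2 * ∫ x, a x * ℓ j x ∂P)
      + ∑ i, ∑ j, v i * v j * ∫ x, ℓ i x * ℓ j x ∂P := by
  have h1 : ∀ x, (a x + ∑ j, v j * ℓ j x) ^ 2 = a x ^ 2 + ∑ j, (v j * 2) * (a x * ℓ j x)
      + ∑ i, ∑ j, v i * v j * (ℓ i x * ℓ j x) := by
    intro x
    have : (∑ j, v j * ℓ j x) ^ 2 = ∑ i, ∑ j, v i * v j * (ℓ i x * ℓ j x) := by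
      rw [sq, Finset.sum_mul_sum]
      exact Finset.sum_congr rfl fun i _ => Finset.sum_congr rfl fun j _ => by ring
    rw [add_sq, this, Finset.mul_sum]
    congr 2
    exact Finset.sum_congr rfl fun j _ => by ring
  have i2 : ∀ j, Integrable (fun x => (v j * 2) * (a x * ℓ j x)) P :=
    fun j => (ha.integrable_mul (hℓ j)).const_mul _
  have i3 : ∀ i j, Integrable (fun x => v i * v j * (ℓ i x * ℓ j x)) P :=
    fun i j => ((hℓ i).integrable_mul (hℓ j)).const_mul _
  simp_rw [h1]
  rw [integral_add (ha.integrable_sq.fun_add (integrable_finsetSum _ fun j _ => i2 j))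
    (integrable_finsetSum _ fun i _ => integrable_finsetSum _ fun j _ => i3 i j),
    integral_add ha.integrable_sq (integrable_finsetSum _ fun j _ => i2 j),
    integral_finsetSum _ fun j _ => i2 j,
    integral_finsetSum _ fun i _ => integrable_finsetSum _ fun j _ => i3 i j]
  congr 1
  · congr 1
    exact Finset.sum_congr rfl fun j _ => by rw [integral_const_mul]; ring
  · refine Finset.sum_congr rfl fun i _ => ?_
    rw [integral_finsetSum _ fun j _ => i3 i j]
    exact Finset.sum_congr rfl fun j _ => by rw [integral_const_mul]

lemma memLp_affine {α ι : Type*} [MeasurableSpace α] [Fintype ι] {P : Measure α}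
    {a : α → ℝ} {ℓ : ι → α → ℝ} (ha : MemLp a 2 P) (hℓ : ∀ j, MemLp (ℓ j) 2 P) (v : ι → ℝ) :
    MemLp (fun x => a x + ∑ j, v j * ℓ j x) 2 P :=
  ha.add (memLp_finsetSum _ fun j _ => (hℓ j).const_mul (v j))

lemma measurable_integral_sq_affine {α ι : Type*} [MeasurableSpace α] [Fintype ι] {P : Measure α}
    {a : α → ℝ} {ℓ : ι → α → ℝ} (ha : MemLp a 2 P) (hℓ : ∀ j, MemLp (ℓ j) 2 P) :
    Measurable fun v : ι → ℝ => ∫ x, (a x + ∑ j, v j * ℓ j x) ^ 2 ∂P := by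
  simp_rw [integral_sq_affine ha hℓ]
  fun_prop

/-- Averaging the second moment over Gaussian shifts of the parameter. -/
lemma integral_sq_affine_shift {α ι : Type*} [MeasurableSpace α] [Fintype ι] {P : Measure α}
    {a : α → ℝ} {ℓ : ι → α → ℝ} (ha : MemLp a 2 P) (hℓ : ∀ j, MemLp (ℓ j) 2 P) (u : ι → ℝ) :
    Integrable (fun v => ∫ x, (a x + ∑ j, (u + v) j * ℓ j x) ^ 2 ∂P) (stdGauss ι) ∧
    ∫ v, (∫ x, (a x + ∑ j, (u + v) j * ℓ j x) ^ 2 ∂P) ∂(stdGauss ι)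
      = ∫ x, (a x + ∑ j, u j * ℓ j x) ^ 2 ∂P + ∑ j, ∫ x, ℓ j x ^ 2 ∂P := by
  classical
  have h0 : ∀ (v : ι → ℝ) x, a x + ∑ j, (u + v) j * ℓ j x
      = (a x + ∑ j, u j * ℓ j x) + ∑ j, v j * ℓ j x := by
    intro v x
    simp only [Pi.add_apply, add_mul, Finset.sum_add_distrib]
    ring
  simp_rw [h0]
  have hA := memLp_affine ha hℓ u
  simp_rw [integral_sq_affine hA hℓ]
  have i2 : ∀ j : ι, Integrable (fun v : ι → ℝ => v j *
      (2 * ∫ x, (a x + ∑ j, u j * ℓ j x) * ℓ j x ∂P)) (stdGauss ι) :=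
    fun j => (integrable_eval_stdGauss j).mul_const _
  have i3 : ∀ i j : ι, Integrable (fun v : ι → ℝ => v i * v j *
      ∫ x, ℓ i x * ℓ j x ∂P) (stdGauss ι) :=
    fun i j => (integrable_mul_eval_stdGauss i j).mul_const _
  have i2' := integrable_finsetSum Finset.univ fun j _ => i2 j
  have i3' := integrable_finsetSum Finset.univ fun i _ =>
    integrable_finsetSum Finset.univ fun j _ => i3 i j
  have i12 := (integrable_const (μ := stdGauss ι) (∫ x, (a x + ∑ j, u j * ℓ j x) ^ 2 ∂P)).fun_add i2'
  refine ⟨i12.add i3', ?_⟩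
  rw [integral_add i12 i3', integral_add (integrable_const _) i2',
    integral_finsetSum _ fun j _ => i2 j,
    integral_finsetSum _ fun i _ => integrable_finsetSum _ fun j _ => i3 i j]
  simp_rw [integral_mul_const, integral_eval_stdGauss]
  have : ∀ i : ι, ∫ v, ∑ j, v i * v j * ∫ x, ℓ i x * ℓ j x ∂P ∂(stdGauss ι)
      = ∫ x, ℓ i x ^ 2 ∂P := by
    intro i
    rw [integral_finsetSum _ fun j _ => i3 i j]
    simp_rw [integral_mul_const, integral_mul_eval_stdGauss]
    simp [sq]
  simp_rw [this]
  simp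

/-- Averaging Catoni's truncation of an affine function over Gaussian shifts. -/
lemma integral_catoni_affine {ι : Type*} [Fintype ι] (t : ℝ) (c : ι → ℝ) :
    Integrable (fun v : ι → ℝ => catoni (t + ∑ j, c j * v j)) (stdGauss ι) ∧
    ∫ v, catoni (t + ∑ j, c j * v j) ∂(stdGauss ι) ≤ max t 0 + min (1 / 3) (∑ j, c j ^ 2) := by
  have hm : MemLp (fun v : ι → ℝ => t + ∑ j, c j * v j) 2 (stdGauss ι) :=
    (memLp_const t).add (memLp_linear_stdGauss c)
  have hi : Integrable (fun v : ι → ℝ => catoni (t + ∑ j, c j * v j)) (stdGauss ι) := by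
    refine Integrable.mono' (((integrable_const (1 : ℝ)).add
      (hm.integrable one_le_two).abs).add hm.integrable_sq)
      (measurable_catoni.comp (by fun_prop)).aestronglyMeasurable (ae_of_all _ fun v => ?_)
    exact abs_catoni_le _
  refine ⟨hi, ?_⟩
  rw [← min_add_add_left]
  refine le_min ?_ ?_
  · have : ∫ v, catoni (t + ∑ j, c j * v j) ∂(stdGauss ι) ≤ ∫ _, (1 / 3 : ℝ) ∂(stdGauss ι) :=
      integral_mono hi (integrable_const _) fun v => catoni_le_third _
    have h2 := le_max_right t 0
    simp only [integral_const, probReal_univ, one_smul] at this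
    linarith
  · have i1 := (integrable_linear_stdGauss c).fun_add (memLp_linear_stdGauss c).integrable_sq
    have h1 : ∫ v, catoni (t + ∑ j, c j * v j) ∂(stdGauss ι)
        ≤ ∫ v, (max t 0 + (∑ j, c j * v j + (∑ j, c j * v j) ^ 2)) ∂(stdGauss ι) :=
      integral_mono hi ((integrable_const _).add i1) fun v => catoni_add_le _ _
    refine h1.trans (le_of_eq ?_)
    rw [integral_add (integrable_const _) i1, integral_add (integrable_linear_stdGauss c)
      (memLp_linear_stdGauss c).integrable_sq, integral_linear_stdGauss,
      integral_sq_linear_stdGauss]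
    simp

variable {m : ℕ} {𝓧 : Fin m → Type*} [∀ l, MeasurableSpace (𝓧 l)]
  {Ω : Type*} [MeasurableSpace Ω] {μ : Measure Ω}

/-- The expectation of a product over independent samples. -/
lemma lintegral_prod_samples {X : ∀ l, ℕ → Ω → 𝓧 l} (hXm : ∀ l i, Measurable (X l i))
    (hXi : iIndepFun (fun (q : Fin m × ℕ) => X q.1 q.2) μ) {P : ∀ l, Measure (𝓧 l)}
    (hXl : ∀ l i, μ.map (X l i) = P l) (n : Fin m → ℕ) {g : ∀ l, 𝓧 l → ℝ≥0∞}
    (hg : ∀ l, Measurable (g l)) :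
    ∫⁻ ω, ∏ l, ∏ i ∈ Finset.range (n l), g l (X l i ω) ∂μ = ∏ l, (∫⁻ x, g l x ∂P l) ^ n l := by
  have h1 : iIndepFun (fun (q : (_ : Fin m) × ℕ) ω => g q.1 (X q.1 q.2 ω)) μ :=
    (hXi.comp (fun q => g q.1) fun q => hg q.1).precomp
      (g := fun q : (_ : Fin m) × ℕ => (q.1, q.2)) (by
        rintro ⟨a, b⟩ ⟨c, d⟩ h
        simp only [Prod.mk.injEq] at h
        obtain ⟨rfl, rfl⟩ := h
        rfl)
  have h2 := lintegral_prod_eq_prod_lintegral_of_indepFun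
    (Finset.univ.sigma fun l => Finset.range (n l)) _ h1
    (fun q => (hg q.1).comp (hXm q.1 q.2))
  simp only [Finset.prod_sigma] at h2
  rw [h2]
  refine Finset.prod_congr rfl fun l _ => ?_
  have : ∀ i ∈ Finset.range (n l), ∫⁻ ω, g l (X l i ω) ∂μ = ∫⁻ x, g l x ∂P l := fun i _ => by
    rw [← hXl l i, lintegral_map (hg l) (hXm l i)]
  rw [Finset.prod_congr rfl this, Finset.prod_const, Finset.card_range]

/-- Markov's inequality in exponential form. -/
lemma measure_exp_le {s : ℝ} {g : Ω → ℝ≥0∞} (hg : AEMeasurable g μ)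
    (h : ∫⁻ ω, g ω ∂μ ≤ 1) : μ {ω | ENNReal.ofReal (Real.exp s) ≤ g ω}
      ≤ ENNReal.ofReal (Real.exp (-s)) := by
  have h1 := mul_meas_ge_le_lintegral₀ hg (ENNReal.ofReal (Real.exp s))
  rw [Real.exp_neg, ENNReal.ofReal_inv_of_pos (Real.exp_pos s),
    ENNReal.le_inv_iff_mul_le, mul_comm]
  exact h1.trans h

end PACBayes

section PACBayes

variable {m : ℕ} {𝓧 : Fin m → Type*} [∀ l, MeasurableSpace (𝓧 l)]
  {Ω : Type*} [MeasurableSpace Ω] {μ : Measure Ω}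

/-- If `exp ∘ g l` has `P l`-expectation at most `exp (c l)`, then the sums of `g l` over the
samples exceed the sum of the `c l` by at least `s` with probability at most `exp (-s)`. -/
lemma lintegral_exp_samples_le {X : ∀ l, ℕ → Ω → 𝓧 l} (hXm : ∀ l i, Measurable (X l i))
    (hXi : iIndepFun (fun (q : Fin m × ℕ) => X q.1 q.2) μ) {P : ∀ l, Measure (𝓧 l)}
    (hXl : ∀ l i, μ.map (X l i) = P l) (n : Fin m → ℕ) {g : ∀ l, 𝓧 l → ℝ}
    (hg : ∀ l, Measurable (g l)) {c : Fin m → ℝ}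
    (hc : ∀ l, ∫⁻ x, ENNReal.ofReal (Real.exp (g l x)) ∂P l ≤ ENNReal.ofReal (Real.exp (c l))) :
    ∫⁻ ω, ENNReal.ofReal (Real.exp (∑ l, ∑ i ∈ Finset.range (n l), g l (X l i ω)
      - ∑ l, n l * c l)) ∂μ ≤ 1 := by
  have h1 : ∀ ω, ENNReal.ofReal (Real.exp (∑ l, ∑ i ∈ Finset.range (n l), g l (X l i ω)
      - ∑ l, n l * c l)) = (∏ l, ∏ i ∈ Finset.range (n l), ENNReal.ofReal (Real.exp
        (g l (X l i ω)))) * ENNReal.ofReal (Real.exp (-∑ l, n l * c l)) := by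
    intro ω
    rw [sub_eq_add_neg, Real.exp_add, ENNReal.ofReal_mul (by positivity), Real.exp_sum,
      ENNReal.ofReal_prod_of_nonneg (fun _ _ => by positivity)]
    congr 1
    refine Finset.prod_congr rfl fun l _ => ?_
    rw [Real.exp_sum, ENNReal.ofReal_prod_of_nonneg (fun _ _ => by positivity)]
  simp_rw [h1]
  rw [lintegral_mul_const' _ _ ENNReal.ofReal_ne_top,
    lintegral_prod_samples hXm hXi hXl n (g := fun l x => ENNReal.ofReal (Real.exp (g l x)))
      (fun l => by have := hg l; fun_prop)]
  have h2 : ∏ l, (∫⁻ x, ENNReal.ofReal (Real.exp (g l x)) ∂P l) ^ n l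
      ≤ ENNReal.ofReal (Real.exp (∑ l, n l * c l)) := by
    rw [Real.exp_sum, ENNReal.ofReal_prod_of_nonneg (fun _ _ => by positivity)]
    refine Finset.prod_le_prod' fun l _ => ?_
    rw [Real.exp_nat_mul, ENNReal.ofReal_pow (by positivity)]
    exact pow_le_pow_left' (hc l) _
  refine (mul_le_mul_left h2 _).trans (le_of_eq ?_)
  rw [← ENNReal.ofReal_mul (by positivity), ← Real.exp_add]
  simp

/-- A PAC-Bayesian lower bound, uniform over the parameter, for the empirical means of the positive
parts of affine families of square integrable functions. -/
theorem measure_exists_sum_pos_part_lt_le {ι : Type*} [Fintype ι]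
    {X : ∀ l, ℕ → Ω → 𝓧 l} [IsProbabilityMeasure μ] (hXm : ∀ l i, Measurable (X l i))
    (hXi : iIndepFun (fun (q : Fin m × ℕ) => X q.1 q.2) μ) {P : ∀ l, Measure (𝓧 l)}
    [∀ l, IsProbabilityMeasure (P l)]
    (hXl : ∀ l i, μ.map (X l i) = P l) {n : Fin m → ℕ} {N : ℕ} (hN : 0 < N) (hn : ∀ l, N ≤ n l)
    {a : ∀ l, 𝓧 l → ℝ} {ℓ : ∀ l, ι → 𝓧 l → ℝ} (ham : ∀ l, Measurable (a l))
    (hℓm : ∀ l j, Measurable (ℓ l j)) (ha : ∀ l, MemLp (a l) 2 (P l))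
    (hℓ : ∀ l j, MemLp (ℓ l j) 2 (P l)) {α : ℝ} (hα : 0 < α) (s : ℝ) :
    μ {ω | ∃ u : ι → ℝ, α * N * ∑ l, (n l : ℝ)⁻¹ * ∑ i ∈ Finset.range (n l),
        max (a l (X l i ω) + ∑ j, u j * ℓ l j (X l i ω)) 0
      < α * N * ∑ l, ∫ x, (a l x + ∑ j, u j * ℓ l j x) ∂P l
        - α ^ 2 * N * ∑ l, ∫ x, (a l x + ∑ j, u j * ℓ l j x) ^ 2 ∂P l
        - 3 * (α ^ 2 * N * ∑ l, ∑ j, ∫ x, ℓ l j x ^ 2 ∂P l) - (∑ j, u j ^ 2) / 2 - 2 * s}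
      ≤ 2 * ENNReal.ofReal (Real.exp (-s)) := by
  have hn0 : ∀ l, (0 : ℝ) < n l := fun l => by exact_mod_cast hN.trans_le (hn l)
  have hN0 : (0 : ℝ) < N := by exact_mod_cast hN
  -- These weights make unequal samples count equally: n_l w_l = αN for every l, while w_l ≤ α
  -- because N ≤ n_l.
  set w : Fin m → ℝ := fun l => α * (N / n l) with hw
  have hw0 : ∀ l, 0 < w l := fun l => by have := hn0 l; positivity
  have hnw : ∀ l, n l * w l = α * N := fun l => by
    have := (hn0 l).ne'; simp only [hw]; field_simp
  have hwα : ∀ l, w l ≤ α := fun l => by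
    have h1 : (N : ℝ) / n l ≤ 1 := by
      rw [div_le_one (hn0 l)]; exact_mod_cast hn l
    simpa [hw] using mul_le_mul_of_nonneg_left h1 hα.le
  have hnw2 : ∀ l, n l * w l ^ 2 ≤ α ^ 2 * N := fun l => by
    calc n l * w l ^ 2 = (n l * w l) * w l := by ring
      _ ≤ (α * N) * α := by
        rw [hnw l]; exact mul_le_mul_of_nonneg_left (hwα l) (by positivity)
      _ = _ := by ring
  set G : Fin m → ℝ := fun l => ∑ j, ∫ x, ℓ l j x ^ 2 ∂P l with hG
  have hG0 : ∀ l, 0 ≤ G l := fun l => Finset.sum_nonneg fun j _ =>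
    integral_nonneg fun x => sq_nonneg _
  -- the main exponential
  set e : Fin m → (ι → ℝ) → ℝ := fun l v => w l * ∫ x, (a l x + ∑ j, v j * ℓ l j x) ∂P l
    - w l ^ 2 * ∫ x, (a l x + ∑ j, v j * ℓ l j x) ^ 2 ∂P l with he
  have hmean : ∀ l (v : ι → ℝ), ∫ x, (a l x + ∑ j, v j * ℓ l j x) ∂P l
      = ∫ x, a l x ∂P l + ∑ j, v j * ∫ x, ℓ l j x ∂P l := by
    intro l v
    rw [integral_add ((ha l).integrable one_le_two) (integrable_finsetSum _ fun j _ =>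
      ((hℓ l j).integrable one_le_two).const_mul _), integral_finsetSum _ fun j _ =>
      ((hℓ l j).integrable one_le_two).const_mul _]
    simp_rw [integral_const_mul]
  have hem : ∀ l, Measurable (e l) := by
    intro l
    have h1 := measurable_integral_sq_affine (ha l) (hℓ l)
    simp only [he, hmean]
    fun_prop
  -- Normalized so that exp f has mean at most 1 for each fixed v: the mean of 1 - t + t² is at most
  -- the exponential of -e, by 1 + x ≤ exp x.
  set f : Ω → (ι → ℝ) → ℝ := fun ω v => ∑ l, ∑ i ∈ Finset.range (n l),
    -catoni (w l * (a l (X l i ω) + ∑ j, v j * ℓ l j (X l i ω))) - ∑ l, n l * (-e l v) with hf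
  have hfm : Measurable (Function.uncurry f) := by
    have := measurable_catoni
    simp only [hf, Function.uncurry_def]
    fun_prop
  have hf1 : ∀ v, ∫⁻ ω, ENNReal.ofReal (Real.exp (f ω v)) ∂μ ≤ 1 := by
    intro v
    refine lintegral_exp_samples_le hXm hXi hXl n
      (g := fun l x => -catoni (w l * (a l x + ∑ j, v j * ℓ l j x))) (c := fun l => -e l v)
      (fun l => by have := measurable_catoni; fun_prop) fun l => ?_
    have hM := memLp_affine (ha l) (hℓ l) v
    have i1 := (hM.integrable one_le_two).const_mul (w l)
    have i2 := hM.integrable_sq.const_mul (w l ^ 2)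
    have ic : Integrable (fun _ => (1 : ℝ)) (P l) := integrable_const 1
    have ic' : Integrable (fun x => 1 - w l * (a l x + ∑ j, v j * ℓ l j x)) (P l) := ic.sub i1
    have i3 : Integrable (fun x => 1 - w l * (a l x + ∑ j, v j * ℓ l j x)
        + w l ^ 2 * (a l x + ∑ j, v j * ℓ l j x) ^ 2) (P l) :=
      ic'.add i2
    have h1 : ∀ x, Real.exp (-catoni (w l * (a l x + ∑ j, v j * ℓ l j x)))
        = 1 - w l * (a l x + ∑ j, v j * ℓ l j x)
          + w l ^ 2 * (a l x + ∑ j, v j * ℓ l j x) ^ 2 := by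
      intro x; rw [exp_neg_catoni]; ring
    simp_rw [h1]
    rw [← ofReal_integral_eq_lintegral_ofReal i3
      (ae_of_all _ fun x => (Real.exp_pos _).le.trans (h1 x).le)]
    refine ENNReal.ofReal_le_ofReal ?_
    rw [integral_add ic' i2, integral_sub ic i1,
      integral_const_mul, integral_const_mul]
    simp only [integral_const, probReal_univ, one_smul]
    have := Real.add_one_le_exp (-e l v)
    simp only [he] at this ⊢
    linarith
  -- Averaging over the Gaussian prior keeps the mean at most 1 and removes the parameter from the
  -- exceptional event. This is where uniformity over u comes from.
  have hF : ∫⁻ ω, (∫⁻ v, ENNReal.ofReal (Real.exp (f ω v)) ∂(stdGauss ι)) ∂μ ≤ 1 := by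
    rw [lintegral_lintegral_swap (by fun_prop)]
    calc ∫⁻ v, (∫⁻ ω, ENNReal.ofReal (Real.exp (f ω v)) ∂μ) ∂(stdGauss ι)
        ≤ ∫⁻ _, 1 ∂(stdGauss ι) := lintegral_mono hf1
      _ = 1 := by simp
  have hE1 := measure_exp_le (s := s) (μ := μ)
    (g := fun ω => ∫⁻ v, ENNReal.ofReal (Real.exp (f ω v)) ∂(stdGauss ι))
    (Measurable.lintegral_prod_right' (f := fun p : Ω × (ι → ℝ) =>
      ENNReal.ofReal (Real.exp (f p.1 p.2))) (by fun_prop)).aemeasurable hF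
  -- the remainder of the smoothing
  set R : ∀ l, 𝓧 l → ℝ := fun l x => min (1 / 3) (∑ j, (w l * ℓ l j x) ^ 2) with hR
  have hRm : ∀ l, Measurable (R l) := fun l => by simp only [hR]; fun_prop
  -- As R lies between 0 and 1/3, exp R ≤ 1 + R + R² ≤ 1 + 2R, so second moments suffice for the
  -- exponential moment.
  have hR1 := lintegral_exp_samples_le hXm hXi hXl n (g := R)
    (c := fun l => 2 * (w l ^ 2 * G l)) hRm (fun l => by
      have iS : Integrable (fun x => ∑ j, (w l * ℓ l j x) ^ 2) (P l) :=
        integrable_finsetSum _ fun j _ => ((hℓ l j).const_mul (w l)).integrable_sq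
      have hS : ∫ x, ∑ j, (w l * ℓ l j x) ^ 2 ∂P l = w l ^ 2 * G l := by
        rw [integral_finsetSum _ fun j _ => ((hℓ l j).const_mul (w l)).integrable_sq]
        simp_rw [mul_pow, integral_const_mul, hG, Finset.mul_sum]
      have hle : ∀ x, Real.exp (R l x) ≤ 1 + 2 * ∑ j, (w l * ℓ l j x) ^ 2 := by
        intro x
        have h0 : 0 ≤ ∑ j, (w l * ℓ l j x) ^ 2 := Finset.sum_nonneg fun j _ => sq_nonneg _
        have h1 : 0 ≤ R l x := le_min (by norm_num) h0
        have h2 : R l x ≤ 1 / 3 := min_le_left _ _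
        have h3 : R l x ≤ ∑ j, (w l * ℓ l j x) ^ 2 := min_le_right _ _
        have := (abs_le.1 (Real.abs_exp_sub_one_sub_id_le (x := R l x)
          (abs_le.2 ⟨by linarith, by linarith⟩))).2
        nlinarith
      calc ∫⁻ x, ENNReal.ofReal (Real.exp (R l x)) ∂P l
          ≤ ∫⁻ x, ENNReal.ofReal (1 + 2 * ∑ j, (w l * ℓ l j x) ^ 2) ∂P l :=
            lintegral_mono fun x => ENNReal.ofReal_le_ofReal (hle x)
        _ = ENNReal.ofReal (1 + 2 * (w l ^ 2 * G l)) := by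
            rw [← ofReal_integral_eq_lintegral_ofReal
              ((integrable_const 1).fun_add (iS.const_mul 2))
              (ae_of_all _ fun x => (Real.exp_pos _).le.trans (hle x)),
              integral_add (integrable_const 1) (iS.const_mul 2), integral_const_mul, hS]
            simp
        _ ≤ _ := ENNReal.ofReal_le_ofReal (by
            rw [add_comm]; exact Real.add_one_le_exp _))
  have hE2 := measure_exp_le (s := s) (μ := μ) (by fun_prop) hR1
  rw [two_mul (ENNReal.ofReal (Real.exp (-s)))]
  refine le_trans (le_trans (measure_mono ?_) (measure_union_le _ _)) (add_le_add hE1 hE2)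
  -- Off both events the shift inequality is applied with the Gaussian recentred at u. Of the three
  -- copies of the smoothing variance, one comes from averaging the second moments and two from R.
  -- Each event accounts for one s.
  rintro ω ⟨u, hu⟩
  by_contra hω
  simp only [Set.mem_union, Set.mem_ofPred_eq, not_or, not_le] at hω
  obtain ⟨h1, h2⟩ := hω
  have h2' := Real.exp_lt_exp.1 ((ENNReal.ofReal_lt_ofReal_iff (Real.exp_pos _)).1 h2)
  -- the shifted average of the main exponent
  have hlin : ∀ l x (v : ι → ℝ), w l * (a l x + ∑ j, (u + v) j * ℓ l j x)
      = w l * (a l x + ∑ j, u j * ℓ l j x) + ∑ j, (w l * ℓ l j x) * v j := by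
    intro l x v
    simp only [Pi.add_apply, add_mul, Finset.sum_add_distrib, mul_add, Finset.mul_sum]
    have : ∑ j, w l * (v j * ℓ l j x) = ∑ j, w l * ℓ l j x * v j :=
      Finset.sum_congr rfl fun j _ => by ring
    rw [this]; ring
  have hcat : ∀ l x, Integrable (fun v : ι → ℝ =>
      -catoni (w l * (a l x + ∑ j, (u + v) j * ℓ l j x))) (stdGauss ι) := by
    intro l x
    simp_rw [hlin]
    exact (integral_catoni_affine _ _).1.neg
  have hcat2 : ∀ l x, -(w l * max (a l x + ∑ j, u j * ℓ l j x) 0 + R l x)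
      ≤ ∫ v, -catoni (w l * (a l x + ∑ j, (u + v) j * ℓ l j x)) ∂(stdGauss ι) := by
    intro l x
    rw [integral_neg]
    simp_rw [hlin]
    have := (integral_catoni_affine (w l * (a l x + ∑ j, u j * ℓ l j x))
      (fun j => w l * ℓ l j x)).2
    rw [mul_max_of_nonneg _ _ (hw0 l).le, mul_zero]
    linarith
  have hmean2 : ∀ l (v : ι → ℝ), ∫ x, (a l x + ∑ j, (u + v) j * ℓ l j x) ∂P l
      = ∫ x, (a l x + ∑ j, u j * ℓ l j x) ∂P l + ∑ j, (∫ x, ℓ l j x ∂P l) * v j := by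
    intro l v
    rw [hmean, hmean]
    simp only [Pi.add_apply, add_mul, Finset.sum_add_distrib]
    have : ∑ j, v j * ∫ x, ℓ l j x ∂P l = ∑ j, (∫ x, ℓ l j x ∂P l) * v j :=
      Finset.sum_congr rfl fun j _ => mul_comm _ _
    rw [this]; ring
  have heI : ∀ l, Integrable (fun v => e l (u + v)) (stdGauss ι) ∧
      ∫ v, e l (u + v) ∂(stdGauss ι) = w l * ∫ x, (a l x + ∑ j, u j * ℓ l j x) ∂P l
        - w l ^ 2 * (∫ x, (a l x + ∑ j, u j * ℓ l j x) ^ 2 ∂P l + G l) := by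
    intro l
    have hq := integral_sq_affine_shift (ha l) (hℓ l) u
    have hl := integrable_linear_stdGauss (fun j => ∫ x, ℓ l j x ∂P l)
    have i1 : Integrable (fun v => w l * ∫ x, (a l x + ∑ j, (u + v) j * ℓ l j x) ∂P l)
        (stdGauss ι) := by
      simp_rw [hmean2]
      exact ((integrable_const _).add hl).const_mul _
    have i2 := hq.1.const_mul (w l ^ 2)
    refine ⟨i1.sub i2, ?_⟩
    simp only [he]
    rw [integral_sub i1 i2, integral_const_mul, integral_const_mul, hq.2]
    simp_rw [hmean2]
    rw [integral_add (integrable_const _) hl, integral_linear_stdGauss]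
    simp [hG]
  have ia : Integrable (fun v => ∑ l, ∑ i ∈ Finset.range (n l),
      -catoni (w l * (a l (X l i ω) + ∑ j, (u + v) j * ℓ l j (X l i ω)))) (stdGauss ι) :=
    integrable_finsetSum _ fun l _ => integrable_finsetSum _ fun i _ => hcat l _
  have ib : Integrable (fun v => ∑ l, n l * (-e l (u + v))) (stdGauss ι) :=
    integrable_finsetSum _ fun l _ => ((heI l).1.fun_neg).const_mul _
  have hfI : Integrable (fun v => f ω (u + v)) (stdGauss ι) := ia.sub ib
  have hshift := exp_integral_shift_le u (f := f ω) (hfm.of_uncurry_left) hfI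
  have h3 := Real.exp_lt_exp.1 ((ENNReal.ofReal_lt_ofReal_iff (Real.exp_pos _)).1
    (hshift.trans_lt h1))
  have h4 : ∫ v, f ω (u + v) ∂(stdGauss ι) = ∑ l, ∑ i ∈ Finset.range (n l),
      ∫ v, -catoni (w l * (a l (X l i ω) + ∑ j, (u + v) j * ℓ l j (X l i ω))) ∂(stdGauss ι)
      + ∑ l, n l * ∫ v, e l (u + v) ∂(stdGauss ι) := by
    simp only [hf]
    rw [integral_sub ia ib, integral_finsetSum _ fun l _ => integrable_finsetSum _ fun i _ =>
      hcat l _, integral_finsetSum _ fun l _ => ((heI l).1.fun_neg).const_mul _]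
    have hneg : ∑ l, ∫ v, n l * (-e l (u + v)) ∂(stdGauss ι)
        = -∑ l, n l * ∫ v, e l (u + v) ∂(stdGauss ι) := by
      rw [← Finset.sum_neg_distrib]
      refine Finset.sum_congr rfl fun l _ => ?_
      rw [integral_const_mul, integral_neg, mul_neg]
    rw [hneg, sub_neg_eq_add]
    congr 1
    exact Finset.sum_congr rfl fun l _ => integral_finsetSum _ fun i _ => hcat l _
  have h5 : ∑ l, ∑ i ∈ Finset.range (n l), -(w l * max (a l (X l i ω)
      + ∑ j, u j * ℓ l j (X l i ω)) 0 + R l (X l i ω)) ≤ ∑ l, ∑ i ∈ Finset.range (n l),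
      ∫ v, -catoni (w l * (a l (X l i ω) + ∑ j, (u + v) j * ℓ l j (X l i ω))) ∂(stdGauss ι) :=
    Finset.sum_le_sum fun l _ => Finset.sum_le_sum fun i _ => hcat2 l _
  have h6 : ∑ l, ∑ i ∈ Finset.range (n l), -(w l * max (a l (X l i ω)
      + ∑ j, u j * ℓ l j (X l i ω)) 0 + R l (X l i ω))
      = -(α * N * ∑ l, (n l : ℝ)⁻¹ * ∑ i ∈ Finset.range (n l),
        max (a l (X l i ω) + ∑ j, u j * ℓ l j (X l i ω)) 0)
        - ∑ l, ∑ i ∈ Finset.range (n l), R l (X l i ω) := by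
    rw [Finset.mul_sum, ← Finset.sum_neg_distrib, ← Finset.sum_sub_distrib]
    refine Finset.sum_congr rfl fun l _ => ?_
    rw [Finset.sum_neg_distrib, Finset.sum_add_distrib, ← Finset.mul_sum]
    simp only [hw]
    ring
  have h7 : α * N * ∑ l, ∫ x, (a l x + ∑ j, u j * ℓ l j x) ∂P l
      - α ^ 2 * N * ∑ l, (∫ x, (a l x + ∑ j, u j * ℓ l j x) ^ 2 ∂P l + G l)
      ≤ ∑ l, n l * ∫ v, e l (u + v) ∂(stdGauss ι) := by
    rw [Finset.mul_sum, Finset.mul_sum, ← Finset.sum_sub_distrib]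
    refine Finset.sum_le_sum fun l _ => ?_
    rw [(heI l).2, mul_sub, ← mul_assoc, hnw l, ← mul_assoc]
    have h0 : 0 ≤ ∫ x, (a l x + ∑ j, u j * ℓ l j x) ^ 2 ∂P l + G l :=
      add_nonneg (integral_nonneg fun x => sq_nonneg _) (hG0 l)
    have := mul_le_mul_of_nonneg_right (hnw2 l) h0
    linarith
  have h8 : ∑ l, n l * (2 * (w l ^ 2 * G l)) ≤ 2 * (α ^ 2 * N * ∑ l, G l) := by
    rw [Finset.mul_sum, Finset.mul_sum]
    refine Finset.sum_le_sum fun l _ => ?_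
    have := mul_le_mul_of_nonneg_right (hnw2 l) (hG0 l)
    linarith
  rw [Finset.sum_add_distrib, mul_add] at h7
  linarith

end PACBayes

/-! ### Existence of the eigensystem of a compact form and the penalty. -/

section Eigensystem

variable {H E : Type*} [NormedAddCommGroup H] [InnerProductSpace ℝ H] [CompleteSpace H]
  [NormedAddCommGroup E] [InnerProductSpace ℝ E]

/-- An operator whose quadratic form is completely continuous with respect to a bounded one is
compact. -/
lemma isCompactOperator_of_completelyContinuous [CompleteSpace E] {L : H →L[ℝ] E} {J : H → ℝ} {B : ℝ}
    (hJ : ∀ g, J g ≤ B * ‖g‖ ^ 2) (hcc : CompletelyContinuous (fun g => ‖L g‖ ^ 2) J) :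
    IsCompactOperator L := by
  have hB : 0 ≤ max B 0 := le_max_right _ _
  have key : ∀ k : ℕ, ∃ F : H →L[ℝ] E, IsCompactOperator F ∧ ‖F - L‖ ≤ 1 / ((k : ℝ) + 1) := by
    intro k
    set ε : ℝ := 1 / ((k : ℝ) + 1) with hε
    have hε0 : 0 < ε := by positivity
    obtain ⟨S, hS⟩ := hcc (ε ^ 2 / (max B 0 + 1)) (by positivity)
    set Φ : H →L[ℝ] (S → ℝ) := ContinuousLinearMap.pi fun ℓ => ℓ.1 with hΦ
    set K : Submodule ℝ H := LinearMap.ker (Φ : H →ₗ[ℝ] (S → ℝ)) with hK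
    have hKc : IsClosed (K : Set H) := Φ.isClosed_ker
    have : CompleteSpace K := hKc.completeSpace_coe
    have : FiniteDimensional ℝ Kᗮ := by
      refine FiniteDimensional.of_injective
        ((Φ : H →ₗ[ℝ] (S → ℝ)).comp Kᗮ.subtype) ?_
      rw [← LinearMap.ker_eq_bot, LinearMap.ker_eq_bot']
      intro x hx
      have h1 : (x : H) ∈ K := hx
      have h2 := Submodule.inner_right_of_mem_orthogonal h1 x.2
      exact Subtype.ext (inner_self_eq_zero.1 h2)
    -- On the common kernel K of the functionals L has norm at most ε, and Kᗮ is finite-dimensional.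
    -- So L after the projection onto Kᗮ is compact and within ε of L.
    refine ⟨L.comp (Kᗮ.starProjection), ?_, ?_⟩
    · have h1 : IsCompactOperator (Kᗮ.orthogonalProjectionOnto) :=
        isCompactOperator_of_locallyCompactSpace_dom
          (Kᗮ.orthogonalProjectionOnto : H →L[ℝ] Kᗮ)
      exact h1.clm_comp (L.comp Kᗮ.subtypeL)
    · refine ContinuousLinearMap.opNorm_le_bound _ hε0.le fun g => ?_
      have h1 : (L.comp (Kᗮ.starProjection) - L) g = -L (K.starProjection g) := by
        have := Submodule.starProjection_add_starProjection_orthogonal (K := K) g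
        conv_lhs => rw [sub_apply]; rw (occs := .pos [2]) [← this]
        simp
      rw [h1, norm_neg]
      have h2 : K.starProjection g ∈ K := Submodule.starProjection_apply_mem _ _
      have h3 : ∀ ℓ ∈ S, ℓ (K.starProjection g) = 0 := by
        intro ℓ hℓ
        have : Φ (K.starProjection g) = 0 := h2
        exact congrFun this ⟨ℓ, hℓ⟩
      have h4 := hS _ h3
      have h5 : ‖K.starProjection g‖ ≤ ‖g‖ := K.norm_starProjection_apply_le g
      have h6 : J (K.starProjection g) ≤ (max B 0 + 1) * ‖g‖ ^ 2 := by
        calc J (K.starProjection g) ≤ B * ‖K.starProjection g‖ ^ 2 := hJ _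
          _ ≤ (max B 0 + 1) * ‖K.starProjection g‖ ^ 2 := by
            have := le_max_left B 0
            gcongr; linarith
          _ ≤ _ := by gcongr
      have h7 : ‖L (K.starProjection g)‖ ^ 2 ≤ (ε * ‖g‖) ^ 2 := by
        calc _ ≤ ε ^ 2 / (max B 0 + 1) * J (K.starProjection g) := h4
          _ ≤ ε ^ 2 / (max B 0 + 1) * ((max B 0 + 1) * ‖g‖ ^ 2) := by gcongr
          _ = _ := by field_simp
      exact (abs_le_of_sq_le_sq' h7 (by positivity)).2
  choose F hF1 hF2 using key
  refine isCompactOperator_of_tendsto (F := F) (l := atTop) ?_ (Eventually.of_forall hF1)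
  rw [tendsto_iff_norm_sub_tendsto_zero]
  exact squeeze_zero (fun k => norm_nonneg _) hF2 tendsto_one_div_add_atTop_nhds_zero_nat

/-- A Rayleigh quotient of a compact operator attains its maximum on a closed subspace. -/
lemma exists_maximizer {L : H →L[ℝ] E} (hL : IsCompactOperator L) (hLi : Function.Injective L)
    {A : LinearMap.BilinForm ℝ H} {c C : ℝ} (hc : 0 < c)
    (hcA : ∀ g, c * ‖g‖ ^ 2 ≤ A g g) (hAC : ∀ g h, |A g h| ≤ C * ‖g‖ * ‖h‖)
    (hLA : ∀ g, ‖L g‖ ^ 2 ≤ A g g) {W : Submodule ℝ H} (hW : IsClosed (W : Set H))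
    (hW0 : W ≠ ⊥) :
    ∃ e ∈ W, A e e = 1 ∧ ∀ g ∈ W, ‖L g‖ ^ 2 ≤ ‖L e‖ ^ 2 * A g g := by
  have hA0 : ∀ g, g ≠ 0 → 0 < A g g := fun g hg =>
    lt_of_lt_of_le (by have := norm_pos_iff.2 hg; positivity) (hcA g)
  have hAcont : Continuous fun g => A g g := by
    refine continuous_iff_continuousAt.2 fun g => ?_
    rw [ContinuousAt, tendsto_iff_dist_tendsto_zero]
    have hb : ∀ h, dist (A h h) (A g g) ≤ C * ‖h - g‖ * ‖h‖ + C * ‖g‖ * ‖h - g‖ := by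
      intro h
      have : A h h - A g g = A (h - g) h + A g (h - g) := by simp
      rw [Real.dist_eq, this]
      exact (abs_add_le _ _).trans (add_le_add (hAC _ _) (hAC _ _))
    refine squeeze_zero (fun h => dist_nonneg) hb ?_
    have hc : Continuous fun h : H => C * ‖h - g‖ * ‖h‖ + C * ‖g‖ * ‖h - g‖ := by fun_prop
    simpa using hc.tendsto g
  set T : Set ℝ := (fun g => ‖L g‖ ^ 2) '' {g | g ∈ W ∧ A g g = 1} with hT
  have hscale : ∀ g, g ≠ 0 → A ((Real.sqrt (A g g))⁻¹ • g) ((Real.sqrt (A g g))⁻¹ • g) = 1 := by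
    intro g hg
    have h0 := hA0 g hg
    have h1 := Real.mul_self_sqrt h0.le
    have h2 := (Real.sqrt_pos.2 h0).ne'
    simp only [map_smul, LinearMap.smul_apply, smul_eq_mul]
    field_simp
    nlinarith
  obtain ⟨g₀, hg₀W, hg₀⟩ := W.exists_mem_ne_zero_of_ne_bot hW0
  have hTne : T.Nonempty :=
    ⟨_, _, ⟨W.smul_mem (Real.sqrt (A g₀ g₀))⁻¹ hg₀W, hscale g₀ hg₀⟩, rfl⟩
  have hTb : BddAbove T := ⟨1, by rintro _ ⟨g, ⟨_, hg⟩, rfl⟩; exact (hLA g).trans hg.le⟩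
  set s := sSup T with hs
  have hsle : ∀ g ∈ W, ‖L g‖ ^ 2 ≤ s * A g g := by
    intro g hg
    by_cases h0 : g = 0
    · simp [h0]
    have h1 : ‖L ((Real.sqrt (A g g))⁻¹ • g)‖ ^ 2 ≤ s :=
      le_csSup hTb ⟨_, ⟨W.smul_mem _ hg, hscale g h0⟩, rfl⟩
    have h2 := hA0 g h0
    rw [map_smul, norm_smul, mul_pow, Real.norm_eq_abs, sq_abs, inv_pow, Real.sq_sqrt h2.le,
      inv_mul_le_iff₀ h2] at h1
    linarith
  have hs0 : 0 < s := by
    have h1 := hsle g₀ hg₀W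
    have h2 : 0 < ‖L g₀‖ ^ 2 := by
      have : L g₀ ≠ 0 := fun h => hg₀ (hLi (by simp [h]))
      have := norm_pos_iff.2 this
      positivity
    exact pos_of_mul_pos_left (h2.trans_le h1) (hA0 g₀ hg₀).le
  obtain ⟨t, -, htt, htT⟩ := exists_seq_tendsto_sSup hTne hTb
  choose g hg hgt using htT
  have hgb : ∀ k, g k ∈ Metric.closedBall (0 : H) (Real.sqrt (1 / c)) := by
    intro k
    rw [mem_closedBall_zero_iff]
    refine Real.le_sqrt_of_sq_le ?_
    have := hcA (g k)
    rw [(hg k).2] at this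
    rw [le_div_iff₀ hc]; linarith
  obtain ⟨y, -, ψ, hψ, hy⟩ := (hL.isCompact_closure_image_closedBall
    (Real.sqrt (1 / c))).tendsto_subseq (x := fun k => L (g k))
    fun k => subset_closure ⟨_, hgb k, rfl⟩
  have hcau : CauchySeq fun k => g (ψ k) := by
    rw [cauchySeq_iff_tendsto_dist_atTop_0]
    -- The parallelogram identities for A and for ‖L ·‖², combined with the maximality bound at x +
    -- z. A maximizing sequence whose images converge is therefore itself Cauchy.
    have hle : ∀ p : ℕ × ℕ, c * s * dist (g (ψ p.1)) (g (ψ p.2)) ^ 2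
        ≤ 2 * (s - t (ψ p.1)) + 2 * (s - t (ψ p.2))
          + dist (L (g (ψ p.1))) (L (g (ψ p.2))) ^ 2 := by
      intro p
      set x := g (ψ p.1)
      set z := g (ψ p.2)
      have hx : x ∈ W ∧ A x x = 1 := hg (ψ p.1)
      have hz : z ∈ W ∧ A z z = 1 := hg (ψ p.2)
      have e1 : ‖L x‖ ^ 2 = t (ψ p.1) := hgt (ψ p.1)
      have e2 : ‖L z‖ ^ 2 = t (ψ p.2) := hgt (ψ p.2)
      have h1 := hsle (x + z) (W.add_mem hx.1 hz.1)
      have h2 := parallelogram_law_with_norm ℝ (L x) (L z)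
      have h3 := hcA (x - z)
      have h4 : A (x - z) (x - z) = 4 - A (x + z) (x + z) := by
        simp only [map_sub, map_add, LinearMap.sub_apply, LinearMap.add_apply, hx.2, hz.2]
        ring
      rw [map_add] at h1
      rw [dist_eq_norm, dist_eq_norm, ← e1, ← e2]
      have h5 := mul_le_mul_of_nonneg_left h3 hs0.le
      rw [h4] at h5
      nlinarith
    have hr : Tendsto (fun p : ℕ × ℕ => 2 * (s - t (ψ p.1)) + 2 * (s - t (ψ p.2))
        + dist (L (g (ψ p.1))) (L (g (ψ p.2))) ^ 2) atTop (𝓝 0) := by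
      have hts : Tendsto (fun k => s - t (ψ k)) atTop (𝓝 0) := by
        have := (htt.comp hψ.tendsto_atTop).const_sub s
        rwa [sub_self] at this
      rw [← prod_atTop_atTop_eq]
      have h1 := (hts.comp (tendsto_fst (f := atTop (α := ℕ)) (g := atTop (α := ℕ)))).const_mul 2
      have h2 := (hts.comp (tendsto_snd (f := atTop (α := ℕ)) (g := atTop (α := ℕ)))).const_mul 2
      have h3 := (cauchySeq_iff_tendsto_dist_atTop_0.1 hy.cauchySeq).pow 2
      rw [← prod_atTop_atTop_eq] at h3
      simpa using (h1.add h2).add h3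
    have hr2 : Tendsto (fun p : ℕ × ℕ => Real.sqrt ((c * s)⁻¹ * (2 * (s - t (ψ p.1))
        + 2 * (s - t (ψ p.2)) + dist (L (g (ψ p.1))) (L (g (ψ p.2))) ^ 2))) atTop (𝓝 0) := by
      simpa using (hr.const_mul (c * s)⁻¹).sqrt
    refine squeeze_zero (fun p => dist_nonneg) (fun p => Real.le_sqrt_of_sq_le ?_) hr2
    rw [le_inv_mul_iff₀ (by positivity)]
    exact hle p
  obtain ⟨e, he⟩ := cauchySeq_tendsto_of_complete hcau
  refine ⟨e, hW.mem_of_tendsto he (Eventually.of_forall fun k => (hg _).1), ?_, ?_⟩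
  · have h1 := (hAcont.tendsto e).comp he
    refine tendsto_nhds_unique h1 ?_
    simp only [Function.comp_def, (hg _).2]
    exact tendsto_const_nhds
  · have h1 : Tendsto (fun k => ‖L (g (ψ k))‖ ^ 2) atTop (𝓝 (‖L e‖ ^ 2)) :=
      (((L.continuous.tendsto e).comp he).norm).pow 2
    have h2 : Tendsto (fun k => ‖L (g (ψ k))‖ ^ 2) atTop (𝓝 s) := by
      have : (fun k => ‖L (g (ψ k))‖ ^ 2) = t ∘ ψ := funext fun k => hgt (ψ k)
      rw [this]
      exact htt.comp hψ.tendsto_atTop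
    rw [tendsto_nhds_unique h1 h2]
    exact hsle

end Eigensystem

section Eigensystem

variable {H E : Type*} [NormedAddCommGroup H] [InnerProductSpace ℝ H]
  [NormedAddCommGroup E] [InnerProductSpace ℝ E]

/-- First order condition at a maximizer of a Rayleigh quotient. -/
lemma inner_eq_of_maximizer {L : H →L[ℝ] E} {A : LinearMap.BilinForm ℝ H}
    (hAs : ∀ g h, A g h = A h g) {W : Submodule ℝ H} {e : H} (heW : e ∈ W) (hAe : A e e = 1)
    (he : ∀ g ∈ W, ‖L g‖ ^ 2 ≤ ‖L e‖ ^ 2 * A g g) {g : H} (hg : g ∈ W) :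
    inner ℝ (L e) (L g) = ‖L e‖ ^ 2 * A e g := by
  have key : ∀ t : ℝ, 0 ≤ t * (2 * (‖L e‖ ^ 2 * A e g - inner ℝ (L e) (L g)))
      + t ^ 2 * (‖L e‖ ^ 2 * A g g - ‖L g‖ ^ 2) := by
    intro t
    have h1 := he (e + t • g) (W.add_mem heW (W.smul_mem t hg))
    rw [map_add, map_smul, norm_add_sq_real, norm_smul, inner_smul_right, mul_pow,
      Real.norm_eq_abs, sq_abs] at h1
    simp only [map_add, map_smul, LinearMap.add_apply, LinearMap.smul_apply, smul_eq_mul, hAe,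
      hAs g e] at h1
    linarith
  set b := 2 * (‖L e‖ ^ 2 * A e g - inner ℝ (L e) (L g)) with hb
  set c := ‖L e‖ ^ 2 * A g g - ‖L g‖ ^ 2 with hc
  have hc0 : 0 ≤ c := sub_nonneg.2 (he g hg)
  -- With this t the quadratic equals -b²/(c + 1)², which forces b = 0. The denominator c + 1 avoids
  -- a separate case c = 0.
  have h2 := key (-b / (c + 1))
  have h3 : -b / (c + 1) * b + (-b / (c + 1)) ^ 2 * c = -(b ^ 2) / (c + 1) ^ 2 := by
    field_simp; ring
  rw [h3, neg_div] at h2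
  have h4 : 0 ≤ b ^ 2 / (c + 1) ^ 2 := by positivity
  have h5 : b ^ 2 / (c + 1) ^ 2 = 0 := le_antisymm (by linarith) h4
  rw [div_eq_zero_iff] at h5
  have h6 : b = 0 := by
    rcases h5 with h5 | h5
    · exact pow_eq_zero_iff (two_ne_zero) |>.1 h5
    · have : 0 < (c + 1) ^ 2 := by positivity
      linarith
  linarith

/-- Simultaneous diagonalization of a compact form and a nonnegative form, with the eigenvalues in
increasing order. -/
theorem exists_simultaneous_diagonalization [CompleteSpace H] (hH : ¬ FiniteDimensional ℝ H)
    {L : H →L[ℝ] E} (hL : IsCompactOperator L) (hLi : Function.Injective L)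
    {J : LinearMap.BilinForm ℝ H} (hJs : ∀ g h, J g h = J h g) (hJ0 : ∀ g, 0 ≤ J g g)
    {c C : ℝ} (hc : 0 < c) (hcA : ∀ g, c * ‖g‖ ^ 2 ≤ ‖L g‖ ^ 2 + J g g)
    (hAC : ∀ g, ‖L g‖ ^ 2 + J g g ≤ C * ‖g‖ ^ 2) :
    ∃ (φ : ℕ → H) (ρ : ℕ → ℝ),
      (∀ i j, inner ℝ (L (φ i)) (L (φ j)) = if i = j then (1 : ℝ) else 0) ∧
      (∀ i j, J (φ i) (φ j) = if i = j then ρ i else 0) ∧ (∀ i, 0 ≤ ρ i) ∧ Monotone ρ ∧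
      Tendsto ρ atTop atTop ∧ (Submodule.span ℝ (Set.range φ)).topologicalClosure = ⊤ := by
  -- Rayleigh quotients are taken against the sum of the two forms, which is equivalent to the norm,
  -- and not against J, which may vanish on nonzero vectors. A value s of this quotient corresponds
  -- to ρ = 1/s - 1.
  set A : LinearMap.BilinForm ℝ H := J + (innerₗ E).compl₁₂ (L : H →ₗ[ℝ] E) (L : H →ₗ[ℝ] E)
    with hAdef
  have hA : ∀ g h, A g h = J g h + inner ℝ (L g) (L h) := fun g h => by simp [hAdef]
  have hAd : ∀ g, A g g = ‖L g‖ ^ 2 + J g g := fun g => by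
    rw [hA, real_inner_self_eq_norm_sq, add_comm]
  have hAs : ∀ g h, A g h = A h g := fun g h => by rw [hA, hA, hJs, real_inner_comm]
  have hAnn : ∀ g, 0 ≤ A g g := fun g => by rw [hAd]; have := hJ0 g; positivity
  have hC0 : ∀ g : H, 0 ≤ C * ‖g‖ ^ 2 := fun g => by
    have := hAC g; have := hJ0 g; nlinarith [sq_nonneg ‖L g‖]
  have hC1 : 0 ≤ C := by
    by_contra h
    obtain ⟨g, hg⟩ : ∃ g : H, g ≠ 0 := by
      by_contra hne
      push Not at hne
      have : Subsingleton H := ⟨fun a b => by rw [hne a, hne b]⟩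
      exact hH inferInstance
    have h1 := hC0 g
    have h2 := norm_pos_iff.2 hg
    have h3 : 0 < ‖g‖ ^ 2 := by positivity
    nlinarith
  have hAb : ∀ g h, |A g h| ≤ C * ‖g‖ * ‖h‖ := by
    intro g h
    have h1 := LinearMap.BilinForm.apply_sq_le_of_symm A hAnn ⟨fun x y => by simp [hAs x y]⟩ g h
    have h2 : (A g h) ^ 2 ≤ (C * ‖g‖ * ‖h‖) ^ 2 := by
      calc (A g h) ^ 2 ≤ A g g * A h h := h1
        _ ≤ (C * ‖g‖ ^ 2) * (C * ‖h‖ ^ 2) := by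
          rw [hAd, hAd]
          exact mul_le_mul (hAC g) (hAC h) (by have := hAnn h; rwa [hAd] at this) (hC0 g)
        _ = _ := by ring
    exact abs_le_of_sq_le_sq h2 (by positivity)
  have hcA' : ∀ g, c * ‖g‖ ^ 2 ≤ A g g := fun g => by rw [hAd]; exact hcA g
  have hLA : ∀ g, ‖L g‖ ^ 2 ≤ A g g := fun g => by rw [hAd]; have := hJ0 g; linarith
  set A' : H →L[ℝ] H →L[ℝ] ℝ := A.mkContinuous₂ C fun g h => hAb g h with hA'
  have hA'A : ∀ g h, A' g h = A g h := fun g h => by simp [hA']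
  -- the orthogonal complement of finitely many vectors
  set W : (n : ℕ) → (Fin n → H) → Submodule ℝ H := fun n x =>
    LinearMap.ker (LinearMap.pi fun i : Fin n => A (x i)) with hWdef
  have hWmem : ∀ n (x : Fin n → H) g, g ∈ W n x ↔ ∀ i, A (x i) g = 0 := by
    intro n x g
    simp only [hWdef, LinearMap.mem_ker]
    exact ⟨fun h i => congrFun h i, fun h => funext h⟩
  have hWc : ∀ n (x : Fin n → H), IsClosed (W n x : Set H) := by
    intro n x
    have : (W n x : Set H) = ⋂ i, {g | A' (x i) g = 0} := by
      ext g
      simp [hWmem, hA'A]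
    rw [this]
    exact isClosed_iInter fun i => isClosed_eq (A' (x i)).continuous continuous_const
  have hW0 : ∀ n (x : Fin n → H), W n x ≠ ⊥ := by
    intro n x h
    exact hH (FiniteDimensional.of_injective _ (LinearMap.ker_eq_bot.1 h))
  choose F hFW hF1 hFmax using fun (n : ℕ) (x : Fin n → H) =>
    exists_maximizer hL hLi hc hcA' hAb hLA (hWc n x) (hW0 n x)
  -- Strong recursion: each vector maximizes the quotient on the A-orthogonal complement of all its
  -- predecessors.
  let e : ℕ → H := WellFounded.fix Nat.lt_wfRel.wf fun n ih => F n fun i => ih i i.2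
  have he : ∀ n, e n = F n fun i => e i := fun n => by
    change WellFounded.fix _ _ _ = _
    rw [WellFounded.fix_eq]
  have heW : ∀ n, e n ∈ W n fun i => e i := fun n => by
    have := hFW n fun i => e i
    rwa [← he] at this
  have he1 : ∀ n, A (e n) (e n) = 1 := fun n => by rw [he]; exact hF1 _ _
  have hemax : ∀ n, ∀ g ∈ W n (fun i => e i), ‖L g‖ ^ 2 ≤ ‖L (e n)‖ ^ 2 * A g g := fun n => by
    have := hFmax n fun i => e i
    rwa [← he] at this
  have hWmono : ∀ i j, i ≤ j → ∀ g ∈ W j (fun i => e i), g ∈ W i (fun i => e i) := by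
    intro i j hij g hg
    rw [hWmem] at hg ⊢
    exact fun k => hg ⟨k, k.2.trans_le hij⟩
  have hAlt : ∀ i j, i < j → A (e i) (e j) = 0 := fun i j hij =>
    (hWmem _ _ _).1 (heW j) ⟨i, hij⟩
  have hVlt : ∀ i j, i < j → inner ℝ (L (e i)) (L (e j)) = 0 := fun i j hij => by
    rw [inner_eq_of_maximizer hAs (heW i) (he1 i) (hemax i) (hWmono i j hij.le _ (heW j)),
      hAlt i j hij, mul_zero]
  set s : ℕ → ℝ := fun n => ‖L (e n)‖ ^ 2 with hs
  have he0 : ∀ n, e n ≠ 0 := fun n h => by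
    have := he1 n; simp [h] at this
  have hs0 : ∀ n, 0 < s n := fun n => by
    have : L (e n) ≠ 0 := fun h => he0 n (hLi (by simp [h]))
    have := norm_pos_iff.2 this
    positivity
  have hs1 : ∀ n, s n ≤ 1 := fun n => by have := hLA (e n); rwa [he1] at this
  have hsanti : Antitone s := fun i j hij => by
    have := hemax i (e j) (hWmono i j hij _ (heW j))
    rwa [he1, mul_one] at this
  -- The images L (e n) are pairwise orthogonal. If their squared norms stayed above δ > 0, no
  -- subsequence could be Cauchy, against compactness.
  have hst : Tendsto s atTop (𝓝 0) := by
    have h1 := tendsto_atTop_ciInf hsanti ⟨0, by rintro _ ⟨n, rfl⟩; exact (hs0 n).le⟩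
    set δ := ⨅ n, s n with hδ
    have hδle : ∀ n, δ ≤ s n := fun n => ciInf_le ⟨0, by rintro _ ⟨n, rfl⟩; exact (hs0 n).le⟩ n
    rcases (le_ciInf fun n => (hs0 n).le : 0 ≤ δ).eq_or_lt with h | hpos
    · rwa [show δ = 0 from h.symm] at h1
    exfalso
    have heb : ∀ k, e k ∈ Metric.closedBall (0 : H) (Real.sqrt (1 / c)) := by
      intro k
      rw [mem_closedBall_zero_iff]
      refine Real.le_sqrt_of_sq_le ?_
      have := hcA' (e k)
      rw [he1] at this
      rw [le_div_iff₀ hc]; linarith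
    obtain ⟨y, -, ψ, hψ, hy⟩ := (hL.isCompact_closure_image_closedBall
      (Real.sqrt (1 / c))).tendsto_subseq (x := fun k => L (e k))
      fun k => subset_closure ⟨_, heb k, rfl⟩
    obtain ⟨N, hN⟩ := Metric.cauchySeq_iff.1 hy.cauchySeq (Real.sqrt δ) (Real.sqrt_pos.2 hpos)
    have h2 := hN N le_rfl (N + 1) (Nat.le_succ N)
    simp only [Function.comp_apply] at h2
    rw [dist_eq_norm] at h2
    have h3 := norm_sub_sq_real (L (e (ψ N))) (L (e (ψ (N + 1))))
    rw [hVlt _ _ (hψ (Nat.lt_succ_self N))] at h3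
    have h4 : ‖L (e (ψ N)) - L (e (ψ (N + 1)))‖ ^ 2 < δ := by
      have := pow_lt_pow_left₀ h2 (norm_nonneg _) two_ne_zero
      rwa [Real.sq_sqrt hpos.le] at this
    have h5 := hδle (ψ N)
    have h6 := hδle (ψ (N + 1))
    simp only [hs] at h5 h6
    linarith
  have hsq : ∀ n, Real.sqrt (s n) ≠ 0 := fun n => (Real.sqrt_pos.2 (hs0 n)).ne'
  have hJe : ∀ n, J (e n) (e n) = 1 - s n := fun n => by
    have h1 := hAd (e n); rw [he1] at h1; simp only [hs]; linarith
  have hJlt : ∀ i j, i < j → J (e i) (e j) = 0 := fun i j hij => by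
    have h1 := hA (e i) (e j)
    rw [hAlt i j hij, hVlt i j hij] at h1
    linarith
  refine ⟨fun n => (Real.sqrt (s n))⁻¹ • e n, fun n => (s n)⁻¹ - 1, ?_, ?_, ?_, ?_, ?_, ?_⟩
  · intro i j
    simp only [map_smul, inner_smul_left, inner_smul_right, RCLike.conj_to_real]
    split_ifs with h
    · subst h
      rw [real_inner_self_eq_norm_sq, ← mul_assoc, ← mul_inv, Real.mul_self_sqrt (hs0 i).le]
      exact inv_mul_cancel₀ (hs0 i).ne'
    · rcases lt_or_gt_of_ne h with h | h
      · rw [hVlt i j h]; simp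
      · rw [real_inner_comm, hVlt j i h]; simp
  · intro i j
    simp only [map_smul, LinearMap.smul_apply, smul_eq_mul]
    split_ifs with h
    · subst h
      rw [hJe, ← mul_assoc, ← mul_inv, Real.mul_self_sqrt (hs0 i).le, mul_sub, mul_one,
        inv_mul_cancel₀ (hs0 i).ne']
    · rcases lt_or_gt_of_ne h with h | h
      · rw [hJlt i j h]; simp
      · rw [hJs, hJlt j i h]; simp
  · intro i
    have := (one_le_inv₀ (hs0 i)).2 (hs1 i)
    linarith
  · intro i j hij
    have := inv_anti₀ (hs0 j) (hsanti hij)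
    simp only
    linarith
  · have h1 : Tendsto (fun n => (s n)⁻¹) atTop atTop :=
      Tendsto.inv_tendsto_nhdsGT_zero
        (tendsto_nhdsWithin_iff.2 ⟨hst, Eventually.of_forall hs0⟩)
    exact tendsto_atTop_add_const_right _ _ h1
  · by_contra hne
    set S := (Submodule.span ℝ (Set.range fun n => (Real.sqrt (s n))⁻¹ • e n)).topologicalClosure
      with hS
    have hSc : CompleteSpace S :=
      (Submodule.isClosed_topologicalClosure _).completeSpace_coe
    have h1 : Sᗮ ≠ ⊥ := fun h => hne ((Submodule.orthogonal_eq_bot_iff).1 h)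
    obtain ⟨f, hfS, hf0⟩ := Sᗮ.exists_mem_ne_zero_of_ne_bot h1
    -- Lax-Milgram writes the pairing with f as A(g, ·). Since f is orthogonal to the system, g is
    -- A-orthogonal to every e n, so ‖L g‖² ≤ s n · A(g, g) for all n. Letting s n tend to 0 and
    -- using injectivity of L gives g = 0.
    have hco : IsCoercive A' := ⟨c, hc, fun g => by
      have := hcA' g
      rw [hA'A]; nlinarith⟩
    obtain ⟨g, hg⟩ := hco.continuousLinearEquivOfBilin.surjective f
    have hgA : ∀ h, A g h = inner ℝ f h := fun h => by
      rw [← hA'A, ← hg]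
      exact (hco.continuousLinearEquivOfBilin_apply g h).symm
    have hge : ∀ n, A g (e n) = 0 := by
      intro n
      have hm : (Real.sqrt (s n))⁻¹ • e n ∈ S :=
        Submodule.le_topologicalClosure _ (Submodule.subset_span ⟨n, rfl⟩)
      have h2 := Submodule.inner_left_of_mem_orthogonal hm hfS
      rw [← hgA, map_smul, smul_eq_mul] at h2
      exact (mul_eq_zero.1 h2).resolve_left (inv_ne_zero (hsq n))
    have hgW : ∀ n, ‖L g‖ ^ 2 ≤ s n * A g g := fun n =>
      hemax n g ((hWmem _ _ _).2 fun i => by rw [hAs]; exact hge i)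
    have hLg : ‖L g‖ ^ 2 ≤ 0 := by
      have h3 : Tendsto (fun n => s n * A g g) atTop (𝓝 0) := by
        simpa using hst.mul_const (A g g)
      exact ge_of_tendsto h3 (Eventually.of_forall hgW)
    have hg0 : g = 0 := by
      have : L g = 0 := by
        rw [← norm_eq_zero]
        exact pow_eq_zero_iff two_ne_zero |>.1 (le_antisymm hLg (sq_nonneg _))
      exact hLi (by simp [this])
    apply hf0
    rw [← hg, hg0, map_zero]

end Eigensystem

/-! ### Exponential tilting: bounded log densities, cumulants, divergences. -/

section Tilting

variable {α : Type*} [MeasurableSpace α]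

/-- If the variances of indicators under `P` and `Q` are comparable, then so are the measures:
one half of the comparison. -/
lemma measureReal_le_of_variance_comparison {P Q : Measure α} [IsProbabilityMeasure P]
    [IsProbabilityMeasure Q] {c C : ℝ} (hc : 0 < c) (hC : 0 < C)
    (h1 : ∀ E, MeasurableSet E → c * (P.real E * (1 - P.real E)) ≤ Q.real E * (1 - Q.real E))
    (h2 : ∀ E, MeasurableSet E → Q.real E * (1 - Q.real E) ≤ C * (P.real E * (1 - P.real E)))
    {G : Set α} (hG : MeasurableSet G) {q : ℝ} (hq : 0 < q)
    (hGq : q ≤ P.real G * (1 - P.real G))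
    {E : Set α} (hE : MeasurableSet E) :
    Q.real E ≤ max (2 * C) ((1 + 2 * C / c) / q) * P.real E := by
  have hx0 : 0 ≤ P.real E := measureReal_nonneg
  have hx1 : P.real E ≤ 1 := measureReal_le_one
  have hy0 : 0 ≤ Q.real E := measureReal_nonneg
  have hy1 : Q.real E ≤ 1 := measureReal_le_one
  have h2E := h2 E hE
  have hCx : Q.real E * (1 - Q.real E) ≤ C * P.real E :=
    h2E.trans (mul_le_mul_of_nonneg_left (by nlinarith) hC.le)
  rcases le_total (Q.real E) (1 / 2) with hy | hy
  · calc Q.real E ≤ 2 * C * P.real E := by nlinarith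
      _ ≤ _ := mul_le_mul_of_nonneg_right (le_max_left _ _) hx0
  -- Indicator variances do not distinguish a set from its complement, so small P(E) might go with
  -- Q(E) near 1. The reference set G excludes this. Its part outside E has Q-measure at most
  -- 2C·P(E), hence small P-variance, so q is at most a constant times P(E) and the trivial bound
  -- Q(E) ≤ 1 suffices.
  · have hy2 : 1 - Q.real E ≤ 2 * C * P.real E := by nlinarith
    have hg1 : Q.real (G ∩ Eᶜ) ≤ 2 * C * P.real E := by
      refine le_trans (measureReal_mono Set.inter_subset_right) ?_
      rw [probReal_compl_eq_one_sub hE]; exact hy2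
    have hg2 := h1 (G ∩ Eᶜ) (hG.inter hE.compl)
    have hg3 : Q.real (G ∩ Eᶜ) * (1 - Q.real (G ∩ Eᶜ)) ≤ 2 * C * P.real E := by
      have : 0 ≤ Q.real (G ∩ Eᶜ) := measureReal_nonneg
      nlinarith
    have hg4 : P.real (G ∩ Eᶜ) ≤ P.real G := measureReal_mono Set.inter_subset_left
    have hg5 : P.real G ≤ P.real (G ∩ Eᶜ) + P.real E := by
      have h := measureReal_union_le (μ := P) (G ∩ Eᶜ) E
      refine (measureReal_mono ?_).trans h
      intro x hx
      by_cases hxE : x ∈ E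
      · exact Or.inr hxE
      · exact Or.inl ⟨hx, hxE⟩
    have hG1 : P.real G ≤ 1 := measureReal_le_one
    have hG0 : 0 ≤ P.real (G ∩ Eᶜ) := measureReal_nonneg
    have hg6 : q - P.real E ≤ P.real (G ∩ Eᶜ) * (1 - P.real (G ∩ Eᶜ)) := by
      nlinarith
    have hg7 : c * (q - P.real E) ≤ 2 * C * P.real E :=
      (mul_le_mul_of_nonneg_left hg6 hc.le).trans (hg2.trans hg3)
    have hg8 : q ≤ (1 + 2 * C / c) * P.real E := by
      have : q - P.real E ≤ 2 * C * P.real E / c := by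
        rw [le_div_iff₀ hc]; linarith
      calc q ≤ P.real E + 2 * C * P.real E / c := by linarith
        _ = _ := by ring
    calc Q.real E ≤ 1 := hy1
      _ ≤ (1 + 2 * C / c) / q * P.real E := by
        rw [div_mul_eq_mul_div, le_div_iff₀ hq]; linarith
      _ ≤ _ := mul_le_mul_of_nonneg_right (le_max_right _ _) hx0

/-- The two-sided comparison of measures with comparable variances of indicators. -/
lemma exists_measureReal_comparison {P : Measure α} [IsProbabilityMeasure P] {c C : ℝ}
    (hc : 0 < c) (hC : 0 < C) {G : Set α} (hG : MeasurableSet G)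
    (hq : 0 < P.real G * (1 - P.real G)) :
    ∃ B : ℝ, 1 ≤ B ∧ ∀ Q : Measure α, IsProbabilityMeasure Q →
    (∀ E, MeasurableSet E → c * (P.real E * (1 - P.real E)) ≤ Q.real E * (1 - Q.real E)) →
    (∀ E, MeasurableSet E → Q.real E * (1 - Q.real E) ≤ C * (P.real E * (1 - P.real E))) →
    ∀ E, MeasurableSet E → Q.real E ≤ B * P.real E ∧ P.real E ≤ B * Q.real E := by
  set q := P.real G * (1 - P.real G) with hqd
  set B₁ := max (2 * C) ((1 + 2 * C / c) / q)
  -- The constant for exchanged roles: the comparison constants are inverted, and the Q-variance of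
  -- G is at least c q. Neither B₁ nor B₂ depends on Q, which yields uniformity over the
  -- neighbourhood.
  set B₂ := max (2 * c⁻¹) ((1 + 2 * c⁻¹ / C⁻¹) / (c * q))
  refine ⟨max 1 (max B₁ B₂), le_max_left _ _, fun Q hQ h1 h2 E hE => ⟨?_, ?_⟩⟩
  · refine (measureReal_le_of_variance_comparison hc hC h1 h2 hG hq le_rfl hE).trans ?_
    exact mul_le_mul_of_nonneg_right ((le_max_left _ _).trans (le_max_right _ _))
      measureReal_nonneg
  · refine (measureReal_le_of_variance_comparison (P := Q) (Q := P) (inv_pos.2 hC) (inv_pos.2 hc)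
      (fun E hE => ?_) (fun E hE => ?_) hG (mul_pos hc hq) (h1 G hG) hE).trans ?_
    · rw [inv_mul_le_iff₀ hC]; exact h2 E hE
    · rw [le_inv_mul_iff₀ hc]; exact h1 E hE
    · exact mul_le_mul_of_nonneg_right ((le_max_right _ _).trans (le_max_right _ _))
        measureReal_nonneg

lemma exp_sub_log_integral {P : Measure α} [IsProbabilityMeasure P] {Δ : α → ℝ}
    (hΔ : Integrable (fun x => Real.exp (Δ x)) P) (x : α) :
    Real.exp (Δ x) / ∫ y, Real.exp (Δ y) ∂P
      = Real.exp (Δ x - Real.log (∫ y, Real.exp (Δ y) ∂P)) := by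
  rw [Real.exp_sub, Real.exp_log (integral_exp_pos hΔ)]

/-- Comparable measures have a bounded log density. -/
lemma abs_sub_log_le_of_comparison {P : Measure α} [IsProbabilityMeasure P] {Δ : α → ℝ}
    (hΔ : Integrable (fun x => Real.exp (Δ x)) P) {B : ℝ} (hB : 1 ≤ B)
    (h : ∀ E, MeasurableSet E → (P.tilted Δ).real E ≤ B * P.real E ∧
      P.real E ≤ B * (P.tilted Δ).real E) :
    ∀ᵐ x ∂P, |Δ x - Real.log (∫ y, Real.exp (Δ y) ∂P)| ≤ Real.log B := by
  set w : α → ℝ := fun x => Real.exp (Δ x) / ∫ y, Real.exp (Δ y) ∂P with hw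
  have hwi : Integrable w P := hΔ.div_const _
  have hQ : ∀ E, MeasurableSet E → (P.tilted Δ).real E = ∫ x in E, w x ∂P := by
    intro E hE
    rw [measureReal_def, tilted_apply_eq_ofReal_integral' _ hE, ENNReal.toReal_ofReal]
    exact integral_nonneg fun x => by
      have := integral_exp_pos hΔ; positivity
  have h1 : w ≤ᵐ[P] fun _ => B := by
    refine ae_le_of_forall_setIntegral_le hwi (integrable_const B) fun E hE _ => ?_
    rw [← hQ E hE]
    simpa [mul_comm] using (h E hE).1
  have h2 : (fun _ => (1 : ℝ)) ≤ᵐ[P] fun x => B * w x := by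
    refine ae_le_of_forall_setIntegral_le (integrable_const 1) (hwi.const_mul B) fun E hE _ => ?_
    rw [integral_const_mul, ← hQ E hE]
    simpa using (h E hE).2
  filter_upwards [h1, h2] with x hx1 hx2
  have hB0 : 0 < B := by linarith
  simp only [hw, exp_sub_log_integral hΔ] at hx1 hx2
  rw [abs_le]
  constructor
  · rw [neg_le, ← Real.log_exp (-(Δ x - Real.log (∫ y, Real.exp (Δ y) ∂P)))]
    refine Real.log_le_log (Real.exp_pos _) ?_
    rw [Real.exp_neg, inv_le_iff_one_le_mul₀ (Real.exp_pos _)]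
    exact hx2
  · rw [Real.le_log_iff_exp_le hB0]; exact hx1

lemma abs_exp_sub_one_le_mul {t b : ℝ} (ht : |t| ≤ b) : |Real.exp t - 1| ≤ |t| * Real.exp b := by
  have h1 := abs_le.1 ht
  have hb : 1 ≤ Real.exp b := Real.one_le_exp ((abs_nonneg t).trans ht)
  rcases le_total 0 t with h | h
  · rw [abs_of_nonneg (by linarith [Real.one_le_exp h]), abs_of_nonneg h]
    have h2 := Real.add_one_le_exp (-t)
    have h3 : Real.exp t * (1 - t) ≤ 1 := by
      calc Real.exp t * (1 - t) ≤ Real.exp t * Real.exp (-t) :=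
            mul_le_mul_of_nonneg_left (by linarith) (Real.exp_pos _).le
        _ = 1 := by rw [← Real.exp_add]; simp
    have h4 : Real.exp t ≤ Real.exp b := Real.exp_le_exp.2 h1.2
    nlinarith
  · rw [abs_of_nonpos (by linarith [Real.exp_le_one_iff.2 h]), abs_of_nonpos h]
    have h2 := Real.add_one_le_exp t
    nlinarith

/-- Since exp(z/2) ≥ 1 + z/2, the right side is at least (exp(z/2) - 1)², and |exp(z/2) - 1| is
bounded below by a multiple of |z|. -/
lemma sq_mul_le_exp_sub {z b : ℝ} (hz : |z| ≤ b) :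
    Real.exp (-b) / 4 * z ^ 2 ≤ Real.exp z - 1 - z := by
  have h1 : Real.exp z = Real.exp (z / 2) ^ 2 := by rw [sq, ← Real.exp_add]; ring_nf
  have h2 := Real.add_one_le_exp (z / 2)
  have h3 : (Real.exp (z / 2) - 1) ^ 2 ≤ Real.exp z - 1 - z := by rw [h1]; nlinarith
  have h4 : Real.exp (-b / 2) * (|z| / 2) ≤ |Real.exp (z / 2) - 1| := by
    have hb := abs_le.1 hz
    have he : Real.exp (-b / 2) ≤ 1 := Real.exp_le_one_iff.2 (by linarith [(abs_nonneg z).trans hz])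
    rcases le_total 0 z with h | h
    · rw [abs_of_nonneg h]
      refine le_trans ?_ (le_abs_self _)
      nlinarith
    · rw [abs_of_nonpos h]
      refine le_trans ?_ (neg_le_abs _)
      have h5 := Real.add_one_le_exp (-z / 2)
      have h6 : Real.exp (z / 2) * Real.exp (-z / 2) = 1 := by rw [← Real.exp_add]; ring_nf; simp
      have h7 : Real.exp (-b / 2) ≤ Real.exp (z / 2) := Real.exp_le_exp.2 (by linarith)
      have h8 : Real.exp (z / 2) * (-z / 2) ≤ 1 - Real.exp (z / 2) := by
        nlinarith [Real.exp_pos (z / 2)]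
      nlinarith
  have h5 : (Real.exp (-b / 2) * (|z| / 2)) ^ 2 ≤ (Real.exp (z / 2) - 1) ^ 2 := by
    rw [← sq_abs (Real.exp (z / 2) - 1)]
    exact pow_le_pow_left₀ (by positivity) h4 2
  have h6 : Real.exp (-b) = Real.exp (-b / 2) ^ 2 := by rw [sq, ← Real.exp_add]; ring_nf
  calc Real.exp (-b) / 4 * z ^ 2 = (Real.exp (-b / 2) * (|z| / 2)) ^ 2 := by
        rw [h6, mul_pow, div_pow, sq_abs]; ring
    _ ≤ _ := h5.trans h3

/-- The Cauchy-Schwarz inequality for integrals. -/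
lemma sq_integral_mul_le {P : Measure α} {f g : α → ℝ} (hf : MemLp f 2 P) (hg : MemLp g 2 P) :
    (∫ x, f x * g x ∂P) ^ 2 ≤ (∫ x, f x ^ 2 ∂P) * ∫ x, g x ^ 2 ∂P := by
  have h := real_inner_mul_inner_self_le (hf.toLp f) (hg.toLp g)
  have key : ∀ {u v : α → ℝ} (hu : MemLp u 2 P) (hv : MemLp v 2 P),
      inner ℝ (hu.toLp u) (hv.toLp v) = ∫ x, u x * v x ∂P := by
    intro u v hu hv
    rw [L2.inner_def]
    refine integral_congr_ae ?_
    filter_upwards [hu.coeFn_toLp, hv.coeFn_toLp] with x h1 h2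
    rw [h1, h2]
    simp [mul_comm]
  rw [key, key, key] at h
  simpa [sq] using h

section Bounded

variable {P : Measure α} [IsProbabilityMeasure P] {Δ : α → ℝ} {b : ℝ}

lemma integral_tilted_eq (hΔ : Integrable (fun x => Real.exp (Δ x)) P) (f : α → ℝ) :
    ∫ x, f x ∂(P.tilted Δ)
      = ∫ x, Real.exp (Δ x - Real.log (∫ y, Real.exp (Δ y) ∂P)) * f x ∂P := by
  rw [integral_tilted]
  simp_rw [exp_sub_log_integral hΔ, smul_eq_mul]

lemma integral_exp_sub_log (hΔ : Integrable (fun x => Real.exp (Δ x)) P) :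
    ∫ x, Real.exp (Δ x - Real.log (∫ y, Real.exp (Δ y) ∂P)) ∂P = 1 := by
  simp_rw [← exp_sub_log_integral hΔ]
  rw [integral_div, div_self (integral_exp_pos hΔ).ne']

/-- The cumulant is bounded below by the variance when the log density is bounded. -/
lemma sq_le_log_integral_exp (hΔ : Integrable (fun x => Real.exp (Δ x)) P) (h2 : MemLp Δ 2 P)
    (h0 : ∫ x, Δ x ∂P = 0)
    (hb : ∀ᵐ x ∂P, |Δ x - Real.log (∫ y, Real.exp (Δ y) ∂P)| ≤ b) :
    Real.exp (-b) / 4 * ∫ x, Δ x ^ 2 ∂P ≤ Real.log (∫ y, Real.exp (Δ y) ∂P) := by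
  set c := Real.log (∫ y, Real.exp (Δ y) ∂P) with hc
  have iΔ := h2.integrable one_le_two
  have hZ2 : MemLp (fun x => Δ x - c) 2 P := h2.sub (memLp_const c)
  have hZ := hZ2.integrable one_le_two
  have hexp : Integrable (fun x => Real.exp (Δ x - c)) P := by
    simp_rw [hc, ← exp_sub_log_integral hΔ]
    exact hΔ.div_const _
  have h1 : ∫ x, Real.exp (-b) / 4 * (Δ x - c) ^ 2 ∂P
      ≤ ∫ x, (Real.exp (Δ x - c) - 1 - (Δ x - c)) ∂P := by
    refine integral_mono_ae (hZ2.integrable_sq.const_mul _)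
      ((hexp.sub (integrable_const 1)).sub hZ) ?_
    filter_upwards [hb] with x hx using sq_mul_le_exp_sub hx
  -- The variable Z = Δ - c has mean -c and exponential mean 1, so the mean of exp Z - 1 - Z is
  -- exactly the cumulant.
  have h3 : ∫ x, (Real.exp (Δ x - c) - 1 - (Δ x - c)) ∂P = c := by
    have ic : Integrable (fun x => Real.exp (Δ x - c) - 1) P := hexp.sub (integrable_const 1)
    rw [integral_sub ic hZ, integral_sub hexp (integrable_const 1), hc, integral_exp_sub_log hΔ,
      integral_sub iΔ (integrable_const _), h0]
    simp
  have h4 : ∫ x, (Δ x - c) ^ 2 ∂P = ∫ x, Δ x ^ 2 ∂P + c ^ 2 := by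
    have h5 : ∀ x, (Δ x - c) ^ 2 = Δ x ^ 2 - 2 * c * Δ x + c ^ 2 := fun x => by ring
    simp_rw [h5]
    have i1 : Integrable (fun x => Δ x ^ 2 - 2 * c * Δ x) P :=
      h2.integrable_sq.sub (iΔ.const_mul _)
    rw [integral_add i1 (integrable_const _), integral_sub h2.integrable_sq (iΔ.const_mul _),
      integral_const_mul, h0]
    simp
  rw [integral_const_mul, h4, h3] at h1
  have h5 : 0 ≤ Real.exp (-b) / 4 * c ^ 2 := by positivity
  linarith

lemma le_log_integral_exp (hΔ : Integrable (fun x => Real.exp (Δ x)) P)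
    (h2 : Integrable Δ P) :
    ∫ x, Δ x ∂P ≤ Real.log (∫ y, Real.exp (Δ y) ∂P) := by
  rw [Real.le_log_iff_exp_le (integral_exp_pos hΔ)]
  exact convexOn_exp.map_integral_le Real.continuous_exp.continuousOn isClosed_univ (by simp) h2 hΔ

/-- Bounded log densities: the cumulant and the centered log density are bounded. -/
lemma log_integral_exp_le (h2 : Integrable Δ P) (h0 : ∫ x, Δ x ∂P = 0)
    (hb : ∀ᵐ x ∂P, |Δ x - Real.log (∫ y, Real.exp (Δ y) ∂P)| ≤ b) :
    Real.log (∫ y, Real.exp (Δ y) ∂P) ≤ b := by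
  set c := Real.log (∫ y, Real.exp (Δ y) ∂P) with hc
  have h1 : ∫ _, (-b : ℝ) ∂P ≤ ∫ x, (Δ x - c) ∂P := by
    refine integral_mono_ae (integrable_const _) (h2.sub (integrable_const c)) ?_
    filter_upwards [hb] with x hx using (abs_le.1 hx).1
  rw [integral_sub h2 (integrable_const c), h0] at h1
  simp at h1
  linarith

/-- For centred Δ the cumulant lies between 0 (Jensen) and b (averaging the bound), so removing it
costs at most another b. -/
lemma abs_le_of_abs_sub_log_le (hΔ : Integrable (fun x => Real.exp (Δ x)) P)
    (h2 : Integrable Δ P) (h0 : ∫ x, Δ x ∂P = 0)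
    (hb : ∀ᵐ x ∂P, |Δ x - Real.log (∫ y, Real.exp (Δ y) ∂P)| ≤ b) :
    ∀ᵐ x ∂P, |Δ x| ≤ 2 * b := by
  have h3 := log_integral_exp_le h2 h0 hb
  have h4 := le_log_integral_exp hΔ h2
  rw [h0] at h4
  filter_upwards [hb] with x hx
  rw [abs_le] at hx ⊢
  constructor <;> linarith

/-- Means under the tilted measure of functions centered under the original measure. -/
lemma sq_integral_tilted_le (hΔ : Integrable (fun x => Real.exp (Δ x)) P) (h2 : MemLp Δ 2 P)
    (h0 : ∫ x, Δ x ∂P = 0)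
    (hb : ∀ᵐ x ∂P, |Δ x - Real.log (∫ y, Real.exp (Δ y) ∂P)| ≤ b)
    {f : α → ℝ} (hf : MemLp f 2 P) (hf0 : ∫ x, f x ∂P = 0) :
    (∫ x, f x ∂(P.tilted Δ)) ^ 2
      ≤ Real.exp (2 * b) ^ 2 * ((∫ x, Δ x ^ 2 ∂P) * ∫ x, f x ^ 2 ∂P) := by
  have iΔ := h2.integrable one_le_two
  have hf1 := hf.integrable one_le_two
  have h3 := abs_le_of_abs_sub_log_le hΔ iΔ h0 hb
  have hc0 := le_log_integral_exp hΔ iΔ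
  rw [h0] at hc0
  rw [integral_tilted_eq hΔ]
  set c := Real.log (∫ y, Real.exp (Δ y) ∂P) with hc
  have hgb : ∀ᵐ x ∂P, |Real.exp (Δ x - c) - Real.exp (-c)| ≤ Real.exp (2 * b) * |Δ x| := by
    filter_upwards [h3] with x hx
    have h4 : Real.exp (Δ x - c) - Real.exp (-c) = Real.exp (-c) * (Real.exp (Δ x) - 1) := by
      rw [show Δ x - c = -c + Δ x by ring, Real.exp_add]; ring
    rw [h4, abs_mul, abs_of_pos (Real.exp_pos _)]
    have h5 : Real.exp (-c) ≤ 1 := Real.exp_le_one_iff.2 (by linarith)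
    have h6 := abs_exp_sub_one_le_mul hx
    nlinarith [abs_nonneg (Real.exp (Δ x) - 1)]
  have hgm : AEStronglyMeasurable (fun x => Real.exp (Δ x - c) - Real.exp (-c)) P := by
    have := h2.1
    have h4 : AEStronglyMeasurable (fun x => Real.exp (Δ x - c)) P :=
      Real.continuous_exp.comp_aestronglyMeasurable (this.sub aestronglyMeasurable_const)
    exact h4.sub aestronglyMeasurable_const
  have hg : MemLp (fun x => Real.exp (Δ x - c) - Real.exp (-c)) 2 P := by
    refine MemLp.of_le_mul (c := Real.exp (2 * b)) h2 hgm ?_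
    filter_upwards [hgb] with x hx using by simpa [Real.norm_eq_abs] using hx
  -- Because f is centred, a constant may be subtracted from the density. Subtracting exp(-c) leaves
  -- a factor of order |Δ|.
  have h7 : ∫ x, Real.exp (Δ x - c) * f x ∂P
      = ∫ x, (Real.exp (Δ x - c) - Real.exp (-c)) * f x ∂P := by
    have h8 : ∀ x, Real.exp (Δ x - c) * f x
        = (Real.exp (Δ x - c) - Real.exp (-c)) * f x + Real.exp (-c) * f x := fun x => by ring
    simp_rw [h8]
    have ig : Integrable (fun x => (Real.exp (Δ x - c) - Real.exp (-c)) * f x) P :=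
      hg.integrable_mul hf
    rw [integral_add ig (hf1.const_mul _), integral_const_mul, hf0]
    simp
  rw [h7]
  refine (sq_integral_mul_le hg hf).trans ?_
  rw [← mul_assoc]
  refine mul_le_mul_of_nonneg_right ?_ (integral_nonneg fun x => sq_nonneg _)
  rw [← integral_const_mul]
  refine integral_mono_ae hg.integrable_sq (h2.integrable_sq.const_mul _) ?_
  filter_upwards [hgb] with x hx
  calc (Real.exp (Δ x - c) - Real.exp (-c)) ^ 2
      = |Real.exp (Δ x - c) - Real.exp (-c)| ^ 2 := (sq_abs _).symm
    _ ≤ (Real.exp (2 * b) * |Δ x|) ^ 2 := pow_le_pow_left₀ (abs_nonneg _) hx 2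
    _ = _ := by rw [mul_pow, sq_abs]

/-- The cumulant is bounded above by the variance when the log density is bounded. -/
lemma integral_tilted_self_le (hΔ : Integrable (fun x => Real.exp (Δ x)) P) (h2 : MemLp Δ 2 P)
    (h0 : ∫ x, Δ x ∂P = 0)
    (hb : ∀ᵐ x ∂P, |Δ x - Real.log (∫ y, Real.exp (Δ y) ∂P)| ≤ b) :
    ∫ x, Δ x ∂(P.tilted Δ) ≤ Real.exp (2 * b) * ∫ x, Δ x ^ 2 ∂P := by
  have h := sq_integral_tilted_le hΔ h2 h0 hb h2 h0
  have h1 : 0 ≤ ∫ x, Δ x ^ 2 ∂P := integral_nonneg fun x => sq_nonneg _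
  refine (abs_le_of_sq_le_sq' (h.trans (le_of_eq ?_)) (by positivity)).2
  ring

/-- Nonnegativity of the divergence of the tilted measure from P, obtained pointwise from y·exp y ≥
exp y - 1 at y = Δ - c. -/
lemma log_integral_exp_le_integral_tilted (hΔ : Integrable (fun x => Real.exp (Δ x)) P)
    (h2 : MemLp Δ 2 P)
    (hb : ∀ᵐ x ∂P, |Δ x - Real.log (∫ y, Real.exp (Δ y) ∂P)| ≤ b) :
    Real.log (∫ y, Real.exp (Δ y) ∂P) ≤ ∫ x, Δ x ∂(P.tilted Δ) := by
  rw [integral_tilted_eq hΔ]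
  have hexp : Integrable (fun x => Real.exp (Δ x - Real.log (∫ y, Real.exp (Δ y) ∂P))) P := by
    simp_rw [← exp_sub_log_integral hΔ]
    exact hΔ.div_const _
  have h1 := integral_exp_sub_log hΔ
  set c := Real.log (∫ y, Real.exp (Δ y) ∂P) with hc
  have iΔ := h2.integrable one_le_two
  have i1 : Integrable (fun x => Real.exp (Δ x - c) * Δ x) P := by
    refine Integrable.bdd_mul (c := Real.exp b) iΔ hexp.1 ?_
    filter_upwards [hb] with x hx
    rw [Real.norm_eq_abs, abs_of_pos (Real.exp_pos _)]
    exact Real.exp_le_exp.2 (abs_le.1 hx).2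
  have h3 : ∫ x, ((c + 1) * Real.exp (Δ x - c) - 1) ∂P ≤ ∫ x, Real.exp (Δ x - c) * Δ x ∂P := by
    refine integral_mono ((hexp.const_mul _).sub (integrable_const 1)) i1 fun x => ?_
    have h4 := Real.add_one_le_exp (-(Δ x - c))
    have h5 : Real.exp (Δ x - c) * Real.exp (-(Δ x - c)) = 1 := by rw [← Real.exp_add]; simp
    have h6 := mul_le_mul_of_nonneg_left h4 (Real.exp_pos (Δ x - c)).le
    simp only
    linarith
  rw [integral_sub (hexp.const_mul _) (integrable_const 1), integral_const_mul, h1] at h3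
  simpa using h3

end Bounded

/-- The Kullback-Leibler divergence of a probability measure from a tilting of it. -/
lemma klDiv_tilted_right {P : Measure α} [IsProbabilityMeasure P] {Δ : α → ℝ}
    (hΔ : Integrable (fun x => Real.exp (Δ x)) P) (h1 : Integrable Δ P) :
    InformationTheory.klDiv P (P.tilted Δ)
      = ENNReal.ofReal (-∫ x, Δ x ∂P + Real.log (∫ y, Real.exp (Δ y) ∂P)) := by
  have hself : Integrable (llr P P) P := by
    rw [integrable_congr (llr_self P)]; exact integrable_zero _ _ _
  have := isProbabilityMeasure_tilted hΔ
  rw [InformationTheory.klDiv_of_ac_of_integrable (absolutelyContinuous_tilted hΔ)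
    (integrable_llr_tilted_right Measure.AbsolutelyContinuous.rfl h1 hself hΔ),
    integral_llr_tilted_right Measure.AbsolutelyContinuous.rfl h1 hΔ hself,
    integral_congr_ae (llr_self P)]
  simp

end Tilting

/-! ### Splitting an almost sure bound on a sum over samples into samplewise bounds. -/

section Decoupling

variable {m : ℕ} {𝓧 : Fin m → Type*} [∀ l, MeasurableSpace (𝓧 l)]
  {Ω : Type*} [MeasurableSpace Ω] {μ : Measure Ω}
  {P : ∀ l, Measure (𝓧 l)} {X : ∀ l, ℕ → Ω → 𝓧 l} {n : Fin m → ℕ}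

/-- By independence, with positive probability all observations of all samples fall below their
thresholds at once. On that event the sum of the averages is at most the sum of the thresholds. -/
lemma sum_nonneg_of_measure_lt_pos (hXm : ∀ l i, Measurable (X l i))
    (hXlaw : ∀ l i, μ.map (X l i) = P l)
    (hXi : iIndepFun (fun q : Fin m × ℕ => X q.1 q.2) μ) (hn : ∀ l, 0 < n l)
    {D : ∀ l, 𝓧 l → ℝ} (hD : ∀ l, Measurable (D l))
    (h : ∀ᵐ ω ∂μ, 0 ≤ ∑ l, (n l : ℝ)⁻¹ * ∑ i ∈ Finset.range (n l), D l (X l i ω))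
    {c : Fin m → ℝ} (hc : ∀ l, 0 < P l {x | D l x < c l}) : 0 ≤ ∑ l, c l := by
  have hmeas : ∀ l, MeasurableSet {x | D l x < c l} := fun l =>
    measurableSet_lt (hD l) measurable_const
  set S : Finset (Fin m × ℕ) := Finset.univ ×ˢ Finset.range (Finset.univ.sup n)
  have h1 := hXi.measure_inter_preimage_eq_mul S (sets := fun q => {x | D q.1 x < c q.1})
    fun q _ => hmeas q.1
  have h2 : μ (⋂ q ∈ S, X q.1 q.2 ⁻¹' {x | D q.1 x < c q.1}) ≠ 0 := by
    rw [h1, Finset.prod_ne_zero_iff]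
    intro q _
    rw [← Measure.map_apply (hXm q.1 q.2) (hmeas q.1), hXlaw]
    exact (hc q.1).ne'
  obtain ⟨ω, hω1, hω2⟩ : ∃ ω, ω ∈ (⋂ q ∈ S, X q.1 q.2 ⁻¹' {x | D q.1 x < c q.1}) ∧
      0 ≤ ∑ l, (n l : ℝ)⁻¹ * ∑ i ∈ Finset.range (n l), D l (X l i ω) := by
    by_contra! hcon
    exact h2 (measure_mono_null (fun ω hω => not_le.2 (hcon ω hω)) h)
  refine hω2.trans (Finset.sum_le_sum fun l _ => ?_)
  have hnl : (0 : ℝ) < n l := by exact_mod_cast hn l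
  rw [inv_mul_le_iff₀ hnl]
  calc ∑ i ∈ Finset.range (n l), D l (X l i ω) ≤ ∑ _i ∈ Finset.range (n l), c l := by
        refine Finset.sum_le_sum fun i hi => ?_
        have h3 := Set.mem_iInter₂.1 hω1 (l, i) (by
          simp only [S, Finset.mem_product, Finset.mem_univ, true_and, Finset.mem_range] at hi ⊢
          exact hi.trans_le (Finset.le_sup (f := n) (Finset.mem_univ l)))
        exact le_of_lt h3
    _ = n l * c l := by simp

/-- If the sum of independent sample averages is almost surely nonnegative, then the summands are
almost surely bounded below by constants with nonnegative sum. -/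
lemma exists_ae_lower_bounds (hXm : ∀ l i, Measurable (X l i))
    (hXlaw : ∀ l i, μ.map (X l i) = P l) (hP : ∀ l, IsProbabilityMeasure (P l))
    (hXi : iIndepFun (fun q : Fin m × ℕ => X q.1 q.2) μ) (hn : ∀ l, 0 < n l)
    {D : ∀ l, 𝓧 l → ℝ} (hD : ∀ l, Measurable (D l))
    (h : ∀ᵐ ω ∂μ, 0 ≤ ∑ l, (n l : ℝ)⁻¹ * ∑ i ∈ Finset.range (n l), D l (X l i ω)) :
    ∃ t : Fin m → ℝ, (∀ l, ∀ᵐ x ∂(P l), t l ≤ D l x) ∧ 0 ≤ ∑ l, t l := by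
  have key : ∀ c : Fin m → ℝ, (∀ l, 0 < P l {x | D l x < c l}) → 0 ≤ ∑ l, c l := fun c hc =>
    sum_nonneg_of_measure_lt_pos hXm hXlaw hXi hn hD h hc
  set B : Fin m → Set ℝ := fun l => {c | 0 < P l {x | D l x < c}} with hB
  have hne : ∀ l, (B l).Nonempty := by
    intro l
    by_contra hcon
    rw [Set.not_nonempty_iff_eq_empty] at hcon
    have h1 : ∀ k : ℕ, P l {x | D l x < k} = 0 := by
      intro k
      by_contra hk
      have : (k : ℝ) ∈ B l := pos_iff_ne_zero.2 hk
      rw [hcon] at this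
      exact this
    have h2 : P l (⋃ k : ℕ, {x | D l x < k}) = 0 := measure_iUnion_null h1
    have h3 : (⋃ k : ℕ, {x | D l x < (k : ℝ)}) = Set.univ := by
      refine Set.eq_univ_of_forall fun x => ?_
      obtain ⟨k, hk⟩ := exists_nat_gt (D l x)
      exact Set.mem_iUnion.2 ⟨k, hk⟩
    rw [h3, measure_univ] at h2
    exact one_ne_zero h2
  choose c₀ hc₀ using hne
  have hbdd : ∀ l, BddBelow (B l) := by
    intro l
    refine ⟨-∑ j ∈ Finset.univ.erase l, c₀ j, fun c hc => ?_⟩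
    have h1 := key (Function.update c₀ l c) (fun j => by
      rcases eq_or_ne j l with rfl | hj
      · rw [Function.update_self]; exact hc
      · rw [Function.update_of_ne hj]; exact hc₀ j)
    rw [← Finset.add_sum_erase _ _ (Finset.mem_univ l)] at h1
    simp only [Function.update_self] at h1
    have h2 : ∑ j ∈ Finset.univ.erase l, Function.update c₀ l c j
        = ∑ j ∈ Finset.univ.erase l, c₀ j :=
      Finset.sum_congr rfl fun j hj => Function.update_of_ne (Finset.ne_of_mem_erase hj) _ _
    linarith
  -- The witnesses are the essential infima of the D l. They are finite because in `key` the
  -- thresholds of the other samples can be held fixed.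
  refine ⟨fun l => sInf (B l), fun l => ?_, ?_⟩
  · have h1 : ∀ k : ℕ, ∀ᵐ x ∂(P l), sInf (B l) - 1 / ((k : ℝ) + 1) ≤ D l x := by
      intro k
      have hk : (0 : ℝ) < 1 / ((k : ℝ) + 1) := by positivity
      have : sInf (B l) - 1 / ((k : ℝ) + 1) ∉ B l := fun hmem => by
        linarith [csInf_le (hbdd l) hmem]
      have h2 : P l {x | D l x < sInf (B l) - 1 / ((k : ℝ) + 1)} = 0 := by
        by_contra hcon
        exact this (pos_iff_ne_zero.2 hcon)
      have h3 : ∀ᵐ x ∂(P l), ¬ D l x < sInf (B l) - 1 / ((k : ℝ) + 1) := by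
        rw [ae_iff]
        simpa only [not_not] using h2
      filter_upwards [h3] with x hx using not_lt.1 hx
    filter_upwards [ae_all_iff.2 h1] with x hx
    refine le_of_forall_pos_lt_add fun δ hδ => ?_
    obtain ⟨k, hk⟩ := exists_nat_one_div_lt hδ
    linarith [hx k]
  · refine le_of_forall_pos_le_add fun δ hδ => ?_
    have hm : (0 : ℝ) < (m : ℝ) + 1 := by positivity
    have h1 : ∀ l, ∃ c ∈ B l, c < sInf (B l) + δ / (m + 1) := fun l =>
      exists_lt_of_csInf_lt ⟨c₀ l, hc₀ l⟩ (by linarith [div_pos hδ hm])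
    choose c hc1 hc2 using h1
    calc (0 : ℝ) ≤ ∑ l, c l := key c hc1
      _ ≤ ∑ l, (sInf (B l) + δ / (m + 1)) := Finset.sum_le_sum fun l _ => (hc2 l).le
      _ = ∑ l, sInf (B l) + m * (δ / (m + 1)) := by
        rw [Finset.sum_add_distrib]; simp
      _ ≤ _ := by
        have : (m : ℝ) * (δ / (m + 1)) ≤ δ := by
          rw [mul_div_assoc', div_le_iff₀ hm]; nlinarith
        linarith

end Decoupling

/-! ### Entropy of ellipsoids. -/

section Covering

/-- The geometric sum over all of ℤ is 3. Keeping the tail term lets the induction close. -/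
lemma sum_Icc_half_pow_natAbs_le (R : ℕ) :
    ∑ k ∈ Finset.Icc (-(R : ℤ)) R, (1 / 2 : ℝ) ^ k.natAbs ≤ 3 - 2 * (1 / 2 : ℝ) ^ R := by
  induction R with
  | zero => norm_num
  | succ R ih =>
    have h1 : Finset.Icc (-((R + 1 : ℕ) : ℤ)) ((R + 1 : ℕ) : ℤ)
        = insert (-((R + 1 : ℕ) : ℤ)) (insert ((R + 1 : ℕ) : ℤ) (Finset.Icc (-(R : ℤ)) R)) := by
      ext k
      simp only [Finset.mem_Icc, Finset.mem_insert]
      push_cast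
      omega
    rw [h1, Finset.sum_insert (by simp only [Finset.mem_Icc, Finset.mem_insert]; push_cast; omega),
      Finset.sum_insert (by simp only [Finset.mem_Icc]; push_cast; omega)]
    have h2 : (-((R + 1 : ℕ) : ℤ)).natAbs = R + 1 := by omega
    have h3 : ((R + 1 : ℕ) : ℤ).natAbs = R + 1 := by omega
    rw [h2, h3]
    have h4 : (1 / 2 : ℝ) ^ (R + 1) = (1 / 2) ^ R / 2 := by rw [pow_succ]; ring
    linarith

/-- The number of lattice points in an `ℓ¹` ball. -/
lemma card_lattice_le {S : Type*} [Fintype S] [DecidableEq S] (R : ℕ) (A : Finset (S → ℤ))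
    (hA : ∀ k ∈ A, ∑ j, (k j).natAbs ≤ R) : (A.card : ℝ) ≤ 2 ^ R * 3 ^ Fintype.card S := by
  have h1 : A ⊆ Fintype.piFinset fun _ : S => Finset.Icc (-(R : ℤ)) R := by
    intro k hk
    rw [Fintype.mem_piFinset]
    intro j
    have h2 : (k j).natAbs ≤ R :=
      (Finset.single_le_sum (f := fun j => (k j).natAbs) (fun _ _ => Nat.zero_le _)
        (Finset.mem_univ j)).trans (hA k hk)
    rw [Finset.mem_Icc]
    omega
  -- Counting by weights: each point of the ball weighs at least 2^{-R}, while the total weight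
  -- factors into at most 3 per coordinate.
  have h2 : ∀ k ∈ A, (1 / 2 : ℝ) ^ R ≤ ∏ j, (1 / 2 : ℝ) ^ (k j).natAbs := by
    intro k hk
    rw [Finset.prod_pow_eq_pow_sum]
    exact pow_le_pow_of_le_one (by norm_num) (by norm_num) (hA k hk)
  have h3 : (A.card : ℝ) * (1 / 2 : ℝ) ^ R ≤ 3 ^ Fintype.card S := by
    calc (A.card : ℝ) * (1 / 2 : ℝ) ^ R = ∑ _k ∈ A, (1 / 2 : ℝ) ^ R := by simp
      _ ≤ ∑ k ∈ A, ∏ j, (1 / 2 : ℝ) ^ (k j).natAbs := Finset.sum_le_sum h2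
      _ ≤ ∑ k ∈ Fintype.piFinset fun _ : S => Finset.Icc (-(R : ℤ)) R,
          ∏ j, (1 / 2 : ℝ) ^ (k j).natAbs :=
        Finset.sum_le_sum_of_subset_of_nonneg h1 fun _ _ _ => by positivity
      _ = ∏ _j : S, ∑ k ∈ Finset.Icc (-(R : ℤ)) R, (1 / 2 : ℝ) ^ k.natAbs := by
        rw [Finset.prod_univ_sum]
      _ ≤ ∏ _j : S, (3 : ℝ) := by
        refine Finset.prod_le_prod (fun _ _ => Finset.sum_nonneg fun _ _ => by positivity)
          fun _ _ => (sum_Icc_half_pow_natAbs_le R).trans ?_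
        have : (0 : ℝ) < (1 / 2) ^ R := by positivity
        linarith
      _ = 3 ^ Fintype.card S := by simp
  rw [one_div, inv_pow, ← div_eq_mul_inv, div_le_iff₀ (by positivity)] at h3
  linarith

lemma sum_subtype_le_sum {ι : Type*} [Fintype ι] (p : ι → Prop) [Fintype {j // p j}] {f : ι → ℝ}
    (hf : ∀ j, 0 ≤ f j) : ∑ j : {j // p j}, f j ≤ ∑ j, f j := by
  calc ∑ j : {j // p j}, f j
      = ∑ j ∈ Finset.univ.map (Function.Embedding.subtype p), f j :=
        (Finset.sum_map Finset.univ (Function.Embedding.subtype p) f).symm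
    _ ≤ _ := Finset.sum_le_univ_sum_of_nonneg hf

/-- Rounding the coordinates with small weights partitions an ellipsoid into few cells of small
diameter. -/
lemma exists_cells {ι : Type*} [Fintype ι] {b : ι → ℝ} (hb1 : ∀ j, 1 ≤ b j) {D C κ ε : ℝ}
    (hD : ∑ j, (b j)⁻¹ ≤ D) (hD1 : 1 ≤ D) (hC : 1 ≤ C) (hκ : 0 < κ) (hκ1 : κ ≤ 1)
    (hε : 0 < ε) {𝒯 : Set (ι → ℝ)} (h𝒯 : ∀ v ∈ 𝒯, ∑ j, b j * v j ^ 2 ≤ C * ε ^ 2) :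
    ∃ Z : Finset (ι → ℝ), (∀ z ∈ Z, z ∈ 𝒯) ∧ (Z.card : ℝ) ≤ Real.exp (8 * C / κ ^ 4 * D) ∧
      ∀ v ∈ 𝒯, ∃ z ∈ Z, ∑ j, (v j - z j) ^ 2 ≤ 5 * C * κ ^ 2 * ε ^ 2 := by
  classical
  have hb : ∀ j, 0 < b j := fun j => by linarith [hb1 j]
  -- Only these coordinates are rounded, with mesh h. There are at most D/κ² of them, so their
  -- errors sum to at most κ²ε². In the other directions κ² b j ≥ 1, and membership in the ellipsoid
  -- already makes the differences small.
  set S := {j // b j < 1 / κ ^ 2} with hS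
  set h : ℝ := κ ^ 2 * ε / Real.sqrt D with hh
  have hD0 : 0 < D := by linarith
  have hsD : 0 < Real.sqrt D := Real.sqrt_pos.2 hD0
  have hh0 : 0 < h := by positivity
  have hh2 : h ^ 2 = κ ^ 4 * ε ^ 2 / D := by
    rw [hh, div_pow, mul_pow, Real.sq_sqrt hD0.le]; ring
  have hcard : (Fintype.card S : ℝ) * κ ^ 2 ≤ D := by
    calc (Fintype.card S : ℝ) * κ ^ 2 = ∑ _j : S, κ ^ 2 := by simp
      _ ≤ ∑ j : S, (b j)⁻¹ := by
        refine Finset.sum_le_sum fun j _ => ?_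
        rw [le_inv_comm₀ (by positivity) (hb _), ← one_div]
        exact j.2.le
      _ ≤ ∑ j, (b j)⁻¹ := sum_subtype_le_sum _ fun j => (inv_pos.2 (hb j)).le
      _ ≤ D := hD
  set cell : (ι → ℝ) → (S → ℤ) := fun v j => ⌊v j / h⌋ with hcell
  set R : ℕ := ⌊C * D / κ ^ 4 + 2 * Fintype.card S⌋₊ with hR
  have hcellR : ∀ v ∈ 𝒯, ∑ j, (cell v j).natAbs ≤ R := by
    intro v hv
    refine Nat.le_floor ?_
    push_cast
    calc ∑ j : S, (((cell v j).natAbs : ℕ) : ℝ) ≤ ∑ j : S, (b j * v j ^ 2 / h ^ 2 + 2) := by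
          refine Finset.sum_le_sum fun j _ => ?_
          rw [Nat.cast_natAbs, Int.cast_abs]
          have h1 := Int.floor_le (v j / h)
          have h2 := Int.lt_floor_add_one (v j / h)
          have h3 : |((cell v j : ℤ) : ℝ)| ≤ |v j / h| + 1 := by
            rw [abs_le]
            constructor
            · linarith [neg_abs_le (v j / h)]
            · linarith [le_abs_self (v j / h)]
          have h4 : |v j / h| ≤ (v j / h) ^ 2 + 1 := by
            rw [← sq_abs (v j / h)]
            nlinarith [sq_nonneg (|v j / h| - 1)]
          have h5 : (v j / h) ^ 2 ≤ b j * v j ^ 2 / h ^ 2 := by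
            rw [div_pow]
            gcongr
            nlinarith [hb1 j, sq_nonneg (v j)]
          linarith
      _ = (∑ j : S, b j * v j ^ 2) / h ^ 2 + 2 * Fintype.card S := by
        rw [Finset.sum_add_distrib, Finset.sum_div]; simp [mul_comm]
      _ ≤ C * ε ^ 2 / h ^ 2 + 2 * Fintype.card S := by
        gcongr
        exact (sum_subtype_le_sum (fun j => b j < 1 / κ ^ 2)
          (f := fun j => b j * v j ^ 2) fun j => mul_nonneg (hb j).le (sq_nonneg _)).trans (h𝒯 v hv)
      _ = C * D / κ ^ 4 + 2 * Fintype.card S := by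
        rw [hh2]; field_simp
  set F : Finset (S → ℤ) := (Fintype.piFinset fun _ : S => Finset.Icc (-(R : ℤ)) R).filter
    (fun k => ∃ v ∈ 𝒯, cell v = k) with hF
  have hcellF : ∀ v ∈ 𝒯, cell v ∈ F := by
    intro v hv
    rw [hF, Finset.mem_filter, Fintype.mem_piFinset]
    refine ⟨fun j => ?_, v, hv, rfl⟩
    have h2 : (cell v j).natAbs ≤ R :=
      (Finset.single_le_sum (f := fun j => (cell v j).natAbs) (fun _ _ => Nat.zero_le _)
        (Finset.mem_univ j)).trans (hcellR v hv)
    rw [Finset.mem_Icc]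
    omega
  have hFc : ∀ k ∈ F, ∃ v ∈ 𝒯, cell v = k := fun k hk => (Finset.mem_filter.1 hk).2
  -- The centres are points of 𝒯 and not lattice points, so that they are themselves admissible
  -- parameters at which subgradients exist.
  choose! rep hrep1 hrep2 using hFc
  refine ⟨F.image rep, ?_, ?_, ?_⟩
  · intro z hz
    obtain ⟨k, hk, rfl⟩ := Finset.mem_image.1 hz
    exact hrep1 k hk
  · have hcR : (F.card : ℝ) ≤ 2 ^ R * 3 ^ Fintype.card S := card_lattice_le R F fun k hk => by
      rw [← hrep2 k hk]
      exact hcellR _ (hrep1 k hk)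
    have hRle : (R : ℝ) ≤ C * D / κ ^ 4 + 2 * Fintype.card S := Nat.floor_le (by positivity)
    have he1 : (2 : ℝ) ≤ Real.exp 1 := by linarith [Real.add_one_le_exp (1 : ℝ)]
    have he2 : (3 : ℝ) ≤ Real.exp 2 := by linarith [Real.add_one_le_exp (2 : ℝ)]
    have hS' : (Fintype.card S : ℝ) ≤ C * D / κ ^ 4 := by
      rw [le_div_iff₀ (by positivity)]
      have h1 : κ ^ 4 ≤ κ ^ 2 := pow_le_pow_of_le_one hκ.le hκ1 (by norm_num)
      have h2 : (0 : ℝ) ≤ Fintype.card S := Nat.cast_nonneg _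
      nlinarith
    calc ((F.image rep).card : ℝ) ≤ F.card := by exact_mod_cast Finset.card_image_le
      _ ≤ 2 ^ R * 3 ^ Fintype.card S := hcR
      _ ≤ Real.exp 1 ^ R * Real.exp 2 ^ Fintype.card S := by gcongr
      _ = Real.exp (R + Fintype.card S * 2) := by
        rw [← Real.exp_nat_mul, ← Real.exp_nat_mul, ← Real.exp_add, mul_one]
      _ ≤ Real.exp (8 * C / κ ^ 4 * D) := by
        refine Real.exp_le_exp.2 ?_
        have h3 : 8 * C / κ ^ 4 * D = 8 * (C * D / κ ^ 4) := by ring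
        rw [h3]
        have : 0 ≤ C * D / κ ^ 4 := by positivity
        linarith
  · intro v hv
    refine ⟨rep (cell v), Finset.mem_image_of_mem _ (hcellF v hv), ?_⟩
    set z := rep (cell v) with hz
    have hz1 : z ∈ 𝒯 := hrep1 _ (hcellF v hv)
    have hz2 : cell z = cell v := hrep2 _ (hcellF v hv)
    have h1 : ∀ j, (v j - z j) ^ 2
        ≤ (if b j < 1 / κ ^ 2 then h ^ 2 else 0) + κ ^ 2 * (b j * (2 * v j ^ 2 + 2 * z j ^ 2)) := by
      intro j
      have hbj := hb j
      split_ifs with hj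
      · have h2 := Int.abs_sub_lt_one_of_floor_eq_floor (congrFun hz2 ⟨j, hj⟩)
        rw [← sub_div, abs_div, abs_of_pos hh0, div_lt_one hh0] at h2
        have h3 : (v j - z j) ^ 2 ≤ h ^ 2 := by
          rw [← sq_abs, abs_sub_comm]
          exact pow_le_pow_left₀ (abs_nonneg _) h2.le 2
        have : 0 ≤ κ ^ 2 * (b j * (2 * v j ^ 2 + 2 * z j ^ 2)) := by positivity
        linarith
      · have h2 : 1 ≤ κ ^ 2 * b j := by
          rw [not_lt, div_le_iff₀ (by positivity)] at hj
          linarith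
        have h3 : (v j - z j) ^ 2 ≤ 2 * v j ^ 2 + 2 * z j ^ 2 := by
          nlinarith [sq_nonneg (v j + z j)]
        have h4 : 0 ≤ 2 * v j ^ 2 + 2 * z j ^ 2 := by positivity
        nlinarith
    calc ∑ j, (v j - z j) ^ 2
        ≤ ∑ j, ((if b j < 1 / κ ^ 2 then h ^ 2 else 0)
            + κ ^ 2 * (b j * (2 * v j ^ 2 + 2 * z j ^ 2))) := Finset.sum_le_sum fun j _ => h1 j
      _ = Fintype.card S * h ^ 2
          + κ ^ 2 * (2 * ∑ j, b j * v j ^ 2 + 2 * ∑ j, b j * z j ^ 2) := by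
        have h2 : ∑ j, (if b j < 1 / κ ^ 2 then h ^ 2 else 0) = Fintype.card S * h ^ 2 := by
          have h3 : Fintype.card S = (Finset.univ.filter fun j => b j < 1 / κ ^ 2).card :=
            Fintype.card_subtype _
          rw [← Finset.sum_filter, h3]
          simp
        rw [Finset.sum_add_distrib, h2]
        simp only [Finset.mul_sum, ← Finset.sum_add_distrib]
        congr 1
        exact Finset.sum_congr rfl fun j _ => by ring
      _ ≤ κ ^ 2 * ε ^ 2 + κ ^ 2 * (2 * (C * ε ^ 2) + 2 * (C * ε ^ 2)) := by
        refine add_le_add ?_ (mul_le_mul_of_nonneg_left ?_ (sq_nonneg κ))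
        · rw [hh2]
          calc (Fintype.card S : ℝ) * (κ ^ 4 * ε ^ 2 / D)
              = (Fintype.card S * κ ^ 2) * (κ ^ 2 * ε ^ 2 / D) := by ring
            _ ≤ D * (κ ^ 2 * ε ^ 2 / D) := by gcongr
            _ = _ := by field_simp
        · linarith [h𝒯 v hv, h𝒯 z hz1]
      _ ≤ 5 * C * κ ^ 2 * ε ^ 2 := by
        have : 0 ≤ κ ^ 2 * ε ^ 2 := by positivity
        nlinarith

end Covering

/-! ### Empirical lower bounds uniform over an ellipsoid. -/

section Uniform

variable {m : ℕ} {𝓧 : Fin m → Type*} [∀ l, MeasurableSpace (𝓧 l)]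
  {Ω : Type*} [MeasurableSpace Ω] {μ : Measure Ω}

set_option maxHeartbeats 1000000 in
/-- The lower bound `measure_exists_sum_pos_part_lt_le` with the scales of the prior chosen for an
ellipsoid of radius `ε` and with an additional free constant in each sample. -/
lemma measure_exists_sum_pos_part_lt_le_of_ellipsoid {ι : Type*} [Fintype ι]
    {X : ∀ l, ℕ → Ω → 𝓧 l} [IsProbabilityMeasure μ] (hXm : ∀ l i, Measurable (X l i))
    (hXi : iIndepFun (fun (q : Fin m × ℕ) => X q.1 q.2) μ) {P : ∀ l, Measure (𝓧 l)}
    [∀ l, IsProbabilityMeasure (P l)]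
    (hXl : ∀ l i, μ.map (X l i) = P l) {n : Fin m → ℕ} {N : ℕ} (hN : 0 < N) (hn : ∀ l, N ≤ n l)
    {a : ∀ l, 𝓧 l → ℝ} {ℓ : ∀ l, ι → 𝓧 l → ℝ} (ham : ∀ l, Measurable (a l))
    (hℓm : ∀ l j, Measurable (ℓ l j)) (ha : ∀ l, MemLp (a l) 2 (P l))
    (hℓ : ∀ l j, MemLp (ℓ l j) 2 (P l)) {b : ι → ℝ} (hb : ∀ j, 1 ≤ b j) {D C α ε : ℝ}
    (hD : ∑ j, (b j)⁻¹ ≤ D) (hD1 : 1 ≤ D) (hC : 1 ≤ C) (hα : 0 < α) (hε : 0 < ε) (hε1 : ε ≤ 1)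
    (hDN : D ≤ α ^ 2 * N * ε ^ 2) (hℓC : ∀ j, ∑ l, ∫ x, ℓ l j x ^ 2 ∂P l ≤ C) :
    μ {ω | ∃ (u : ι → ℝ) (β : Fin m → ℝ), ∑ j, b j * u j ^ 2 ≤ 4 * C * ε ^ 2 ∧
        (∀ l, |β l| ≤ C * ε ^ 2) ∧
        ∑ l, ∫ x, (a l x + ∑ j, u j * ℓ l j x) ^ 2 ∂P l ≤ C * ε ^ 2 ∧
        ∑ l, (n l : ℝ)⁻¹ * ∑ i ∈ Finset.range (n l),
          max (a l (X l i ω) + ∑ j, u j * ℓ l j (X l i ω) + β l) 0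
        < ∑ l, ∫ x, (a l x + ∑ j, u j * ℓ l j x) ∂P l + ∑ l, β l
          - 9 * (m + 1) * C ^ 2 * α * ε ^ 2}
      ≤ 2 * ENNReal.ofReal (Real.exp (-(α ^ 2 * N * ε ^ 2))) := by
  have hN0 : (0 : ℝ) < N := by exact_mod_cast hN
  have hb0 : ∀ j, 0 < b j := fun j => by linarith [hb j]
  -- The prior has standard deviation σ/√(b j) in direction j. Points of the ellipsoid then cost a
  -- multiple of α²Nε², and the smoothing variance is at most C σ² D ≤ C ε², by D ≤ α²Nε².
  set σ : ℝ := 1 / (α * Real.sqrt N) with hσ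
  have hsN : 0 < Real.sqrt N := Real.sqrt_pos.2 hN0
  have hσ0 : 0 < σ := by positivity
  have hσ2 : σ ^ 2 = 1 / (α ^ 2 * N) := by
    rw [hσ, div_pow, mul_pow, Real.sq_sqrt hN0.le, one_pow]
  have hNα : 1 ≤ α ^ 2 * N := by
    have h1 : ε ^ 2 ≤ 1 := pow_le_one₀ hε.le hε1
    have h2 : 0 ≤ α ^ 2 * N := by positivity
    nlinarith
  -- The m additional directions are constants on a single sample. They absorb the shifts β l, which
  -- vary with the parameter and so have to be covered by the same uniform bound.
  set ℓ' : ∀ l, ι ⊕ Fin m → 𝓧 l → ℝ := fun l => Sum.elim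
    (fun j x => σ / Real.sqrt (b j) * ℓ l j x) (fun l' _ => if l = l' then ε else 0) with hℓ'
  have hℓ'm : ∀ l j, Measurable (ℓ' l j) := by
    rintro l (j | l')
    · exact (hℓm l j).const_mul _
    · exact measurable_const
  have hℓ'2 : ∀ l j, MemLp (ℓ' l j) 2 (P l) := by
    rintro l (j | l')
    · exact (hℓ l j).const_mul _
    · exact memLp_const _
  refine le_trans (measure_mono ?_) (measure_exists_sum_pos_part_lt_le hXm hXi hXl hN hn ham hℓ'm
    ha hℓ'2 hα (α ^ 2 * N * ε ^ 2))
  rintro ω ⟨u, β, hu, hβ, hT, hlt⟩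
  set u' : ι ⊕ Fin m → ℝ := Sum.elim (fun j => u j * Real.sqrt (b j) / σ) (fun l => β l / ε)
    with hu'
  refine ⟨u', ?_⟩
  have hlin : ∀ l x, a l x + ∑ j, u' j * ℓ' l j x = a l x + ∑ j, u j * ℓ l j x + β l := by
    intro l x
    rw [Fintype.sum_sum_type, add_assoc]
    congr 2
    · refine Finset.sum_congr rfl fun j _ => ?_
      have := (Real.sqrt_pos.2 (hb0 j)).ne'
      simp only [hu', hℓ', Sum.elim_inl]
      field_simp
    · simp only [hu', hℓ', Sum.elim_inr]
      rw [Finset.sum_eq_single l (fun l' _ hl' => by simp [Ne.symm hl']) (by simp)]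
      simp [hε.ne']
  simp only [hlin]
  have hT2 : ∀ l, MemLp (fun x => a l x + ∑ j, u j * ℓ l j x) 2 (P l) := fun l =>
    (ha l).add (memLp_finsetSum _ fun j _ => (hℓ l j).const_mul _)
  have h1 : ∑ l, ∫ x, (a l x + ∑ j, u j * ℓ l j x + β l) ∂P l
      = ∑ l, ∫ x, (a l x + ∑ j, u j * ℓ l j x) ∂P l + ∑ l, β l := by
    rw [← Finset.sum_add_distrib]
    refine Finset.sum_congr rfl fun l _ => ?_
    rw [integral_add ((hT2 l).integrable one_le_two) (integrable_const _)]
    simp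
  have hβ2 : ∀ l, β l ^ 2 ≤ C ^ 2 * ε ^ 4 := fun l => by
    rw [← sq_abs]
    calc |β l| ^ 2 ≤ (C * ε ^ 2) ^ 2 := pow_le_pow_left₀ (abs_nonneg _) (hβ l) 2
      _ = _ := by ring
  have hsumβ : ∑ l, β l ^ 2 ≤ m * (C ^ 2 * ε ^ 4) := by
    calc ∑ l, β l ^ 2 ≤ ∑ _l : Fin m, C ^ 2 * ε ^ 4 := Finset.sum_le_sum fun l _ => hβ2 l
      _ = _ := by simp
  have h2 : ∑ l, ∫ x, (a l x + ∑ j, u j * ℓ l j x + β l) ^ 2 ∂P l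
      ≤ 2 * (C * ε ^ 2) + 2 * (m * (C ^ 2 * ε ^ 4)) := by
    calc ∑ l, ∫ x, (a l x + ∑ j, u j * ℓ l j x + β l) ^ 2 ∂P l
        ≤ ∑ l, (2 * ∫ x, (a l x + ∑ j, u j * ℓ l j x) ^ 2 ∂P l + 2 * β l ^ 2) := by
          refine Finset.sum_le_sum fun l _ => ?_
          have i1 : Integrable (fun x => 2 * (a l x + ∑ j, u j * ℓ l j x) ^ 2 + 2 * β l ^ 2)
              (P l) := ((hT2 l).integrable_sq.const_mul 2).add (integrable_const _)
          have i2 : MemLp (fun x => a l x + ∑ j, u j * ℓ l j x + β l) 2 (P l) :=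
            (hT2 l).add (memLp_const _)
          calc ∫ x, (a l x + ∑ j, u j * ℓ l j x + β l) ^ 2 ∂P l
              ≤ ∫ x, (2 * (a l x + ∑ j, u j * ℓ l j x) ^ 2 + 2 * β l ^ 2) ∂P l := by
                refine integral_mono i2.integrable_sq i1 fun x => ?_
                simp only
                nlinarith [sq_nonneg (a l x + ∑ j, u j * ℓ l j x - β l)]
            _ = _ := by
              rw [integral_add ((hT2 l).integrable_sq.const_mul 2) (integrable_const _),
                integral_const_mul]
              simp
      _ = 2 * ∑ l, ∫ x, (a l x + ∑ j, u j * ℓ l j x) ^ 2 ∂P l + 2 * ∑ l, β l ^ 2 := by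
        rw [Finset.sum_add_distrib, Finset.mul_sum, Finset.mul_sum]
      _ ≤ _ := by gcongr
  have hDσ : D * σ ^ 2 ≤ ε ^ 2 := by
    rw [hσ2, mul_one_div, div_le_iff₀ (by positivity)]
    linarith
  have h3 : ∑ l, ∑ j, ∫ x, ℓ' l j x ^ 2 ∂P l ≤ C * ε ^ 2 + m * ε ^ 2 := by
    have h4 : ∀ l, ∑ j, ∫ x, ℓ' l j x ^ 2 ∂P l
        = ∑ j, σ ^ 2 * ((b j)⁻¹ * ∫ x, ℓ l j x ^ 2 ∂P l) + ε ^ 2 := by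
      intro l
      rw [Fintype.sum_sum_type]
      congr 1
      · refine Finset.sum_congr rfl fun j _ => ?_
        simp only [hℓ', Sum.elim_inl, mul_pow, div_pow, Real.sq_sqrt (hb0 j).le]
        rw [integral_const_mul]
        ring
      · simp only [hℓ', Sum.elim_inr]
        rw [Finset.sum_eq_single l (fun l' _ hl' => by simp [Ne.symm hl']) (by simp)]
        simp
    simp only [h4]
    rw [Finset.sum_add_distrib, Finset.sum_comm]
    have h5 : ∑ j, ∑ l, σ ^ 2 * ((b j)⁻¹ * ∫ x, ℓ l j x ^ 2 ∂P l) ≤ C * ε ^ 2 := by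
      calc ∑ j, ∑ l, σ ^ 2 * ((b j)⁻¹ * ∫ x, ℓ l j x ^ 2 ∂P l)
          = ∑ j, σ ^ 2 * ((b j)⁻¹ * ∑ l, ∫ x, ℓ l j x ^ 2 ∂P l) := by
            simp only [Finset.mul_sum]
        _ ≤ ∑ j, σ ^ 2 * ((b j)⁻¹ * C) := by
          refine Finset.sum_le_sum fun j _ => ?_
          have := (inv_pos.2 (hb0 j)).le
          have := hℓC j
          gcongr
        _ = C * ((∑ j, (b j)⁻¹) * σ ^ 2) := by
          rw [Finset.sum_mul, Finset.mul_sum]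
          exact Finset.sum_congr rfl fun j _ => by ring
        _ ≤ C * (D * σ ^ 2) := by gcongr
        _ ≤ C * ε ^ 2 := by gcongr
    have h6 : ∑ _l : Fin m, ε ^ 2 = m * ε ^ 2 := by simp
    linarith
  have h7 : ∑ j, u' j ^ 2 ≤ α ^ 2 * N * (4 * C * ε ^ 2) + m * (C ^ 2 * ε ^ 2) := by
    rw [Fintype.sum_sum_type]
    refine add_le_add ?_ ?_
    · calc ∑ j, u' (Sum.inl j) ^ 2 = α ^ 2 * N * ∑ j, b j * u j ^ 2 := by
            rw [Finset.mul_sum]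
            refine Finset.sum_congr rfl fun j _ => ?_
            simp only [hu', Sum.elim_inl]
            rw [div_pow, mul_pow, Real.sq_sqrt (hb0 j).le, hσ2]
            field_simp
        _ ≤ _ := by gcongr
    · calc ∑ l, u' (Sum.inr l) ^ 2 = (∑ l, β l ^ 2) / ε ^ 2 := by
            rw [Finset.sum_div]
            exact Finset.sum_congr rfl fun l _ => by simp only [hu', Sum.elim_inr, div_pow]
        _ ≤ m * (C ^ 2 * ε ^ 4) / ε ^ 2 := by gcongr
        _ = _ := by field_simp
  rw [h1]
  have hαN : 0 < α * N := by positivity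
  have h8 := mul_lt_mul_of_pos_left hlt hαN
  refine h8.trans_le ?_
  have hm0 : (0 : ℝ) ≤ m := Nat.cast_nonneg m
  have hε4 : ε ^ 4 ≤ ε ^ 2 := pow_le_pow_of_le_one hε.le hε1 (by norm_num)
  have hC2 : C ≤ C ^ 2 := by nlinarith
  have e1 : α ^ 2 * N * ∑ l, ∫ x, (a l x + ∑ j, u j * ℓ l j x + β l) ^ 2 ∂P l
      ≤ α ^ 2 * N * ε ^ 2 * (2 * C ^ 2 + 2 * (m * C ^ 2)) := by
    rw [mul_assoc (α ^ 2 * N)]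
    refine mul_le_mul_of_nonneg_left (h2.trans ?_) (by positivity)
    have i1 : C * ε ^ 2 ≤ C ^ 2 * ε ^ 2 := by gcongr
    have i2 : m * (C ^ 2 * ε ^ 4) ≤ m * (C ^ 2 * ε ^ 2) := by gcongr
    linarith
  have e2 : 3 * (α ^ 2 * N * ∑ l, ∑ j, ∫ x, ℓ' l j x ^ 2 ∂P l)
      ≤ α ^ 2 * N * ε ^ 2 * (3 * C ^ 2 + 3 * (m * C ^ 2)) := by
    have i1 : C * ε ^ 2 + m * ε ^ 2 ≤ ε ^ 2 * (C ^ 2 + m * C ^ 2) := by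
      have : (m : ℝ) * 1 ≤ m * C ^ 2 := by gcongr; nlinarith
      nlinarith [sq_nonneg ε]
    have i2 := mul_le_mul_of_nonneg_left (h3.trans i1) (by positivity : 0 ≤ α ^ 2 * N)
    linarith
  have e3 : (∑ j, u' j ^ 2) / 2 ≤ α ^ 2 * N * ε ^ 2 * (2 * C ^ 2 + (m * C ^ 2) / 2) := by
    have i1 : α ^ 2 * N * (4 * C * ε ^ 2) ≤ α ^ 2 * N * (4 * C ^ 2 * ε ^ 2) := by gcongr
    have i2 : 1 * (m * (C ^ 2 * ε ^ 2)) ≤ α ^ 2 * N * (m * (C ^ 2 * ε ^ 2)) := by gcongr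
    linarith
  have e4 : 2 * (α ^ 2 * N * ε ^ 2) ≤ α ^ 2 * N * ε ^ 2 * (2 * C ^ 2) := by
    have : 0 ≤ α ^ 2 * N * ε ^ 2 := by positivity
    nlinarith
  have e5 : 0 ≤ α ^ 2 * N * ε ^ 2 * (m * C ^ 2) := by positivity
  linarith

/-- The uniform lower bound over a countable subset of an ellipsoid. -/
theorem measure_exists_empirical_lt_le {ι : Type*} [Fintype ι]
    {X : ∀ l, ℕ → Ω → 𝓧 l} [IsProbabilityMeasure μ] (hXm : ∀ l i, Measurable (X l i))
    (hXi : iIndepFun (fun (q : Fin m × ℕ) => X q.1 q.2) μ) {P : ∀ l, Measure (𝓧 l)}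
    [∀ l, IsProbabilityMeasure (P l)]
    (hXl : ∀ l i, μ.map (X l i) = P l) {n : Fin m → ℕ} {N : ℕ} (hN : 0 < N) (hn : ∀ l, N ≤ n l)
    {𝒯 : Set (ι → ℝ)} (h𝒯 : 𝒯.Countable)
    {a : (ι → ℝ) → ∀ l, 𝓧 l → ℝ} {ℓ : (ι → ℝ) → ∀ l, ι → 𝓧 l → ℝ}
    (ham : ∀ z l, Measurable (a z l))
    (hℓm : ∀ z l j, Measurable (ℓ z l j)) (ha : ∀ z ∈ 𝒯, ∀ l, MemLp (a z l) 2 (P l))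
    (hℓ : ∀ z ∈ 𝒯, ∀ l j, MemLp (ℓ z l j) 2 (P l)) {b : ι → ℝ} (hb : ∀ j, 1 ≤ b j)
    {D C α ε : ℝ} (hD : ∑ j, (b j)⁻¹ ≤ D) (hD1 : 1 ≤ D) (hC : 1 ≤ C) (hα : 0 < α) (hα1 : α ≤ 1)
    (hε : 0 < ε) (hε1 : ε ≤ 1) (hDN : D ≤ α ^ 2 * N * ε ^ 2)
    (hℓC : ∀ z ∈ 𝒯, ∀ j, ∑ l, ∫ x, ℓ z l j x ^ 2 ∂P l ≤ C)
    (h𝒯b : ∀ v ∈ 𝒯, ∑ j, b j * v j ^ 2 ≤ C * ε ^ 2)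
    (hT : ∀ z ∈ 𝒯, ∀ v ∈ 𝒯,
      ∑ l, ∫ x, (a z l x + ∑ j, (v j - z j) * ℓ z l j x) ^ 2 ∂P l ≤ C * ε ^ 2)
    {R : (ι → ℝ) → ∀ l, 𝓧 l → ℝ} {Q : (ι → ℝ) → ℝ}
    (hR : ∀ z ∈ 𝒯, ∀ v ∈ 𝒯, ∑ j, (v j - z j) ^ 2 ≤ 5 * C * α ^ 2 * ε ^ 2 →
      ∃ A β : Fin m → ℝ, (∀ l, |β l| ≤ C * ε ^ 2) ∧
        (∀ l, ∀ᵐ x ∂P l, A l + max (a z l x + ∑ j, (v j - z j) * ℓ z l j x + β l) 0 ≤ R v l x) ∧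
        Q v ≤ ∑ l, A l + (∑ l, ∫ x, (a z l x + ∑ j, (v j - z j) * ℓ z l j x) ∂P l + ∑ l, β l)) :
    μ {ω | ∃ v ∈ 𝒯, ∑ l, (n l : ℝ)⁻¹ * ∑ i ∈ Finset.range (n l), R v l (X l i ω)
        < Q v - 9 * (m + 1) * C ^ 2 * α * ε ^ 2}
      ≤ 2 * ENNReal.ofReal (Real.exp (8 * C / α ^ 4 * D - α ^ 2 * N * ε ^ 2)) := by
  have hb0 : ∀ j, 0 < b j := fun j => by linarith [hb j]
  -- Cells with κ = α. Each centre has its own exceptional event, and the number of centres is the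
  -- first term in the final exponent.
  obtain ⟨Z, hZ𝒯, hZc, hZ⟩ := exists_cells hb hD hD1 hC hα hα1 hε h𝒯b
  choose! A β hβ hAR hQ using hR
  set bad : (ι → ℝ) → Set Ω := fun z => {ω | ∃ (u : ι → ℝ) (β : Fin m → ℝ),
    ∑ j, b j * u j ^ 2 ≤ 4 * C * ε ^ 2 ∧ (∀ l, |β l| ≤ C * ε ^ 2) ∧
      ∑ l, ∫ x, (a z l x + ∑ j, u j * ℓ z l j x) ^ 2 ∂P l ≤ C * ε ^ 2 ∧
      ∑ l, (n l : ℝ)⁻¹ * ∑ i ∈ Finset.range (n l),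
          max (a z l (X l i ω) + ∑ j, u j * ℓ z l j (X l i ω) + β l) 0
        < ∑ l, ∫ x, (a z l x + ∑ j, u j * ℓ z l j x) ∂P l + ∑ l, β l
          - 9 * (m + 1) * C ^ 2 * α * ε ^ 2} with hbad
  -- The minorant holds off a null set that depends on v and z; countability merges these null sets.
  have hae : ∀ᵐ ω ∂μ, ∀ v ∈ 𝒯, ∀ z ∈ (Z : Set (ι → ℝ)), ∑ j, (v j - z j) ^ 2 ≤ 5 * C * α ^ 2 * ε ^ 2 →
      ∀ l i, A z v l + max (a z l (X l i ω) + ∑ j, (v j - z j) * ℓ z l j (X l i ω) + β z v l) 0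
        ≤ R v l (X l i ω) := by
    rw [ae_ball_iff h𝒯]
    intro v hv
    rw [ae_ball_iff Z.countable_toSet]
    intro z hz
    by_cases hvz : ∑ j, (v j - z j) ^ 2 ≤ 5 * C * α ^ 2 * ε ^ 2
    · have h1 : ∀ l i, ∀ᵐ ω ∂μ, A z v l
          + max (a z l (X l i ω) + ∑ j, (v j - z j) * ℓ z l j (X l i ω) + β z v l) 0
          ≤ R v l (X l i ω) := by
        intro l i
        have h2 := hAR z (hZ𝒯 z hz) v hv hvz l
        rw [← hXl l i] at h2
        exact ae_of_ae_map (hXm l i).aemeasurable h2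
      filter_upwards [ae_all_iff.2 fun l => ae_all_iff.2 (h1 l)] with ω hω _ using hω
    · exact ae_of_all _ fun ω h => absurd h hvz
  have hsub : {ω | ∃ v ∈ 𝒯, ∑ l, (n l : ℝ)⁻¹ * ∑ i ∈ Finset.range (n l), R v l (X l i ω)
        < Q v - 9 * (m + 1) * C ^ 2 * α * ε ^ 2} ≤ᵐ[μ] (⋃ z ∈ Z, bad z : Set Ω) := by
    filter_upwards [hae] with ω hω
    rintro ⟨v, hv, hlt⟩
    obtain ⟨z, hz, hvz⟩ := hZ v hv
    have hz' := hZ𝒯 z hz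
    refine Set.mem_iUnion₂.2 ⟨z, hz, fun j => v j - z j, β z v, ?_, hβ z hz' v hv hvz,
      hT z hz' v hv, ?_⟩
    · calc ∑ j, b j * (v j - z j) ^ 2 ≤ ∑ j, (2 * (b j * v j ^ 2) + 2 * (b j * z j ^ 2)) := by
            refine Finset.sum_le_sum fun j _ => ?_
            nlinarith [mul_nonneg (hb0 j).le (sq_nonneg (v j + z j))]
        _ = 2 * ∑ j, b j * v j ^ 2 + 2 * ∑ j, b j * z j ^ 2 := by
          rw [Finset.sum_add_distrib, Finset.mul_sum, Finset.mul_sum]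
        _ ≤ 4 * C * ε ^ 2 := by linarith [h𝒯b v hv, h𝒯b z hz']
    · have h1 : ∑ l, A z v l + ∑ l, (n l : ℝ)⁻¹ * ∑ i ∈ Finset.range (n l),
          max (a z l (X l i ω) + ∑ j, (v j - z j) * ℓ z l j (X l i ω) + β z v l) 0
          ≤ ∑ l, (n l : ℝ)⁻¹ * ∑ i ∈ Finset.range (n l), R v l (X l i ω) := by
        rw [← Finset.sum_add_distrib]
        refine Finset.sum_le_sum fun l _ => ?_
        have hnl : (0 : ℝ) < n l := by exact_mod_cast hN.trans_le (hn l)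
        calc A z v l + (n l : ℝ)⁻¹ * ∑ i ∈ Finset.range (n l),
              max (a z l (X l i ω) + ∑ j, (v j - z j) * ℓ z l j (X l i ω) + β z v l) 0
            = (n l : ℝ)⁻¹ * ∑ i ∈ Finset.range (n l), (A z v l +
              max (a z l (X l i ω) + ∑ j, (v j - z j) * ℓ z l j (X l i ω) + β z v l) 0) := by
              rw [Finset.sum_add_distrib]
              simp only [Finset.sum_const, Finset.card_range, nsmul_eq_mul]
              field_simp
          _ ≤ _ := by
            gcongr with i _
            exact hω v hv z hz hvz l i
      have h2 := hQ z hz' v hv hvz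
      linarith
  calc μ {ω | ∃ v ∈ 𝒯, ∑ l, (n l : ℝ)⁻¹ * ∑ i ∈ Finset.range (n l), R v l (X l i ω)
        < Q v - 9 * (m + 1) * C ^ 2 * α * ε ^ 2}
      ≤ μ (⋃ z ∈ Z, bad z) := measure_mono_ae hsub
    _ ≤ ∑ z ∈ Z, μ (bad z) := measure_biUnion_finset_le _ _
    _ ≤ ∑ _z ∈ Z, 2 * ENNReal.ofReal (Real.exp (-(α ^ 2 * N * ε ^ 2))) := by
      refine Finset.sum_le_sum fun z hz => ?_
      have hz' := hZ𝒯 z hz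
      exact measure_exists_sum_pos_part_lt_le_of_ellipsoid hXm hXi hXl hN hn (ham z) (hℓm z)
        (ha z hz') (hℓ z hz') hb hD hD1 hC hα hε hε1 hDN (hℓC z hz')
    _ = 2 * ENNReal.ofReal (Z.card * Real.exp (-(α ^ 2 * N * ε ^ 2))) := by
      rw [Finset.sum_const, nsmul_eq_mul, ENNReal.ofReal_mul (Nat.cast_nonneg _),
        ENNReal.ofReal_natCast]
      ring
    _ ≤ _ := by
      gcongr
      rw [sub_eq_add_neg, Real.exp_add]
      gcongr

end Uniform

/-! ### Mean value comparisons along segments. -/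

section MeanValue

variable {F E : Type*} [NormedAddCommGroup F] [NormedSpace ℝ F] [NormedAddCommGroup E]
  [InnerProductSpace ℝ E] {f : F → E} {f' : F → F →L[ℝ] E} {E' : Type*}
  [NormedAddCommGroup E'] {L : F → E'} {N : Set F}

/-- Pairing with a fixed vector reduces mean value estimates for a vector-valued map to the scalar
case. -/
lemma hasDerivAt_inner_segment {z u : F} {t : ℝ} (w : E)
    (h : HasFDerivAt f (f' (z + t • u)) (z + t • u)) :
    HasDerivAt (fun s : ℝ => inner ℝ w (f (z + s • u))) (inner ℝ w (f' (z + t • u) u)) t := by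
  have h1 : HasDerivAt (fun s : ℝ => z + s • u) u t := by
    simpa using ((hasDerivAt_id t).smul_const u).const_add z
  have h2 := h.comp_hasDerivAt t h1
  simpa using (hasDerivAt_const t w).inner ℝ h2

lemma segment_mem (hN : Convex ℝ N) {z u : F} (hz : z ∈ N) (hu : z + u ∈ N) {t : ℝ} (h0 : 0 ≤ t)
    (h1 : t ≤ 1) : z + t • u ∈ N :=
  hN.add_smul_mem hz hu ⟨h0, h1⟩

lemma tendsto_difference_quotient {G : Type*} [NormedAddCommGroup G] [NormedSpace ℝ G]
    {g : F → G} {g' : F →L[ℝ] G} {z : F} {t : ℕ → ℝ} (ht : Tendsto t atTop (𝓝[≠] 0)) (u : F)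
    (hg : HasFDerivAt g g' z) :
    Tendsto (fun k => (t k)⁻¹ • (g (z + t k • u) - g z)) atTop (𝓝 (g' u)) := by
  have hline : HasDerivAt (fun s : ℝ => z + s • u) u 0 := by
    simpa using ((hasDerivAt_id (0 : ℝ)).smul_const u).const_add z
  have h1 : HasDerivAt (fun s : ℝ => g (z + s • u)) (g' u) 0 :=
    HasFDerivAt.comp_hasDerivAt (0 : ℝ) (by simpa using hg) hline
  have h2 := (hasDerivAt_iff_tendsto_slope_zero.1 h1).comp ht
  refine h2.congr fun k => ?_
  simp

/-- An upper bound on a difference by a directional bound on the derivative. -/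
lemma norm_sub_le_of_fderiv_le (hN : Convex ℝ N) (hf : ∀ x ∈ N, HasFDerivAt f (f' x) x) {C : ℝ}
    (hC : ∀ x ∈ N, ∀ u, ‖f' x u‖ ≤ C * ‖L u‖) {z u : F} (hz : z ∈ N) (hu : z + u ∈ N) :
    ‖f (z + u) - f z‖ ≤ C * ‖L u‖ := by
  set w := f (z + u) - f z with hw
  have hd : ∀ t ∈ Set.Icc (0 : ℝ) 1, HasDerivAt (fun s : ℝ => inner ℝ w (f (z + s • u)))
      (inner ℝ w (f' (z + t • u) u)) t := fun t ht =>
    hasDerivAt_inner_segment w (hf _ (segment_mem hN hz hu ht.1 ht.2))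
  have h1 := Convex.image_sub_le_mul_sub_of_deriv_le (convex_Icc (0 : ℝ) 1)
    (f := fun s : ℝ => inner ℝ w (f (z + s • u))) (C := ‖w‖ * (C * ‖L u‖))
    (fun t ht => (hd t ht).continuousAt.continuousWithinAt)
    (fun t ht => (hd t (interior_subset ht)).differentiableAt.differentiableWithinAt)
    (fun t ht => by
      rw [(hd t (interior_subset ht)).deriv]
      have ht' := interior_subset ht
      exact (real_inner_le_norm _ _).trans (mul_le_mul_of_nonneg_left
        (hC _ (segment_mem hN hz hu ht'.1 ht'.2) u) (norm_nonneg _)))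
    0 (by simp) 1 (by simp) zero_le_one
  simp only [one_smul, zero_smul, add_zero, sub_zero, mul_one] at h1
  rw [← inner_sub_right, ← hw, real_inner_self_eq_norm_sq, sq] at h1
  rcases (norm_nonneg w).eq_or_lt with h0 | h0
  · rw [← h0]
    exact (norm_nonneg _).trans (hC z hz u)
  · exact le_of_mul_le_mul_left h1 h0

/-- A lower bound on a difference when the derivative oscillates little. -/
lemma mul_norm_le_norm_sub_of_fderiv (hN : Convex ℝ N) (hf : ∀ x ∈ N, HasFDerivAt f (f' x) x)
    {C₁ C₂ C : ℝ} (hC₂ : 0 < C₂)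
    (h1 : ∀ x ∈ N, ∀ u, C₁ * ‖L u‖ ^ 2 ≤ ‖f' x u‖ ^ 2)
    (h2 : ∀ x ∈ N, ∀ u, ‖f' x u‖ ^ 2 ≤ C₂ * ‖L u‖ ^ 2)
    (h3 : ∀ x ∈ N, ∀ y ∈ N, ∀ u, ‖f' x u - f' y u‖ ^ 2 ≤ C * ‖L u‖ ^ 2)
    {z u : F} (hz : z ∈ N) (hu : z + u ∈ N) :
    (C₁ - C / 2) / Real.sqrt C₂ * ‖L u‖ ≤ ‖f (z + u) - f z‖ := by
  set w := f' z u with hw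
  have hd' : ∀ t ∈ Set.Icc (0 : ℝ) 1, HasDerivAt (fun s : ℝ => inner ℝ w (f (z + s • u)))
      (inner ℝ w (f' (z + t • u) u)) t := fun t ht =>
    hasDerivAt_inner_segment w (hf _ (segment_mem hN hz hu ht.1 ht.2))
  have h4 := Convex.mul_sub_le_image_sub_of_le_deriv (convex_Icc (0 : ℝ) 1)
    (f := fun s : ℝ => inner ℝ w (f (z + s • u))) (C := (C₁ - C / 2) * ‖L u‖ ^ 2)
    (fun t ht => (hd' t ht).continuousAt.continuousWithinAt)
    (fun t ht => (hd' t (interior_subset ht)).differentiableAt.differentiableWithinAt)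
    (fun t ht => by
      rw [(hd' t (interior_subset ht)).deriv]
      have ht' := interior_subset ht
      have hm := segment_mem hN hz hu ht'.1 ht'.2
      -- Polarization: twice the inner product is the sum of the two squared norms minus the squared
      -- difference, hence at least (2C₁ - C)‖L u‖². The derivative keeps a positive component along
      -- its initial value when C < 2C₁.
      have e := norm_sub_sq_real w (f' (z + t • u) u)
      have e1 := h1 z hz u
      have e2 := h1 _ hm u
      have e3 := h3 z hz _ hm u
      rw [← hw] at e1 e3
      linarith)
    0 (by simp) 1 (by simp) zero_le_one
  simp only [one_smul, zero_smul, add_zero, sub_zero, mul_one] at h4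
  rw [← inner_sub_right] at h4
  have h5 : ‖w‖ ≤ Real.sqrt C₂ * ‖L u‖ := by
    rw [← Real.sqrt_sq (norm_nonneg (L u)), ← Real.sqrt_mul hC₂.le]
    exact Real.le_sqrt_of_sq_le (h2 z hz u)
  have h6 := h4.trans ((real_inner_le_norm _ _).trans
    (mul_le_mul_of_nonneg_right h5 (norm_nonneg _)))
  have hs : 0 < Real.sqrt C₂ := Real.sqrt_pos.2 hC₂
  rcases (norm_nonneg (L u)).eq_or_lt with h0 | h0
  · rw [← h0, mul_zero]; exact norm_nonneg _
  · rw [div_mul_eq_mul_div, div_le_iff₀ hs]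
    refine le_of_mul_le_mul_right ?_ h0
    calc (C₁ - C / 2) * ‖L u‖ * ‖L u‖ = (C₁ - C / 2) * ‖L u‖ ^ 2 := by ring
      _ ≤ _ := h6
      _ = _ := by ring

end MeanValue

lemma ae_comp_of_map_eq {α Ω : Type*} [MeasurableSpace α] [MeasurableSpace Ω] {μ : Measure Ω}
    {P : Measure α} {X : Ω → α} (hX : Measurable X) (h : μ.map X = P) {q : α → Prop}
    (hq : ∀ᵐ x ∂P, q x) : ∀ᵐ ω ∂μ, q (X ω) := by
  subst h
  exact ae_of_ae_map hX.aemeasurable hq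

/-! ### Centred square integrable functions. -/

section L20

variable {α : Type*} [MeasurableSpace α] {P : Measure α} [IsProbabilityMeasure P]

lemma memLp_coe_L20 (f : L20 P) : MemLp (fun x => (f : Lp ℝ 2 P) x) 2 P := Lp.memLp _

lemma measurable_coe_L20 (f : L20 P) : Measurable (fun x => (f : Lp ℝ 2 P) x) :=
  (Lp.stronglyMeasurable _).measurable

lemma inner_L20 (f g : L20 P) :
    inner ℝ f g = ∫ x, (f : Lp ℝ 2 P) x * (g : Lp ℝ 2 P) x ∂P := by
  rw [Submodule.coe_inner, L2.inner_def]
  simp [mul_comm]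

lemma norm_sq_L20 (f : L20 P) : ‖f‖ ^ 2 = ∫ x, (f : Lp ℝ 2 P) x ^ 2 ∂P := by
  rw [← real_inner_self_eq_norm_sq, inner_L20]
  simp [sq]

lemma integral_L20 (f : L20 P) : ∫ x, (f : Lp ℝ 2 P) x ∂P = 0 := by
  have h := (Submodule.mem_orthogonal_singleton_iff_inner_right).1 f.2
  rw [L2.inner_def] at h
  rw [← h]
  refine integral_congr_ae ?_
  filter_upwards [Lp.coeFn_const 2 P (1 : ℝ)] with x hx
  rw [hx]
  simp

lemma memLp_const_add_L20 (c : ℝ) (f : L20 P) :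
    MemLp (fun x => c + (f : Lp ℝ 2 P) x) 2 P := (memLp_const c).add (memLp_coe_L20 f)

lemma integral_const_add_L20 (c : ℝ) (f : L20 P) :
    ∫ x, (c + (f : Lp ℝ 2 P) x) ∂P = c := by
  rw [integral_add (integrable_const _) ((memLp_coe_L20 f).integrable one_le_two), integral_L20]
  simp

lemma integral_sq_const_add_L20 (c : ℝ) (f : L20 P) :
    ∫ x, (c + (f : Lp ℝ 2 P) x) ^ 2 ∂P = c ^ 2 + ‖f‖ ^ 2 := by
  have h1 : ∀ x, (c + (f : Lp ℝ 2 P) x) ^ 2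
      = c ^ 2 + 2 * c * (f : Lp ℝ 2 P) x + (f : Lp ℝ 2 P) x ^ 2 := fun x => by ring
  simp_rw [h1]
  have i1 := ((memLp_coe_L20 f).integrable one_le_two).const_mul (2 * c)
  have i2 : Integrable (fun x => c ^ 2 + 2 * c * (f : Lp ℝ 2 P) x) P :=
    (integrable_const _).add i1
  rw [integral_add i2 (memLp_coe_L20 f).integrable_sq, integral_add (integrable_const _) i1,
    integral_const_mul, integral_L20, norm_sq_L20]
  simp

lemma coe_L20_add (f g : L20 P) :
    ∀ᵐ x ∂P, ((f + g : L20 P) : Lp ℝ 2 P) x = (f : Lp ℝ 2 P) x + (g : Lp ℝ 2 P) x :=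
  Lp.coeFn_add _ _

lemma coe_L20_sub (f g : L20 P) :
    ∀ᵐ x ∂P, ((f - g : L20 P) : Lp ℝ 2 P) x = (f : Lp ℝ 2 P) x - (g : Lp ℝ 2 P) x :=
  Lp.coeFn_sub _ _

lemma coe_L20_smul (c : ℝ) (f : L20 P) :
    ∀ᵐ x ∂P, ((c • f : L20 P) : Lp ℝ 2 P) x = c * (f : Lp ℝ 2 P) x :=
  Lp.coeFn_smul _ _

lemma coe_L20_neg (f : L20 P) :
    ∀ᵐ x ∂P, ((-f : L20 P) : Lp ℝ 2 P) x = -(f : Lp ℝ 2 P) x :=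
  Lp.coeFn_neg _

lemma coe_L20_sum {ι : Type*} (s : Finset ι) (f : ι → L20 P) :
    ∀ᵐ x ∂P, ((∑ j ∈ s, f j : L20 P) : Lp ℝ 2 P) x = ∑ j ∈ s, (f j : Lp ℝ 2 P) x := by
  classical
  induction s using Finset.induction_on with
  | empty =>
    filter_upwards [Lp.coeFn_zero ℝ 2 P] with x hx
    simp
  | insert a s ha ih =>
    rw [Finset.sum_insert ha]
    filter_upwards [ih, coe_L20_add (f a) (∑ j ∈ s, f j)] with x h1 h2
    rw [h2, h1, Finset.sum_insert ha]

/-- A nonconstant square integrable function gives a set of nontrivial probability. -/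
lemma exists_measureReal_mul_pos {f : L20 P} (hf : f ≠ 0) :
    ∃ G : Set α, MeasurableSet G ∧ 0 < P.real G * (1 - P.real G) := by
  have hm := measurable_coe_L20 f
  have hi := (memLp_coe_L20 f).integrable one_le_two
  refine ⟨{x | 0 < (f : Lp ℝ 2 P) x}, measurableSet_lt measurable_const hm, ?_⟩
  have hne : ¬ (fun x => (f : Lp ℝ 2 P) x) =ᵐ[P] 0 := fun h => hf (by
    apply Subtype.ext
    apply Lp.ext
    filter_upwards [h, Lp.coeFn_zero ℝ 2 P] with x hx h0
    rw [hx]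
    exact h0.symm)
  have h1 : 0 < P.real {x | 0 < (f : Lp ℝ 2 P) x} := by
    refine lt_of_le_of_ne measureReal_nonneg fun h => hne ?_
    have h2 : ∀ᵐ x ∂P, 0 ≤ -(f : Lp ℝ 2 P) x := by
      rw [eq_comm, measureReal_eq_zero_iff] at h
      rw [ae_iff]
      simpa only [Left.nonneg_neg_iff, not_le] using h
    have h3 := (integral_eq_zero_iff_of_nonneg_ae h2 hi.neg).1 (by
      rw [integral_neg, integral_L20, neg_zero])
    filter_upwards [h3] with x hx
    exact neg_eq_zero.1 hx
  have h2 : P.real {x | 0 < (f : Lp ℝ 2 P) x} < 1 := by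
    refine lt_of_le_of_ne measureReal_le_one fun h => hne ?_
    have h2 : ∀ᵐ x ∂P, 0 < (f : Lp ℝ 2 P) x := by
      have h3 := probReal_compl_eq_one_sub (μ := P)
        (s := {x | 0 < (f : Lp ℝ 2 P) x}) (measurableSet_lt measurable_const hm)
      rw [h, sub_self, measureReal_eq_zero_iff] at h3
      exact mem_ae_iff.2 h3
    exact (integral_eq_zero_iff_of_nonneg_ae (h2.mono fun x hx => hx.le) hi).1 (integral_L20 f)
  exact mul_pos h1 (by linarith)

end L20

/-! ### The model around the true parameter: tilts, cumulants and the symmetrized divergence. -/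

namespace Model

section Tilt

variable {m p : ℕ} {H : Type*} {𝓧 : Fin m → Type*} [∀ l, MeasurableSpace (𝓧 l)]
  (M : Model m p H 𝓧)

/-- The difference `η_l(·; τ) - η_l(·; τ₀)`. -/
def dη (l : Fin m) (τ : Param p H) (x : 𝓧 l) : ℝ := M.η l τ x - M.η l M.τ₀ x

/-- The difference `η_l(·; τ) - η_l(·; τ₀)` as an element of `L²₀`. -/
noncomputable def dηL2 (l : Fin m) (τ : Param p H) : M.L2 l := M.etaL2 l τ - M.etaL2 l M.τ₀

/-- The log normalizing constant. -/
noncomputable def logZ (l : Fin m) (τ : Param p H) : ℝ :=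
  Real.log (∫ y, Real.exp (M.η l τ y) ∂(M.ν l))

/-- The cumulant `log ∫ exp (η_l(·; τ) - η_l(·; τ₀)) f_{l,τ₀}`. -/
noncomputable def cgf (l : Fin m) (τ : Param p H) : ℝ :=
  Real.log (∫ y, Real.exp (M.dη l τ y) ∂(M.P l M.τ₀))

variable {M}

lemma coe_etaL2 (l : Fin m) (τ : Param p H) :
    ∀ᵐ x ∂(M.P l M.τ₀), (M.etaL2 l τ : Lp ℝ 2 (M.P l M.τ₀)) x = M.η l τ x :=
  MemLp.coeFn_toLp (μ := M.P l M.τ₀) (M.memLp l τ)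

lemma coe_dηL2 (l : Fin m) (τ : Param p H) :
    ∀ᵐ x ∂(M.P l M.τ₀), (M.dηL2 l τ : Lp ℝ 2 (M.P l M.τ₀)) x = M.dη l τ x := by
  have h : ∀ᵐ x ∂(M.P l M.τ₀), (M.dηL2 l τ : Lp ℝ 2 (M.P l M.τ₀)) x
      = (M.etaL2 l τ : Lp ℝ 2 (M.P l M.τ₀)) x - (M.etaL2 l M.τ₀ : Lp ℝ 2 (M.P l M.τ₀)) x :=
    Lp.coeFn_sub _ _
  filter_upwards [h, coe_etaL2 (M := M) l τ, coe_etaL2 (M := M) l M.τ₀] with x h1 h2 h3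
  rw [h1, h2, h3, dη]

lemma memLp_dη (l : Fin m) (τ : Param p H) : MemLp (M.dη l τ) 2 (M.P l M.τ₀) :=
  (M.memLp l τ).sub (M.memLp l M.τ₀)

lemma dη_τ₀ (l : Fin m) : M.dη l M.τ₀ = 0 := by ext x; simp [dη]

lemma dηL2_τ₀ (l : Fin m) : M.dηL2 l M.τ₀ = 0 := sub_self _

variable (hP : ∀ l, IsProbabilityMeasure (M.P l M.τ₀))
include hP

omit hP in
lemma integral_dη (l : Fin m) (τ : Param p H) : ∫ x, M.dη l τ x ∂(M.P l M.τ₀) = 0 := by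
  have i1 : Integrable (M.η l τ) (M.P l M.τ₀) :=
    MemLp.integrable (μ := M.P l M.τ₀) one_le_two (M.memLp l τ)
  have i2 : Integrable (M.η l M.τ₀) (M.P l M.τ₀) :=
    MemLp.integrable (μ := M.P l M.τ₀) one_le_two (M.memLp l M.τ₀)
  simp only [dη]
  rw [integral_sub i1 i2]
  have h1 : ∫ x, M.η l τ x ∂(M.P l M.τ₀) = 0 := M.integral_eq_zero l τ
  have h2 : ∫ x, M.η l M.τ₀ x ∂(M.P l M.τ₀) = 0 := M.integral_eq_zero l M.τ₀
  rw [h1, h2, sub_zero]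

lemma norm_sq_dηL2 (l : Fin m) (τ : Param p H) :
    ‖M.dηL2 l τ‖ ^ 2 = ∫ x, M.dη l τ x ^ 2 ∂(M.P l M.τ₀) := by
  have := hP l
  rw [norm_sq_L20]
  refine integral_congr_ae ?_
  filter_upwards [coe_dηL2 (M := M) l τ] with x hx
  rw [hx]

lemma V_τ₀ (l : Fin m) (f : M.L2 l) : M.V l M.τ₀ f = ‖f‖ ^ 2 := by
  have := hP l
  rw [V, variance_of_integral_eq_zero (measurable_coe_L20 f).aemeasurable (integral_L20 f),
    norm_sq_L20]

lemma Vcov_τ₀ (l : Fin m) (f g : M.L2 l) : M.Vcov l M.τ₀ f g = inner ℝ f g := by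
  have := hP l
  rw [Vcov, covariance_eq_sub (memLp_coe_L20 f) (memLp_coe_L20 g), integral_L20, inner_L20]
  simp

section InN

variable {l : Fin m} {τ : Param p H}
  (h₀ : Integrable (fun x => Real.exp (M.η l M.τ₀ x)) (M.ν l))
  (hτ : Integrable (fun x => Real.exp (M.η l τ x)) (M.ν l))
include h₀

omit hP in
lemma P_eq_tilted (τ : Param p H) : M.P l τ = (M.P l M.τ₀).tilted (M.dη l τ) := by
  rw [P, P, tilted_tilted h₀]
  congr 1
  ext x
  simp [dη]

include hτ

omit hP in
lemma integrable_exp_dη : Integrable (fun x => Real.exp (M.dη l τ x)) (M.P l M.τ₀) := by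
  rw [P, integrable_tilted_iff]
  · refine hτ.congr (ae_of_all _ fun x => ?_)
    simp only [smul_eq_mul, dη, ← Real.exp_add]
    congr 1
    ring
  · exact h₀

omit h₀ in
lemma integral_exp_pos' : 0 < ∫ x, Real.exp (M.η l τ x) ∂(M.ν l) := by
  have : NeZero (M.ν l) := ⟨fun h => by
    have := (hP l).measure_univ
    simp [P, h] at this⟩
  exact integral_exp_pos hτ

lemma cgf_eq : M.cgf l τ = M.logZ l τ - M.logZ l M.τ₀ := by
  rw [cgf, P, integral_exp_tilted, logZ, logZ, ← Real.log_div
    (integral_exp_pos' hP hτ).ne' (integral_exp_pos' hP h₀).ne']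
  congr 3
  ext x
  simp [dη]

lemma isProbabilityMeasure_P : IsProbabilityMeasure (M.P l τ) := by
  have := hP l
  rw [P_eq_tilted h₀]
  exact isProbabilityMeasure_tilted (integrable_exp_dη h₀ hτ)

end InN

end Tilt

end Model

namespace Model

section Bound

variable {m p : ℕ} {H : Type*} {𝓧 : Fin m → Type*} [∀ l, MeasurableSpace (𝓧 l)]
  {M : Model m p H 𝓧} (hP : ∀ l, IsProbabilityMeasure (M.P l M.τ₀))
  {N : Set (Param p H)} (hN₀ : M.τ₀ ∈ N) {C₃ C₄ : ℝ} (hV : VarianceEquivalent M N C₃ C₄)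

lemma V_zero {l : Fin m} {τ : Param p H} (h : M.P l τ ≪ M.P l M.τ₀) : M.V l τ 0 = 0 := by
  have h1 : ∀ᵐ x ∂(M.P l M.τ₀), ((0 : M.L2 l) : Lp ℝ 2 (M.P l M.τ₀)) x = 0 := by
    filter_upwards [Lp.coeFn_zero ℝ 2 (M.P l M.τ₀)] with x hx using hx
  rw [V, variance_congr (Y := fun _ => (0 : ℝ)) (h.ae_le h1)]
  exact variance_zero _

include hP in
/-- The centered indicator of a set, with its variances. -/
lemma exists_V_eq_measureReal {l : Fin m} {E : Set (𝓧 l)} (hE : MeasurableSet E) :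
    ∃ f : M.L2 l, ∀ τ, IsProbabilityMeasure (M.P l τ) → M.P l τ ≪ M.P l M.τ₀ →
      M.V l τ f = (M.P l τ).real E * (1 - (M.P l τ).real E) := by
  have := hP l
  have hm : Measurable (E.indicator fun _ => (1 : ℝ)) := measurable_const.indicator hE
  have hmem : ∀ Q : Measure (𝓧 l), IsProbabilityMeasure Q →
      MemLp (E.indicator fun _ => (1 : ℝ)) 2 Q := fun Q _ =>
    (memLp_const (1 : ℝ)).indicator hE
  have hint : ∀ Q : Measure (𝓧 l), IsProbabilityMeasure Q →
      ∫ x, E.indicator (fun _ => (1 : ℝ)) x ∂Q = Q.real E := fun Q _ => by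
    rw [integral_indicator_const _ hE]; simp
  set c := (M.P l M.τ₀).real E with hc
  have hg : MemLp (fun x => E.indicator (fun _ => (1 : ℝ)) x - c) 2 (M.P l M.τ₀) :=
    (hmem _ this).sub (memLp_const c)
  have hg0 : ∫ x, (E.indicator (fun _ => (1 : ℝ)) x - c) ∂(M.P l M.τ₀) = 0 := by
    rw [integral_sub ((hmem _ this).integrable one_le_two) (integrable_const _), hint _ this]
    simp [hc]
  refine ⟨⟨hg.toLp _, toLp_mem_L20 hg hg0⟩, fun τ hτ hac => ?_⟩
  have h1 : ∀ᵐ x ∂(M.P l M.τ₀), (hg.toLp _ : Lp ℝ 2 (M.P l M.τ₀)) x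
      = E.indicator (fun _ => (1 : ℝ)) x - c := hg.coeFn_toLp
  rw [V, variance_congr (hac.ae_le h1), variance_sub_const hm.aestronglyMeasurable,
    variance_eq_sub (hmem _ hτ)]
  have h2 : (E.indicator fun _ => (1 : ℝ)) ^ 2 = E.indicator fun _ => (1 : ℝ) := by
    ext x
    by_cases hx : x ∈ E <;> simp [hx]
  rw [h2, hint _ hτ]
  ring

include hV hN₀

lemma absolutelyContinuous_P (l : Fin m) (τ : Param p H) : M.P l τ ≪ M.P l M.τ₀ := by
  rw [P_eq_tilted (hV.integrable_exp l _ hN₀) τ]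
  exact tilted_absolutelyContinuous _ _

/-- The assumption compares sums over the samples. A family supported on one sample isolates its
term. -/
lemma V_comparison {l : Fin m} {τ : Param p H} (hτ : τ ∈ N) (f : M.L2 l) :
    C₃ * M.V l M.τ₀ f ≤ M.V l τ f ∧ M.V l τ f ≤ C₄ * M.V l M.τ₀ f := by
  classical
  have key : ∀ τ, ∑ l', M.V l' τ ((Pi.single l f : (l' : Fin m) → M.L2 l') l') = M.V l τ f := by
    intro τ
    rw [Finset.sum_eq_single l]
    · simp
    · intro l' _ hl'
      rw [Pi.single_eq_of_ne hl']
      exact V_zero (absolutelyContinuous_P hN₀ hV l' τ)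
    · simp
  have h1 := hV.le_variance τ hτ (Pi.single l f)
  have h2 := hV.variance_le τ hτ (Pi.single l f)
  rw [key, key] at h1 h2
  exact ⟨h1, h2⟩

include hP

/-- The log densities are uniformly bounded on the neighborhood. -/
theorem exists_abs_dη_sub_cgf_le (hC₃ : 0 < C₃) (hC₄ : 0 < C₄)
    (hne : ∀ l, ∃ f : M.L2 l, f ≠ 0) :
    ∃ b : ℝ, 0 ≤ b ∧ ∀ l, ∀ τ ∈ N, ∀ᵐ x ∂(M.P l M.τ₀), |M.dη l τ x - M.cgf l τ| ≤ b := by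
  have h1 : ∀ l, ∃ B : ℝ, 1 ≤ B ∧ ∀ τ ∈ N,
      ∀ᵐ x ∂(M.P l M.τ₀), |M.dη l τ x - M.cgf l τ| ≤ Real.log B := by
    intro l
    have := hP l
    -- A nonzero centred function is positive on a set of probability strictly between 0 and 1; this
    -- is the reference set for the comparison of measures.
    obtain ⟨f, hf⟩ := hne l
    obtain ⟨G, hG, hG0⟩ := exists_measureReal_mul_pos hf
    obtain ⟨B, hB1, hB⟩ := exists_measureReal_comparison hC₃ hC₄ hG hG0
    refine ⟨B, hB1, fun τ hτ => ?_⟩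
    have h₀ := hV.integrable_exp l _ hN₀
    have hτi := hV.integrable_exp l _ hτ
    have hprob := isProbabilityMeasure_P hP h₀ hτi
    have hac := absolutelyContinuous_P hN₀ hV l τ
    refine abs_sub_log_le_of_comparison (integrable_exp_dη h₀ hτi) hB1 ?_
    rw [← P_eq_tilted h₀ τ]
    refine hB _ hprob (fun E hE => ?_) fun E hE => ?_
    · obtain ⟨g, hg⟩ := exists_V_eq_measureReal (M := M) hP hE
      rw [← hg _ this Measure.AbsolutelyContinuous.rfl, ← hg _ hprob hac]
      exact (V_comparison hN₀ hV hτ g).1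
    · obtain ⟨g, hg⟩ := exists_V_eq_measureReal (M := M) hP hE
      rw [← hg _ this Measure.AbsolutelyContinuous.rfl, ← hg _ hprob hac]
      exact (V_comparison hN₀ hV hτ g).2
  choose B hB1 hB using h1
  have hlog : ∀ l, 0 ≤ Real.log (B l) := fun l => Real.log_nonneg (hB1 l)
  refine ⟨∑ l, Real.log (B l), Finset.sum_nonneg fun l _ => hlog l, fun l τ hτ => ?_⟩
  filter_upwards [hB l τ hτ] with x hx
  exact hx.trans (Finset.single_le_sum (f := fun l => Real.log (B l)) (fun l _ => hlog l)
    (Finset.mem_univ l))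

/-- The symmetrized Kullback-Leibler distance. -/
theorem SKL_eq {τ : Param p H} (hτ : τ ∈ N) :
    M.SKL τ = ENNReal.ofReal
      (∑ l, ((∫ x, (M.η l M.τ₀ x - M.η l τ x) ∂(M.P l M.τ₀))
        + ∫ x, (M.η l τ x - M.η l M.τ₀ x) ∂(M.P l τ))) := by
  have key : ∀ l, 0 ≤ (∫ x, (M.η l M.τ₀ x - M.η l τ x) ∂(M.P l M.τ₀))
        + ∫ x, (M.η l τ x - M.η l M.τ₀ x) ∂(M.P l τ) ∧
      InformationTheory.klDiv (M.P l M.τ₀) (M.P l τ)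
        + InformationTheory.klDiv (M.P l τ) (M.P l M.τ₀)
      = ENNReal.ofReal ((∫ x, (M.η l M.τ₀ x - M.η l τ x) ∂(M.P l M.τ₀))
        + ∫ x, (M.η l τ x - M.η l M.τ₀ x) ∂(M.P l τ)) := by
    intro l
    have hp0 := hP l
    have h₀ := hV.integrable_exp l _ hN₀
    have hτi := hV.integrable_exp l _ hτ
    have hp1 := isProbabilityMeasure_P hP h₀ hτi
    have i1 := integrable_exp_dη h₀ hτi
    have i2 : Integrable (M.dη l τ) (M.P l M.τ₀) := (memLp_dη l τ).integrable one_le_two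
    -- The true law is in turn a tilt of P_τ, so the reverse divergence follows from the same
    -- formula. The two cumulants are opposite and cancel in the sum.
    have e1 : M.P l M.τ₀ = (M.P l τ).tilted (fun x => -M.dη l τ x) := by
      rw [P, P, tilted_tilted hτi]
      congr 1
      ext x
      simp [dη]
    have i3 : Integrable (fun x => Real.exp (-M.dη l τ x)) (M.P l τ) := by
      rw [P, integrable_tilted_iff hτi]
      refine h₀.congr (ae_of_all _ fun x => ?_)
      simp only [smul_eq_mul, dη, ← Real.exp_add]
      congr 1
      ring
    have i4 : Integrable (fun x => -M.dη l τ x) (M.P l τ) := by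
      have h1 := (hV.memLp l τ hτ (M.dηL2 l τ)).integrable one_le_two
      refine (h1.congr ?_).neg
      exact (absolutelyContinuous_P hN₀ hV l τ).ae_le (coe_dηL2 (M := M) l τ)
    have k1 := klDiv_tilted_right i1 i2
    have k2 := klDiv_tilted_right i3 i4
    rw [← P_eq_tilted h₀ τ] at k1
    rw [← e1] at k2
    have c1 : Real.log (∫ x, Real.exp (-M.dη l τ x) ∂(M.P l τ))
        = -Real.log (∫ x, Real.exp (M.dη l τ x) ∂(M.P l M.τ₀)) := by
      have h1 := cgf_eq hP h₀ hτi
      rw [cgf] at h1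
      rw [h1, P, integral_exp_tilted, Real.log_div]
      · simp only [logZ]
        have : ∀ x, (M.η l τ + fun x => -M.dη l τ x) x = M.η l M.τ₀ x := fun x => by simp [dη]
        simp_rw [this]
        ring
      · have : ∀ x, (M.η l τ + fun x => -M.dη l τ x) x = M.η l M.τ₀ x := fun x => by simp [dη]
        simp_rw [this]
        exact (integral_exp_pos' hP h₀).ne'
      · exact (integral_exp_pos' hP hτi).ne'
    have n1 := le_log_integral_exp i1 i2
    have n2 := le_log_integral_exp i3 i4
    have e2 : ∀ x, M.η l M.τ₀ x - M.η l τ x = -M.dη l τ x := fun x => by simp [dη]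
    have e3 : ∀ x, M.η l τ x - M.η l M.τ₀ x = M.dη l τ x := fun x => rfl
    simp_rw [e2, e3]
    rw [integral_neg] at n2 k2 ⊢
    rw [k1, k2, c1, ← ENNReal.ofReal_add (by linarith) (by linarith)]
    rw [c1] at n2
    refine ⟨by linarith, ?_⟩
    congr 1
    ring
  rw [SKL, ENNReal.ofReal_sum_of_nonneg fun l _ => (key l).1]
  exact Finset.sum_congr rfl fun l _ => (key l).2

/-- Jensen's inequality for the log normalizing constant. -/
lemma mean_le_logZ_sub {τ τ' : Param p H} (hτ : τ ∈ N) (hτ' : τ' ∈ N) (l : Fin m) :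
    ∫ x, ((M.etaL2 l τ' - M.etaL2 l τ : M.L2 l) : Lp ℝ 2 (M.P l M.τ₀)) x ∂(M.P l τ)
      ≤ M.logZ l τ' - M.logZ l τ := by
  have h₀ := hV.integrable_exp l _ hN₀
  have hτi := hV.integrable_exp l _ hτ
  have hτi' := hV.integrable_exp l _ hτ'
  have hp1 := isProbabilityMeasure_P hP h₀ hτi
  have hae : ∀ᵐ x ∂(M.P l τ), ((M.etaL2 l τ' - M.etaL2 l τ : M.L2 l) : Lp ℝ 2 (M.P l M.τ₀)) x
      = M.η l τ' x - M.η l τ x := by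
    refine (absolutelyContinuous_P hN₀ hV l τ).ae_le ?_
    filter_upwards [coe_L20_sub (M.etaL2 l τ') (M.etaL2 l τ), coe_etaL2 (M := M) l τ',
      coe_etaL2 (M := M) l τ] with x h1 h2 h3
    rw [h1, h2, h3]
  rw [integral_congr_ae hae]
  have e1 : ∀ x, (M.η l τ + fun x => M.η l τ' x - M.η l τ x) x = M.η l τ' x := fun x => by simp
  have i1 : Integrable (fun x => Real.exp (M.η l τ' x - M.η l τ x)) (M.P l τ) := by
    rw [P, integrable_tilted_iff hτi]
    refine hτi'.congr (ae_of_all _ fun x => ?_)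
    simp only [smul_eq_mul, ← Real.exp_add]
    congr 1
    ring
  have i2 : Integrable (fun x => M.η l τ' x - M.η l τ x) (M.P l τ) :=
    ((hV.memLp l τ hτ (M.etaL2 l τ' - M.etaL2 l τ)).integrable one_le_two).congr hae
  refine (le_log_integral_exp i1 i2).trans (le_of_eq ?_)
  rw [P, integral_exp_tilted]
  simp_rw [e1]
  rw [Real.log_div (integral_exp_pos' hP hτi').ne' (integral_exp_pos' hP hτi).ne', logZ, logZ]

lemma nll_sub (n : Fin m → ℕ) (x : ∀ l, ℕ → 𝓧 l) {τ τ' : Param p H} (hτ : τ ∈ N)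
    (hτ' : τ' ∈ N) :
    M.nll n x τ' - M.nll n x τ = ∑ l, (-((n l : ℝ)⁻¹ * ∑ i ∈ Finset.range (n l),
      (M.η l τ' (x l i) - M.η l τ (x l i))) + (M.cgf l τ' - M.cgf l τ)) := by
  rw [nll, nll, ← Finset.sum_sub_distrib]
  refine Finset.sum_congr rfl fun l _ => ?_
  have h₀ := hV.integrable_exp l _ hN₀
  rw [cgf_eq hP h₀ (hV.integrable_exp l _ hτ), cgf_eq hP h₀ (hV.integrable_exp l _ hτ'),
    Finset.sum_sub_distrib, logZ, logZ, logZ]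
  ring

/-- The negative log likelihood ratio in terms of elements of `L²₀`. -/
lemma ae_nll_sub {Ω : Type*} [MeasurableSpace Ω] {μ : Measure Ω} {X : ∀ l, ℕ → Ω → 𝓧 l}
    (hXm : ∀ l i, Measurable (X l i))
    (hXlaw : ∀ l i, μ.map (X l i) = M.P l M.τ₀) (n : Fin m → ℕ) {τ τ' : Param p H} (hτ : τ ∈ N)
    (hτ' : τ' ∈ N) :
    ∀ᵐ ω ∂μ, M.nll n (fun l i => X l i ω) τ' - M.nll n (fun l i => X l i ω) τ
      = ∑ l, (-((n l : ℝ)⁻¹ * ∑ i ∈ Finset.range (n l),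
        ((M.dηL2 l τ' : Lp ℝ 2 (M.P l M.τ₀)) (X l i ω)
          - (M.dηL2 l τ : Lp ℝ 2 (M.P l M.τ₀)) (X l i ω))) + (M.cgf l τ' - M.cgf l τ)) := by
  have h1 : ∀ σ : Param p H, ∀ᵐ ω ∂μ, ∀ l i,
      (M.dηL2 l σ : Lp ℝ 2 (M.P l M.τ₀)) (X l i ω) = M.dη l σ (X l i ω) := fun σ =>
    ae_all_iff.2 fun l => ae_all_iff.2 fun i =>
      ae_comp_of_map_eq (hXm l i) (hXlaw l i) (coe_dηL2 l σ)
  filter_upwards [h1 τ, h1 τ'] with ω h2 h3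
  rw [nll_sub hP hN₀ hV n _ hτ hτ']
  refine Finset.sum_congr rfl fun l _ => ?_
  congr 3
  refine Finset.sum_congr rfl fun i _ => ?_
  rw [h2, h3, dη, dη]
  ring

variable {b : ℝ} (hb : ∀ l, ∀ τ ∈ N, ∀ᵐ x ∂(M.P l M.τ₀), |M.dη l τ x - M.cgf l τ| ≤ b)
include hb

/-- The increment of η is centred under the true law, so only its mean under P_τ survives. With a
bounded log density this mean is at most a multiple of the second moment. -/
lemma SKL_le {τ : Param p H} (hτ : τ ∈ N) :
    M.SKL τ ≤ ENNReal.ofReal (Real.exp (2 * b) * ∑ l, ‖M.dηL2 l τ‖ ^ 2) := by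
  rw [SKL_eq hP hN₀ hV hτ]
  refine ENNReal.ofReal_le_ofReal ?_
  rw [Finset.mul_sum]
  refine Finset.sum_le_sum fun l _ => ?_
  have := hP l
  have h₀ := hV.integrable_exp l _ hN₀
  have hτi := hV.integrable_exp l _ hτ
  have e2 : ∀ x, M.η l M.τ₀ x - M.η l τ x = -M.dη l τ x := fun x => by simp [dη]
  have e3 : ∀ x, M.η l τ x - M.η l M.τ₀ x = M.dη l τ x := fun x => rfl
  simp_rw [e2, e3]
  rw [integral_neg, integral_dη, neg_zero, zero_add, norm_sq_dηL2 hP, P_eq_tilted h₀ τ]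
  exact integral_tilted_self_le (integrable_exp_dη h₀ hτi) (memLp_dη l τ) (integral_dη l τ)
    (hb l τ hτ)

lemma cgf_lower {τ : Param p H} (hτ : τ ∈ N) (l : Fin m) :
    Real.exp (-b) / 4 * ‖M.dηL2 l τ‖ ^ 2 ≤ M.cgf l τ := by
  have := hP l
  rw [norm_sq_dηL2 hP]
  exact sq_le_log_integral_exp (integrable_exp_dη (hV.integrable_exp l _ hN₀)
    (hV.integrable_exp l _ hτ)) (memLp_dη l τ) (integral_dη l τ) (hb l τ hτ)

lemma cgf_upper {τ : Param p H} (hτ : τ ∈ N) (l : Fin m) :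
    M.cgf l τ ≤ Real.exp (2 * b) * ‖M.dηL2 l τ‖ ^ 2 := by
  have := hP l
  rw [norm_sq_dηL2 hP]
  have h1 := integrable_exp_dη (hV.integrable_exp l _ hN₀) (hV.integrable_exp l _ hτ)
  exact (log_integral_exp_le_integral_tilted h1 (memLp_dη l τ) (hb l τ hτ)).trans
    (integral_tilted_self_le h1 (memLp_dη l τ) (integral_dη l τ) (hb l τ hτ))

/-- The mean under another parameter value as a functional on `L²₀`. -/
lemma exists_mean {τ : Param p H} (hτ : τ ∈ N) (l : Fin m) :
    ∃ ψ : M.L2 l →L[ℝ] ℝ, (∀ f, ψ f = ∫ x, (f : Lp ℝ 2 (M.P l M.τ₀)) x ∂(M.P l τ)) ∧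
      ∀ f, |ψ f| ≤ Real.exp (2 * b) * (‖M.dηL2 l τ‖ * ‖f‖) := by
  have := hP l
  have h₀ := hV.integrable_exp l _ hN₀
  have hτi := hV.integrable_exp l _ hτ
  have hp1 := isProbabilityMeasure_P hP h₀ hτi
  have hac := absolutelyContinuous_P hN₀ hV l τ
  have hi : ∀ f : M.L2 l, Integrable (fun x => (f : Lp ℝ 2 (M.P l M.τ₀)) x) (M.P l τ) :=
    fun f => (hV.memLp l τ hτ f).integrable one_le_two
  have hbd : ∀ f : M.L2 l, |∫ x, (f : Lp ℝ 2 (M.P l M.τ₀)) x ∂(M.P l τ)|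
      ≤ Real.exp (2 * b) * (‖M.dηL2 l τ‖ * ‖f‖) := by
    intro f
    have h1 := sq_integral_tilted_le (integrable_exp_dη h₀ hτi) (memLp_dη l τ) (integral_dη l τ)
      (hb l τ hτ) (memLp_coe_L20 f) (integral_L20 f)
    rw [← P_eq_tilted h₀ τ, ← norm_sq_dηL2 hP, ← norm_sq_L20, ← mul_pow, ← mul_pow] at h1
    exact abs_le_of_sq_le_sq h1 (by positivity)
  refine ⟨LinearMap.mkContinuous
    { toFun := fun f => ∫ x, (f : Lp ℝ 2 (M.P l M.τ₀)) x ∂(M.P l τ)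
      map_add' := fun f g => ?_
      map_smul' := fun c f => ?_ } (Real.exp (2 * b) * ‖M.dηL2 l τ‖) fun f => ?_,
    fun f => rfl, hbd⟩
  · rw [← integral_add (hi f) (hi g)]
    exact integral_congr_ae (hac.ae_le (coe_L20_add f g))
  · rw [RingHom.id_apply, smul_eq_mul, ← integral_const_mul]
    exact integral_congr_ae (hac.ae_le (coe_L20_smul c f))
  · rw [mul_assoc]
    exact hbd f

end Bound

end Model

/-! ### Derivatives of η and subgradients of the likelihood. -/

namespace Model

section Subgradient

variable {m p : ℕ} {H : Type*} [NormedAddCommGroup H] [InnerProductSpace ℝ H]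
  {𝓧 : Fin m → Type*} [∀ l, MeasurableSpace (𝓧 l)]

/-- The Fréchet derivative of `η_l` as a map into `L²₀`. -/
noncomputable def Dη (M : Model m p H 𝓧) (l : Fin m) (τ : Param p H) : Param p H →L[ℝ] M.L2 l :=
  fderiv ℝ (M.etaL2 l) τ

variable {M : Model m p H 𝓧} {N : Set (Param p H)}

lemma hasFDerivAt_etaL2 (hNo : IsOpen N) {l : Fin m} (h : ContDiffOn ℝ 3 (M.etaL2 l) N)
    {τ : Param p H} (hτ : τ ∈ N) : HasFDerivAt (M.etaL2 l) (M.Dη l τ) τ :=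
  ((h.contDiffAt (hNo.mem_nhds hτ)).differentiableAt (by norm_num)).hasFDerivAt

lemma Dη_apply (hNo : IsOpen N) {l : Fin m} (h : ContDiffOn ℝ 3 (M.etaL2 l) N)
    {τ : Param p H} (hτ : τ ∈ N) (ζ : EuclideanSpace ℝ (Fin p)) (g : H) :
    M.Dη l τ (ζ, g) = M.Dθ l τ ζ + M.Dh l τ g := by
  have h1 := hasFDerivAt_etaL2 hNo h hτ
  have h2 : HasFDerivAt (fun θ => M.etaL2 l (θ, τ.2))
      ((M.Dη l τ).comp (ContinuousLinearMap.inl ℝ _ _)) τ.1 :=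
    HasFDerivAt.comp (g := M.etaL2 l) (f := fun θ => (θ, τ.2)) τ.1 h1
      (hasFDerivAt_prodMk_left τ.1 τ.2)
  have h3 : HasFDerivAt (fun h => M.etaL2 l (τ.1, h))
      ((M.Dη l τ).comp (ContinuousLinearMap.inr ℝ _ _)) τ.2 :=
    HasFDerivAt.comp (g := M.etaL2 l) (f := fun h => (τ.1, h)) τ.2 h1
      (hasFDerivAt_prodMk_right τ.1 τ.2)
  rw [Dθ, Dh, h2.fderiv, h3.fderiv]
  simp only [ContinuousLinearMap.coe_comp, Function.comp_apply, ContinuousLinearMap.inl_apply,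
    ContinuousLinearMap.inr_apply]
  rw [← map_add]
  simp

/-- Difference quotients converge to the derivative almost everywhere. -/
lemma ae_tendsto_difference_quotient (hP : ∀ l, IsProbabilityMeasure (M.P l M.τ₀))
    (hNo : IsOpen N) {l : Fin m} (h : ContDiffOn ℝ 3 (M.etaL2 l) N)
    (hx : ∀ x, ContDiffOn ℝ 3 (fun τ => M.η l τ x) N) {z : Param p H} (hz : z ∈ N)
    (u : Param p H) {t : ℕ → ℝ} (ht : Tendsto t atTop (𝓝[≠] 0)) :
    Tendsto (fun k => (t k)⁻¹ • (M.etaL2 l (z + t k • u) - M.etaL2 l z)) atTop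
        (𝓝 (M.Dη l z u)) ∧
    ∀ᵐ x ∂(M.P l M.τ₀), Tendsto (fun k => (t k)⁻¹ * (M.η l (z + t k • u) x - M.η l z x)) atTop
      (𝓝 ((M.Dη l z u : Lp ℝ 2 (M.P l M.τ₀)) x)) := by
  have := hP l
  have hL2 := tendsto_difference_quotient ht u (hasFDerivAt_etaL2 hNo h hz)
  refine ⟨hL2, ?_⟩
  have hpt : ∀ x, Tendsto (fun k => (t k)⁻¹ * (M.η l (z + t k • u) x - M.η l z x)) atTop
      (𝓝 (fderiv ℝ (fun τ => M.η l τ x) z u)) := fun x =>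
    tendsto_difference_quotient ht u
      (((hx x).contDiffAt (hNo.mem_nhds hz)).differentiableAt (by norm_num)).hasFDerivAt
  have hae : ∀ k, (fun x => (((t k)⁻¹ • (M.etaL2 l (z + t k • u) - M.etaL2 l z) : M.L2 l) :
      Lp ℝ 2 (M.P l M.τ₀)) x) =ᵐ[M.P l M.τ₀]
      fun x => (t k)⁻¹ * (M.η l (z + t k • u) x - M.η l z x) := by
    intro k
    filter_upwards [coe_L20_smul (t k)⁻¹ (M.etaL2 l (z + t k • u) - M.etaL2 l z),
      coe_L20_sub (M.etaL2 l (z + t k • u)) (M.etaL2 l z), coe_etaL2 (M := M) l (z + t k • u),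
      coe_etaL2 (M := M) l z] with x h1 h2 h3 h4
    rw [h1, h2, h3, h4]
  -- The derivative in L² and the pointwise derivative are given separately. Both are limits in
  -- measure of the same quotients, hence equal almost everywhere.
  have m1 : TendstoInMeasure (M.P l M.τ₀)
      (fun k x => (t k)⁻¹ * (M.η l (z + t k • u) x - M.η l z x)) atTop
      (fun x => (M.Dη l z u : Lp ℝ 2 (M.P l M.τ₀)) x) := by
    have h1 : Tendsto (fun k => (((t k)⁻¹ • (M.etaL2 l (z + t k • u) - M.etaL2 l z) : M.L2 l) :
      Lp ℝ 2 (M.P l M.τ₀))) atTop (𝓝 (M.Dη l z u : Lp ℝ 2 (M.P l M.τ₀))) :=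
      (continuous_subtype_val.tendsto _).comp hL2
    exact (tendstoInMeasure_of_tendsto_Lp h1).congr_left hae
  have m2 : TendstoInMeasure (M.P l M.τ₀)
      (fun k x => (t k)⁻¹ * (M.η l (z + t k • u) x - M.η l z x)) atTop
      (fun x => fderiv ℝ (fun τ => M.η l τ x) z u) := by
    refine tendstoInMeasure_of_tendsto_ae (fun k => ?_) (ae_of_all _ hpt)
    exact (memLp_coe_L20 ((t k)⁻¹ • (M.etaL2 l (z + t k • u) - M.etaL2 l z))).1.congr (hae k)
  filter_upwards [tendstoInMeasure_ae_unique m1 m2] with x h1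
  rw [h1]
  exact hpt x

variable (hP : ∀ l, IsProbabilityMeasure (M.P l M.τ₀)) (hN₀ : M.τ₀ ∈ N) {C₃ C₄ : ℝ}
  (hV : VarianceEquivalent M N C₃ C₄)
include hP hN₀ hV

variable {Ω : Type*} [MeasurableSpace Ω] {μ : Measure Ω} {X : ∀ l, ℕ → Ω → 𝓧 l}

/-- The subgradient inequality for the negative log likelihood. -/
lemma ae_subgradient (hNo : IsOpen N) (hNc : Convex ℝ N)
    (hη : ∀ l, ContDiffOn ℝ 3 (M.etaL2 l) N)
    (hηx : ∀ l x, ContDiffOn ℝ 3 (fun τ => M.η l τ x) N)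
    (hXm : ∀ l i, Measurable (X l i)) (hXlaw : ∀ l i, μ.map (X l i) = M.P l M.τ₀)
    {n : Fin m → ℕ} (hconv : ∀ᵐ ω ∂μ, ConvexOn ℝ N (M.nll n (fun l i => X l i ω)))
    {z u : Param p H} (hz : z ∈ N) (hu : z + u ∈ N) {ψ : ∀ l, M.L2 l →L[ℝ] ℝ}
    (hψ : ∀ l f, ψ l f = ∫ x, (f : Lp ℝ 2 (M.P l M.τ₀)) x ∂(M.P l z)) :
    ∀ᵐ ω ∂μ, ∑ l, (-((n l : ℝ)⁻¹ * ∑ i ∈ Finset.range (n l),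
        (M.Dη l z u : Lp ℝ 2 (M.P l M.τ₀)) (X l i ω)) + ψ l (M.Dη l z u))
      ≤ M.nll n (fun l i => X l i ω) (z + u) - M.nll n (fun l i => X l i ω) z := by
  set t : ℕ → ℝ := fun k => 1 / ((k : ℝ) + 1) with ht
  have ht0 : ∀ k, 0 < t k := fun k => by positivity
  have ht1 : ∀ k, t k ≤ 1 := fun k => by
    rw [ht]
    simp only
    rw [div_le_one (by positivity)]
    linarith [(Nat.cast_nonneg k : (0 : ℝ) ≤ k)]
  have htt : Tendsto t atTop (𝓝[≠] 0) := by
    refine tendsto_nhdsWithin_iff.2 ⟨tendsto_one_div_add_atTop_nhds_zero_nat, ?_⟩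
    exact Eventually.of_forall fun k => (ht0 k).ne'
  have hdq := fun l => ae_tendsto_difference_quotient hP hNo (hη l) (hηx l) hz u htt
  have hae : ∀ᵐ ω ∂μ, ∀ l i,
      Tendsto (fun k => (t k)⁻¹ * (M.η l (z + t k • u) (X l i ω) - M.η l z (X l i ω))) atTop
        (𝓝 ((M.Dη l z u : Lp ℝ 2 (M.P l M.τ₀)) (X l i ω))) := by
    refine ae_all_iff.2 fun l => ae_all_iff.2 fun i => ?_
    exact ae_comp_of_map_eq (hXm l i) (hXlaw l i) (hdq l).2
  filter_upwards [hae, hconv] with ω hω hc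
  refine le_of_tendsto' (x := atTop) (f := fun k => ∑ l, (-((n l : ℝ)⁻¹ *
    ∑ i ∈ Finset.range (n l),
      (t k)⁻¹ * (M.η l (z + t k • u) (X l i ω) - M.η l z (X l i ω)))
      + ψ l ((t k)⁻¹ • (M.etaL2 l (z + t k • u) - M.etaL2 l z)))) ?_ fun k => ?_
  · refine tendsto_finsetSum _ fun l _ => ?_
    refine Tendsto.add ?_ (((ψ l).continuous.tendsto _).comp (hdq l).1)
    exact ((tendsto_finsetSum _ fun i _ => hω l i).const_mul _).neg
  · have hm : z + t k • u ∈ N := segment_mem hNc hz hu (ht0 k).le (ht1 k)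
    have h1 := hc.2 hz hu (by linarith [ht1 k] : 0 ≤ 1 - t k) (ht0 k).le (by ring)
    have h2 : (1 - t k) • z + t k • (z + u) = z + t k • u := by
      rw [smul_add, sub_smul, one_smul]; abel
    rw [h2, smul_eq_mul, smul_eq_mul] at h1
    have h3 : (t k)⁻¹ * (M.nll n (fun l i => X l i ω) (z + t k • u)
        - M.nll n (fun l i => X l i ω) z)
        ≤ M.nll n (fun l i => X l i ω) (z + u) - M.nll n (fun l i => X l i ω) z := by
      rw [inv_mul_le_iff₀ (ht0 k)]
      linarith
    refine le_trans ?_ h3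
    rw [nll_sub hP hN₀ hV n _ hz hm, Finset.mul_sum]
    refine Finset.sum_le_sum fun l _ => ?_
    have h₀ := hV.integrable_exp l _ hN₀
    -- Jensen takes the place of differentiating the normalizing constant: its increment is at least
    -- the mean under P_z of the increment of η. That mean passes to the limit because ψ is
    -- continuous.
    have h4 := mean_le_logZ_sub hP hN₀ hV hz hm l
    rw [← hψ] at h4
    rw [cgf_eq hP h₀ (hV.integrable_exp l _ hz), cgf_eq hP h₀ (hV.integrable_exp l _ hm),
      map_smul, smul_eq_mul, mul_add, ← Finset.mul_sum]
    have h5 := mul_le_mul_of_nonneg_left h4 (inv_pos.2 (ht0 k)).le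
    refine add_le_add (le_of_eq (by ring)) (h5.trans (le_of_eq (by ring)))

end Subgradient

end Model

/-! ### Lower bounds for the linearization remainder, sample by sample. -/

namespace Model

section LowerBound

variable {m p : ℕ} {H : Type*} [NormedAddCommGroup H] [InnerProductSpace ℝ H]
  {𝓧 : Fin m → Type*} [∀ l, MeasurableSpace (𝓧 l)]
  {M : Model m p H 𝓧} {N : Set (Param p H)}

variable (hP : ∀ l, IsProbabilityMeasure (M.P l M.τ₀)) (hN₀ : M.τ₀ ∈ N) {C₃ C₄ : ℝ}
  (hV : VarianceEquivalent M N C₃ C₄)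
include hP hN₀ hV

variable {Ω : Type*} [MeasurableSpace Ω] {μ : Measure Ω} {X : ∀ l, ℕ → Ω → 𝓧 l}

/-- The samplewise form of the subgradient inequality. -/
lemma exists_samplewise_subgradient (hNo : IsOpen N) (hNc : Convex ℝ N)
    (hη : ∀ l, ContDiffOn ℝ 3 (M.etaL2 l) N)
    (hηx : ∀ l x, ContDiffOn ℝ 3 (fun τ => M.η l τ x) N)
    (hXm : ∀ l i, Measurable (X l i)) (hXlaw : ∀ l i, μ.map (X l i) = M.P l M.τ₀)
    (hXi : iIndepFun (fun q : Fin m × ℕ => X q.1 q.2) μ)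
    {n : Fin m → ℕ} (hn : ∀ l, 0 < n l)
    (hconv : ∀ᵐ ω ∂μ, ConvexOn ℝ N (M.nll n (fun l i => X l i ω)))
    {z u : Param p H} (hz : z ∈ N) (hu : z + u ∈ N) {ψ : ∀ l, M.L2 l →L[ℝ] ℝ}
    (hψ : ∀ l f, ψ l f = ∫ x, (f : Lp ℝ 2 (M.P l M.τ₀)) x ∂(M.P l z)) :
    ∃ t : Fin m → ℝ, (∀ l, ∀ᵐ x ∂(M.P l M.τ₀), t l ≤ M.cgf l (z + u) - M.cgf l z
        - ψ l (M.Dη l z u) + ((-M.dηL2 l (z + u) + M.dηL2 l z + M.Dη l z u : M.L2 l) :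
          Lp ℝ 2 (M.P l M.τ₀)) x) ∧ 0 ≤ ∑ l, t l ∧
      ∀ l, |t l| ≤ ∑ l, |M.cgf l (z + u) - M.cgf l z - ψ l (M.Dη l z u)| := by
  set e : Fin m → ℝ := fun l => M.cgf l (z + u) - M.cgf l z - ψ l (M.Dη l z u) with he
  set y : ∀ l, M.L2 l := fun l => -M.dηL2 l (z + u) + M.dηL2 l z + M.Dη l z u with hy
  have hy' : ∀ l, ∀ᵐ x ∂(M.P l M.τ₀), (y l : Lp ℝ 2 (M.P l M.τ₀)) x
      = -(M.dηL2 l (z + u) : Lp ℝ 2 (M.P l M.τ₀)) x + (M.dηL2 l z : Lp ℝ 2 (M.P l M.τ₀)) x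
        + (M.Dη l z u : Lp ℝ 2 (M.P l M.τ₀)) x := by
    intro l
    have := hP l
    filter_upwards [coe_L20_add (-M.dηL2 l (z + u) + M.dηL2 l z) (M.Dη l z u),
      coe_L20_add (-M.dηL2 l (z + u)) (M.dηL2 l z), coe_L20_neg (M.dηL2 l (z + u))]
      with x h1 h2 h3
    rw [h1, h2, h3]
  have hae : ∀ᵐ ω ∂μ, 0 ≤ ∑ l, (n l : ℝ)⁻¹ * ∑ i ∈ Finset.range (n l),
      (e l + (y l : Lp ℝ 2 (M.P l M.τ₀)) (X l i ω)) := by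
    have h1 : ∀ᵐ ω ∂μ, ∀ l i, (y l : Lp ℝ 2 (M.P l M.τ₀)) (X l i ω)
      = -(M.dηL2 l (z + u) : Lp ℝ 2 (M.P l M.τ₀)) (X l i ω)
        + (M.dηL2 l z : Lp ℝ 2 (M.P l M.τ₀)) (X l i ω)
        + (M.Dη l z u : Lp ℝ 2 (M.P l M.τ₀)) (X l i ω) :=
      ae_all_iff.2 fun l => ae_all_iff.2 fun i =>
        ae_comp_of_map_eq (hXm l i) (hXlaw l i) (hy' l)
    filter_upwards [ae_subgradient hP hN₀ hV hNo hNc hη hηx hXm hXlaw hconv hz hu hψ,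
      ae_nll_sub hP hN₀ hV hXm hXlaw n hz hu, h1] with ω h2 h3 h4
    rw [h3, ← sub_nonneg, ← Finset.sum_sub_distrib] at h2
    refine h2.trans (le_of_eq (Finset.sum_congr rfl fun l _ => ?_))
    have hnl : (n l : ℝ) ≠ 0 := by exact_mod_cast (hn l).ne'
    simp only [h4, he]
    simp only [Finset.sum_add_distrib, Finset.sum_sub_distrib, Finset.sum_neg_distrib,
      Finset.sum_const, Finset.card_range, nsmul_eq_mul]
    field_simp
    ring
  obtain ⟨t, ht1, ht2⟩ := exists_ae_lower_bounds hXm hXlaw hP hXi hn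
    (D := fun l x => e l + (y l : Lp ℝ 2 (M.P l M.τ₀)) x)
    (fun l => (measurable_coe_L20 (y l)).const_add _) hae
  -- Integrating the bound removes the centred part y l. Together with ∑ t ≥ 0 this also bounds t l
  -- from below, because the other terms are at most |e j|.
  have hte : ∀ l, t l ≤ e l := by
    intro l
    have := hP l
    have h1 : ∫ _, t l ∂(M.P l M.τ₀) ≤ ∫ x, (e l + (y l : Lp ℝ 2 (M.P l M.τ₀)) x) ∂(M.P l M.τ₀) :=
      integral_mono_ae (integrable_const _)
        ((memLp_const_add_L20 (e l) (y l)).integrable one_le_two) (ht1 l)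
    rw [integral_const_add_L20] at h1
    simpa using h1
  refine ⟨t, ht1, ht2, fun l => ?_⟩
  have h1 : ∀ l, t l ≤ |e l| := fun l => (hte l).trans (le_abs_self _)
  have h2 : |e l| ≤ ∑ l, |e l| :=
    Finset.single_le_sum (f := fun l => |e l|) (fun _ _ => abs_nonneg _) (Finset.mem_univ l)
  rw [abs_le]
  refine ⟨?_, (h1 l).trans h2⟩
  have h3 : ∑ j ∈ Finset.univ.erase l, t j ≤ ∑ j ∈ Finset.univ.erase l, |e j| :=
    Finset.sum_le_sum fun j _ => h1 j
  rw [← Finset.add_sum_erase _ _ (Finset.mem_univ l)] at ht2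
  have h4 : ∑ j ∈ Finset.univ.erase l, |e j| ≤ ∑ j, |e j| :=
    Finset.sum_le_univ_sum_of_nonneg fun _ => abs_nonneg _
  linarith

variable {b : ℝ} (hb : ∀ l, ∀ τ ∈ N, ∀ᵐ x ∂(M.P l M.τ₀), |M.dη l τ x - M.cgf l τ| ≤ b)
  {E : Type*} [NormedAddCommGroup E] [NormedSpace ℝ E] {LL : Param p H →L[ℝ] E} {C : ℝ}
  (hC : 0 ≤ C)
  (hW : ∀ d, M.τ₀ + d ∈ N → ∑ l, ‖M.dηL2 l (M.τ₀ + d)‖ ^ 2 ≤ C * ‖LL d‖ ^ 2)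
  (hD : ∀ τ ∈ N, ∀ u, ∑ l, ‖M.Dη l τ u‖ ^ 2 ≤ C * ‖LL u‖ ^ 2)
include hb hC hW hD

omit hP hN₀ hV hb in
lemma sum_abs_mean_le {z : Param p H} (hz : M.τ₀ + z ∈ N) (u : Param p H)
    {ψ : ∀ l, M.L2 l →L[ℝ] ℝ}
    (hψb : ∀ l f, |ψ l f| ≤ Real.exp (2 * b) * (‖M.dηL2 l (M.τ₀ + z)‖ * ‖f‖)) :
    ∑ l, |ψ l (M.Dη l (M.τ₀ + z) u)| ≤ Real.exp (2 * b) * C * (‖LL z‖ * ‖LL u‖) := by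
  calc ∑ l, |ψ l (M.Dη l (M.τ₀ + z) u)|
      ≤ ∑ l, Real.exp (2 * b) * (‖M.dηL2 l (M.τ₀ + z)‖ * ‖M.Dη l (M.τ₀ + z) u‖) :=
        Finset.sum_le_sum fun l _ => hψb l _
    _ = Real.exp (2 * b) * ∑ l, ‖M.dηL2 l (M.τ₀ + z)‖ * ‖M.Dη l (M.τ₀ + z) u‖ := by
      rw [Finset.mul_sum]
    _ ≤ Real.exp (2 * b) * (C * (‖LL z‖ * ‖LL u‖)) := by
      have hC' : 0 ≤ C * (‖LL z‖ * ‖LL u‖) := by positivity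
      refine mul_le_mul_of_nonneg_left (abs_le_of_sq_le_sq ?_ hC' |> le_of_abs_le)
        (Real.exp_pos _).le
      refine (Finset.sum_mul_sq_le_sq_mul_sq _ _ _).trans ?_
      calc (∑ l, ‖M.dηL2 l (M.τ₀ + z)‖ ^ 2) * ∑ l, ‖M.Dη l (M.τ₀ + z) u‖ ^ 2
          ≤ (C * ‖LL z‖ ^ 2) * (C * ‖LL u‖ ^ 2) :=
            mul_le_mul (hW z hz) (hD _ hz u) (Finset.sum_nonneg fun _ _ => sq_nonneg _)
              ((Finset.sum_nonneg fun _ _ => sq_nonneg _).trans (hW z hz))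
        _ = _ := by ring
    _ = _ := by ring

/-- Every term is of second order: cumulants are quadratic in `LL`, and the mean functional at τ₀ +
z has norm of order ‖LL z‖ because it vanishes at τ₀. -/
lemma sum_abs_cgf_sub_le {z u : Param p H} (hz : M.τ₀ + z ∈ N) (hu : M.τ₀ + z + u ∈ N)
    {ψ : ∀ l, M.L2 l →L[ℝ] ℝ}
    (hψb : ∀ l f, |ψ l f| ≤ Real.exp (2 * b) * (‖M.dηL2 l (M.τ₀ + z)‖ * ‖f‖)) :
    ∑ l, |M.cgf l (M.τ₀ + z + u) - M.cgf l (M.τ₀ + z) - ψ l (M.Dη l (M.τ₀ + z) u)|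
      ≤ 3 * Real.exp (2 * b) * C * (‖LL (z + u)‖ ^ 2 + ‖LL z‖ ^ 2) := by
  have hcgf : ∀ d, M.τ₀ + d ∈ N → ∑ l, |M.cgf l (M.τ₀ + d)|
      ≤ Real.exp (2 * b) * C * ‖LL d‖ ^ 2 := by
    intro d hd
    calc ∑ l, |M.cgf l (M.τ₀ + d)| ≤ ∑ l, Real.exp (2 * b) * ‖M.dηL2 l (M.τ₀ + d)‖ ^ 2 := by
          refine Finset.sum_le_sum fun l _ => ?_
          rw [abs_of_nonneg]
          · exact cgf_upper hP hN₀ hV hb hd l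
          · refine le_trans ?_ (cgf_lower hP hN₀ hV hb hd l)
            positivity
      _ = Real.exp (2 * b) * ∑ l, ‖M.dηL2 l (M.τ₀ + d)‖ ^ 2 := by rw [Finset.mul_sum]
      _ ≤ Real.exp (2 * b) * (C * ‖LL d‖ ^ 2) :=
        mul_le_mul_of_nonneg_left (hW d hd) (Real.exp_pos _).le
      _ = _ := by ring
  have h1 := hcgf z hz
  have h2 := hcgf (z + u) (by rwa [← add_assoc])
  rw [← add_assoc] at h2
  have h3 := sum_abs_mean_le hC hW hD hz u hψb
  have h4 : ‖LL u‖ ≤ ‖LL (z + u)‖ + ‖LL z‖ := by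
    calc ‖LL u‖ = ‖LL (z + u) - LL z‖ := by rw [← map_sub]; simp
      _ ≤ _ := norm_sub_le _ _
  have h5 : ‖LL z‖ * ‖LL u‖ ≤ 2 * (‖LL (z + u)‖ ^ 2 + ‖LL z‖ ^ 2) := by
    nlinarith [norm_nonneg (LL z), sq_nonneg (‖LL (z + u)‖ - ‖LL z‖), sq_nonneg ‖LL (z + u)‖,
      mul_le_mul_of_nonneg_left h4 (norm_nonneg (LL z))]
  have hK : 0 ≤ Real.exp (2 * b) * C := by positivity
  have h6 := mul_le_mul_of_nonneg_left h5 hK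
  calc ∑ l, |M.cgf l (M.τ₀ + z + u) - M.cgf l (M.τ₀ + z) - ψ l (M.Dη l (M.τ₀ + z) u)|
      ≤ ∑ l, (|M.cgf l (M.τ₀ + z + u)| + |M.cgf l (M.τ₀ + z)|
        + |ψ l (M.Dη l (M.τ₀ + z) u)|) := by
        refine Finset.sum_le_sum fun l _ => ?_
        exact (abs_sub _ _).trans (add_le_add_left (abs_sub _ _) _)
    _ = ∑ l, |M.cgf l (M.τ₀ + z + u)| + ∑ l, |M.cgf l (M.τ₀ + z)|
        + ∑ l, |ψ l (M.Dη l (M.τ₀ + z) u)| := by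
      rw [Finset.sum_add_distrib, Finset.sum_add_distrib]
    _ ≤ _ := by linarith

/-- The lower bound of the linearization remainder at a parameter `τ₀ + z + u` by the positive part
of a function that depends on `u` in an affine way. -/
theorem exists_remainder_lower_bound (hNo : IsOpen N) (hNc : Convex ℝ N)
    (hη : ∀ l, ContDiffOn ℝ 3 (M.etaL2 l) N)
    (hηx : ∀ l x, ContDiffOn ℝ 3 (fun τ => M.η l τ x) N)
    (hXm : ∀ l i, Measurable (X l i)) (hXlaw : ∀ l i, μ.map (X l i) = M.P l M.τ₀)
    (hXi : iIndepFun (fun q : Fin m × ℕ => X q.1 q.2) μ)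
    {n : Fin m → ℕ} (hn : ∀ l, 0 < n l)
    (hconv : ∀ᵐ ω ∂μ, ConvexOn ℝ N (M.nll n (fun l i => X l i ω)))
    {c : ℝ} (hW' : ∀ d, M.τ₀ + d ∈ N → c * ‖LL d‖ ^ 2 ≤ ∑ l, ‖M.dηL2 l (M.τ₀ + d)‖ ^ 2)
    {z u : Param p H} (hz : M.τ₀ + z ∈ N) (hu : M.τ₀ + z + u ∈ N) {ψ : ∀ l, M.L2 l →L[ℝ] ℝ}
    (hψ : ∀ l f, ψ l f = ∫ x, (f : Lp ℝ 2 (M.P l M.τ₀)) x ∂(M.P l (M.τ₀ + z)))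
    (hψb : ∀ l f, |ψ l f| ≤ Real.exp (2 * b) * (‖M.dηL2 l (M.τ₀ + z)‖ * ‖f‖)) :
    ∃ A β : Fin m → ℝ,
      (∀ l, |β l| ≤ 6 * Real.exp (2 * b) * C * (‖LL (z + u)‖ ^ 2 + ‖LL z‖ ^ 2)) ∧
      (∀ l, ∀ᵐ x ∂(M.P l M.τ₀), A l + max (M.cgf l (M.τ₀ + z) + ψ l (M.Dη l (M.τ₀ + z) u)
          + ((-M.dηL2 l (M.τ₀ + z) - M.Dη l (M.τ₀ + z) u + M.Dη l M.τ₀ (z + u) : M.L2 l) :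
            Lp ℝ 2 (M.P l M.τ₀)) x + β l) 0
        ≤ M.cgf l (M.τ₀ + z + u) + ((-M.dηL2 l (M.τ₀ + z + u) + M.Dη l M.τ₀ (z + u) : M.L2 l) :
            Lp ℝ 2 (M.P l M.τ₀)) x) ∧
      Real.exp (-b) / 4 * c * ‖LL z‖ ^ 2 - Real.exp (2 * b) * C * (‖LL z‖ * ‖LL u‖)
        ≤ ∑ l, A l + (∑ l, (M.cgf l (M.τ₀ + z) + ψ l (M.Dη l (M.τ₀ + z) u)) + ∑ l, β l) := by
  choose ψ₀ hψ₀ hψ₀b using fun l => exists_mean hP hN₀ hV hb hN₀ l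
  have hz0 : M.τ₀ + (0 : Param p H) ∈ N := by rwa [add_zero]
  have hu0 : M.τ₀ + (z + u) ∈ N := by rwa [← add_assoc]
  obtain ⟨A, hA1, hA2, hA3⟩ := exists_samplewise_subgradient hP hN₀ hV hNo hNc hη hηx hXm hXlaw hXi
    hn hconv hN₀ hu0 hψ₀
  obtain ⟨t, ht1, ht2, ht3⟩ := exists_samplewise_subgradient hP hN₀ hV hNo hNc hη hηx hXm hXlaw hXi
    hn hconv hz hu hψ
  have hA4 := sum_abs_cgf_sub_le hP hN₀ hV hb hC hW hD (z := 0) (u := z + u) (ψ := ψ₀)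
    (by rwa [add_zero]) (by rwa [add_zero]) (by simpa using hψ₀b)
  have ht4 := sum_abs_cgf_sub_le hP hN₀ hV hb hC hW hD hz hu hψb
  simp only [add_zero, zero_add, map_zero, norm_zero] at hA4
  have hψ₀0 : ∀ l f, ψ₀ l f = 0 := fun l f => by
    have := hψ₀b l f
    rw [dηL2_τ₀, norm_zero, zero_mul, mul_zero] at this
    exact abs_nonpos_iff.1 this
  have hcgf0 : ∀ l, M.cgf l M.τ₀ = 0 := fun l => by
    have := hP l
    simp [cgf, dη_τ₀]
  simp only [hψ₀0, hcgf0, dηL2_τ₀, sub_zero, add_zero, ← add_assoc] at hA1 hA3 hA4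
  -- The subgradient at τ₀, where the cumulant and the mean functional vanish, bounds the remainder
  -- below by A. The one at τ₀ + z bounds it by t plus an affine function. The maximum of the two is
  -- A plus a positive part shifted by β = t - A.
  refine ⟨A, fun l => t l - A l, fun l => ?_, fun l => ?_, ?_⟩
  · have h1 := (hA3 l).trans hA4
    have h2 := (ht3 l).trans ht4
    have h3 := abs_sub (t l) (A l)
    have h4 : 0 ≤ Real.exp (2 * b) * C * ‖LL z‖ ^ 2 := by positivity
    simp only [ne_eq, OfNat.ofNat_ne_zero, not_false_eq_true, zero_pow, add_zero] at h1
    linarith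
  · have := hP l
    filter_upwards [hA1 l, ht1 l,
      coe_L20_add (-M.dηL2 l (M.τ₀ + z) - M.Dη l (M.τ₀ + z) u) (M.Dη l M.τ₀ (z + u)),
      coe_L20_sub (-M.dηL2 l (M.τ₀ + z)) (M.Dη l (M.τ₀ + z) u),
      coe_L20_neg (M.dηL2 l (M.τ₀ + z)),
      coe_L20_add (-M.dηL2 l (M.τ₀ + z + u)) (M.Dη l M.τ₀ (z + u)),
      coe_L20_add (-M.dηL2 l (M.τ₀ + z + u) + M.dηL2 l (M.τ₀ + z)) (M.Dη l (M.τ₀ + z) u),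
      coe_L20_add (-M.dηL2 l (M.τ₀ + z + u)) (M.dηL2 l (M.τ₀ + z))]
      with x h1 h2 h3 h4 h5 h6 h7 h8
    rw [h7, h8] at h2
    rw [h3, h4, h5, h6]
    rw [h6] at h1
    rw [add_comm, ← le_sub_iff_add_le]
    refine max_le ?_ ?_ <;> linarith
  · have h1 : Real.exp (-b) / 4 * c * ‖LL z‖ ^ 2 ≤ ∑ l, M.cgf l (M.τ₀ + z) := by
      calc Real.exp (-b) / 4 * c * ‖LL z‖ ^ 2 = Real.exp (-b) / 4 * (c * ‖LL z‖ ^ 2) := by ring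
        _ ≤ Real.exp (-b) / 4 * ∑ l, ‖M.dηL2 l (M.τ₀ + z)‖ ^ 2 :=
          mul_le_mul_of_nonneg_left (hW' z hz) (by positivity)
        _ = ∑ l, Real.exp (-b) / 4 * ‖M.dηL2 l (M.τ₀ + z)‖ ^ 2 := by rw [Finset.mul_sum]
        _ ≤ _ := Finset.sum_le_sum fun l _ => cgf_lower hP hN₀ hV hb hz l
    have h2 := sum_abs_mean_le hC hW hD hz u hψb
    have h3 : -∑ l, |ψ l (M.Dη l (M.τ₀ + z) u)| ≤ ∑ l, ψ l (M.Dη l (M.τ₀ + z) u) := by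
      rw [← Finset.sum_neg_distrib]
      exact Finset.sum_le_sum fun l _ => neg_abs_le _
    -- The sums of A and β add up to ∑ t ≥ 0, so the unknown constants cost nothing in the mean.
    rw [Finset.sum_sub_distrib, Finset.sum_add_distrib]
    linarith

end LowerBound

end Model

lemma coe_L20_affine {α : Type*} [MeasurableSpace α] {P : Measure α} [IsProbabilityMeasure P]
    {ι : Type*} [Fintype ι] (f : L20 P) (g : ι → L20 P) (w : ι → ℝ) :
    ∀ᵐ x ∂P, ((f + ∑ j, w j • g j : L20 P) : Lp ℝ 2 P) x
      = (f : Lp ℝ 2 P) x + ∑ j, w j * (g j : Lp ℝ 2 P) x := by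
  filter_upwards [coe_L20_add f (∑ j, w j • g j), coe_L20_sum Finset.univ (fun j => w j • g j),
    ae_all_iff.2 fun j => coe_L20_smul (w j) (g j)] with x h1 h2 h3
  rw [h1, h2]
  simp only [h3]

lemma sum_sq_le_sq_sum_abs {m : ℕ} (a : Fin m → ℝ) : ∑ l, a l ^ 2 ≤ (∑ l, |a l|) ^ 2 := by
  calc ∑ l, a l ^ 2 = ∑ l, |a l| ^ 2 := by simp
    _ ≤ _ := Finset.sum_sq_le_sq_sum_of_nonneg fun _ _ => abs_nonneg _

/-! ### Uniform control of the remainder in finitely many coordinates. -/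

namespace Model

section Uniform

variable {m p : ℕ} {H : Type*} [NormedAddCommGroup H] [InnerProductSpace ℝ H]
  {𝓧 : Fin m → Type*} [∀ l, MeasurableSpace (𝓧 l)]
  {M : Model m p H 𝓧} {N : Set (Param p H)}
  (hP : ∀ l, IsProbabilityMeasure (M.P l M.τ₀)) (hN₀ : M.τ₀ ∈ N) {C₃ C₄ : ℝ}
  (hV : VarianceEquivalent M N C₃ C₄)
  {Ω : Type*} [MeasurableSpace Ω] {μ : Measure Ω} {X : ∀ l, ℕ → Ω → 𝓧 l}
  {b : ℝ} (hb0 : 0 ≤ b)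
  (hb : ∀ l, ∀ τ ∈ N, ∀ᵐ x ∂(M.P l M.τ₀), |M.dη l τ x - M.cgf l τ| ≤ b)
  {E : Type*} [NormedAddCommGroup E] [NormedSpace ℝ E] {LL : Param p H →L[ℝ] E} {B : ℝ}
  (hB : 1 ≤ B) (hbB : Real.exp (2 * b) ≤ B)
  (hW : ∀ d, M.τ₀ + d ∈ N → ∑ l, ‖M.dηL2 l (M.τ₀ + d)‖ ^ 2 ≤ B * ‖LL d‖ ^ 2)
  (hD : ∀ τ ∈ N, ∀ u, ∑ l, ‖M.Dη l τ u‖ ^ 2 ≤ B * ‖LL u‖ ^ 2)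

set_option maxHeartbeats 2000000 in
include hP hN₀ hV hb0 hb hB hbB hW hD in
/-- The uniform lower bound for the linearization remainders. -/
theorem measure_exists_remainder_lt_le [IsProbabilityMeasure μ] (hNo : IsOpen N)
    (hNc : Convex ℝ N)
    (hη : ∀ l, ContDiffOn ℝ 3 (M.etaL2 l) N)
    (hηx : ∀ l x, ContDiffOn ℝ 3 (fun τ => M.η l τ x) N)
    (hXm : ∀ l i, Measurable (X l i)) (hXlaw : ∀ l i, μ.map (X l i) = M.P l M.τ₀)
    (hXi : iIndepFun (fun q : Fin m × ℕ => X q.1 q.2) μ)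
    {n : Fin m → ℕ} {K : ℕ} (hK : 0 < K) (hn : ∀ l, K ≤ n l)
    (hconv : ∀ᵐ ω ∂μ, ConvexOn ℝ N (M.nll n (fun l i => X l i ω)))
    {c : ℝ} (hc0 : 0 ≤ c) (hc1 : c ≤ 1)
    (hW' : ∀ d, M.τ₀ + d ∈ N → c * ‖LL d‖ ^ 2 ≤ ∑ l, ‖M.dηL2 l (M.τ₀ + d)‖ ^ 2)
    {ι : Type*} [Fintype ι] {e : ι → Param p H} {w : ι → ℝ} (hw : ∀ j, 1 ≤ w j)
    {D α ε : ℝ} (hwD : ∑ j, (w j)⁻¹ ≤ D) (hD1 : 1 ≤ D) (hα : 0 < α) (hα1 : α ≤ 1)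
    (hε : 0 < ε) (hε1 : ε ≤ 1) (hDN : D ≤ α ^ 2 * K * ε ^ 2)
    (he : ∀ v : ι → ℝ, ‖LL (∑ j, v j • e j)‖ ^ 2 ≤ B * ∑ j, v j ^ 2)
    {𝒯 : Set (ι → ℝ)} (h𝒯 : 𝒯.Countable) (h𝒯N : ∀ v ∈ 𝒯, M.τ₀ + ∑ j, v j • e j ∈ N)
    (h𝒯L : ∀ v ∈ 𝒯, ‖LL (∑ j, v j • e j)‖ ^ 2 ≤ 2 * ε ^ 2)
    (h𝒯w : ∀ v ∈ 𝒯, ∑ j, w j * v j ^ 2 ≤ 2 * B * ε ^ 2) :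
    μ {ω | ∃ v ∈ 𝒯, ∑ l, (n l : ℝ)⁻¹ * ∑ i ∈ Finset.range (n l),
        (M.cgf l (M.τ₀ + ∑ j, v j • e j) + ((-M.dηL2 l (M.τ₀ + ∑ j, v j • e j)
          + M.Dη l M.τ₀ (∑ j, v j • e j) : M.L2 l) : Lp ℝ 2 (M.P l M.τ₀)) (X l i ω))
        < Real.exp (-b) / 8 * c * ‖LL (∑ j, v j • e j)‖ ^ 2
          - (783 * B ^ 6 + 9 * (m + 1) * (136 * B ^ 5) ^ 2) * α * ε ^ 2}
      ≤ 2 * ENNReal.ofReal (Real.exp (8 * (136 * B ^ 5) / α ^ 4 * D - α ^ 2 * K * ε ^ 2)) := by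
  have hB0 : 0 < B := by linarith
  have hB5 : (1 : ℝ) ≤ B ^ 5 := one_le_pow₀ hB
  set s : (ι → ℝ) → Param p H := fun v => ∑ j, v j • e j with hs
  have hssub : ∀ v z : ι → ℝ, s v - s z = ∑ j, (v j - z j) • e j := fun v z => by
    simp only [hs, sub_smul, Finset.sum_sub_distrib]
  have hε2 : ε ^ 2 ≤ 1 := pow_le_one₀ hε.le hε1
  have hLs : ∀ v ∈ 𝒯, ‖LL (s v)‖ ≤ 3 / 2 * ε := fun v hv => by
    refine abs_le_of_sq_le_sq ?_ (by positivity) |> le_of_abs_le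
    nlinarith [h𝒯L v hv]
  have hexists : ∀ z ∈ 𝒯, ∃ ψ : ∀ l, M.L2 l →L[ℝ] ℝ,
      (∀ l f, ψ l f = ∫ x, (f : Lp ℝ 2 (M.P l M.τ₀)) x ∂(M.P l (M.τ₀ + s z))) ∧
      ∀ l f, |ψ l f| ≤ Real.exp (2 * b) * (‖M.dηL2 l (M.τ₀ + s z)‖ * ‖f‖) := by
    intro z hz
    choose ψ h1 h2 using fun l => exists_mean hP hN₀ hV hb (h𝒯N z hz) l
    exact ⟨ψ, h1, h2⟩
  choose! ψ hψ hψb using hexists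
  -- The minorant built at a centre z is affine in v - z: y is the centred part of its intercept, g
  -- that of its slopes, Y the centred part at v, and κ its mean.
  set y : (ι → ℝ) → ∀ l, M.L2 l := fun z l => -M.dηL2 l (M.τ₀ + s z) + M.Dη l M.τ₀ (s z) with hy
  set g : (ι → ℝ) → ∀ l, ι → M.L2 l := fun z l j =>
    -M.Dη l (M.τ₀ + s z) (e j) + M.Dη l M.τ₀ (e j) with hg
  set Y : (ι → ℝ) → (ι → ℝ) → ∀ l, M.L2 l := fun z v l =>
    -M.dηL2 l (M.τ₀ + s z) - M.Dη l (M.τ₀ + s z) (s v - s z) + M.Dη l M.τ₀ (s v) with hY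
  set κ : (ι → ℝ) → (ι → ℝ) → Fin m → ℝ := fun z v l =>
    M.cgf l (M.τ₀ + s z) + ψ z l (M.Dη l (M.τ₀ + s z) (s v - s z)) with hκ
  have hYy : ∀ z v l, Y z v l = y z l + ∑ j, (v j - z j) • g z l j := by
    intro z v l
    have h1 : s v = s z + ∑ j, (v j - z j) • e j := by rw [← hssub]; abel
    have h2 : ∑ j, (v j - z j) • g z l j = -M.Dη l (M.τ₀ + s z) (s v - s z)
        + M.Dη l M.τ₀ (∑ j, (v j - z j) • e j) := by
      rw [hssub, map_sum, map_sum, ← Finset.sum_neg_distrib, ← Finset.sum_add_distrib]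
      refine Finset.sum_congr rfl fun j _ => ?_
      rw [hg, map_smul, map_smul, smul_add, smul_neg]
    rw [h2, hY, hy]
    simp only
    nth_rewrite 2 [h1]
    rw [map_add]
    abel
  have haff : ∀ z v l, ∀ᵐ x ∂(M.P l M.τ₀),
      (M.cgf l (M.τ₀ + s z) + (y z l : Lp ℝ 2 (M.P l M.τ₀)) x)
        + ∑ j, (v j - z j) * (ψ z l (M.Dη l (M.τ₀ + s z) (e j))
          + (g z l j : Lp ℝ 2 (M.P l M.τ₀)) x)
      = κ z v l + (Y z v l : Lp ℝ 2 (M.P l M.τ₀)) x := by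
    intro z v l
    have := hP l
    filter_upwards [coe_L20_affine (y z l) (g z l) (fun j => v j - z j)] with x hx
    rw [hYy, hx, hκ]
    simp only [mul_add, Finset.sum_add_distrib]
    have h1 : ψ z l (M.Dη l (M.τ₀ + s z) (s v - s z))
        = ∑ j, (v j - z j) * ψ z l (M.Dη l (M.τ₀ + s z) (e j)) := by
      rw [hssub, map_sum, map_sum]
      simp only [map_smul, smul_eq_mul]
    rw [h1]
    ring
  have hψD : ∀ z ∈ 𝒯, ∀ u, ∑ l, |ψ z l (M.Dη l (M.τ₀ + s z) u)|
      ≤ B ^ 2 * (‖LL (s z)‖ * ‖LL u‖) := by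
    intro z hz u
    refine (sum_abs_mean_le hB0.le hW hD (h𝒯N z hz) u (hψb z hz)).trans ?_
    refine mul_le_mul_of_nonneg_right ?_ (by positivity)
    nlinarith
  have hcgf : ∀ z ∈ 𝒯, ∑ l, |M.cgf l (M.τ₀ + s z)| ≤ B ^ 2 * ‖LL (s z)‖ ^ 2 := by
    intro z hz
    calc ∑ l, |M.cgf l (M.τ₀ + s z)| ≤ ∑ l, B * ‖M.dηL2 l (M.τ₀ + s z)‖ ^ 2 := by
          refine Finset.sum_le_sum fun l _ => ?_
          rw [abs_of_nonneg]
          · exact (cgf_upper hP hN₀ hV hb (h𝒯N z hz) l).trans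
              (mul_le_mul_of_nonneg_right hbB (sq_nonneg _))
          · refine le_trans ?_ (cgf_lower hP hN₀ hV hb (h𝒯N z hz) l)
            positivity
      _ = B * ∑ l, ‖M.dηL2 l (M.τ₀ + s z)‖ ^ 2 := by rw [Finset.mul_sum]
      _ ≤ B * (B * ‖LL (s z)‖ ^ 2) := mul_le_mul_of_nonneg_left (hW _ (h𝒯N z hz)) hB0.le
      _ = _ := by ring
  have hLe : ∀ j, ‖LL (e j)‖ ^ 2 ≤ B := by
    classical
    intro j
    have h1 := he (Pi.single j 1)
    simpa [Pi.single_apply, ite_smul] using h1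
  have hLu : ∀ z ∈ 𝒯, ∀ v ∈ 𝒯, ‖LL (s v - s z)‖ ≤ 3 * ε := fun z hz v hv => by
    rw [map_sub]
    exact (norm_sub_le _ _).trans (by linarith [hLs z hz, hLs v hv])
  have hmain := measure_exists_empirical_lt_le (μ := μ) hXm hXi hXlaw hK hn h𝒯
    (a := fun z l x => M.cgf l (M.τ₀ + s z) + (y z l : Lp ℝ 2 (M.P l M.τ₀)) x)
    (ℓ := fun z l j x => ψ z l (M.Dη l (M.τ₀ + s z) (e j))
      + (g z l j : Lp ℝ 2 (M.P l M.τ₀)) x)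
    (fun z l => (measurable_coe_L20 _).const_add _)
    (fun z l j => (measurable_coe_L20 _).const_add _)
    (fun z _ l => memLp_const_add_L20 _ _) (fun z _ l j => memLp_const_add_L20 _ _) hw
    (C := 136 * B ^ 5) hwD hD1 (by linarith) hα hα1 hε hε1 hDN ?_ ?_ ?_
    (R := fun v l x => M.cgf l (M.τ₀ + s v) + ((-M.dηL2 l (M.τ₀ + s v) + M.Dη l M.τ₀ (s v) :
      M.L2 l) : Lp ℝ 2 (M.P l M.τ₀)) x)
    (Q := fun v => Real.exp (-b) / 8 * c * ‖LL (s v)‖ ^ 2 - 783 * B ^ 6 * α * ε ^ 2) ?_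
  · refine le_trans (measure_mono ?_) hmain
    rintro ω ⟨v, hv, hlt⟩
    exact ⟨v, hv, hlt.trans_le (by linarith)⟩
  · intro z hz j
    simp only [integral_sq_const_add_L20]
    rw [Finset.sum_add_distrib]
    have h1 : ∑ l, ψ z l (M.Dη l (M.τ₀ + s z) (e j)) ^ 2 ≤ (B ^ 2 * (‖LL (s z)‖ * ‖LL (e j)‖)) ^ 2 :=
      (sum_sq_le_sq_sum_abs _).trans (pow_le_pow_left₀ (Finset.sum_nonneg fun _ _ => abs_nonneg _)
        (hψD z hz (e j)) 2)
    have h2 : ∑ l, ‖g z l j‖ ^ 2 ≤ 4 * (B * B) := by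
      calc ∑ l, ‖g z l j‖ ^ 2
          ≤ ∑ l, (2 * ‖M.Dη l (M.τ₀ + s z) (e j)‖ ^ 2 + 2 * ‖M.Dη l M.τ₀ (e j)‖ ^ 2) := by
            refine Finset.sum_le_sum fun l _ => ?_
            have h3 := norm_add_le (-M.Dη l (M.τ₀ + s z) (e j)) (M.Dη l M.τ₀ (e j))
            rw [norm_neg] at h3
            have h4 := pow_le_pow_left₀ (norm_nonneg _) h3 2
            nlinarith [sq_nonneg (‖M.Dη l (M.τ₀ + s z) (e j)‖ - ‖M.Dη l M.τ₀ (e j)‖)]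
        _ = 2 * ∑ l, ‖M.Dη l (M.τ₀ + s z) (e j)‖ ^ 2 + 2 * ∑ l, ‖M.Dη l M.τ₀ (e j)‖ ^ 2 := by
          rw [Finset.sum_add_distrib, Finset.mul_sum, Finset.mul_sum]
        _ ≤ 2 * (B * ‖LL (e j)‖ ^ 2) + 2 * (B * ‖LL (e j)‖ ^ 2) := by
          linarith [hD _ (h𝒯N z hz) (e j), hD _ hN₀ (e j)]
        _ ≤ _ := by nlinarith [hLe j]
    have h5 : (B ^ 2 * (‖LL (s z)‖ * ‖LL (e j)‖)) ^ 2 ≤ 2 * B ^ 5 := by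
      calc (B ^ 2 * (‖LL (s z)‖ * ‖LL (e j)‖)) ^ 2
          = B ^ 4 * (‖LL (s z)‖ ^ 2 * ‖LL (e j)‖ ^ 2) := by ring
        _ ≤ B ^ 4 * (2 * B) := by
          refine mul_le_mul_of_nonneg_left ?_ (by positivity)
          exact mul_le_mul ((h𝒯L z hz).trans (by linarith)) (hLe j) (sq_nonneg _) (by norm_num)
        _ = _ := by ring
    have h6 : B * B ≤ B ^ 5 := by
      calc B * B = B ^ 2 := by ring
        _ ≤ B ^ 5 := pow_le_pow_right₀ hB (by norm_num)
    linarith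
  · intro v hv
    refine (h𝒯w v hv).trans ?_
    refine mul_le_mul_of_nonneg_right ?_ (sq_nonneg _)
    have : B ≤ B ^ 5 := le_self_pow₀ hB (by norm_num)
    linarith
  · intro z hz v hv
    have h1 : ∀ l, ∫ x, ((M.cgf l (M.τ₀ + s z) + (y z l : Lp ℝ 2 (M.P l M.τ₀)) x)
        + ∑ j, (v j - z j) * (ψ z l (M.Dη l (M.τ₀ + s z) (e j))
          + (g z l j : Lp ℝ 2 (M.P l M.τ₀)) x)) ^ 2 ∂(M.P l M.τ₀)
        = κ z v l ^ 2 + ‖Y z v l‖ ^ 2 := by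
      intro l
      have := hP l
      rw [← integral_sq_const_add_L20]
      refine integral_congr_ae ?_
      filter_upwards [haff z v l] with x hx
      rw [hx]
    simp only [h1]
    rw [Finset.sum_add_distrib]
    have h2 : ∑ l, |κ z v l| ≤ 10 * B ^ 2 * ε ^ 2 := by
      calc ∑ l, |κ z v l| ≤ ∑ l, (|M.cgf l (M.τ₀ + s z)|
            + |ψ z l (M.Dη l (M.τ₀ + s z) (s v - s z))|) :=
            Finset.sum_le_sum fun l _ => abs_add_le _ _
        _ ≤ B ^ 2 * ‖LL (s z)‖ ^ 2 + B ^ 2 * (‖LL (s z)‖ * ‖LL (s v - s z)‖) := by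
          rw [Finset.sum_add_distrib]
          exact add_le_add (hcgf z hz) (hψD z hz _)
        _ ≤ B ^ 2 * (2 * ε ^ 2) + B ^ 2 * (3 / 2 * ε * (3 * ε)) := by
          have h3 := h𝒯L z hz
          have h4 := hLs z hz
          have h5 := hLu z hz v hv
          gcongr
        _ ≤ _ := by nlinarith [sq_nonneg (B * ε)]
    have h3 : ∑ l, κ z v l ^ 2 ≤ 100 * B ^ 5 * ε ^ 2 := by
      refine (sum_sq_le_sq_sum_abs _).trans ((pow_le_pow_left₀
        (Finset.sum_nonneg fun _ _ => abs_nonneg _) h2 2).trans ?_)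
      calc (10 * B ^ 2 * ε ^ 2) ^ 2 = 100 * B ^ 4 * (ε ^ 2 * ε ^ 2) := by ring
        _ ≤ 100 * B ^ 5 * (1 * ε ^ 2) := by
          have : B ^ 4 ≤ B ^ 5 := pow_le_pow_right₀ hB (by norm_num)
          gcongr
        _ = _ := by ring
    have h4 : ∑ l, ‖Y z v l‖ ^ 2 ≤ 36 * B ^ 5 * ε ^ 2 := by
      calc ∑ l, ‖Y z v l‖ ^ 2
          ≤ ∑ l, (3 * ‖M.dηL2 l (M.τ₀ + s z)‖ ^ 2 + 3 * ‖M.Dη l (M.τ₀ + s z) (s v - s z)‖ ^ 2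
              + 3 * ‖M.Dη l M.τ₀ (s v)‖ ^ 2) := by
            refine Finset.sum_le_sum fun l _ => ?_
            have h5 : ‖Y z v l‖ ≤ ‖M.dηL2 l (M.τ₀ + s z)‖
                + ‖M.Dη l (M.τ₀ + s z) (s v - s z)‖ + ‖M.Dη l M.τ₀ (s v)‖ := by
              refine (norm_add_le _ _).trans (add_le_add_left ?_ _)
              refine (norm_sub_le _ _).trans ?_
              rw [norm_neg]
            have h6 := pow_le_pow_left₀ (norm_nonneg _) h5 2
            nlinarith [sq_nonneg (‖M.dηL2 l (M.τ₀ + s z)‖ - ‖M.Dη l (M.τ₀ + s z) (s v - s z)‖),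
              sq_nonneg (‖M.dηL2 l (M.τ₀ + s z)‖ - ‖M.Dη l M.τ₀ (s v)‖),
              sq_nonneg (‖M.Dη l (M.τ₀ + s z) (s v - s z)‖ - ‖M.Dη l M.τ₀ (s v)‖)]
        _ = 3 * ∑ l, ‖M.dηL2 l (M.τ₀ + s z)‖ ^ 2
            + 3 * ∑ l, ‖M.Dη l (M.τ₀ + s z) (s v - s z)‖ ^ 2
            + 3 * ∑ l, ‖M.Dη l M.τ₀ (s v)‖ ^ 2 := by
          simp only [Finset.sum_add_distrib, Finset.mul_sum]
        _ ≤ 3 * (B * ‖LL (s z)‖ ^ 2) + 3 * (B * ‖LL (s v - s z)‖ ^ 2)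
            + 3 * (B * ‖LL (s v)‖ ^ 2) := by
          linarith [hW _ (h𝒯N z hz), hD _ (h𝒯N z hz) (s v - s z), hD _ hN₀ (s v)]
        _ ≤ 3 * (B * (2 * ε ^ 2)) + 3 * (B * (8 * ε ^ 2)) + 3 * (B * (2 * ε ^ 2)) := by
          have h5 := h𝒯L z hz
          have h6 := h𝒯L v hv
          have h7 : ‖LL (s v - s z)‖ ^ 2 ≤ 8 * ε ^ 2 := by
            have h8 := pow_le_pow_left₀ (norm_nonneg _) (norm_sub_le (LL (s v)) (LL (s z))) 2
            rw [map_sub]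
            nlinarith [sq_nonneg (‖LL (s v)‖ - ‖LL (s z)‖)]
          gcongr
        _ = 36 * B * ε ^ 2 := by ring
        _ ≤ _ := by
          have : B ≤ B ^ 5 := le_self_pow₀ hB (by norm_num)
          gcongr
    linarith
  · intro z hz v hv hvz
    have e1 : M.τ₀ + s z + (s v - s z) = M.τ₀ + s v := by abel
    have e2 : s z + (s v - s z) = s v := by abel
    obtain ⟨A, β, hβ, hAβ, hQ⟩ := exists_remainder_lower_bound hP hN₀ hV hb hB0.le hW hD hNo hNc hη
      hηx hXm hXlaw hXi (fun l => hK.trans_le (hn l)) hconv hW' (z := s z) (u := s v - s z) (h𝒯N z hz)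
      (by rw [e1]; exact h𝒯N v hv) (hψ z hz) (hψb z hz)
    rw [e2] at hβ
    simp only [e1, e2] at hAβ
    refine ⟨A, β, fun l => (hβ l).trans ?_, fun l => ?_, ?_⟩
    · calc 6 * Real.exp (2 * b) * B * (‖LL (s v)‖ ^ 2 + ‖LL (s z)‖ ^ 2)
          ≤ 6 * B * B * (2 * ε ^ 2 + 2 * ε ^ 2) := by
            have h5 := h𝒯L z hz
            have h6 := h𝒯L v hv
            gcongr
        _ = 24 * (B ^ 2) * ε ^ 2 := by ring
        _ ≤ 136 * B ^ 5 * ε ^ 2 := by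
          have : B ^ 2 ≤ B ^ 5 := pow_le_pow_right₀ hB (by norm_num)
          refine mul_le_mul_of_nonneg_right ?_ (sq_nonneg _)
          nlinarith
    · filter_upwards [hAβ l, haff z v l] with x h1 h2
      rw [h2]
      exact h1
    · have h1 : ∀ l, ∫ x, ((M.cgf l (M.τ₀ + s z) + (y z l : Lp ℝ 2 (M.P l M.τ₀)) x)
        + ∑ j, (v j - z j) * (ψ z l (M.Dη l (M.τ₀ + s z) (e j))
          + (g z l j : Lp ℝ 2 (M.P l M.τ₀)) x)) ∂(M.P l M.τ₀) = κ z v l := by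
        intro l
        have := hP l
        rw [← integral_const_add_L20 (κ z v l) (Y z v l)]
        exact integral_congr_ae (haff z v l)
      simp only [h1]
      refine le_trans ?_ hQ
      -- Within a cell v - z has size O(αε), so linearizing at z costs O(αε²). Passing from ‖LL z‖²
      -- to ‖LL v‖² halves the quadratic coefficient, whence exp(-b)/8 in place of exp(-b)/4.
      have h2 : ‖LL (s v - s z)‖ ^ 2 ≤ 680 * B ^ 6 * α ^ 2 * ε ^ 2 := by
        rw [hssub]
        refine (he _).trans ?_
        calc B * ∑ j, (v j - z j) ^ 2 ≤ B * (5 * (136 * B ^ 5) * α ^ 2 * ε ^ 2) := by gcongr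
          _ = _ := by ring
      have h3 : ‖LL (s v - s z)‖ ≤ 27 * B ^ 3 * α * ε := by
        refine abs_le_of_sq_le_sq (h2.trans ?_) (by positivity) |> le_of_abs_le
        have : 0 ≤ B ^ 6 * α ^ 2 * ε ^ 2 := by positivity
        linarith
      have h4 : ‖LL (s v)‖ ^ 2 ≤ 2 * ‖LL (s z)‖ ^ 2 + 2 * ‖LL (s v - s z)‖ ^ 2 := by
        have h5 := norm_add_le (LL (s z)) (LL (s v - s z))
        rw [← map_add, e2] at h5
        have h6 := pow_le_pow_left₀ (norm_nonneg _) h5 2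
        nlinarith [sq_nonneg (‖LL (s z)‖ - ‖LL (s v - s z)‖)]
      have hk : 0 ≤ Real.exp (-b) / 8 * c := by positivity
      have hk1 : Real.exp (-b) / 8 * c ≤ 1 / 8 := by
        have : Real.exp (-b) ≤ 1 := Real.exp_le_one_iff.2 (by linarith)
        have := Real.exp_pos (-b)
        nlinarith
      have h5 : Real.exp (2 * b) * B * (‖LL (s z)‖ * ‖LL (s v - s z)‖)
          ≤ B ^ 2 * (3 / 2 * ε * (27 * B ^ 3 * α * ε)) := by
        have h6 := hLs z hz
        have h7 : Real.exp (2 * b) * B ≤ B ^ 2 := by nlinarith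
        gcongr
      have h6 : Real.exp (-b) / 8 * c * (2 * ‖LL (s v - s z)‖ ^ 2)
          ≤ 1 / 8 * (2 * (680 * B ^ 6 * α ^ 2 * ε ^ 2)) := by
        gcongr
      have h7 : B ^ 6 * α ^ 2 * ε ^ 2 ≤ B ^ 6 * α * ε ^ 2 := by
        have : α ^ 2 ≤ α := by nlinarith
        gcongr
      have h8 : B ^ 5 * α * ε ^ 2 ≤ B ^ 6 * α * ε ^ 2 := by
        have : B ^ 5 ≤ B ^ 6 := pow_le_pow_right₀ hB (by norm_num)
        gcongr
      have h9 := mul_le_mul_of_nonneg_left h4 hk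
      have h10 : 0 ≤ B ^ 6 * α * ε ^ 2 := by positivity
      linarith

end Uniform

end Model

/-! ### Second moments of the score. -/

section Score

variable {m : ℕ} {𝓧 : Fin m → Type*} [∀ l, MeasurableSpace (𝓧 l)]
  {Ω : Type*} [MeasurableSpace Ω] {μ : Measure Ω} [IsProbabilityMeasure μ]
  {P : ∀ l, Measure (𝓧 l)} [∀ l, IsProbabilityMeasure (P l)] {X : ∀ l, ℕ → Ω → 𝓧 l}
  (hXm : ∀ l i, Measurable (X l i)) (hXlaw : ∀ l i, μ.map (X l i) = P l)

include hXm hXlaw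

omit [IsProbabilityMeasure μ] in
lemma memLp_coe_L20_comp {l : Fin m} (f : L20 (P l)) (i : ℕ) :
    MemLp (fun ω => (f : Lp ℝ 2 (P l)) (X l i ω)) 2 μ := by
  have h : MemLp (fun x => (f : Lp ℝ 2 (P l)) x) 2 (μ.map (X l i)) := by
    rw [hXlaw]
    exact memLp_coe_L20 f
  exact h.comp_of_map (hXm l i).aemeasurable

omit [IsProbabilityMeasure μ] [∀ l, IsProbabilityMeasure (P l)] in
lemma integral_comp_of_map_eq {l : Fin m} {g : 𝓧 l → ℝ} (hg : Measurable g) (i : ℕ) :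
    ∫ ω, g (X l i ω) ∂μ = ∫ x, g x ∂(P l) := by
  rw [← hXlaw l i, integral_map (hXm l i).aemeasurable hg.aestronglyMeasurable]

/-- The second moment of a sum of sample means of centered functions. -/
lemma integral_sq_sum_sample_means (hXi : iIndepFun (fun q : Fin m × ℕ => X q.1 q.2) μ)
    {n : Fin m → ℕ} (hn : ∀ l, 0 < n l) (f : ∀ l, L20 (P l)) :
    MemLp (fun ω => ∑ l, (n l : ℝ)⁻¹ * ∑ i ∈ Finset.range (n l), (f l : Lp ℝ 2 (P l)) (X l i ω)) 2 μ ∧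
    ∫ ω, (∑ l, (n l : ℝ)⁻¹ * ∑ i ∈ Finset.range (n l), (f l : Lp ℝ 2 (P l)) (X l i ω)) ^ 2 ∂μ
      = ∑ l, (n l : ℝ)⁻¹ * ‖f l‖ ^ 2 := by
  set W : (Σ l, Fin (n l)) → Ω → ℝ := fun q ω =>
    (n q.1 : ℝ)⁻¹ * (f q.1 : Lp ℝ 2 (P q.1)) (X q.1 q.2 ω) with hW
  have hsum : (fun ω => ∑ l, (n l : ℝ)⁻¹ * ∑ i ∈ Finset.range (n l),
      (f l : Lp ℝ 2 (P l)) (X l i ω)) = ∑ q, W q := by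
    ext ω
    rw [Finset.sum_apply, Fintype.sum_sigma]
    refine Finset.sum_congr rfl fun l _ => ?_
    rw [Finset.sum_range, Finset.mul_sum]
  have hWm : ∀ q, MemLp (W q) 2 μ := fun q =>
    (memLp_coe_L20_comp hXm hXlaw (f q.1) q.2).const_mul _
  have hW0 : ∀ q, ∫ ω, W q ω ∂μ = 0 := fun q => by
    simp only [hW]
    rw [integral_const_mul, integral_comp_of_map_eq hXm hXlaw (measurable_coe_L20 (f q.1)),
      integral_L20, mul_zero]
  have hWv : ∀ q, variance (W q) μ = (n q.1 : ℝ)⁻¹ ^ 2 * ‖f q.1‖ ^ 2 := fun q => by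
    rw [variance_of_integral_eq_zero (hWm q).1.aemeasurable (hW0 q)]
    simp only [hW, mul_pow]
    rw [integral_const_mul, norm_sq_L20]
    congr 1
    exact integral_comp_of_map_eq hXm hXlaw ((measurable_coe_L20 (f q.1)).pow_const 2) q.2
  have hind : Set.Pairwise ↑(Finset.univ : Finset (Σ l, Fin (n l)))
      fun q q' => W q ⟂ᵢ[μ] W q' := by
    intro q _ q' _ hqq
    have hne : ((q.1, (q.2 : ℕ)) : Fin m × ℕ) ≠ (q'.1, (q'.2 : ℕ)) := by
      intro h
      apply hqq
      obtain ⟨l, i⟩ := q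
      obtain ⟨l', i'⟩ := q'
      simp only [Prod.mk.injEq] at h
      obtain ⟨rfl, h2⟩ := h
      congr 1
      exact Fin.ext h2
    have h1 := hXi.indepFun hne
    exact h1.comp (φ := fun x => (n q.1 : ℝ)⁻¹ * (f q.1 : Lp ℝ 2 (P q.1)) x)
      (ψ := fun x => (n q'.1 : ℝ)⁻¹ * (f q'.1 : Lp ℝ 2 (P q'.1)) x)
      ((measurable_coe_L20 (f q.1)).const_mul _) ((measurable_coe_L20 (f q'.1)).const_mul _)
  have hmem : MemLp (∑ q, W q) 2 μ := memLp_finsetSum' _ fun q _ => hWm q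
  refine ⟨hsum ▸ hmem, ?_⟩
  have h1 : ∫ ω, (∑ q, W q) ω ∂μ = 0 := by
    simp only [Finset.sum_apply]
    rw [integral_finsetSum _ fun q _ => (hWm q).integrable one_le_two]
    simp [hW0]
  have h2 := IndepFun.variance_sum (fun q _ => hWm q) hind
  rw [variance_of_integral_eq_zero hmem.1.aemeasurable h1] at h2
  have h3 : ∀ ω, (∑ l, (n l : ℝ)⁻¹ * ∑ i ∈ Finset.range (n l),
      (f l : Lp ℝ 2 (P l)) (X l i ω)) = (∑ q, W q) ω := fun ω => congrFun hsum ω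
  simp only [h3]
  rw [h2, Fintype.sum_sigma]
  refine Finset.sum_congr rfl fun l _ => ?_
  have hnl : (n l : ℝ) ≠ 0 := by exact_mod_cast (hn l).ne'
  simp only [hWv]
  change ∑ _x : Fin (n l), (n l : ℝ)⁻¹ ^ 2 * ‖f l‖ ^ 2 = _
  simp only [Finset.sum_const, Finset.card_univ, Fintype.card_fin, nsmul_eq_mul]
  field_simp

/-- A tail bound for a weighted sum of squares of sample means of centered functions. -/
lemma measure_lt_sum_sq_le (hXi : iIndepFun (fun q : Fin m × ℕ => X q.1 q.2) μ)
    {n : Fin m → ℕ} {K : ℕ} (hK : 0 < K) (hn : ∀ l, K ≤ n l) {ι : Type*} [Fintype ι]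
    (f : ∀ l, ι → L20 (P l)) {w : ι → ℝ} (hw : ∀ j, 1 ≤ w j) {D B A : ℝ}
    (hwD : ∑ j, (w j)⁻¹ ≤ D) (hD : 0 < D) (hB : 0 ≤ B) (hA : 0 < A)
    (hf : ∀ j, ∑ l, ‖f l j‖ ^ 2 ≤ B) :
    μ {ω | A * (D / K) < ∑ j, (w j)⁻¹ * (∑ l, (n l : ℝ)⁻¹ *
      ∑ i ∈ Finset.range (n l), (f l j : Lp ℝ 2 (P l)) (X l i ω)) ^ 2} ≤ ENNReal.ofReal (B / A) := by
  have hK0 : (0 : ℝ) < K := by exact_mod_cast hK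
  have hw0 : ∀ j, 0 < (w j)⁻¹ := fun j => inv_pos.2 (by linarith [hw j])
  have hY := fun j => integral_sq_sum_sample_means hXm hXlaw hXi
    (fun l => hK.trans_le (hn l)) (fun l => f l j)
  set Y : ι → Ω → ℝ := fun j ω => ∑ l, (n l : ℝ)⁻¹ *
      ∑ i ∈ Finset.range (n l), (f l j : Lp ℝ 2 (P l)) (X l i ω) with hYd
  have hint : Integrable (fun ω => ∑ j, (w j)⁻¹ * Y j ω ^ 2) μ :=
    integrable_finsetSum _ fun j _ => ((hY j).1.integrable_sq).const_mul _
  have hle : ∫ ω, ∑ j, (w j)⁻¹ * Y j ω ^ 2 ∂μ ≤ B * (D / K) := by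
    rw [integral_finsetSum _ fun j _ => ((hY j).1.integrable_sq).const_mul _]
    calc ∑ j, ∫ ω, (w j)⁻¹ * Y j ω ^ 2 ∂μ
        ≤ ∑ j, (w j)⁻¹ * ((K : ℝ)⁻¹ * B) := by
          refine Finset.sum_le_sum fun j _ => ?_
          rw [integral_const_mul]
          refine mul_le_mul_of_nonneg_left ?_ (hw0 j).le
          refine (hY j).2.le.trans ?_
          calc ∑ l, (n l : ℝ)⁻¹ * ‖f l j‖ ^ 2 ≤ ∑ l, (K : ℝ)⁻¹ * ‖f l j‖ ^ 2 := by
                refine Finset.sum_le_sum fun l _ => ?_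
                have : (K : ℝ) ≤ n l := by exact_mod_cast hn l
                gcongr
            _ = (K : ℝ)⁻¹ * ∑ l, ‖f l j‖ ^ 2 := by rw [Finset.mul_sum]
            _ ≤ _ := by gcongr; exact hf j
      _ = (∑ j, (w j)⁻¹) * ((K : ℝ)⁻¹ * B) := by rw [Finset.sum_mul]
      _ ≤ D * ((K : ℝ)⁻¹ * B) := by gcongr
      _ = _ := by ring
  have hDK : 0 < D / K := by positivity
  have h1 := mul_meas_ge_le_integral_of_nonneg (μ := μ) (f := fun ω => ∑ j, (w j)⁻¹ * Y j ω ^ 2)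
    (ae_of_all _ fun ω => Finset.sum_nonneg fun j _ => mul_nonneg (hw0 j).le (sq_nonneg _)) hint
    (A * (D / K))
  have h2 : μ.real {ω | A * (D / K) ≤ ∑ j, (w j)⁻¹ * Y j ω ^ 2} ≤ B / A := by
    rw [le_div_iff₀ hA]
    refine le_of_mul_le_mul_right ?_ hDK
    calc μ.real {ω | A * (D / K) ≤ ∑ j, (w j)⁻¹ * Y j ω ^ 2} * A * (D / K)
        = A * (D / K) * μ.real {ω | A * (D / K) ≤ ∑ j, (w j)⁻¹ * Y j ω ^ 2} := by ring
      _ ≤ _ := h1.trans hle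
  calc μ {ω | A * (D / K) < ∑ j, (w j)⁻¹ * Y j ω ^ 2}
      ≤ μ {ω | A * (D / K) ≤ ∑ j, (w j)⁻¹ * Y j ω ^ 2} := by
        refine measure_mono ?_
        intro ω hω
        simp only [Set.mem_ofPred_eq] at hω ⊢
        exact hω.le
    _ = ENNReal.ofReal (μ.real {ω | A * (D / K) ≤ ∑ j, (w j)⁻¹ * Y j ω ^ 2}) :=
      (ofReal_measureReal).symm
    _ ≤ _ := ENNReal.ofReal_le_ofReal h2

end Score

/-! ### Increments of the likelihood at the true parameter. -/

namespace Model

section Uniform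

variable {m p : ℕ} {H : Type*} [NormedAddCommGroup H] [InnerProductSpace ℝ H]
  {𝓧 : Fin m → Type*} [∀ l, MeasurableSpace (𝓧 l)]
  {M : Model m p H 𝓧} {N : Set (Param p H)}
  (hP : ∀ l, IsProbabilityMeasure (M.P l M.τ₀)) (hN₀ : M.τ₀ ∈ N) {C₃ C₄ : ℝ}
  (hV : VarianceEquivalent M N C₃ C₄)
  {Ω : Type*} [MeasurableSpace Ω] {μ : Measure Ω} {X : ∀ l, ℕ → Ω → 𝓧 l}
  {b : ℝ} (hb0 : 0 ≤ b)
  (hb : ∀ l, ∀ τ ∈ N, ∀ᵐ x ∂(M.P l M.τ₀), |M.dη l τ x - M.cgf l τ| ≤ b)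
  {E : Type*} [NormedAddCommGroup E] [NormedSpace ℝ E] {LL : Param p H →L[ℝ] E} {B : ℝ}
  (hB : 1 ≤ B) (hbB : Real.exp (2 * b) ≤ B)
  (hW : ∀ d, M.τ₀ + d ∈ N → ∑ l, ‖M.dηL2 l (M.τ₀ + d)‖ ^ 2 ≤ B * ‖LL d‖ ^ 2)
  (hD : ∀ τ ∈ N, ∀ u, ∑ l, ‖M.Dη l τ u‖ ^ 2 ≤ B * ‖LL u‖ ^ 2)

include hP hN₀ hV hb0 hb hB hbB hW hD in
/-- The uniform lower bound for the increments of the negative log likelihood at the true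
parameter. -/
theorem measure_exists_nll_sub_lt_le [IsProbabilityMeasure μ] (hNo : IsOpen N)
    (hNc : Convex ℝ N)
    (hη : ∀ l, ContDiffOn ℝ 3 (M.etaL2 l) N)
    (hηx : ∀ l x, ContDiffOn ℝ 3 (fun τ => M.η l τ x) N)
    (hXm : ∀ l i, Measurable (X l i)) (hXlaw : ∀ l i, μ.map (X l i) = M.P l M.τ₀)
    (hXi : iIndepFun (fun q : Fin m × ℕ => X q.1 q.2) μ)
    {n : Fin m → ℕ} {K : ℕ} (hK : 0 < K) (hn : ∀ l, K ≤ n l)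
    (hconv : ∀ᵐ ω ∂μ, ConvexOn ℝ N (M.nll n (fun l i => X l i ω)))
    {c : ℝ} (hc0 : 0 ≤ c) (hc1 : c ≤ 1)
    (hW' : ∀ d, M.τ₀ + d ∈ N → c * ‖LL d‖ ^ 2 ≤ ∑ l, ‖M.dηL2 l (M.τ₀ + d)‖ ^ 2)
    {ι : Type*} [Fintype ι] {e : ι → Param p H} {w : ι → ℝ} (hw : ∀ j, 1 ≤ w j)
    {D α ε A : ℝ} (hwD : ∑ j, (w j)⁻¹ ≤ D) (hD1 : 1 ≤ D) (hα : 0 < α) (hα1 : α ≤ 1)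
    (hε : 0 < ε) (hε1 : ε ≤ 1) (hA : 0 < A) (hDN : D ≤ α ^ 2 * K * ε ^ 2)
    (he : ∀ v : ι → ℝ, ‖LL (∑ j, v j • e j)‖ ^ 2 ≤ B * ∑ j, v j ^ 2)
    {𝒯 : Set (ι → ℝ)} (h𝒯 : 𝒯.Countable) (h𝒯N : ∀ v ∈ 𝒯, M.τ₀ + ∑ j, v j • e j ∈ N)
    (h𝒯L : ∀ v ∈ 𝒯, ‖LL (∑ j, v j • e j)‖ ^ 2 ≤ 2 * ε ^ 2)
    (h𝒯w : ∀ v ∈ 𝒯, ∑ j, w j * v j ^ 2 ≤ 2 * B * ε ^ 2) :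
    μ {ω | ∃ v ∈ 𝒯, M.nll n (fun l i => X l i ω) (M.τ₀ + ∑ j, v j • e j)
          - M.nll n (fun l i => X l i ω) M.τ₀
        < Real.exp (-b) / 8 * c * ‖LL (∑ j, v j • e j)‖ ^ 2
          - (783 * B ^ 6 + 9 * (m + 1) * (136 * B ^ 5) ^ 2) * α * ε ^ 2
          - 2 * B * A * ε * Real.sqrt (D / K)}
      ≤ 2 * ENNReal.ofReal (Real.exp (8 * (136 * B ^ 5) / α ^ 4 * D - α ^ 2 * K * ε ^ 2))
        + ENNReal.ofReal (B ^ 2 / A ^ 2) := by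
  have hB0 : 0 < B := by linarith
  have hK0 : (0 : ℝ) < K := by exact_mod_cast hK
  set s : (ι → ℝ) → Param p H := fun v => ∑ j, v j • e j with hs
  have h1 := measure_exists_remainder_lt_le hP hN₀ hV hb0 hb hB hbB hW hD hNo hNc hη hηx hXm hXlaw
    hXi hK hn hconv hc0 hc1 hW' hw hwD hD1 hα hα1 hε hε1 hDN he h𝒯 h𝒯N h𝒯L h𝒯w
  have hLe : ∀ j, ‖LL (e j)‖ ^ 2 ≤ B := by
    classical
    intro j
    have h1 := he (Pi.single j 1)
    simpa [Pi.single_apply, ite_smul] using h1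
  have h2 := measure_lt_sum_sq_le hXm hXlaw hXi hK hn (fun l j => M.Dη l M.τ₀ (e j)) hw hwD
    (by linarith : 0 < D) (B := B ^ 2) (A := A ^ 2) (by positivity) (by positivity) fun j =>
      (hD _ hN₀ (e j)).trans (by nlinarith [hLe j])
  refine le_trans ?_ (add_le_add h1 h2)
  refine le_trans (measure_mono_ae ?_) (measure_union_le _ _)
  -- An exact decomposition: the increment is the empirical mean of the linearization remainder
  -- minus the score, the latter expanded in the coordinates of v.
  have hae1 : ∀ᵐ ω ∂μ, ∀ v ∈ 𝒯, M.nll n (fun l i => X l i ω) (M.τ₀ + s v)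
      - M.nll n (fun l i => X l i ω) M.τ₀
      = ∑ l, (n l : ℝ)⁻¹ * ∑ i ∈ Finset.range (n l),
        (M.cgf l (M.τ₀ + s v) + ((-M.dηL2 l (M.τ₀ + s v) + M.Dη l M.τ₀ (s v) : M.L2 l) :
          Lp ℝ 2 (M.P l M.τ₀)) (X l i ω))
        - ∑ j, v j * ∑ l, (n l : ℝ)⁻¹ * ∑ i ∈ Finset.range (n l),
          (M.Dη l M.τ₀ (e j) : Lp ℝ 2 (M.P l M.τ₀)) (X l i ω) := by
    rw [ae_ball_iff h𝒯]
    intro v hv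
    have h3 : ∀ᵐ ω ∂μ, ∀ l i, ((-M.dηL2 l (M.τ₀ + s v) + M.Dη l M.τ₀ (s v) : M.L2 l) :
        Lp ℝ 2 (M.P l M.τ₀)) (X l i ω) = -(M.dηL2 l (M.τ₀ + s v) : Lp ℝ 2 (M.P l M.τ₀)) (X l i ω)
        + ∑ j, v j * (M.Dη l M.τ₀ (e j) : Lp ℝ 2 (M.P l M.τ₀)) (X l i ω) := by
      refine ae_all_iff.2 fun l => ae_all_iff.2 fun i => ?_
      have := hP l
      refine ae_comp_of_map_eq (q := fun x => ((-M.dηL2 l (M.τ₀ + s v) + M.Dη l M.τ₀ (s v) :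
        M.L2 l) : Lp ℝ 2 (M.P l M.τ₀)) x = -(M.dηL2 l (M.τ₀ + s v) : Lp ℝ 2 (M.P l M.τ₀)) x
        + ∑ j, v j * (M.Dη l M.τ₀ (e j) : Lp ℝ 2 (M.P l M.τ₀)) x) (hXm l i) (hXlaw l i) ?_
      have h4 : M.Dη l M.τ₀ (s v) = ∑ j, v j • M.Dη l M.τ₀ (e j) := by
        rw [hs]
        simp only [map_sum, map_smul]
      rw [h4]
      filter_upwards [coe_L20_affine (-M.dηL2 l (M.τ₀ + s v)) (fun j => M.Dη l M.τ₀ (e j)) v,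
        coe_L20_neg (M.dηL2 l (M.τ₀ + s v))] with x h5 h6
      rw [h5, h6]
    have h0 : ∀ᵐ ω ∂μ, ∀ l i, (M.dηL2 l M.τ₀ : Lp ℝ 2 (M.P l M.τ₀)) (X l i ω) = 0 := by
      refine ae_all_iff.2 fun l => ae_all_iff.2 fun i => ?_
      refine ae_comp_of_map_eq (q := fun x => (M.dηL2 l M.τ₀ : Lp ℝ 2 (M.P l M.τ₀)) x = 0)
        (hXm l i) (hXlaw l i) ?_
      filter_upwards [coe_dηL2 (M := M) l M.τ₀] with x hx
      rw [hx, dη_τ₀]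
      rfl
    have hcgf0 : ∀ l, M.cgf l M.τ₀ = 0 := fun l => by
      have := hP l
      simp [cgf, dη_τ₀]
    filter_upwards [h3, h0, ae_nll_sub hP hN₀ hV hXm hXlaw n hN₀ (h𝒯N v hv)] with ω h4 h5 h6
    rw [h6]
    simp only [h4, h5, hcgf0, sub_zero]
    simp only [Finset.mul_sum]
    rw [Finset.sum_comm (s := Finset.univ (α := ι)), ← Finset.sum_sub_distrib]
    refine Finset.sum_congr rfl fun l _ => ?_
    rw [Finset.sum_comm (s := Finset.univ (α := ι)), ← Finset.sum_sub_distrib]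
    have hnl : (n l : ℝ) ≠ 0 := by exact_mod_cast (hK.trans_le (hn l)).ne'
    have h7 : M.cgf l (M.τ₀ + s v) = ∑ _i ∈ Finset.range (n l), (n l : ℝ)⁻¹ * M.cgf l (M.τ₀ + s v) := by
      simp only [Finset.sum_const, Finset.card_range, nsmul_eq_mul]
      field_simp
    nth_rewrite 1 [h7]
    rw [← Finset.sum_neg_distrib, ← Finset.sum_add_distrib]
    refine Finset.sum_congr rfl fun i _ => ?_
    rw [mul_add, mul_add, Finset.mul_sum]
    have h8 : ∑ j, v j * ((n l : ℝ)⁻¹ * (M.Dη l M.τ₀ (e j) : Lp ℝ 2 (M.P l M.τ₀)) (X l i ω))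
        = ∑ j, (n l : ℝ)⁻¹ * (v j * (M.Dη l M.τ₀ (e j) : Lp ℝ 2 (M.P l M.τ₀)) (X l i ω)) :=
      Finset.sum_congr rfl fun j _ => by ring
    rw [h8]
    ring
  filter_upwards [hae1] with ω hω
  rintro ⟨v, hv, hlt⟩
  by_contra hcon
  obtain ⟨hc1, hc2⟩ := not_or.1 (show ¬ (_ ∨ _) from hcon)
  have h3 := not_lt.1 fun h => hc1 ⟨v, hv, h⟩
  rw [hω v hv] at hlt
  set Y : ι → ℝ := fun j => ∑ l, (n l : ℝ)⁻¹ * ∑ i ∈ Finset.range (n l),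
    (M.Dη l M.τ₀ (e j) : Lp ℝ 2 (M.P l M.τ₀)) (X l i ω) with hY
  have h4 : ∑ j, (w j)⁻¹ * Y j ^ 2 ≤ A ^ 2 * (D / K) := by
    by_contra h
    exact hc2 (not_le.1 h)
  -- Cauchy-Schwarz with weights w and w⁻¹ pairs the ellipsoid norm of v with the dual norm of the
  -- score, the one that the second moment event controls.
  have h5 : ∑ j, v j * Y j ≤ 2 * B * A * ε * Real.sqrt (D / K) := by
    refine abs_le_of_sq_le_sq ?_ (by positivity) |> le_of_abs_le
    have hw0 : ∀ j, 0 < w j := fun j => by linarith [hw j]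
    have h6 := Finset.sum_mul_sq_le_sq_mul_sq Finset.univ (fun j => Real.sqrt (w j) * v j)
      (fun j => (Real.sqrt (w j))⁻¹ * Y j)
    have h7 : ∀ j, Real.sqrt (w j) * v j * ((Real.sqrt (w j))⁻¹ * Y j) = v j * Y j := fun j => by
      have := (Real.sqrt_pos.2 (hw0 j)).ne'
      field_simp
    simp only [h7, mul_pow, inv_pow, Real.sq_sqrt (hw0 _).le] at h6
    refine h6.trans ?_
    calc (∑ j, w j * v j ^ 2) * ∑ j, (w j)⁻¹ * Y j ^ 2
        ≤ (2 * B * ε ^ 2) * (A ^ 2 * (D / K)) :=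
          mul_le_mul (h𝒯w v hv) h4 (Finset.sum_nonneg fun j _ =>
            mul_nonneg (inv_pos.2 (hw0 j)).le (sq_nonneg _)) (by positivity)
      _ ≤ (4 * B ^ 2 * ε ^ 2) * (A ^ 2 * (D / K)) := by
        have hDK : 0 ≤ A ^ 2 * (D / K) := by positivity
        refine mul_le_mul_of_nonneg_right ?_ hDK
        refine mul_le_mul_of_nonneg_right ?_ (sq_nonneg _)
        nlinarith
      _ = _ := by
        have hDK : 0 ≤ D / K := by positivity
        rw [mul_pow, Real.sq_sqrt hDK]
        ring
  linarith

end Uniform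

end Model

/-! ### Hilbert sums over the samples and comparison of norms. -/

section Pi

variable {m : ℕ} {F : Type*} [NormedAddCommGroup F] [NormedSpace ℝ F] {G : Fin m → Type*}
  [∀ l, NormedAddCommGroup (G l)] [∀ l, InnerProductSpace ℝ (G l)]

/-- A family of operators as an operator into the Hilbert sum. -/
noncomputable def piLp (f : ∀ l, F →L[ℝ] G l) : F →L[ℝ] PiLp 2 G :=
  ((PiLp.continuousLinearEquiv 2 ℝ G).symm : (∀ l, G l) →L[ℝ] PiLp 2 G).comp
    (ContinuousLinearMap.pi f)

lemma piLp_apply (f : ∀ l, F →L[ℝ] G l) (x : F) (l : Fin m) : piLp f x l = f l x := rfl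

lemma norm_sq_piLp (f : ∀ l, F →L[ℝ] G l) (x : F) : ‖piLp f x‖ ^ 2 = ∑ l, ‖f l x‖ ^ 2 := by
  rw [PiLp.norm_sq_eq_of_L2]
  rfl

lemma inner_piLp (f : ∀ l, F →L[ℝ] G l) (x y : F) :
    inner ℝ (piLp f x) (piLp f y) = ∑ l, inner ℝ (f l x) (f l y) := by
  rw [PiLp.inner_apply]
  rfl

lemma hasFDerivAt_piLp_of_forall {f : ∀ l, F → G l} {f' : ∀ l, F →L[ℝ] G l} {x : F}
    (h : ∀ l, HasFDerivAt (f l) (f' l) x) :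
    HasFDerivAt (fun y => (WithLp.toLp 2 fun l => f l y : PiLp 2 G)) (piLp f') x :=
  ((PiLp.continuousLinearEquiv 2 ℝ G).symm : (∀ l, G l) →L[ℝ] PiLp 2 G).hasFDerivAt.comp x
    (hasFDerivAt_pi.2 h)

/-- A mean value comparison for a family of maps whose derivatives are comparable to `LL`. -/
theorem exists_comparison_of_fderiv {E : Type*} [NormedAddCommGroup E] [NormedSpace ℝ E]
    {LL : F →L[ℝ] E} {N : Set F} {f : ∀ l, F → G l} {f' : ∀ l, F → F →L[ℝ] G l}
    {C₁ C₂ C_d : ℝ} {x₀ : F} (hNc : Convex ℝ N) (hx₀ : x₀ ∈ N) (hC₂ : 0 < C₂)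
    (hC_d : C_d < 2 * C₁) (hf : ∀ l, ∀ x ∈ N, HasFDerivAt (f l) (f' l x) x)
    (h1 : ∀ x ∈ N, ∀ u, C₁ * ‖LL u‖ ^ 2 ≤ ∑ l, ‖f' l x u‖ ^ 2)
    (h2 : ∀ x ∈ N, ∀ u, ∑ l, ‖f' l x u‖ ^ 2 ≤ C₂ * ‖LL u‖ ^ 2)
    (h3 : ∀ x ∈ N, ∀ y ∈ N, ∀ u, ∑ l, ‖f' l x u - f' l y u‖ ^ 2 ≤ C_d * ‖LL u‖ ^ 2) :
    ∃ c : ℝ, 0 < c ∧ c ≤ 1 ∧ ∀ d, x₀ + d ∈ N →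
      ∑ l, ‖f l (x₀ + d) - f l x₀‖ ^ 2 ≤ C₂ * ‖LL d‖ ^ 2 ∧
      c * ‖LL d‖ ^ 2 ≤ ∑ l, ‖f l (x₀ + d) - f l x₀‖ ^ 2 := by
  set g : F → PiLp 2 G := fun y => WithLp.toLp 2 fun l => f l y with hg
  have hfd : ∀ x ∈ N, HasFDerivAt g (piLp fun l => f' l x) x := fun x hx =>
    hasFDerivAt_piLp_of_forall fun l => hf l x hx
  have hfn : ∀ x y, ‖g x - g y‖ ^ 2 = ∑ l, ‖f l x - f l y‖ ^ 2 := fun x y => by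
    rw [PiLp.norm_sq_eq_of_L2]
    rfl
  have hsub : ∀ x y u, ‖piLp (fun l => f' l x) u - piLp (fun l => f' l y) u‖ ^ 2
      = ∑ l, ‖f' l x u - f' l y u‖ ^ 2 := fun x y u => by
    rw [PiLp.norm_sq_eq_of_L2]
    rfl
  have hs : 0 < Real.sqrt C₂ := Real.sqrt_pos.2 hC₂
  have hk : 0 < (C₁ - C_d / 2) / Real.sqrt C₂ := div_pos (by linarith) hs
  refine ⟨min 1 (((C₁ - C_d / 2) / Real.sqrt C₂) ^ 2), lt_min one_pos (by positivity),
    min_le_left _ _, fun d hd => ⟨?_, ?_⟩⟩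
  · rw [← hfn]
    have h4 := norm_sub_le_of_fderiv_le (L := LL) hNc hfd (C := Real.sqrt C₂)
      (fun x hx u => by
        rw [← Real.sqrt_sq (norm_nonneg (LL u)), ← Real.sqrt_mul hC₂.le]
        exact Real.le_sqrt_of_sq_le (by rw [norm_sq_piLp]; exact h2 x hx u)) hx₀ hd
    refine (pow_le_pow_left₀ (norm_nonneg _) h4 2).trans (le_of_eq ?_)
    rw [mul_pow, Real.sq_sqrt hC₂.le]
  · rw [← hfn]
    have h4 := mul_norm_le_norm_sub_of_fderiv (L := LL) hNc hfd hC₂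
      (fun x hx u => by rw [norm_sq_piLp]; exact h1 x hx u)
      (fun x hx u => by rw [norm_sq_piLp]; exact h2 x hx u)
      (fun x hx y hy u => by rw [hsub]; exact h3 x hx y hy u) hx₀ hd
    refine le_trans ?_ (pow_le_pow_left₀ (by positivity) h4 2)
    rw [mul_pow]
    exact mul_le_mul_of_nonneg_right (min_le_right _ _) (sq_nonneg _)

/-- Simultaneous diagonalization of the form of a family of operators and a nonnegative form. -/
theorem exists_simultaneous_diagonalization_pi {H : Type*} [NormedAddCommGroup H]
    [InnerProductSpace ℝ H] [CompleteSpace H] [∀ l, CompleteSpace (G l)] (hm : 1 ≤ m)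
    (hH : ¬ FiniteDimensional ℝ H) {f : ∀ l, H →L[ℝ] G l} (hf : ∀ l, Function.Injective (f l))
    {J : LinearMap.BilinForm ℝ H} (hJs : ∀ g h, J g h = J h g) (hJ0 : ∀ g, 0 ≤ J g g)
    {c C : ℝ} (hc : 0 < c)
    (hA : ∀ g, c * ‖g‖ ^ 2 ≤ ∑ l, ‖f l g‖ ^ 2 + J g g ∧ ∑ l, ‖f l g‖ ^ 2 + J g g ≤ C * ‖g‖ ^ 2)
    (hcc : CompletelyContinuous (fun g => ∑ l, ‖f l g‖ ^ 2) (fun g => J g g)) :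
    ∃ (φ : ℕ → H) (ρ : ℕ → ℝ),
      (∀ i j, ∑ l, inner ℝ (f l (φ i)) (f l (φ j)) = if i = j then (1 : ℝ) else 0) ∧
      (∀ i j, J (φ i) (φ j) = if i = j then ρ i else 0) ∧ (∀ i, 0 ≤ ρ i) ∧ Monotone ρ ∧
      Tendsto ρ atTop atTop ∧ (Submodule.span ℝ (Set.range φ)).topologicalClosure = ⊤ := by
  simp only [← norm_sq_piLp] at hA hcc
  have hcomp : IsCompactOperator (piLp f) :=
    isCompactOperator_of_completelyContinuous (J := fun g => J g g) (B := C)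
      (fun g => by nlinarith [(hA g).2, sq_nonneg ‖piLp f g‖]) hcc
  have hi : Function.Injective (piLp f) := fun x y hxy =>
    hf ⟨0, hm⟩ (by rw [← piLp_apply f x, hxy, piLp_apply])
  simp only [← inner_piLp]
  exact exists_simultaneous_diagonalization hH hcomp hi hJs hJ0 hc (fun g => (hA g).1)
    (fun g => (hA g).2)

end Pi

/-- Finite families of operators into Hilbert spaces as operators into a single one. -/
theorem exists_hilbert_sum.{w} {m : ℕ} {F H : Type*} [NormedAddCommGroup F] [NormedSpace ℝ F]
    [NormedAddCommGroup H] [NormedSpace ℝ H] {G : Fin m → Type w}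
    [∀ l, NormedAddCommGroup (G l)] [∀ l, InnerProductSpace ℝ (G l)]
    (S : ∀ l, F →L[ℝ] G l) (L : ∀ l, H →L[ℝ] G l) :
    ∃ (E : Type w) (_ : NormedAddCommGroup E) (_ : InnerProductSpace ℝ E)
      (S' : F →L[ℝ] E) (L' : H →L[ℝ] E),
      (∀ g h, inner ℝ (L' g) (L' h) = ∑ l, inner ℝ (L l g) (L l h)) ∧
      (∀ ζ g, ‖S' ζ + L' g‖ ^ 2 = ∑ l, ‖S l ζ + L l g‖ ^ 2) := by
  refine ⟨PiLp 2 G, inferInstance, inferInstance, piLp S, piLp L, inner_piLp L, fun ζ g => ?_⟩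
  rw [PiLp.norm_sq_eq_of_L2]
  rfl

/-- If `S` stays away from the range of `L` on the unit sphere, then `S ζ + L g` controls both
components. -/
theorem exists_separation {F H E : Type*} [NormedAddCommGroup F] [NormedSpace ℝ F]
    [NormedAddCommGroup H] [NormedSpace ℝ H] [NormedAddCommGroup E] [NormedSpace ℝ E]
    (S : F →L[ℝ] E) (L : H →L[ℝ] E) {c : ℝ} (hc : 0 < c)
    (hsep : ∀ ζ g, ‖ζ‖ = 1 → c < ‖S ζ - L g‖ ^ 2) :
    ∃ B : ℝ, 1 ≤ B ∧ ∀ ζ g,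
      ‖ζ‖ ^ 2 + ‖L g‖ ^ 2 ≤ B * ‖S ζ + L g‖ ^ 2 ∧
      ‖S ζ + L g‖ ^ 2 ≤ B * (‖ζ‖ ^ 2 + ‖L g‖ ^ 2) := by
  have h1 : ∀ ζ g, c * ‖ζ‖ ^ 2 ≤ ‖S ζ + L g‖ ^ 2 := by
    intro ζ g
    rcases eq_or_ne ζ 0 with rfl | hζ
    · simp only [norm_zero, ne_eq, OfNat.ofNat_ne_zero, not_false_eq_true, zero_pow, mul_zero]
      exact sq_nonneg _
    · have hn : 0 < ‖ζ‖ := norm_pos_iff.2 hζ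
      -- Homogeneity reduces to unit ζ. The sign of g is reversed because separation is stated for a
      -- difference.
      have h2 := hsep (‖ζ‖⁻¹ • ζ) (-(‖ζ‖⁻¹ • g)) (by rw [norm_smul, norm_inv, norm_norm,
        inv_mul_cancel₀ hn.ne'])
      have h3 : S (‖ζ‖⁻¹ • ζ) - L (-(‖ζ‖⁻¹ • g)) = ‖ζ‖⁻¹ • (S ζ + L g) := by
        rw [map_neg, sub_neg_eq_add, map_smul, map_smul, smul_add]
      rw [h3, norm_smul, norm_inv, norm_norm, mul_pow, inv_pow,
        lt_inv_mul_iff₀ (by positivity)] at h2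
      linarith
  set T := ‖S‖ with hT
  have hT0 : 0 ≤ T := norm_nonneg _
  have h2 : ∀ ζ, ‖S ζ‖ ≤ T * ‖ζ‖ := fun ζ => S.le_opNorm ζ
  refine ⟨2 + 2 * T ^ 2 + (1 + 2 * T ^ 2) / c, ?_, fun ζ g => ⟨?_, ?_⟩⟩
  · have : 0 ≤ (1 + 2 * T ^ 2) / c := by positivity
    nlinarith [sq_nonneg T]
  · have h3 : ‖L g‖ ≤ ‖S ζ + L g‖ + T * ‖ζ‖ := by
      have : L g = (S ζ + L g) - S ζ := by abel
      rw [this]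
      exact (norm_sub_le _ _).trans (by rw [← this]; linarith [h2 ζ])
    have h4 := pow_le_pow_left₀ (norm_nonneg _) h3 2
    have h5 : ‖ζ‖ ^ 2 ≤ ‖S ζ + L g‖ ^ 2 / c := by
      rw [le_div_iff₀ hc]
      linarith [h1 ζ g]
    have h6 : (1 + 2 * T ^ 2) * ‖ζ‖ ^ 2 ≤ (1 + 2 * T ^ 2) * (‖S ζ + L g‖ ^ 2 / c) := by
      gcongr
    have h7 : (1 + 2 * T ^ 2) / c * ‖S ζ + L g‖ ^ 2
        = (1 + 2 * T ^ 2) * (‖S ζ + L g‖ ^ 2 / c) := by ring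
    have h8 : 0 ≤ T ^ 2 * ‖S ζ + L g‖ ^ 2 := by positivity
    nlinarith [sq_nonneg (‖S ζ + L g‖ - T * ‖ζ‖)]
  · have h3 : ‖S ζ + L g‖ ≤ T * ‖ζ‖ + ‖L g‖ :=
      (norm_add_le _ _).trans (by linarith [h2 ζ])
    have h4 := pow_le_pow_left₀ (norm_nonneg _) h3 2
    have h5 : 0 ≤ (1 + 2 * T ^ 2) / c * (‖ζ‖ ^ 2 + ‖L g‖ ^ 2) := by positivity
    have h6 : 0 ≤ T ^ 2 * ‖L g‖ ^ 2 := by positivity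
    nlinarith [sq_nonneg (T * ‖ζ‖ - ‖L g‖), sq_nonneg ‖ζ‖]

namespace Model

section Constants

variable {m p : ℕ} {H : Type*} [NormedAddCommGroup H] [InnerProductSpace ℝ H]
  {𝓧 : Fin m → Type*} [∀ l, MeasurableSpace (𝓧 l)]
  {M : Model m p H 𝓧} {N : Set (Param p H)}
  {Lθ : ∀ l, EuclideanSpace ℝ (Fin p) →L[ℝ] M.L2 l} {Lh : ∀ l, H →L[ℝ] M.L2 l}
  {E : Type*} [NormedAddCommGroup E] [NormedSpace ℝ E]

/-- The constants of the comparison of `η_l` with the auxiliary operators. -/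
theorem exists_comparison_constants (hP : ∀ l, IsProbabilityMeasure (M.P l M.τ₀))
    {C₁ C₂ C_d : ℝ} (hNo : IsOpen N) (hη : ∀ l, ContDiffOn ℝ 3 (M.etaL2 l) N)
    (hNc : Convex ℝ N) (hN₀ : M.τ₀ ∈ N) (hC₂ : 0 < C₂)
    (hC_d : C_d < 2 * C₁) (hD : DerivativeBounds M Lθ Lh N C₁ C₂)
    (hOsc : DerivativeOscillation M Lθ Lh N C_d) {LL : Param p H →L[ℝ] E}
    (hLL : ∀ ζ g, ‖LL (ζ, g)‖ ^ 2 = ∑ l, M.V l M.τ₀ (Lθ l ζ + Lh l g)) :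
    (∀ τ ∈ N, ∀ u, ∑ l, ‖M.Dη l τ u‖ ^ 2 ≤ C₂ * ‖LL u‖ ^ 2) ∧
    ∃ c : ℝ, 0 < c ∧ c ≤ 1 ∧ ∀ d, M.τ₀ + d ∈ N →
      ∑ l, ‖M.dηL2 l (M.τ₀ + d)‖ ^ 2 ≤ C₂ * ‖LL d‖ ^ 2 ∧
      c * ‖LL d‖ ^ 2 ≤ ∑ l, ‖M.dηL2 l (M.τ₀ + d)‖ ^ 2 := by
  have h0 : ∀ τ ∈ N, ∀ u : Param p H,
      ∑ l, ‖M.Dη l τ u‖ ^ 2 = ∑ l, M.V l M.τ₀ (M.Dθ l τ u.1 + M.Dh l τ u.2) :=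
    fun τ hτ u => Finset.sum_congr rfl fun l _ => by
      rw [V_τ₀ hP, ← Dη_apply hNo (hη l) hτ]
  have h1 : ∀ τ ∈ N, ∀ u, ∑ l, ‖M.Dη l τ u‖ ^ 2 ≤ C₂ * ‖LL u‖ ^ 2 := fun τ hτ u => by
    rw [h0 τ hτ, show u = (u.1, u.2) from rfl, hLL]
    exact (hD τ hτ u.1 u.2).2
  refine ⟨h1, exists_comparison_of_fderiv (f' := fun l τ => M.Dη l τ) hNc hN₀ hC₂ hC_d
    (fun l τ hτ => hasFDerivAt_etaL2 hNo (hη l) hτ) (fun τ hτ u => ?_) h1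
    (fun τ hτ τ' hτ' u => ?_)⟩
  · rw [h0 τ hτ, show u = (u.1, u.2) from rfl, hLL]
    exact (hD τ hτ u.1 u.2).1
  · rw [show u = (u.1, u.2) from rfl, hLL]
    refine le_trans (le_of_eq (Finset.sum_congr rfl fun l _ => ?_)) (hOsc τ hτ τ' hτ' u.1 u.2)
    rw [V_τ₀ hP, Dη_apply hNo (hη l) hτ u.1 u.2, Dη_apply hNo (hη l) hτ' u.1 u.2]
    simp only [sub_apply]
    congr 2
    abel

end Constants

end Model

/-! ### The effective dimension. -/

lemma sum_range_mul_div {T : ℕ} (hT : 0 < T) (g : ℕ → ℝ) (k : ℕ) :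
    ∑ j ∈ Finset.range (k * T), g (j / T) = T * ∑ i ∈ Finset.range k, g i := by
  induction k with
  | zero => simp
  | succ k ih =>
    rw [Nat.succ_mul, Finset.sum_range_add, ih, Finset.sum_range_succ, mul_add]
    congr 1
    rw [← nsmul_eq_mul, ← Finset.card_range T, ← Finset.sum_const, Finset.card_range]
    refine Finset.sum_congr rfl fun x hx => ?_
    rw [mul_comm k T, Nat.mul_add_div hT, Nat.div_eq_of_lt (Finset.mem_range.1 hx), add_zero]

/-- Eigenvalues growing like `ν ^ r` have effective dimension of order `lam ^ (-1 / r)`. -/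
theorem exists_sum_inv_le {ρ : ℕ → ℝ} (hρ : ∀ i, 0 ≤ ρ i) {β r : ℝ} (hβ : 0 < β) (hr : 1 < r)
    (hev : ∀ᶠ i : ℕ in atTop, β * ((i : ℝ) + 1) ^ r < ρ i) :
    ∃ C : ℝ, 0 ≤ C ∧ ∀ lam : ℝ, 0 < lam → lam ≤ 1 → ∀ k : ℕ,
      ∑ j ∈ Finset.range k, (1 + lam * ρ j)⁻¹ ≤ C * lam ^ (-(1 / r)) := by
  obtain ⟨j₀, hj₀⟩ := eventually_atTop.1 hev
  have hr0 : 0 < r := by linarith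
  have hsum : Summable fun i : ℕ => ((i : ℝ) ^ r)⁻¹ := Real.summable_nat_rpow_inv.2 hr
  set S : ℝ := 1 + β⁻¹ * ∑' i : ℕ, ((i : ℝ) ^ r)⁻¹ with hS
  have hS0 : 0 ≤ S := by
    have : 0 ≤ ∑' i : ℕ, ((i : ℝ) ^ r)⁻¹ := tsum_nonneg fun i => by positivity
    positivity
  set g : ℕ → ℝ := fun i => (1 + β * (i : ℝ) ^ r)⁻¹ with hg
  have hg0 : ∀ i, 0 ≤ g i := fun i => by positivity
  have hgS : ∀ k, ∑ i ∈ Finset.range k, g i ≤ S := fun k => by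
    have h1 : ∀ i, g i ≤ (if i = 0 then 1 else 0) + β⁻¹ * ((i : ℝ) ^ r)⁻¹ := fun i => by
      rcases Nat.eq_zero_or_pos i with rfl | hi
      · simp [hg, Real.zero_rpow hr0.ne']
      · have hi' : (0 : ℝ) < i := by exact_mod_cast hi
        have h2 : 0 < (i : ℝ) ^ r := Real.rpow_pos_of_pos hi' r
        rw [if_neg hi.ne', zero_add, ← mul_inv]
        exact inv_anti₀ (by positivity) (by linarith)
    refine (Finset.sum_le_sum fun i _ => h1 i).trans ?_
    rw [Finset.sum_add_distrib, ← Finset.mul_sum, hS]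
    refine add_le_add ?_ (mul_le_mul_of_nonneg_left
      (hsum.sum_le_tsum _ fun i _ => by positivity) (by positivity))
    rw [Finset.sum_ite_eq']
    split_ifs <;> norm_num
  refine ⟨j₀ + 2 * S, by positivity, fun lam hl0 hl1 k => ?_⟩
  -- Chosen so that lam · T^r = 1. In blocks of length ⌈T⌉ the summands of block i are at most 1/(1
  -- + β i^r), and r > 1 makes these summable, leaving a multiple of T. Indices below j₀, where no
  -- growth is known, count 1 each.
  set T : ℝ := lam ^ (-(1 / r)) with hT
  have hT1 : 1 ≤ T := Real.one_le_rpow_of_pos_of_le_one_of_nonpos hl0 hl1 (by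
    rw [neg_nonpos]; positivity)
  have hTr : lam * T ^ r = 1 := by
    rw [hT, ← Real.rpow_mul hl0.le, neg_mul, one_div, inv_mul_cancel₀ hr0.ne',
      Real.rpow_neg_one, mul_inv_cancel₀ hl0.ne']
  set T' : ℕ := ⌈T⌉₊ with hT'
  have hTT : T ≤ T' := Nat.le_ceil T
  have hT'2 : (T' : ℝ) ≤ 2 * T := by
    have := Nat.ceil_lt_add_one (by linarith : 0 ≤ T)
    linarith
  have hT'0 : 0 < T' := Nat.ceil_pos.2 (by linarith)
  have hj : ∀ j, (1 + lam * ρ j)⁻¹ ≤ (if j < j₀ then 1 else 0) + g (j / T') := fun j => by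
    have h0 : 0 ≤ lam * ρ j := mul_nonneg hl0.le (hρ j)
    split_ifs with h
    · have : (1 + lam * ρ j)⁻¹ ≤ 1 := inv_le_one_of_one_le₀ (by linarith)
      linarith [hg0 (j / T')]
    · rw [zero_add]
      refine inv_anti₀ (by positivity) ?_
      have h1 := hj₀ j (not_lt.1 h)
      have h2 : ((j / T' : ℕ) : ℝ) * T ≤ (j : ℝ) + 1 := by
        have h3 : ((j / T' : ℕ) : ℝ) * T' ≤ j := by exact_mod_cast Nat.div_mul_le_self j T'
        have h4 : ((j / T' : ℕ) : ℝ) * T ≤ ((j / T' : ℕ) : ℝ) * T' := by gcongr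
        linarith
      have h5 : (((j / T' : ℕ) : ℝ) * T) ^ r ≤ ((j : ℝ) + 1) ^ r :=
        Real.rpow_le_rpow (by positivity) h2 hr0.le
      rw [Real.mul_rpow (by positivity) (by linarith)] at h5
      have h6 : β * ((j / T' : ℕ) : ℝ) ^ r = lam * (β * (((j / T' : ℕ) : ℝ) ^ r * T ^ r)) := by
        linear_combination (-(β * ((j / T' : ℕ) : ℝ) ^ r)) * hTr
      rw [h6]
      have h7 : β * (((j / T' : ℕ) : ℝ) ^ r * T ^ r) ≤ ρ j :=
        (mul_le_mul_of_nonneg_left h5 hβ.le).trans h1.le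
      have := mul_le_mul_of_nonneg_left h7 hl0.le
      linarith
  calc ∑ j ∈ Finset.range k, (1 + lam * ρ j)⁻¹
      ≤ ∑ j ∈ Finset.range k, ((if j < j₀ then (1 : ℝ) else 0) + g (j / T')) :=
        Finset.sum_le_sum fun j _ => hj j
    _ = ∑ j ∈ Finset.range k, (if j < j₀ then (1 : ℝ) else 0)
        + ∑ j ∈ Finset.range k, g (j / T') := Finset.sum_add_distrib
    _ ≤ j₀ + T' * S := by
        refine add_le_add ?_ ?_
        · rw [Finset.sum_boole]
          have : ((Finset.range k).filter fun j => j < j₀).card ≤ (Finset.range j₀).card :=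
            Finset.card_le_card fun j hj => by simpa using (Finset.mem_filter.1 hj).2
          rw [Finset.card_range] at this
          exact_mod_cast this
        · refine le_trans (Finset.sum_le_sum_of_subset_of_nonneg (t := Finset.range (k * T'))
            (fun j hj => ?_) fun j _ _ => hg0 _) ?_
          · rw [Finset.mem_range] at hj ⊢
            exact hj.trans_le (Nat.le_mul_of_pos_right k hT'0)
          · rw [sum_range_mul_div hT'0]
            exact mul_le_mul_of_nonneg_left (hgS k) (by positivity)
    _ ≤ (j₀ + 2 * S) * T := by
        have h1 : (T' : ℝ) * S ≤ 2 * T * S := by gcongr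
        have h2 : (j₀ : ℝ) * 1 ≤ j₀ * T := by gcongr
        linarith

/-- The coordinate vectors of the parameter space given by the standard basis of the first
component and the first `k` vectors of a system in the second one. -/
noncomputable def coordVec {p : ℕ} {H : Type*} [NormedAddCommGroup H] (φ : ℕ → H) (k : ℕ) :
    Fin p ⊕ Fin k → Param p H :=
  Sum.elim (fun i => (EuclideanSpace.single i 1, 0)) fun j => (0, φ j)

/-! ### Finite coordinate expansions and a countable dense set of directions. -/

section Coordinates

variable {p : ℕ} {H : Type*} [NormedAddCommGroup H] [InnerProductSpace ℝ H] {φ : ℕ → H}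

lemma sum_smul_coordVec {k : ℕ} (v : Fin p ⊕ Fin k → ℝ) :
    ∑ j, v j • coordVec (p := p) φ k j
      = (WithLp.toLp 2 fun i => v (Sum.inl i), ∑ j : Fin k, v (Sum.inr j) • φ j) := by
  rw [Fintype.sum_sum_type]
  ext1
  · rw [Prod.fst_add, Prod.fst_sum, Prod.fst_sum]
    ext i
    simp [coordVec, Pi.single_apply]
  · rw [Prod.snd_add, Prod.snd_sum, Prod.snd_sum]
    simp [coordVec]

lemma norm_sq_map_sum_smul {E : Type*} [NormedAddCommGroup E] [InnerProductSpace ℝ E]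
    {Λ : H →L[ℝ] E} (hφ : ∀ i j, inner ℝ (Λ (φ i)) (Λ (φ j)) = if i = j then (1 : ℝ) else 0)
    {k : ℕ} (c : Fin k → ℝ) : ‖Λ (∑ j : Fin k, c j • φ j)‖ ^ 2 = ∑ j, c j ^ 2 := by
  rw [← real_inner_self_eq_norm_sq, map_sum, sum_inner]
  refine Finset.sum_congr rfl fun i _ => ?_
  rw [inner_sum]
  simp only [map_smul, inner_smul_left, inner_smul_right, hφ, RCLike.conj_to_real, Fin.val_inj]
  simp [sq]

lemma bilin_sum_smul {J : LinearMap.BilinForm ℝ H} {ρ : ℕ → ℝ}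
    (hφ : ∀ i j, J (φ i) (φ j) = if i = j then ρ i else 0) {k : ℕ} (c : Fin k → ℝ) :
    J (∑ j : Fin k, c j • φ j) (∑ j : Fin k, c j • φ j) = ∑ j : Fin k, ρ j * c j ^ 2 := by
  rw [map_sum]
  refine Finset.sum_congr rfl fun i _ => ?_
  rw [map_smul, map_sum, LinearMap.sum_apply]
  simp only [map_smul, LinearMap.smul_apply, hφ, Fin.val_inj, smul_eq_mul]
  simp
  ring

/-- Padding with zeros gives an expansion at every level from some k₀ on. Asking for all of these
makes the sets of level k increase with k. -/
lemma exists_eq_sum_smul_coordVec {d : Param p H}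
    (hd : d.2 ∈ Submodule.span ℝ (Set.range φ)) :
    ∃ k₀, ∀ k ≥ k₀, ∃ v : Fin p ⊕ Fin k → ℝ, ∑ j, v j • coordVec φ k j = d := by
  obtain ⟨c, hc⟩ := (Finsupp.mem_span_range_iff_exists_finsupp).1 hd
  obtain ⟨k₀, hk₀⟩ : ∃ k₀, c.support ⊆ Finset.range k₀ :=
    ⟨c.support.sup id + 1, fun i hi => Finset.mem_range.2 (Nat.lt_succ_of_le
      (Finset.le_sup (f := id) hi))⟩
  refine ⟨k₀, fun k hk => ⟨Sum.elim (fun i => d.1 i) fun j => c j, ?_⟩⟩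
  rw [sum_smul_coordVec]
  ext1
  · rfl
  · change ∑ j : Fin k, c j • φ j = d.2
    rw [← hc, Fin.sum_univ_eq_sum_range (fun j => c j • φ j) k]
    refine (Finset.sum_subset (fun i hi => ?_) fun i _ hi => ?_).symm
    · exact Finset.mem_range.2 ((Finset.mem_range.1 (hk₀ hi)).trans_le hk)
    · rw [Finsupp.notMem_support_iff.1 hi, zero_smul]

/-- Countability lets bounds that hold almost surely at each parameter hold simultaneously;
membership in the span leaves finitely many coordinates at a time. -/
lemma exists_countable_dense (hφ : (Submodule.span ℝ (Set.range φ)).topologicalClosure = ⊤) :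
    ∃ 𝒟 : Set (Param p H), 𝒟.Countable ∧ Dense 𝒟 ∧
      ∀ d ∈ 𝒟, d.2 ∈ Submodule.span ℝ (Set.range φ) := by
  have h1 : TopologicalSpace.IsSeparable
      ((Set.univ : Set (EuclideanSpace ℝ (Fin p))) ×ˢ
        (Submodule.span ℝ (Set.range φ) : Set H)) :=
    (TopologicalSpace.IsSeparable.of_separableSpace _).prod
      (Set.countable_range φ).isSeparable.span
  obtain ⟨t, ht, htc, hcl⟩ := h1.exists_countable_dense_subset
  refine ⟨t, htc, ?_, fun d hd => (ht hd).2⟩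
  have h2 : Dense ((Set.univ : Set (EuclideanSpace ℝ (Fin p))) ×ˢ
        (Submodule.span ℝ (Set.range φ) : Set H)) :=
    dense_univ.prod ((Submodule.dense_iff_topologicalClosure_eq_top).2 hφ)
  exact fun x => closure_minimal hcl isClosed_closure (h2 x)

end Coordinates

/-! ### The eigensystem of the model and the uniform bound on a dense set. -/

namespace Model

variable {m p : ℕ} {H : Type*} [NormedAddCommGroup H] [InnerProductSpace ℝ H]
  {𝓧 : Fin m → Type*} [∀ l, MeasurableSpace (𝓧 l)]
  {M : Model m p H 𝓧} {N : Set (Param p H)}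

instance (l : Fin m) : CompleteSpace (M.L2 l) :=
  inferInstanceAs (CompleteSpace (Submodule.span ℝ {Lp.const 2 (M.P l M.τ₀) (1 : ℝ)})ᗮ)

/-- Existence of the eigensystem. -/
theorem exists_isEigensystem [CompleteSpace H] (hP : ∀ l, IsProbabilityMeasure (M.P l M.τ₀))
    (hm : 1 ≤ m) (hH : ¬ FiniteDimensional ℝ H) {J : LinearMap.BilinForm ℝ H}
    {Lθ : ∀ l, EuclideanSpace ℝ (Fin p) →L[ℝ] M.L2 l} {Lh : ∀ l, H →L[ℝ] M.L2 l}
    (hJ : IsPenalty J) (hL : AuxiliaryOperators M J Lθ Lh)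
    (hcc : CompletelyContinuous (fun g => ∑ l, M.V l M.τ₀ (Lh l g)) (fun g => J g g)) :
    ∃ (φ : ℕ → H) (ρ : ℕ → ℝ), IsEigensystem M J Lh φ ρ := by
  have hn : (fun g => ∑ l, M.V l M.τ₀ (Lh l g)) = fun g => ∑ l, ‖Lh l g‖ ^ 2 := by
    funext g
    exact Finset.sum_congr rfl fun l _ => V_τ₀ hP l _
  obtain ⟨M₁, M₂, hM₁, hM₂, hM⟩ := hL.norm_equiv 1 one_pos
  have hM' : ∀ g, M₁ * ‖g‖ ^ 2 ≤ ∑ l, ‖Lh l g‖ ^ 2 + J g g ∧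
      ∑ l, ‖Lh l g‖ ^ 2 + J g g ≤ M₂ * ‖g‖ ^ 2 := fun g => by
    have h := hM g
    rwa [congrFun hn g, one_mul] at h
  obtain ⟨φ, ρ, h1, h2, h3, h4, h5, h6⟩ := exists_simultaneous_diagonalization_pi hm hH
    hL.injective_h hJ.symm hJ.nonneg hM₁ hM' (hn ▸ hcc)
  refine ⟨φ, ρ, fun i j => ?_, h2, h3, h4, h5, h6⟩
  rw [← h1 i j]
  exact Finset.sum_congr rfl fun l _ => Vcov_τ₀ hP l _ _

section UniformBound

variable {E F : Type*} [NormedAddCommGroup E] [NormedSpace ℝ E] [NormedAddCommGroup F]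
  [InnerProductSpace ℝ F]
  (hP : ∀ l, IsProbabilityMeasure (M.P l M.τ₀)) (hN₀ : M.τ₀ ∈ N) {C₃ C₄ : ℝ}
  (hV : VarianceEquivalent M N C₃ C₄)
  {Ω : Type*} [MeasurableSpace Ω] {μ : Measure Ω} {X : ∀ l, ℕ → Ω → 𝓧 l}
  {b : ℝ} (hb0 : 0 ≤ b)
  (hb : ∀ l, ∀ τ ∈ N, ∀ᵐ x ∂(M.P l M.τ₀), |M.dη l τ x - M.cgf l τ| ≤ b)
  {LL : Param p H →L[ℝ] E} {B : ℝ} (hB : 1 ≤ B) (hbB : Real.exp (2 * b) ≤ B)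
  (hW : ∀ d, M.τ₀ + d ∈ N → ∑ l, ‖M.dηL2 l (M.τ₀ + d)‖ ^ 2 ≤ B * ‖LL d‖ ^ 2)
  (hD : ∀ τ ∈ N, ∀ u, ∑ l, ‖M.Dη l τ u‖ ^ 2 ≤ B * ‖LL u‖ ^ 2)

include hP hN₀ hV hb0 hb hB hbB hW hD in
/-- The uniform lower bound for the increments of the negative log likelihood over a countable set
of parameters with finitely many nonzero coordinates. -/
theorem measure_exists_mem_nll_sub_lt_le [IsProbabilityMeasure μ] (hNo : IsOpen N)
    (hNc : Convex ℝ N)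
    (hη : ∀ l, ContDiffOn ℝ 3 (M.etaL2 l) N)
    (hηx : ∀ l x, ContDiffOn ℝ 3 (fun τ => M.η l τ x) N)
    (hXm : ∀ l i, Measurable (X l i)) (hXlaw : ∀ l i, μ.map (X l i) = M.P l M.τ₀)
    (hXi : iIndepFun (fun q : Fin m × ℕ => X q.1 q.2) μ)
    {n : Fin m → ℕ} {K : ℕ} (hK : 0 < K) (hn : ∀ l, K ≤ n l)
    (hconv : ∀ᵐ ω ∂μ, ConvexOn ℝ N (M.nll n (fun l i => X l i ω)))
    {c : ℝ} (hc0 : 0 ≤ c) (hc1 : c ≤ 1)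
    (hW' : ∀ d, M.τ₀ + d ∈ N → c * ‖LL d‖ ^ 2 ≤ ∑ l, ‖M.dηL2 l (M.τ₀ + d)‖ ^ 2)
    {Λ : H →L[ℝ] F} {J : LinearMap.BilinForm ℝ H} (hJ0 : ∀ g, 0 ≤ J g g)
    {φ : ℕ → H} {ρ : ℕ → ℝ} (hρ0 : ∀ i, 0 ≤ ρ i)
    (hφΛ : ∀ i j, inner ℝ (Λ (φ i)) (Λ (φ j)) = if i = j then (1 : ℝ) else 0)
    (hφJ : ∀ i j, J (φ i) (φ j) = if i = j then ρ i else 0)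
    (hsep : ∀ ζ g, ‖ζ‖ ^ 2 + ‖Λ g‖ ^ 2 ≤ B * ‖LL (ζ, g)‖ ^ 2 ∧
      ‖LL (ζ, g)‖ ^ 2 ≤ B * (‖ζ‖ ^ 2 + ‖Λ g‖ ^ 2))
    {lam D α ε A : ℝ} (hlam : 0 ≤ lam)
    (hwD : ∀ k : ℕ, p + ∑ j ∈ Finset.range k, (1 + lam * ρ j)⁻¹ ≤ D) (hD1 : 1 ≤ D)
    (hα : 0 < α) (hα1 : α ≤ 1)
    (hε : 0 < ε) (hε1 : ε ≤ 1) (hA : 0 < A) (hDN : D ≤ α ^ 2 * K * ε ^ 2)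
    {𝒟 : Set (Param p H)} (h𝒟 : 𝒟.Countable)
    (h𝒟φ : ∀ d ∈ 𝒟, d.2 ∈ Submodule.span ℝ (Set.range φ)) :
    μ {ω | ∃ d ∈ 𝒟, M.τ₀ + d ∈ N ∧ ‖LL d‖ ^ 2 + lam * J d.2 d.2 ≤ 2 * ε ^ 2 ∧
        M.nll n (fun l i => X l i ω) (M.τ₀ + d) - M.nll n (fun l i => X l i ω) M.τ₀
        < Real.exp (-b) / 8 * c * ‖LL d‖ ^ 2
          - (783 * B ^ 6 + 9 * (m + 1) * (136 * B ^ 5) ^ 2) * α * ε ^ 2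
          - 2 * B * A * ε * Real.sqrt (D / K)}
      ≤ 2 * ENNReal.ofReal (Real.exp (8 * (136 * B ^ 5) / α ^ 4 * D - α ^ 2 * K * ε ^ 2))
        + ENNReal.ofReal (B ^ 2 / A ^ 2) := by
  set s : ∀ k, (Fin p ⊕ Fin k → ℝ) → Param p H := fun k v => ∑ j, v j • coordVec φ k j with hs
  -- Exhaustion by the number of coordinates. The probability bound does not depend on k, since D
  -- dominates all partial sums, so it passes to the increasing union.
  set Dk : ℕ → Set (Param p H) := fun k =>
    {d | d ∈ 𝒟 ∧ M.τ₀ + d ∈ N ∧ ‖LL d‖ ^ 2 + lam * J d.2 d.2 ≤ 2 * ε ^ 2 ∧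
      ∀ k' ≥ k, ∃ v, s k' v = d} with hDk
  set bad : ℕ → Set Ω := fun k => {ω | ∃ d ∈ Dk k,
        M.nll n (fun l i => X l i ω) (M.τ₀ + d) - M.nll n (fun l i => X l i ω) M.τ₀
        < Real.exp (-b) / 8 * c * ‖LL d‖ ^ 2
          - (783 * B ^ 6 + 9 * (m + 1) * (136 * B ^ 5) ^ 2) * α * ε ^ 2
          - 2 * B * A * ε * Real.sqrt (D / K)} with hbad
  have hmono : Monotone bad := fun k k' hk ω ⟨d, hd, h⟩ =>
    ⟨d, ⟨hd.1, hd.2.1, hd.2.2.1, fun k'' hk'' => hd.2.2.2 k'' (hk.trans hk'')⟩, h⟩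
  have hsub : {ω | ∃ d ∈ 𝒟, M.τ₀ + d ∈ N ∧ ‖LL d‖ ^ 2 + lam * J d.2 d.2 ≤ 2 * ε ^ 2 ∧
        M.nll n (fun l i => X l i ω) (M.τ₀ + d) - M.nll n (fun l i => X l i ω) M.τ₀
        < Real.exp (-b) / 8 * c * ‖LL d‖ ^ 2
          - (783 * B ^ 6 + 9 * (m + 1) * (136 * B ^ 5) ^ 2) * α * ε ^ 2
          - 2 * B * A * ε * Real.sqrt (D / K)} ⊆ ⋃ k, bad k := by
    rintro ω ⟨d, hd, hdN, hdq, h⟩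
    obtain ⟨k, hk⟩ := exists_eq_sum_smul_coordVec (h𝒟φ d hd)
    exact Set.mem_iUnion.2 ⟨k, d, ⟨hd, hdN, hdq, hk⟩, h⟩
  refine (measure_mono hsub).trans ?_
  rw [hmono.measure_iUnion]
  refine iSup_le fun k => ?_
  -- With these weights the ellipsoid norm of the coordinates is ‖ζ‖² + ‖Λ g‖² + lam·J(g, g), and
  -- the sum of w⁻¹ is the effective dimension.
  set w : Fin p ⊕ Fin k → ℝ := Sum.elim (fun _ => 1) fun j => 1 + lam * ρ j with hw
  have hnorm : ∀ v : Fin p ⊕ Fin k → ℝ,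
      ‖(s k v).1‖ ^ 2 + ‖Λ (s k v).2‖ ^ 2 = ∑ j, v j ^ 2 := fun v => by
    rw [hs]
    simp only [sum_smul_coordVec]
    rw [norm_sq_map_sum_smul hφΛ, EuclideanSpace.norm_sq_eq, Fintype.sum_sum_type]
    simp
  have hwsum : ∀ v : Fin p ⊕ Fin k → ℝ, ∑ j, w j * v j ^ 2
      = ‖(s k v).1‖ ^ 2 + ‖Λ (s k v).2‖ ^ 2 + lam * J (s k v).2 (s k v).2 := fun v => by
    rw [hnorm]
    rw [hs]
    simp only [sum_smul_coordVec]
    rw [bilin_sum_smul hφJ, Fintype.sum_sum_type, Fintype.sum_sum_type, Finset.mul_sum, add_assoc,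
      ← Finset.sum_add_distrib]
    simp only [hw, Sum.elim_inl, Sum.elim_inr, one_mul]
    congr 1
    exact Finset.sum_congr rfl fun j _ => by ring
  have hex : ∀ d : Dk k, ∃ v, s k v = (d : Param p H) := fun d => d.2.2.2.2 k le_rfl
  choose σ hσ using hex
  have hT : (Set.range σ).Countable :=
    haveI : Countable (Dk k) := (h𝒟.mono fun d hd => hd.1).to_subtype
    Set.countable_range σ
  have key := measure_exists_nll_sub_lt_le hP hN₀ hV hb0 hb hB hbB hW hD hNo hNc hη hηx hXm
    hXlaw hXi hK hn hconv hc0 hc1 hW' (e := coordVec φ k) (w := w) (D := D) (α := α) (ε := ε)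
    (A := A) (𝒯 := Set.range σ)
    (fun j => by
      rcases j with i | j
      · exact le_rfl
      · have := mul_nonneg hlam (hρ0 j)
        simp only [hw, Sum.elim_inr]
        linarith)
    (by
      refine le_trans (le_of_eq ?_) (hwD k)
      rw [Fintype.sum_sum_type, ← Fin.sum_univ_eq_sum_range (fun j => (1 + lam * ρ j)⁻¹) k]
      simp [hw]) hD1 hα hα1 hε hε1 hA hDN
    (fun v => by
      rw [← hnorm v]
      exact (hsep (s k v).1 (s k v).2).2) hT
    (by
      rintro _ ⟨d, rfl⟩
      change M.τ₀ + s k (σ d) ∈ N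
      rw [hσ]
      exact d.2.2.1)
    (by
      rintro _ ⟨d, rfl⟩
      change ‖LL (s k (σ d))‖ ^ 2 ≤ _
      rw [hσ]
      have h1 := d.2.2.2.1
      have h2 := mul_nonneg hlam (hJ0 (d : Param p H).2)
      linarith)
    (by
      rintro _ ⟨d, rfl⟩
      rw [hwsum, hσ]
      have h1 := d.2.2.2.1
      have h2 := mul_nonneg hlam (hJ0 (d : Param p H).2)
      have h3 : ‖(d : Param p H).1‖ ^ 2 + ‖Λ (d : Param p H).2‖ ^ 2
        ≤ B * ‖LL (d : Param p H)‖ ^ 2 := (hsep (d : Param p H).1 (d : Param p H).2).1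
      nlinarith)
  refine (measure_mono ?_).trans key
  rintro ω ⟨d, hd, h⟩
  refine ⟨σ ⟨d, hd⟩, ⟨⟨d, hd⟩, rfl⟩, ?_⟩
  have hσd : ∑ j, σ ⟨d, hd⟩ j • coordVec φ k j = d := hσ ⟨d, hd⟩
  rw [hσd]
  exact h

end UniformBound

end Model

/-! ### Localization of penalized minimizers by convexity. -/

section Quadratic

variable {H : Type*} [NormedAddCommGroup H] [InnerProductSpace ℝ H] {J : LinearMap.BilinForm ℝ H}

lemma abs_bilin_le_sqrt_mul_sqrt (hJs : ∀ g h, J g h = J h g) (hJ0 : ∀ g, 0 ≤ J g g) (g h : H) :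
    |J g h| ≤ Real.sqrt (J g g) * Real.sqrt (J h h) := by
  rw [← Real.sqrt_mul (hJ0 g)]
  exact Real.abs_le_sqrt (LinearMap.BilinForm.apply_sq_le_of_symm J hJ0
    ⟨fun x y => by simp [hJs x y]⟩ g h)

lemma continuous_bilin_self (hJs : ∀ g h, J g h = J h g) (hJ0 : ∀ g, 0 ≤ J g g) {C : ℝ}
    (hC : ∀ g, J g g ≤ C * ‖g‖ ^ 2) : Continuous fun g => J g g := by
  have h1 : ∀ g, Real.sqrt (J g g) ≤ Real.sqrt C * ‖g‖ := fun g => by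
    rw [← Real.sqrt_sq (norm_nonneg g), ← Real.sqrt_mul' _ (sq_nonneg _)]
    exact Real.sqrt_le_sqrt (hC g)
  have h2 : ∀ g h, ‖J g h‖ ≤ Real.sqrt C * Real.sqrt C * ‖g‖ * ‖h‖ := fun g h => by
    rw [Real.norm_eq_abs]
    refine (abs_bilin_le_sqrt_mul_sqrt hJs hJ0 g h).trans ((mul_le_mul (h1 g) (h1 h)
      (Real.sqrt_nonneg _) (by positivity)).trans (le_of_eq (by ring)))
  have h3 : (fun g => J g g) = fun g => (J.mkContinuous₂ _ h2) g g := rfl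
  rw [h3]
  fun_prop

lemma convexOn_bilin_self (hJs : ∀ g h, J g h = J h g) (hJ0 : ∀ g, 0 ≤ J g g) :
    ConvexOn ℝ Set.univ fun g => J g g := by
  refine ⟨convex_univ, fun x _ y _ a b ha hb hab => ?_⟩
  have h1 := mul_nonneg (mul_nonneg ha hb) (hJ0 (x - y))
  have h2 : J (a • x + b • y) (a • x + b • y)
      = a ^ 2 * J x x + 2 * (a * b) * J x y + b ^ 2 * J y y := by
    simp only [map_add, map_smul, LinearMap.add_apply, LinearMap.smul_apply, smul_eq_mul, hJs y x]
    ring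
  have h3 : J (x - y) (x - y) = J x x - 2 * J x y + J y y := by
    simp only [map_sub, LinearMap.sub_apply, hJs y x]
    ring
  simp only [smul_eq_mul]
  rw [h2]
  rw [h3] at h1
  obtain rfl : b = 1 - a := by linarith
  nlinarith

variable {p : ℕ} {E : Type*} [NormedAddCommGroup E] [NormedSpace ℝ E]

/-- A lower bound for the increments of a convex loss on a dense set of directions localizes the
local minima of the penalized loss. -/
theorem norm_sq_add_penalty_le_of_isLocalMin {N : Set (Param p H)} (hNo : IsOpen N)
    {τ₀ : Param p H} (hτ₀ : τ₀ ∈ N) {ℓ : Param p H → ℝ} (hℓ : ConvexOn ℝ N ℓ)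
    (hℓc : ContinuousOn ℓ N) (hJs : ∀ g h, J g h = J h g) (hJ0 : ∀ g, 0 ≤ J g g)
    (hJc : Continuous fun g => J g g) (LL : Param p H →L[ℝ] E) {lam ε κ R : ℝ} (hlam : 0 ≤ lam)
    (hε : 0 < ε) (hκ : κ ≤ 1 / 2)
    (hR : R + ε * Real.sqrt (lam * J τ₀.2 τ₀.2) < κ * ε ^ 2) {𝒟 : Set (Param p H)} (h𝒟 : Dense 𝒟)
    (hlow : ∀ d ∈ 𝒟, τ₀ + d ∈ N → ‖LL d‖ ^ 2 + lam * J d.2 d.2 ≤ 2 * ε ^ 2 →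
      κ * ‖LL d‖ ^ 2 - R ≤ ℓ (τ₀ + d) - ℓ τ₀)
    {d : Param p H} (hd : τ₀ + d ∈ N)
    (hmin : IsLocalMin (fun τ => ℓ τ + lam / 2 * J τ.2 τ.2) (τ₀ + d)) :
    ‖LL d‖ ^ 2 + lam * J d.2 d.2 ≤ ε ^ 2 := by
  set q : Param p H → ℝ := fun d => ‖LL d‖ ^ 2 + lam * J d.2 d.2 with hq
  have hqc : Continuous q :=
    (LL.continuous.norm.pow 2).add (continuous_const.mul (hJc.comp continuous_snd))
  have hpen : ConvexOn ℝ N fun τ => ℓ τ + lam / 2 * J τ.2 τ.2 := by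
    have h1 : ConvexOn ℝ Set.univ fun τ : Param p H => J τ.2 τ.2 :=
      (convexOn_bilin_self hJs hJ0).comp_linearMap (LinearMap.snd ℝ _ _)
    exact hℓ.add ((h1.subset (Set.subset_univ _) hℓ.1).smul (by positivity : 0 ≤ lam / 2))
  have hglob : ∀ τ ∈ N, ℓ (τ₀ + d) + lam / 2 * J (τ₀ + d).2 (τ₀ + d).2
      ≤ ℓ τ + lam / 2 * J τ.2 τ.2 :=
    IsMinOn.of_isLocalMinOn_of_convexOn hd (hmin.on N) hpen
  by_contra! hlt
  have hqd : 0 < q d := (sq_nonneg ε).trans_lt hlt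
  -- Moves back along the segment to the point where q equals ε². A local minimum of a convex
  -- function is global, so the penalized loss at this point is at most its value at τ₀, which the
  -- lower bound contradicts.
  set t : ℝ := ε / Real.sqrt (q d) with ht
  have hs0 : 0 < Real.sqrt (q d) := Real.sqrt_pos.2 hqd
  have ht0 : 0 < t := div_pos hε hs0
  have ht1 : t ≤ 1 := by
    rw [ht, div_le_one hs0]
    exact Real.le_sqrt_of_sq_le hlt.le
  have hqt : q (t • d) = ε ^ 2 := by
    have : q (t • d) = t ^ 2 * q d := by
      simp only [hq, map_smul, norm_smul, Prod.smul_snd, LinearMap.smul_apply, smul_eq_mul,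
        Real.norm_eq_abs, mul_pow, sq_abs]
      ring
    rw [this, ht, div_pow, Real.sq_sqrt hqd.le, div_mul_cancel₀ _ hqd.ne']
  have htN : τ₀ + t • d ∈ N := segment_mem hℓ.1 hτ₀ hd ht0.le ht1
  have hup : ℓ (τ₀ + t • d) + lam / 2 * J (τ₀ + t • d).2 (τ₀ + t • d).2
      ≤ ℓ τ₀ + lam / 2 * J τ₀.2 τ₀.2 := by
    have h1 := hpen.2 hτ₀ hd (sub_nonneg.2 ht1) ht0.le (by ring)
    have h2 : (1 - t) • τ₀ + t • (τ₀ + d) = τ₀ + t • d := by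
      rw [sub_smul, one_smul, smul_add]
      abel
    rw [h2] at h1
    have h3 := mul_le_mul_of_nonneg_left (hglob τ₀ hτ₀) ht0.le
    simp only [smul_eq_mul] at h1
    linarith
  -- The point t • d need not lie in the dense set. The slack between ε² and 2ε² admits all nearby
  -- points of it, and continuity of the loss carries the bound over.
  have hlow' : κ * ‖LL (t • d)‖ ^ 2 - R ≤ ℓ (τ₀ + t • d) - ℓ τ₀ := by
    have hne : (𝓝[𝒟] (t • d)).NeBot := mem_closure_iff_nhdsWithin_neBot.1 (h𝒟 _)
    have hadd : Tendsto (fun x : Param p H => τ₀ + x) (𝓝[𝒟] (t • d)) (𝓝 (τ₀ + t • d)) :=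
      ((continuous_const.add continuous_id).tendsto _).mono_left nhdsWithin_le_nhds
    have hℓ1 : Tendsto (fun x => ℓ (τ₀ + x) - ℓ τ₀) (𝓝[𝒟] (t • d))
        (𝓝 (ℓ (τ₀ + t • d) - ℓ τ₀)) :=
      (((hℓc.continuousAt (hNo.mem_nhds htN)).tendsto.comp hadd).sub_const _)
    have hLL1 : Tendsto (fun x => κ * ‖LL x‖ ^ 2 - R) (𝓝[𝒟] (t • d))
        (𝓝 (κ * ‖LL (t • d)‖ ^ 2 - R)) :=
      ((((LL.continuous.norm.pow 2).const_mul κ).sub continuous_const).tendsto _).mono_left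
        nhdsWithin_le_nhds
    refine le_of_tendsto_of_tendsto hLL1 hℓ1 ?_
    have hq1 : ∀ᶠ x in 𝓝[𝒟] (t • d), q x < 2 * ε ^ 2 :=
      nhdsWithin_le_nhds ((hqc.tendsto _).eventually_lt_const (by rw [hqt]; nlinarith))
    filter_upwards [hq1, hadd.eventually_mem (hNo.mem_nhds htN), self_mem_nhdsWithin]
      with x hx1 hx2 hx3
    exact hlow x hx3 hx2 hx1.le
  have hJadd : J (τ₀ + t • d).2 (τ₀ + t • d).2
      = J τ₀.2 τ₀.2 + 2 * J τ₀.2 (t • d).2 + J (t • d).2 (t • d).2 := by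
    rw [Prod.snd_add]
    simp only [map_add, LinearMap.add_apply, hJs (t • d).2 τ₀.2]
    ring
  have hcross : |lam * J τ₀.2 (t • d).2| ≤ ε * Real.sqrt (lam * J τ₀.2 τ₀.2) := by
    have h1 := abs_bilin_le_sqrt_mul_sqrt hJs hJ0 τ₀.2 (t • d).2
    have h2 : Real.sqrt (lam * J (t • d).2 (t • d).2) ≤ ε := by
      rw [Real.sqrt_le_left hε.le, ← hqt]
      simp only [hq]
      nlinarith [sq_nonneg ‖LL (t • d)‖]
    rw [Real.sqrt_mul hlam] at h2
    rw [abs_mul, abs_of_nonneg hlam, Real.sqrt_mul hlam]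
    calc lam * |J τ₀.2 (t • d).2|
        ≤ (Real.sqrt lam * Real.sqrt lam)
          * (Real.sqrt (J τ₀.2 τ₀.2) * Real.sqrt (J (t • d).2 (t • d).2)) := by
          rw [Real.mul_self_sqrt hlam]
          exact mul_le_mul_of_nonneg_left h1 hlam
      _ = (Real.sqrt lam * Real.sqrt (J (t • d).2 (t • d).2))
          * (Real.sqrt lam * Real.sqrt (J τ₀.2 τ₀.2)) := by ring
      _ ≤ ε * (Real.sqrt lam * Real.sqrt (J τ₀.2 τ₀.2)) := by gcongr
  rw [hJadd] at hup
  have hcr := (abs_le.1 hcross).1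
  have hJt := mul_nonneg hlam (hJ0 (t • d).2)
  have hqt' : ‖LL (t • d)‖ ^ 2 + lam * J (t • d).2 (t • d).2 = ε ^ 2 := hqt
  -- As κ ≤ 1/2, half of the penalty at t • d supplies the part of κε² that κ‖LL (t • d)‖² leaves
  -- out.
  nlinarith [mul_nonneg (sub_nonneg.2 hκ) hJt]

end Quadratic

/-! ### Continuity of the likelihood. -/

namespace Model

variable {m p : ℕ} {H : Type*} [NormedAddCommGroup H]
  {𝓧 : Fin m → Type*} [∀ l, MeasurableSpace (𝓧 l)]
  {M : Model m p H 𝓧} {N : Set (Param p H)}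
  (hP : ∀ l, IsProbabilityMeasure (M.P l M.τ₀)) (hN₀ : M.τ₀ ∈ N) {C₃ C₄ : ℝ}
  (hV : VarianceEquivalent M N C₃ C₄) {b : ℝ}
  (hb : ∀ l, ∀ τ ∈ N, ∀ᵐ x ∂(M.P l M.τ₀), |M.dη l τ x - M.cgf l τ| ≤ b)

include hP hN₀ hV hb in
-- Jensen from both ends: the increment of the log normalizer lies between the means of the
-- increment of η under the two parameters, and the L² norm of that increment controls both.
lemma continuousOn_logZ (l : Fin m) (hc : ContinuousOn (M.etaL2 l) N) :
    ContinuousOn (M.logZ l) N := by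
  intro τ hτ
  have hbd : ∀ σ ∈ N, |M.logZ l σ - M.logZ l τ| ≤
      Real.exp (2 * b) * ((‖M.dηL2 l τ‖ + ‖M.dηL2 l σ‖) * ‖M.etaL2 l σ - M.etaL2 l τ‖) := by
    intro σ hσ
    obtain ⟨ψ, hψ, hψb⟩ := exists_mean hP hN₀ hV hb hτ l
    obtain ⟨χ, hχ, hχb⟩ := exists_mean hP hN₀ hV hb hσ l
    have h1 := mean_le_logZ_sub hP hN₀ hV hτ hσ l
    have h2 := mean_le_logZ_sub hP hN₀ hV hσ hτ l
    rw [← hψ] at h1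
    rw [← hχ] at h2
    have h3 := (abs_le.1 (hψb (M.etaL2 l σ - M.etaL2 l τ))).1
    have h4 := (abs_le.1 (hχb (M.etaL2 l τ - M.etaL2 l σ))).1
    rw [norm_sub_rev] at h4
    have h5 : 0 ≤ Real.exp (2 * b) * (‖M.dηL2 l τ‖ * ‖M.etaL2 l σ - M.etaL2 l τ‖) := by positivity
    have h6 : 0 ≤ Real.exp (2 * b) * (‖M.dηL2 l σ‖ * ‖M.etaL2 l σ - M.etaL2 l τ‖) := by positivity
    rw [abs_le]
    constructor <;> nlinarith
  have hcd : ContinuousWithinAt (fun σ => Real.exp (2 * b) *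
      ((‖M.dηL2 l τ‖ + ‖M.dηL2 l σ‖) * ‖M.etaL2 l σ - M.etaL2 l τ‖)) N τ := by
    have hd : ContinuousWithinAt (M.dηL2 l) N τ := (hc τ hτ).sub continuousWithinAt_const
    exact continuousWithinAt_const.mul ((continuousWithinAt_const.add hd.norm).mul
      ((hc τ hτ).sub continuousWithinAt_const).norm)
  have h0 : Tendsto (fun σ => Real.exp (2 * b) *
      ((‖M.dηL2 l τ‖ + ‖M.dηL2 l σ‖) * ‖M.etaL2 l σ - M.etaL2 l τ‖)) (𝓝[N] τ) (𝓝 0) := by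
    have := hcd.tendsto
    simpa using this
  refine tendsto_iff_dist_tendsto_zero.2 (squeeze_zero' (Eventually.of_forall fun _ => dist_nonneg)
    ?_ h0)
  filter_upwards [self_mem_nhdsWithin] with σ hσ
  rw [Real.dist_eq]
  exact hbd σ hσ

include hP hN₀ hV hb in
lemma continuousOn_nll (hc : ∀ l, ContinuousOn (M.etaL2 l) N)
    (hcx : ∀ l x, ContinuousOn (fun τ => M.η l τ x) N) (n : Fin m → ℕ) (x : ∀ l, ℕ → 𝓧 l) :
    ContinuousOn (M.nll n x) N :=
  continuousOn_finsetSum _ fun l _ =>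
    ((continuousOn_const.mul (continuousOn_finsetSum _ fun i _ => hcx l (x l i))).neg).add
      (continuousOn_logZ hP hN₀ hV hb l (hc l))

end Model

/-- The choice of the radius of the localization. -/
lemma tuning_bounds {κ K₁ K₂ B A J₀ C R K T lam a ε : ℝ} (hκ : 0 < κ) (hK₁ : 0 < K₁)
    (hK₂ : 0 ≤ K₂) (hB : 0 < B) (hA : 0 < A) (hJ₀ : 0 ≤ J₀) (hC1 : 1 ≤ C) (hK0 : 0 < K)
    (hT1 : 1 ≤ T) (hlam : 0 < lam) (ha : a = K⁻¹ * T + lam)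
    (hR1 : C * (K₂ / (κ / (4 * K₁)) ^ 4 + 1) / (κ / (4 * K₁)) ^ 2 ≤ R)
    (hR2 : C * (8 * B * A / κ) ^ 2 ≤ R) (hR3 : 16 * J₀ / κ ^ 2 ≤ R)
    (hε0 : 0 < ε) (hεsq : ε ^ 2 = R * a) :
    C * T ≤ (κ / (4 * K₁)) ^ 2 * K * ε ^ 2 ∧
    K₁ * (κ / (4 * K₁)) * ε ^ 2 + 2 * B * A * ε * Real.sqrt (C * T / K)
      + ε * Real.sqrt (lam * J₀) < κ * ε ^ 2 ∧
    Real.exp (K₂ / (κ / (4 * K₁)) ^ 4 * (C * T) - (κ / (4 * K₁)) ^ 2 * K * ε ^ 2) ≤ T⁻¹ := by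
  set α : ℝ := κ / (4 * K₁) with hα
  have hα0 : 0 < α := by positivity
  have hR0 : 0 < R := lt_of_lt_of_le (by positivity) hR1
  have hak1 : K⁻¹ * T ≤ a := by rw [ha]; linarith
  have hak2 : lam ≤ a := by
    have : 0 ≤ K⁻¹ * T := by positivity
    rw [ha]; linarith
  have hak0 : 0 < a := hlam.trans_le hak2
  have hKa : T ≤ K * a := by
    have := mul_le_mul_of_nonneg_left hak1 hK0.le
    rwa [mul_inv_cancel_left₀ hK0.ne'] at this
  -- The deviation exponent exceeds the entropy of the cells by C·T. This excess makes the
  -- exceptional probability at most exp(-T), hence at most 1/T.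
  have hexp : (K₂ / α ^ 4 + 1) * (C * T) ≤ α ^ 2 * K * ε ^ 2 := by
    have e1 : α ^ 2 * (C * (K₂ / α ^ 4 + 1) / α ^ 2) = C * (K₂ / α ^ 4 + 1) := by
      field_simp
    have e2 : C * (K₂ / α ^ 4 + 1) ≤ α ^ 2 * R := by
      rw [← e1]
      exact mul_le_mul_of_nonneg_left hR1 (by positivity)
    calc (K₂ / α ^ 4 + 1) * (C * T) = (C * (K₂ / α ^ 4 + 1)) * T := by ring
      _ ≤ (α ^ 2 * R) * (K * a) := mul_le_mul e2 hKa (by linarith) (by positivity)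
      _ = α ^ 2 * K * ε ^ 2 := by rw [hεsq]; ring
  have hKα : 0 ≤ K₂ / α ^ 4 := by positivity
  have hDN : C * T ≤ α ^ 2 * K * ε ^ 2 := by
    have : 0 ≤ K₂ / α ^ 4 * (C * T) := by positivity
    linarith
  -- Remainder, score and penalty bias take at most a quarter of κε² each, through α = κ/(4K₁) and
  -- the second and third lower bounds on R. The last quarter makes the inequality strict.
  have hterm1 : K₁ * α * ε ^ 2 = κ / 4 * ε ^ 2 := by
    rw [hα]
    field_simp
  have hterm2 : 2 * B * A * ε * Real.sqrt (C * T / K) ≤ κ / 4 * ε ^ 2 := by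
    have e1 : Real.sqrt (C * T / K) ≤ κ / (8 * B * A) * ε := by
      refine Real.sqrt_le_iff.2 ⟨by positivity, ?_⟩
      rw [mul_pow, hεsq]
      have e2 : C * T / K ≤ C * a := by
        rw [mul_div_assoc]
        refine mul_le_mul_of_nonneg_left ?_ (by linarith)
        rw [div_eq_inv_mul]
        exact hak1
      have e3 : C = (κ / (8 * B * A)) ^ 2 * (C * (8 * B * A / κ) ^ 2) := by
        field_simp
      have e4 : C ≤ (κ / (8 * B * A)) ^ 2 * R := by
        refine le_trans e3.le (mul_le_mul_of_nonneg_left hR2 (by positivity))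
      calc C * T / K ≤ C * a := e2
        _ ≤ ((κ / (8 * B * A)) ^ 2 * R) * a := mul_le_mul_of_nonneg_right e4 hak0.le
        _ = (κ / (8 * B * A)) ^ 2 * (R * a) := by ring
    calc 2 * B * A * ε * Real.sqrt (C * T / K)
        ≤ 2 * B * A * ε * (κ / (8 * B * A) * ε) := by gcongr
      _ = κ / 4 * ε ^ 2 := by
        field_simp
        norm_num
  have hterm3 : ε * Real.sqrt (lam * J₀) ≤ κ / 4 * ε ^ 2 := by
    have e1 : Real.sqrt (lam * J₀) ≤ κ / 4 * ε := by
      refine Real.sqrt_le_iff.2 ⟨by positivity, ?_⟩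
      rw [mul_pow, hεsq]
      have e2 : J₀ = (κ / 4) ^ 2 * (16 * J₀ / κ ^ 2) := by
        field_simp
        norm_num
      have e3 : J₀ ≤ (κ / 4) ^ 2 * R := by
        refine le_trans e2.le (mul_le_mul_of_nonneg_left hR3 (by positivity))
      calc lam * J₀ ≤ a * ((κ / 4) ^ 2 * R) := mul_le_mul hak2 e3 hJ₀ hak0.le
        _ = (κ / 4) ^ 2 * (R * a) := by ring
    calc ε * Real.sqrt (lam * J₀) ≤ ε * (κ / 4 * ε) := by gcongr
      _ = κ / 4 * ε ^ 2 := by ring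
  refine ⟨hDN, ?_, ?_⟩
  · have : 0 < κ * ε ^ 2 := by positivity
    rw [hterm1]
    linarith
  · calc Real.exp (K₂ / α ^ 4 * (C * T) - α ^ 2 * K * ε ^ 2) ≤ Real.exp (-T) := by
          refine Real.exp_le_exp.2 ?_
          have : T ≤ C * T := le_mul_of_one_le_left (by linarith) hC1
          linarith
      _ = (Real.exp T)⁻¹ := Real.exp_neg T
      _ ≤ T⁻¹ := by
          refine inv_anti₀ (by linarith) ?_
          linarith [Real.add_one_le_exp T]

/-- The sum of the probabilities of the exceptional events. -/
lemma ofReal_quarter_add_le {δ x y : ℝ} {z : ℝ≥0∞} (hδ : 0 < δ) (hz : z ≤ ENNReal.ofReal (δ / 4))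
    (hx : x ≤ δ / 8) (hy : y = δ / 4) :
    z + (2 * ENNReal.ofReal x + ENNReal.ofReal y) ≤ ENNReal.ofReal δ := by
  calc z + (2 * ENNReal.ofReal x + ENNReal.ofReal y)
      ≤ ENNReal.ofReal (δ / 4) + (2 * ENNReal.ofReal (δ / 8) + ENNReal.ofReal (δ / 4)) := by
        rw [hy]
        gcongr
    _ = ENNReal.ofReal (δ / 4 + (2 * (δ / 8) + δ / 4)) := by
        rw [ENNReal.ofReal_add (by positivity) (by positivity),
          ENNReal.ofReal_add (by positivity) (by positivity),
          ENNReal.ofReal_mul (by positivity), ENNReal.ofReal_ofNat]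
    _ ≤ ENNReal.ofReal δ := ENNReal.ofReal_le_ofReal (by linarith)

/-! ### The risk bound and the rate. -/

namespace Model

variable {m p : ℕ} {H : Type*} [NormedAddCommGroup H] [InnerProductSpace ℝ H]
  {𝓧 : Fin m → Type*} [∀ l, MeasurableSpace (𝓧 l)]
  {M : Model m p H 𝓧} {N : Set (Param p H)}
  {E F : Type*} [NormedAddCommGroup E] [NormedSpace ℝ E] [NormedAddCommGroup F]
  [InnerProductSpace ℝ F]
  (hP : ∀ l, IsProbabilityMeasure (M.P l M.τ₀)) (hN₀ : M.τ₀ ∈ N) {C₃ C₄ : ℝ}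
  (hV : VarianceEquivalent M N C₃ C₄)
  {Ω : Type*} [MeasurableSpace Ω] {μ : Measure Ω} {X : ∀ l, ℕ → Ω → 𝓧 l}
  {b : ℝ} (hb0 : 0 ≤ b)
  (hb : ∀ l, ∀ τ ∈ N, ∀ᵐ x ∂(M.P l M.τ₀), |M.dη l τ x - M.cgf l τ| ≤ b)
  {LL : Param p H →L[ℝ] E} {B : ℝ} (hB : 1 ≤ B) (hbB : Real.exp (2 * b) ≤ B)
  (hW : ∀ d, M.τ₀ + d ∈ N → ∑ l, ‖M.dηL2 l (M.τ₀ + d)‖ ^ 2 ≤ B * ‖LL d‖ ^ 2)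
  (hD : ∀ τ ∈ N, ∀ u, ∑ l, ‖M.Dη l τ u‖ ^ 2 ≤ B * ‖LL u‖ ^ 2)

include hP hN₀ hV hb0 hb hB hbB hW hD in
/-- A finite-sample bound for the symmetrized Kullback-Leibler risk of the penalized estimator. -/
theorem measure_lt_SKL_le [IsProbabilityMeasure μ] (hNo : IsOpen N)
    (hNc : Convex ℝ N)
    (hη : ∀ l, ContDiffOn ℝ 3 (M.etaL2 l) N)
    (hηx : ∀ l x, ContDiffOn ℝ 3 (fun τ => M.η l τ x) N)
    (hXm : ∀ l i, Measurable (X l i)) (hXlaw : ∀ l i, μ.map (X l i) = M.P l M.τ₀)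
    (hXi : iIndepFun (fun q : Fin m × ℕ => X q.1 q.2) μ)
    {n : Fin m → ℕ} {K : ℕ} (hK : 0 < K) (hn : ∀ l, K ≤ n l)
    (hconv : ∀ᵐ ω ∂μ, ConvexOn ℝ N (M.nll n (fun l i => X l i ω)))
    {c : ℝ} (hc0 : 0 < c) (hc1 : c ≤ 1)
    (hW' : ∀ d, M.τ₀ + d ∈ N → c * ‖LL d‖ ^ 2 ≤ ∑ l, ‖M.dηL2 l (M.τ₀ + d)‖ ^ 2)
    {Λ : H →L[ℝ] F} {J : LinearMap.BilinForm ℝ H} (hJs : ∀ g h, J g h = J h g)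
    (hJ0 : ∀ g, 0 ≤ J g g) (hJc : Continuous fun g => J g g)
    {φ : ℕ → H} {ρ : ℕ → ℝ} (hρ0 : ∀ i, 0 ≤ ρ i)
    (hφΛ : ∀ i j, inner ℝ (Λ (φ i)) (Λ (φ j)) = if i = j then (1 : ℝ) else 0)
    (hφJ : ∀ i j, J (φ i) (φ j) = if i = j then ρ i else 0)
    (hφ : (Submodule.span ℝ (Set.range φ)).topologicalClosure = ⊤)
    (hsep : ∀ ζ g, ‖ζ‖ ^ 2 + ‖Λ g‖ ^ 2 ≤ B * ‖LL (ζ, g)‖ ^ 2 ∧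
      ‖LL (ζ, g)‖ ^ 2 ≤ B * (‖ζ‖ ^ 2 + ‖Λ g‖ ^ 2))
    {lam D α ε A : ℝ} (hlam : 0 ≤ lam)
    (hwD : ∀ k : ℕ, p + ∑ j ∈ Finset.range k, (1 + lam * ρ j)⁻¹ ≤ D) (hD1 : 1 ≤ D)
    (hα : 0 < α) (hα1 : α ≤ 1)
    (hε : 0 < ε) (hε1 : ε ≤ 1) (hA : 0 < A) (hDN : D ≤ α ^ 2 * K * ε ^ 2)
    (hR : (783 * B ^ 6 + 9 * (m + 1) * (136 * B ^ 5) ^ 2) * α * ε ^ 2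
        + 2 * B * A * ε * Real.sqrt (D / K) + ε * Real.sqrt (lam * J M.τ₀.2 M.τ₀.2)
        < Real.exp (-b) / 8 * c * ε ^ 2)
    (τhat : Ω → Param p H) :
    μ {ω | ENNReal.ofReal (B ^ 2 * ε ^ 2) < M.SKL (τhat ω)}
      ≤ μ {ω | ¬ M.IsEstimator J N n lam (fun l i => X l i ω) (τhat ω)}
        + (2 * ENNReal.ofReal (Real.exp (8 * (136 * B ^ 5) / α ^ 4 * D - α ^ 2 * K * ε ^ 2))
          + ENNReal.ofReal (B ^ 2 / A ^ 2)) := by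
  obtain ⟨𝒟, h𝒟, h𝒟d, h𝒟φ⟩ := exists_countable_dense (p := p) hφ
  have key := measure_exists_mem_nll_sub_lt_le hP hN₀ hV hb0 hb hB hbB hW hD hNo hNc hη hηx hXm
    hXlaw hXi hK hn hconv hc0.le hc1 hW' hJ0 hρ0 hφΛ hφJ hsep hlam hwD hD1 hα hα1 hε hε1 hA hDN
    h𝒟 h𝒟φ
  refine le_trans ?_ (add_le_add le_rfl key)
  refine le_trans (measure_mono_ae ?_) (measure_union_le _ _)
  filter_upwards [hconv] with ω hω hSKL
  by_contra hnot
  have hnot' : ¬ (_ ∨ _) := hnot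
  rw [not_or] at hnot'
  have hest : M.IsEstimator J N n lam (fun l i => X l i ω) (τhat ω) := by
    by_contra h
    exact hnot'.1 h
  have hbad := hnot'.2
  obtain ⟨hτN, hτmin, -⟩ := hest
  have hlow : ∀ d ∈ 𝒟, M.τ₀ + d ∈ N → ‖LL d‖ ^ 2 + lam * J d.2 d.2 ≤ 2 * ε ^ 2 →
      Real.exp (-b) / 8 * c * ‖LL d‖ ^ 2
        - ((783 * B ^ 6 + 9 * (m + 1) * (136 * B ^ 5) ^ 2) * α * ε ^ 2
          + 2 * B * A * ε * Real.sqrt (D / K))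
      ≤ M.nll n (fun l i => X l i ω) (M.τ₀ + d) - M.nll n (fun l i => X l i ω) M.τ₀ := by
    intro d hd hdN hdq
    by_contra! h
    exact hbad ⟨d, hd, hdN, hdq, by linarith⟩
  have hκ : Real.exp (-b) / 8 * c ≤ 1 / 2 := by
    have h1 : Real.exp (-b) ≤ 1 := Real.exp_le_one_iff.2 (by linarith)
    nlinarith [Real.exp_pos (-b)]
  have hτ' : M.τ₀ + (τhat ω - M.τ₀) = τhat ω := add_sub_cancel _ _
  have hq := norm_sq_add_penalty_le_of_isLocalMin hNo hN₀ hω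
    (continuousOn_nll hP hN₀ hV hb (fun l => (hη l).continuousOn)
      (fun l x => (hηx l x).continuousOn) n _) hJs hJ0 hJc LL hlam hε hκ hR h𝒟d hlow
    (d := τhat ω - M.τ₀) (by rwa [hτ']) (by rw [hτ']; exact hτmin)
  have hSKL' : ENNReal.ofReal (B ^ 2 * ε ^ 2) < M.SKL (τhat ω) := hSKL
  refine absurd ((SKL_le hP hN₀ hV hb hτN).trans (ENNReal.ofReal_le_ofReal ?_)) (not_le.2 hSKL')
  have h1 := hW (τhat ω - M.τ₀) (by rwa [hτ'])
  rw [hτ'] at h1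
  have h2 := mul_nonneg hlam (hJ0 (τhat ω - M.τ₀).2)
  have h3 : ∑ l, ‖M.dηL2 l (τhat ω)‖ ^ 2 ≤ B * ε ^ 2 :=
    h1.trans (mul_le_mul_of_nonneg_left (by linarith) (by linarith))
  calc Real.exp (2 * b) * ∑ l, ‖M.dηL2 l (τhat ω)‖ ^ 2
      ≤ B * (B * ε ^ 2) := mul_le_mul hbB h3 (Finset.sum_nonneg fun l _ => sq_nonneg _)
        (by linarith)
    _ = B ^ 2 * ε ^ 2 := by ring

include hP hN₀ hV hb0 hb hB hbB hW hD in
/-- The rate of convergence of the penalized estimator. -/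
theorem isBigOp_SKL [IsProbabilityMeasure μ] (hNo : IsOpen N)
    (hNc : Convex ℝ N)
    (hη : ∀ l, ContDiffOn ℝ 3 (M.etaL2 l) N)
    (hηx : ∀ l x, ContDiffOn ℝ 3 (fun τ => M.η l τ x) N)
    (hXm : ∀ l i, Measurable (X l i)) (hXlaw : ∀ l i, μ.map (X l i) = M.P l M.τ₀)
    (hXi : iIndepFun (fun q : Fin m × ℕ => X q.1 q.2) μ)
    {c : ℝ} (hc0 : 0 < c) (hc1 : c ≤ 1)
    (hW' : ∀ d, M.τ₀ + d ∈ N → c * ‖LL d‖ ^ 2 ≤ ∑ l, ‖M.dηL2 l (M.τ₀ + d)‖ ^ 2)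
    {Λ : H →L[ℝ] F} {J : LinearMap.BilinForm ℝ H} (hJs : ∀ g h, J g h = J h g)
    (hJ0 : ∀ g, 0 ≤ J g g) (hJc : Continuous fun g => J g g)
    {φ : ℕ → H} {ρ : ℕ → ℝ} (hρ0 : ∀ i, 0 ≤ ρ i)
    (hφΛ : ∀ i j, inner ℝ (Λ (φ i)) (Λ (φ j)) = if i = j then (1 : ℝ) else 0)
    (hφJ : ∀ i j, J (φ i) (φ j) = if i = j then ρ i else 0)
    (hφ : (Submodule.span ℝ (Set.range φ)).topologicalClosure = ⊤)
    (hsep : ∀ ζ g, ‖ζ‖ ^ 2 + ‖Λ g‖ ^ 2 ≤ B * ‖LL (ζ, g)‖ ^ 2 ∧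
      ‖LL (ζ, g)‖ ^ 2 ≤ B * (‖ζ‖ ^ 2 + ‖Λ g‖ ^ 2))
    {r C : ℝ} (hr : 0 < r) (hC1 : 1 ≤ C)
    (hC : ∀ t : ℝ, 0 < t → t ≤ 1 → ∀ k : ℕ,
      p + ∑ j ∈ Finset.range k, (1 + t * ρ j)⁻¹ ≤ C * t ^ (-(1 / r)))
    {n : ℕ → Fin m → ℕ} {lam : ℕ → ℝ} (hlam : ∀ k, 0 < lam k)
    (hn : Tendsto (fun k => ⨅ l, n k l) atTop atTop)
    (hlam0 : Tendsto lam atTop (𝓝 0))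
    (hnlam : Tendsto (fun k => ((⨅ l, n k l : ℕ) : ℝ) * lam k ^ (1 / r)) atTop atTop)
    (hconv : ∀ᶠ k in atTop, ∀ᵐ ω ∂μ, ConvexOn ℝ N (M.nll (n k) (fun l i => X l i ω)))
    (τhat : ℕ → Ω → Param p H)
    (hτhat : Tendsto (fun k => μ {ω | ¬ M.IsEstimator J N (n k) (lam k)
      (fun l i => X l i ω) (τhat k ω)}) atTop (𝓝 0)) :
    IsBigOp μ (fun k ω => M.SKL (τhat k ω))
      (fun k => ((⨅ l, n k l : ℕ) : ℝ)⁻¹ * lam k ^ (-(1 / r)) + lam k) := by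
  intro δ hδ
  set κ : ℝ := Real.exp (-b) / 8 * c with hκ
  have hκ0 : 0 < κ := by positivity
  have hκ1 : κ ≤ 1 := by
    have h1 : Real.exp (-b) ≤ 1 := Real.exp_le_one_iff.2 (by linarith)
    rw [hκ]
    nlinarith [Real.exp_pos (-b)]
  set K₁ : ℝ := 783 * B ^ 6 + 9 * (m + 1) * (136 * B ^ 5) ^ 2 with hK₁
  have hK₁1 : 1 ≤ K₁ := by
    have h1 : 1 ≤ B ^ 6 := one_le_pow₀ hB
    have h2 : 0 ≤ 9 * ((m : ℝ) + 1) * (136 * B ^ 5) ^ 2 := by positivity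
    rw [hK₁]
    linarith
  set K₂ : ℝ := 8 * (136 * B ^ 5) with hK₂
  have hK₂0 : 0 ≤ K₂ := by positivity
  set α : ℝ := κ / (4 * K₁) with hα
  have hα0 : 0 < α := by positivity
  have hα1 : α ≤ 1 := by
    rw [hα, div_le_one (by positivity)]
    linarith
  -- Makes the Markov bound B²/A² for the score equal to δ/4.
  set A : ℝ := 2 * B / Real.sqrt δ with hA
  have hA0 : 0 < A := by positivity
  have hAδ : B ^ 2 / A ^ 2 = δ / 4 := by
    rw [hA, div_pow, Real.sq_sqrt hδ.le]
    field_simp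
    norm_num
  set J₀ : ℝ := J M.τ₀.2 M.τ₀.2 with hJ₀
  have hJ₀0 : 0 ≤ J₀ := hJ0 _
  set R : ℝ := C * (K₂ / α ^ 4 + 1) / α ^ 2 + C * (8 * B * A / κ) ^ 2 + 16 * J₀ / κ ^ 2 with hR
  have hR1 : C * (K₂ / α ^ 4 + 1) / α ^ 2 ≤ R := by
    have h1 : 0 ≤ C * (8 * B * A / κ) ^ 2 := by positivity
    have h2 : 0 ≤ 16 * J₀ / κ ^ 2 := by positivity
    linarith
  have hR2 : C * (8 * B * A / κ) ^ 2 ≤ R := by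
    have h1 : 0 ≤ C * (K₂ / α ^ 4 + 1) / α ^ 2 := by positivity
    have h2 : 0 ≤ 16 * J₀ / κ ^ 2 := by positivity
    linarith
  have hR3 : 16 * J₀ / κ ^ 2 ≤ R := by
    have h1 : 0 ≤ C * (K₂ / α ^ 4 + 1) / α ^ 2 := by positivity
    have h2 : 0 ≤ C * (8 * B * A / κ) ^ 2 := by positivity
    linarith
  have hR0 : 0 < R := lt_of_lt_of_le (by positivity) hR1
  refine ⟨B ^ 2 * R, by positivity, ?_⟩
  set a : ℕ → ℝ := fun k => ((⨅ l, n k l : ℕ) : ℝ)⁻¹ * lam k ^ (-(1 / r)) + lam k with ha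
  have hpow : ∀ k, lam k ^ (-(1 / r)) = (lam k ^ (1 / r))⁻¹ := fun k => Real.rpow_neg (hlam k).le _
  have ha0 : Tendsto a atTop (𝓝 0) := by
    have h1 : Tendsto (fun k => (((⨅ l, n k l : ℕ) : ℝ) * lam k ^ (1 / r))⁻¹) atTop (𝓝 0) :=
      hnlam.inv_tendsto_atTop
    have h2 := h1.add hlam0
    rw [add_zero] at h2
    refine h2.congr fun k => ?_
    rw [ha]
    simp only [hpow, mul_inv]
  have hsmall : Tendsto (fun k => lam k ^ (1 / r)) atTop (𝓝 0) := by
    have h1 := hlam0.rpow_const (p := 1 / r) (Or.inr (by positivity))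
    rwa [Real.zero_rpow (by positivity)] at h1
  have hRa : Tendsto (fun k => R * a k) atTop (𝓝 0) := by
    simpa using ha0.const_mul R
  have hest : ∀ᶠ k in atTop, μ {ω | ¬ M.IsEstimator J N (n k) (lam k)
      (fun l i => X l i ω) (τhat k ω)} ≤ ENNReal.ofReal (δ / 4) :=
    (hτhat.eventually_lt_const (by simpa using (by positivity : 0 < δ / 4))).mono
      fun k hk => hk.le
  filter_upwards [hest, hconv, hn.eventually_ge_atTop 1, hlam0.eventually_le_const one_pos,
    hRa.eventually_le_const one_pos,
    hsmall.eventually_le_const (by positivity : 0 < δ / 8)] with k h1 h2 h3 h4 h5 h6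
  set K : ℕ := ⨅ l, n k l with hK
  have hK0 : 0 < K := h3
  have hK0' : (0 : ℝ) < K := by exact_mod_cast hK0
  set T : ℝ := lam k ^ (-(1 / r)) with hT
  have hT1 : 1 ≤ T := Real.one_le_rpow_of_pos_of_le_one_of_nonpos (hlam k) h4 (by
    rw [neg_nonpos]; positivity)
  have hak : a k = (K : ℝ)⁻¹ * T + lam k := rfl
  have hak2 : lam k ≤ a k := by
    have : 0 ≤ (K : ℝ)⁻¹ * T := by positivity
    rw [hak]; linarith
  have hak0 : 0 < a k := (hlam k).trans_le hak2
  set ε : ℝ := Real.sqrt (R * a k) with hε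
  have hε0 : 0 < ε := Real.sqrt_pos.2 (by positivity)
  have hεsq : ε ^ 2 = R * a k := Real.sq_sqrt (by positivity)
  have hε1 : ε ≤ 1 := Real.sqrt_le_one.2 h5
  obtain ⟨hDN, hterm, hexp⟩ := tuning_bounds hκ0 (by linarith : 0 < K₁) hK₂0 (by linarith : 0 < B)
    hA0 hJ₀0 hC1 hK0' hT1 (hlam k) hak hR1 hR2 hR3 hε0 hεsq
  have hmain := measure_lt_SKL_le hP hN₀ hV hb0 hb hB hbB hW hD hNo hNc hη hηx hXm hXlaw hXi hK0
    (fun l => ciInf_le (OrderBot.bddBelow _) l) h2 hc0 hc1 hW' hJs hJ0 hJc hρ0 hφΛ hφJ hφ hsep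
    (hlam k).le (hC (lam k) (hlam k) h4) (one_le_mul_of_one_le_of_one_le hC1 hT1) hα0 hα1 hε0 hε1
    hA0 hDN hterm (τhat k)
  have hset : B ^ 2 * R * a k = B ^ 2 * ε ^ 2 := by rw [hεsq]; ring
  change μ {ω | ENNReal.ofReal (B ^ 2 * R * a k) < M.SKL (τhat k ω)} ≤ ENNReal.ofReal δ
  rw [hset]
  refine hmain.trans (ofReal_quarter_add_le hδ h1 (hexp.trans ?_) hAδ)
  -- Here 1/T is lam^{1/r}, which tends to zero and is eventually at most δ/8.
  rw [hT, hpow, inv_inv]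
  exact h6

end Model

end SemiDensity

theorem mainTheorem4 {m p : ℕ} (hm : 1 ≤ m)
    {H : Type*} [NormedAddCommGroup H] [InnerProductSpace ℝ H] [CompleteSpace H]
    (hH : ¬ FiniteDimensional ℝ H)
    {𝓧 : Fin m → Type*} [∀ l, MeasurableSpace (𝓧 l)]
    (M : SemiDensity.Model m p H 𝓧) (J : LinearMap.BilinForm ℝ H)
    (Lθ : ∀ l, EuclideanSpace ℝ (Fin p) →L[ℝ] M.L2 l) (Lh : ∀ l, H →L[ℝ] M.L2 l)
    -- independent samples from the true densities
    {Ω : Type*} [MeasurableSpace Ω] (μ : Measure Ω) [IsProbabilityMeasure μ]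
    (X : ∀ l, ℕ → Ω → 𝓧 l) (hXmeas : ∀ l i, Measurable (X l i))
    (hXlaw : ∀ l i, μ.map (X l i) = M.P l M.τ₀)
    (hXindep : iIndepFun (fun (q : Fin m × ℕ) => X q.1 q.2) μ)
    -- the neighborhood of the true parameter
    (Nθ : Set (EuclideanSpace ℝ (Fin p))) (Nh : Set H) (hNθ : IsOpen Nθ) (hNh : IsOpen Nh)
    (hθ₀ : M.τ₀.1 ∈ Nθ) (hh₀ : M.τ₀.2 ∈ Nh) (hN : Convex ℝ (Nθ ×ˢ Nh))
    -- the assumptions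
    (hJ : SemiDensity.IsPenalty J)
    (hL : SemiDensity.AuxiliaryOperators M J Lθ Lh)
    (hη : SemiDensity.SmoothIdentifiable M μ X (Nθ ×ˢ Nh))
    (C₁ C₂ C_d C₃ C₄ : ℝ) (hC₁ : 0 < C₁) (hC₂ : 0 < C₂) (hC_d : 0 < C_d) (hC_d' : C_d < 2 * C₁)
    (hC₃ : 0 < C₃) (hC₄ : 0 < C₄)
    (hD : SemiDensity.DerivativeBounds M Lθ Lh (Nθ ×ˢ Nh) C₁ C₂)
    (hOsc : SemiDensity.DerivativeOscillation M Lθ Lh (Nθ ×ˢ Nh) C_d)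
    (hV : SemiDensity.VarianceEquivalent M (Nθ ×ˢ Nh) C₃ C₄)
    (hcc : SemiDensity.CompletelyContinuous (fun g => ∑ l, M.V l M.τ₀ (Lh l g)) (fun g => J g g))
    (r : ℝ) (hr : 1 < r) (hρ : SemiDensity.EigenvalueGrowth M J Lh r)
    -- the sample sizes and the smoothing parameter
    (n : ℕ → Fin m → ℕ) (lam : ℕ → ℝ) (hlam : ∀ k, 0 < lam k)
    (hn : Tendsto (fun k => ⨅ l, n k l) atTop atTop)
    (hlam0 : Tendsto lam atTop (𝓝 0))
    (hnlam : Tendsto (fun k => ((⨅ l, n k l : ℕ) : ℝ) * lam k ^ (1 / r)) atTop atTop)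
    -- the likelihood is convex and the estimator is its unique penalized local minimum
    (hconv : ∀ᶠ k in atTop, ∀ᵐ ω ∂μ, ConvexOn ℝ (Nθ ×ˢ Nh) (M.nll (n k) (fun l i => X l i ω)))
    (τhat : ℕ → Ω → SemiDensity.Param p H)
    (hτhat : Tendsto (fun k => μ {ω | ¬ M.IsEstimator J (Nθ ×ˢ Nh) (n k) (lam k)
      (fun l i => X l i ω) (τhat k ω)}) atTop (𝓝 0)) :
    (∀ τ ∈ Nθ ×ˢ Nh, M.SKL τ = ENNReal.ofReal
      (∑ l, ((∫ x, (M.η l M.τ₀ x - M.η l τ x) ∂(M.P l M.τ₀))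
        + ∫ x, (M.η l τ x - M.η l M.τ₀ x) ∂(M.P l τ)))) ∧
    SemiDensity.IsBigOp μ (fun k ω => M.SKL (τhat k ω))
      (fun k => ((⨅ l, n k l : ℕ) : ℝ)⁻¹ * lam k ^ (-(1 / r)) + lam k) := by
  -- A tilted measure is zero when the exponential is not integrable; being the law of an
  -- observation excludes this.
  have hP : ∀ l, IsProbabilityMeasure (M.P l M.τ₀) := fun l => by
    rw [← hXlaw l 0]
    exact Measure.isProbabilityMeasure_map (hXmeas l 0).aemeasurable
  have hN₀ : M.τ₀ ∈ Nθ ×ˢ Nh := ⟨hθ₀, hh₀⟩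
  have hNo : IsOpen (Nθ ×ˢ Nh) := hNθ.prod hNh
  refine ⟨fun τ hτ => SemiDensity.Model.SKL_eq hP hN₀ hV hτ, ?_⟩
  have hne : ∀ l, ∃ f : M.L2 l, f ≠ 0 := fun l => by
    obtain ⟨g, hg⟩ : ∃ g : H, g ≠ 0 := by
      by_contra! h
      have : Subsingleton H := ⟨fun x y => (h x).trans (h y).symm⟩
      exact hH inferInstance
    exact ⟨Lh l g, fun h => hg (hL.injective_h l (h.trans (map_zero _).symm))⟩
  obtain ⟨b, hb0, hb⟩ := SemiDensity.Model.exists_abs_dη_sub_cgf_le hP hN₀ hV hC₃ hC₄ hne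
  obtain ⟨E, _, _, S, Λ, hΛ, hSΛ⟩ := SemiDensity.exists_hilbert_sum Lθ Lh
  have hSV : ∀ ζ g, ‖S ζ + Λ g‖ ^ 2 = ∑ l, M.V l M.τ₀ (Lθ l ζ + Lh l g) := fun ζ g => by
    rw [hSΛ]
    exact Finset.sum_congr rfl fun l _ => (SemiDensity.Model.V_τ₀ hP l _).symm
  obtain ⟨hD', c, hc0, hc1, hW⟩ := SemiDensity.Model.exists_comparison_constants hP hNo
    hη.contDiffOn hN hN₀ hC₂ hC_d' hD hOsc (LL := S.coprod Λ) hSV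
  obtain ⟨c', hc', hsep⟩ := hL.separated
  obtain ⟨B', hB', hB⟩ := SemiDensity.exists_separation S Λ hc' fun ζ g hζ => by
    have h1 := hsep ζ g hζ
    have h2 := hSV ζ (-g)
    simp only [map_neg, ← sub_eq_add_neg] at h2
    rwa [h2]
  -- The growth condition speaks of every eigensystem without providing one, so one is constructed
  -- first.
  obtain ⟨φ, ρ, hφ⟩ := SemiDensity.Model.exists_isEigensystem hP hm hH hJ hL hcc
  obtain ⟨β₁, β₂, hβ₁, hβ⟩ := hρ φ ρ hφ
  obtain ⟨C, hC0, hC⟩ := SemiDensity.exists_sum_inv_le hφ.nonneg hβ₁ hr (hβ.mono fun i hi => hi.1)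
  obtain ⟨M₁, M₂, -, -, hM⟩ := hL.norm_equiv 1 one_pos
  have hJc : Continuous fun g => J g g :=
    SemiDensity.continuous_bilin_self hJ.symm hJ.nonneg (C := M₂) fun g => by
      have h1 : 0 ≤ ∑ l, M.V l M.τ₀ (Lh l g) :=
        Finset.sum_nonneg fun l _ => variance_nonneg _ _
      have h2 := (hM g).2
      linarith
  -- A single constant dominating the separation, log density and derivative bounds.
  have hB1 : 1 ≤ B' + Real.exp (2 * b) + C₂ := by
    have := Real.exp_pos (2 * b)
    linarith
  have hBle : B' ≤ B' + Real.exp (2 * b) + C₂ := by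
    have := Real.exp_pos (2 * b)
    linarith
  have hC₂le : C₂ ≤ B' + Real.exp (2 * b) + C₂ := by
    have := Real.exp_pos (2 * b)
    linarith
  refine SemiDensity.Model.isBigOp_SKL hP hN₀ hV hb0 hb (LL := S.coprod Λ) hB1 (by linarith)
    (fun d hd => ((hW d hd).1.trans (mul_le_mul_of_nonneg_right hC₂le (sq_nonneg _))))
    (fun τ hτ u => ((hD' τ hτ u).trans (mul_le_mul_of_nonneg_right hC₂le (sq_nonneg _))))
    hNo hN hη.contDiffOn hη.contDiffOn_apply hXmeas hXlaw hXindep hc0 hc1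
    (fun d hd => (hW d hd).2) (Λ := Λ) hJ.symm hJ.nonneg hJc hφ.nonneg
    (fun i j => ?_) hφ.penalty_diag hφ.complete
    (fun ζ g => ⟨(hB ζ g).1.trans (mul_le_mul_of_nonneg_right hBle (sq_nonneg _)),
      (hB ζ g).2.trans (mul_le_mul_of_nonneg_right hBle (by positivity))⟩)
    (by linarith : 0 < r) (by linarith [Nat.cast_nonneg (α := ℝ) p] : 1 ≤ (p : ℝ) + 1 + C)
    (fun t ht0 ht1 k => ?_) hlam hn hlam0 hnlam hconv τhat hτhat
  · rw [hΛ, ← hφ.variance_diag i j]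
    exact Finset.sum_congr rfl fun l _ => (SemiDensity.Model.Vcov_τ₀ hP l _ _).symm
  -- In the constant p + 1 + C, the term p pays for the θ-coordinates because t^{-1/r} ≥ 1, and the
  -- 1 only keeps the constant at least 1.
  · have h1 := hC t ht0 ht1 k
    have h2 : 1 ≤ t ^ (-(1 / r)) := Real.one_le_rpow_of_pos_of_le_one_of_nonpos ht0 ht1 (by
      rw [neg_nonpos]
      have : 0 < r := by linarith
      positivity)
    have h3 : (p : ℝ) * 1 ≤ p * t ^ (-(1 / r)) := by gcongr
    linarith
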